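/- **Notation.** For $0\le k\le\min\{m,n\}$ let $G_{m,n,k}$ be the complete bipartite graph with parts $A=\{a_1,\dots,a_m\}$ and $B=\{b_1,\dots,b_n\}$ from which a $k$-matching has been removed. The bipartite join $G_{A,B}\oplus G_{C,D}$ of two bipartite graphs with disjoint vertex sets has all edges of both graphs, all edges between $C$ and $B$, and all edges between $A$ and $D$. Embeddings are 2-cell embeddings of connected graphs in closed surfaces (given by rotation systems with signatures); $\mathcal E(\Pi)=2-|V|+|E|-|F|$ is the Euler genus of an embedding $\Pi$. An embedding is quadrilateral if all its faces have length 4, and near-quadrilateral if all of them do except for one, which has length 6. **Extendible pairs.** Two pairs of corners of a face are parallel if the four corners are distinct and the pairs do not separate each other on the boundary walk of the face. An *extendible pair* $(\mathcal F_A,\mathcal F_B)$ in an embedding of a connected bipartite graph with parts $A,B$, $|A|=m\ge 2$, $|B|=n\ge2$, consists of a naming $A=\{a_1,\dots,a_m\}$, $B=\{b_1,\dots,b_n\}$, and of faces $f_1,\dots,f_{\lceil m/2\rceil}$ and $g_1,\dots,g_{\lceil n/2\rceil}$ (repetitions allowed), each with a marked pair of corners, such that: - the marked corners of $f_i$ are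 at $a_{2i-1},a_{2i}$ for $1\le i\le\lfloor (m-2)/2\rfloor$, those of $f_{\lceil m/2\rceil}$ are at $a_{m-1},a_m$ and, if $m$ is odd, those of $f_{(m-1)/2}$ are at $a_{m-3},a_{m-2}$ (at $a_2,a_1$ if $m=3$); likewise for the $g_j$, with $n$ and the $b$'s; - $f_{\lceil m/2\rceil}=g_{\lceil n/2\rceil}$, and the marked corners occur on this face in the cyclic order $a_{m-1},b_{n-1},a_m,b_n$; - any two marked pairs (of $f$'s, of $g$'s, or of an $f$ and a $g$) that lie in the same face are parallel, with the only exception of the two pairs in the previous item. **Extended embeddings.** Given an extendible pair in $\Pi$, the *extended embedding* of $G_{A,B}\oplus G_{0,2,0}$ is obtained as follows. Place two new vertices $b_{n+1},b_{n+2}$ in $f_{\lceil m/2\rceil}$ and join them to $a_{m-1},a_m$, which creates a face $g=(a_mb_{n+1}a_{m-1}b_{n+2})$. For $1\le i\le\lfloor(m-2)/2\rfloor$ insert a handle (of either kind) between $g$ and $f_i$ that carries the edges from $b_{n+1},b_{n+2}$ to the marked corners $a_{2i-1},a_{2i}$. If $m$ is odd, add a crosscap near the vertex $a_{m-3}$ ($a_2$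 if $m=3$); through it pass the edges from $b_{n+1},b_{n+2}$ to $a_{m-2}$, one of the new edges at $a_{m-3}$, and the edges at $a_{m-3}$ between its two marked corners. The extended embedding of $G_{A,B}\oplus G_{2,0,0}$ is obtained in the same way with the roles of the two parts exchanged. For $G_{A,B}\oplus G_{2,2,2}$, four new vertices $a_{m+1},a_{m+2},b_{n+1},b_{n+2}$ and the edges $a_{m+1}b_{n+2}$, $a_{m+2}b_{n+1}$ are placed on the boundary of a crosscap in $f_{\lceil m/2\rceil}$, they are joined to $a_{m-1},a_m,b_{n-1},b_n$, where the edges at $a_{m-1}$ and at $b_{n-1}$ cross this crosscap, which creates the faces $(a_mb_{n+1}a_{m-1}b_{n+2})$ and $(b_na_{m+1}b_{n-1}a_{m+2})$, and then the handles and crosscaps above are added for both parts. **Theorem.** Let $m,n\ge 2$, $0\le k\le\min\{m,n\}$ and $(m,n,k)\ne(4,4,4),(5,5,5)$, and let $\Pi$ be any embedding of $G_{m,n,k}$ with $\mathcal E(\Pi)=\left\lceil\frac{(m-2)(n-2)-k}{2}\right\rceil$. Then $\Pi$ has an extendible pair and, for every extendible pair in $\Pi$, the extended embeddings $\Pi',\Pi'',\Pi'''$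 of $G_{m,n,k}\oplus G_{2,2,2}$, $G_{m,n,k}\oplus G_{2,0,0}$ and $G_{m,n,k}\oplus G_{0,2,0}$ obtained from $\Pi$ through it exist; $\Pi'$ is nonorientable, and $$\mathcal E(\Pi')=\left\lceil\frac{mn-(k+2)}{2}\right\rceil,\qquad \mathcal E(\Pi'')=\left\lceil\frac{m(n-2)-k}{2}\right\rceil,\qquad \mathcal E(\Pi''')=\left\lceil\frac{(m-2)n-k}{2}\right\rceil .$$ Moreover, each of $\Pi',\Pi'',\Pi'''$ has the minimum Euler genus among all embeddings of its graph, and is quadrilateral or near-quadrilateral. -/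

import Mathlib

/-! ### Bipartite graphs and bipartite joins -/

/-- The bipartite graph with parts `A` and `B` in which `a` and `b` are joined iff `R a b`. -/
def bipGraph {A B : Type*} (R : A → B → Prop) : SimpleGraph (A ⊕ B) where
  Adj x y :=
    match x, y with
    | Sum.inl a, Sum.inr b => R a b
    | Sum.inr b, Sum.inl a => R a b
    | _, _ => False
  symm := ⟨by rintro (a | b) (a' | b') h <;> exact h⟩
  loopless := ⟨by rintro (a | b) h <;> exact h⟩

/-- The edge relation of `G_{m,n,k}`: the complete bipartite graph `K_{m,n}` with the `k`-matching
`{a₁b₁, …, a_k b_k}` removed. -/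
def minusMatching (m n k : ℕ) (i : Fin m) (j : Fin n) : Prop :=
  ¬ (i.val = j.val ∧ i.val < k)

/-- The edge relation of the bipartite join: the edges of both graphs, all edges between `C` and
`B`, and all edges between `A` and `D`. -/
def bipJoin {A B C D : Type*} (R : A → B → Prop) (S : C → D → Prop) : A ⊕ C → B ⊕ D → Prop
  | Sum.inl a, Sum.inl b => R a b
  | Sum.inr c, Sum.inr d => S c d
  | Sum.inl _, Sum.inr _ => True
  | Sum.inr _, Sum.inl _ => True

/-! ### 2-cell embeddings as rotation systems with signatures -/

/-- A 2-cell embedding of a connected graph in a closed surface, given by a rotation system and a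
signature.  `rot v` is the cyclic order of the neighbours of `v` around `v` (with respect to a local
orientation at `v`), and `twist e` says whether the edge `e` reverses the local orientations of
its ends; the values of `twist` outside the edge set are irrelevant. -/
structure CellEmbedding {V : Type*} (G : SimpleGraph V) where
  connected : G.Connected
  rot : V → Cycle V
  nodup : ∀ v, (rot v).Nodup
  mem_rot : ∀ v w, w ∈ rot v ↔ G.Adj v w
  twist : Sym2 V → Bool

/-- A position in a walk along a face boundary, together with the direction of the walk: the walk
is at the vertex `fst` and is about to leave it along the edge to `snd`.  If `rev` is `false`, the
walk came from the predecessor of `snd` in the rotation at `fst` (it passes the vertex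
in the sense of the local orientation); if `rev` is `true`, it came from the successor of `snd`
(it passes the vertex against the local orientation). -/
structure FaceFlag {V : Type*} (G : SimpleGraph V) where
  fst : V
  snd : V
  adj : G.Adj fst snd
  rev : Bool

namespace CellEmbedding

variable {V : Type*} [DecidableEq V] {G : SimpleGraph V}

/-- The rotation at `v` as a permutation: each neighbour is sent to the next one. -/
def perm (E : CellEmbedding G) (v : V) : Equiv.Perm V :=
  (E.rot v).formPerm (E.nodup v)

theorem adj_perm (E : CellEmbedding G) {v w : V} (h : G.Adj v w) : G.Adj v (E.perm v w) := by
  rw [← E.mem_rot] at h ⊢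
  unfold perm
  rw [Cycle.formPerm_apply_mem_eq_next _ (E.nodup v) w h]
  exact Cycle.next_mem _ _ _ _

theorem adj_perm_symm (E : CellEmbedding G) {v w : V} (h : G.Adj v w) :
    G.Adj v ((E.perm v).symm w) := by
  by_contra hc
  have hm : (E.perm v).symm w ∉ E.rot v := fun hh => hc ((E.mem_rot _ _).1 hh)
  have h1 : E.perm v ((E.perm v).symm w) = (E.perm v).symm w :=
    Cycle.formPerm_eq_self_of_notMem _ _ _ hm
  rw [Equiv.apply_symm_apply] at h1
  rw [← h1] at hc
  exact hc h

/-- One step of the face traversal: move along the current edge, then turn into the next edge on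
the same side. -/
def step (E : CellEmbedding G) (x : FaceFlag G) : FaceFlag G :=
  if (x.rev ^^ E.twist s(x.fst, x.snd)) = true then
    ⟨x.snd, (E.perm x.snd).symm x.fst, E.adj_perm_symm x.adj.symm, true⟩
  else
    ⟨x.snd, E.perm x.snd x.fst, E.adj_perm x.adj.symm, false⟩

/-- The same corner of the same face, passed in the opposite direction. -/
def back (E : CellEmbedding G) (x : FaceFlag G) : FaceFlag G :=
  if x.rev = true then ⟨x.fst, E.perm x.fst x.snd, E.adj_perm x.adj, false⟩
  else ⟨x.fst, (E.perm x.fst).symm x.snd, E.adj_perm_symm x.adj, true⟩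

/-- The faces: classes of flags under the face traversal, its two directions being identified. -/
def Face (E : CellEmbedding G) : Type _ :=
  Quot (fun x y : FaceFlag G => y = E.step x ∨ y = E.back x)

/-- The face to which a flag belongs. -/
def face (E : CellEmbedding G) (x : FaceFlag G) : E.Face := Quot.mk _ x

/-- The length of the boundary walk of the face to which `x` belongs. -/
noncomputable def walkLength (E : CellEmbedding G) (x : FaceFlag G) : ℕ := Function.minimalPeriod E.step x

/-- The Euler genus, `2 - |V| + |E| - |F|` (for finite connected graphs with at least one edge). -/
noncomputable def eulerGenus (E : CellEmbedding G) : ℤ :=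
  2 - (Nat.card V : ℤ) + (Nat.card G.edgeSet : ℤ) - (Nat.card E.Face : ℤ)

/-- The surface is orientable: the local orientations can be chosen coherently. -/
def Orientable (E : CellEmbedding G) : Prop :=
  ∃ o : V → Bool, ∀ v w, G.Adj v w → E.twist s(v, w) = (o v ^^ o w)

/-- No embedding of the same graph has smaller Euler genus. -/
def HasMinimumEulerGenus (E : CellEmbedding G) : Prop :=
  ∀ E₂ : CellEmbedding G, E.eulerGenus ≤ E₂.eulerGenus

/-- All faces are quadrilaterals. -/
def IsQuadrilateral (E : CellEmbedding G) : Prop :=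
  ∀ x : FaceFlag G, E.walkLength x = 4

/-- All faces are quadrilaterals, except for exactly one, which is a hexagon. -/
def IsNearQuadrilateral (E : CellEmbedding G) : Prop :=
  ∃ x₀ : FaceFlag G, E.walkLength x₀ = 6 ∧
    ∀ x : FaceFlag G, E.face x ≠ E.face x₀ → E.walkLength x = 4

/-! ### Extendible pairs -/

/-- `x` and `y` are the same corner, passed in the same or in opposite directions. -/
def SameCorner (E : CellEmbedding G) (x y : FaceFlag G) : Prop := y = x ∨ y = E.back x

/-- The pair of corners `x₁, x₂` and the pair of corners `y₁, y₂` are parallel: they are four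
different corners of one face, whose boundary walk can be written `(x₁ ⋯ x₂ ⋯ y ⋯ y' ⋯)`, where
`y, y'` are `y₁, y₂` in some order. -/
def Parallel (E : CellEmbedding G) (x₁ x₂ y₁ y₂ : FaceFlag G) : Prop :=
  ∃ z : FaceFlag G, E.SameCorner x₁ z ∧
    ∃ p q r : ℕ, 0 < p ∧ p < q ∧ q < r ∧ r < E.walkLength z ∧
      E.SameCorner x₂ (E.step^[p] z) ∧
      ((E.SameCorner y₁ (E.step^[q] z) ∧ E.SameCorner y₂ (E.step^[r] z)) ∨
        (E.SameCorner y₂ (E.step^[q] z) ∧ E.SameCorner y₁ (E.step^[r] z)))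

/-- The boundary walk of a face, in the direction given by `x`, can be written
`(x ⋯ y ⋯ z ⋯ w ⋯)`. -/
def CyclicOrder (E : CellEmbedding G) (x y z w : FaceFlag G) : Prop :=
  ∃ p q r : ℕ, 0 < p ∧ p < q ∧ q < r ∧ r < E.walkLength x ∧
    E.step^[p] x = y ∧ E.step^[q] x = z ∧ E.step^[r] x = w

end CellEmbedding

/-- Index of the first vertex of the `i`-th pair, `1 ≤ i ≤ ⌈m/2⌉`, for a part with the vertices
`x₁, …, x_m`.  The pairs are `{x_{2i-1}, x_{2i}}` for `i ≤ ⌊(m-2)/2⌋`, then `{x_{m-1}, x_m}` for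
`i = ⌈m/2⌉` and, if `m` is odd, `{x_{m-3}, x_{m-2}}` for `i = (m-1)/2`, which is to be read as
`{x₂, x₁}` if `m = 3`. -/
def pairLeft (m i : ℕ) : ℕ :=
  if i = (m + 1) / 2 then m - 1
  else if Odd m ∧ i = (m - 1) / 2 then (if m = 3 then 2 else m - 3)
  else 2 * i - 1

/-- Index of the second vertex of the `i`-th pair; see `pairLeft`. -/
def pairRight (m i : ℕ) : ℕ :=
  if i = (m + 1) / 2 then m
  else if Odd m ∧ i = (m - 1) / 2 then m - 2
  else 2 * i

/-- The data of a sequence `(f₁, f₂, …, f_{⌈m/2⌉})` of faces with a marked pair of corners in each.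
`vertex 1, …, vertex m` is the chosen naming of the vertices of one part; `left i` and `right i`
are the marked corners of `f_i`, with `f_i` written in the direction of these flags.
Only the values `vertex j` for `1 ≤ j ≤ m` and `left i`, `right i` for `1 ≤ i ≤ ⌈m/2⌉` matter. -/
structure FaceSeq {V : Type*} (G : SimpleGraph V) where
  vertex : ℕ → V
  left : ℕ → FaceFlag G
  right : ℕ → FaceFlag G

/-- For odd `m`: the marked corner at the vertex shared by two pairs, in the pair other than
the `(m-1)/2`-th.  (That other pair is the one with index `(m-3)/2` if `m ≥ 5`, and the last one if
`m = 3`.) -/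
def FaceSeq.shared {V : Type*} {G : SimpleGraph V} (S : FaceSeq G) (m : ℕ) : FaceFlag G :=
  if m = 3 then S.left 2 else S.right ((m - 3) / 2)

/-- `S` is a face sequence for the part `X` with `m` vertices: the names `vertex 1, …, vertex m`
list `X` without repetition, and `f_i` is a face whose boundary walk passes the
two marked corners, which are corners at the two vertices of the `i`-th pair. If `m` is odd, the
face `f_{(m-1)/2}` is written in the direction that passes the vertex shared by two pairs in the
sense opposite to the other face marked there (of the two directions of a face exactly one does). -/
structure FaceSeq.IsFaceSeq {V : Type*} [DecidableEq V] {G : SimpleGraph V}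
    (E : CellEmbedding G) (S : FaceSeq G) (m : ℕ) (X : Set V) : Prop where
  names : Set.BijOn S.vertex (Set.Icc 1 m) X
  left_fst : ∀ i, 1 ≤ i → i ≤ (m + 1) / 2 → (S.left i).fst = S.vertex (pairLeft m i)
  right_fst : ∀ i, 1 ≤ i → i ≤ (m + 1) / 2 → (S.right i).fst = S.vertex (pairRight m i)
  same_walk : ∀ i, 1 ≤ i → i ≤ (m + 1) / 2 → ∃ t : ℕ, E.step^[t] (S.left i) = S.right i
  direction : Odd m → (S.left ((m - 1) / 2)).rev = !(S.shared m).rev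

/-- `(𝓕_A, 𝓕_B)` is an extendible pair in the embedding `E`: a saturated pair of face sequences
(`seqA`, `seqB`, `central`) in which any two marked pairs lying in one face are parallel, with the
only exception of the two marked pairs that cross in the common last face. -/
structure Extendible {m n : ℕ} {G : SimpleGraph (Fin m ⊕ Fin n)} (E : CellEmbedding G)
    (FA FB : FaceSeq G) : Prop where
  seqA : FA.IsFaceSeq E m (Set.range Sum.inl)
  seqB : FB.IsFaceSeq E n (Set.range Sum.inr)
  central : E.CyclicOrder (FA.left ((m + 1) / 2)) (FB.left ((n + 1) / 2))
    (FA.right ((m + 1) / 2)) (FB.right ((n + 1) / 2))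
  parallel_A : ∀ s t, 1 ≤ s → s < t → t ≤ (m + 1) / 2 →
    E.face (FA.left s) = E.face (FA.left t) →
    E.Parallel (FA.left s) (FA.right s) (FA.left t) (FA.right t)
  parallel_B : ∀ p q, 1 ≤ p → p < q → q ≤ (n + 1) / 2 →
    E.face (FB.left p) = E.face (FB.left q) →
    E.Parallel (FB.left p) (FB.right p) (FB.left q) (FB.right q)
  parallel_A_B : ∀ i j, 1 ≤ i → i < (m + 1) / 2 → 1 ≤ j → j ≤ (n + 1) / 2 →
    E.face (FA.left i) = E.face (FB.left j) →
    E.Parallel (FA.left i) (FA.right i) (FB.left j) (FB.right j)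
  parallel_B_last : ∀ j, 1 ≤ j → j < (n + 1) / 2 →
    E.face (FB.left j) = E.face (FA.left ((m + 1) / 2)) →
    E.Parallel (FB.left j) (FB.right j) (FA.left ((m + 1) / 2)) (FA.right ((m + 1) / 2))

/-! ### Extended embeddings -/

namespace CellEmbedding

variable {V : Type*} [DecidableEq V] {G : SimpleGraph V}

/-- The rotation at `v`, read in the sense of the local orientation or (if `r`) against it. -/
def read (E : CellEmbedding G) (r : Bool) (v : V) : Cycle V :=
  if r = true then (E.rot v).reverse else E.rot v

/-- The rotation at the vertex of the flags `x` and `y`, read in the sense in which `x` passes this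
vertex, is `(S₁ S₂)`, where `S₁` runs from the corner `x` to the corner `y`.  (Here `x` and `y` pass
the vertex in opposite senses, and both leave it along an edge of `S₁`.) -/
def IsArc (E : CellEmbedding G) (x y : FaceFlag G) (S₁ S₂ : List V) : Prop :=
  E.read x.rev x.fst = ↑(S₁ ++ S₂) ∧ S₁.head? = some x.snd ∧ S₁.getLast? = some y.snd

end CellEmbedding

/-- The edges of the given graph that cross the crosscap added near the vertex shared by two
pairs of `S` (none if `m` is even): those between the two corners marked at that vertex. -/
def crosscapEdges {V : Type*} [DecidableEq V] {G : SimpleGraph V} (E : CellEmbedding G)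
    (S : FaceSeq G) (m : ℕ) : Set (Sym2 V) :=
  {d | Odd m ∧ ∃ S₁ S₂ : List V, E.IsArc (S.shared m) (S.left ((m - 1) / 2)) S₁ S₂ ∧
    ∃ w ∈ S₁, d = s((S.shared m).fst, w)}

section Extension

variable {V W : Type*} [DecidableEq V] [DecidableEq W] {G : SimpleGraph V} {H : SimpleGraph W}

/-- In `E'`, edges to the new vertices `u₀`, `u₁` are inserted in the corner `x` of `E`.  If `x` is
the corner between the edges `p` and `q`, passed by the walk from `p` to `q`, then the rotation,
read in this sense, becomes `(… p u₀ u₁ q …)`, or `(… p u₁ u₀ q …)` if `swap`.  With respect to the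
sense of the walk `x` the two edges are untwisted, or twisted if `tw`. -/
def Inserted (E : CellEmbedding G) (E' : CellEmbedding H) (ι : V → W) (u₀ u₁ : W)
    (x : FaceFlag G) (swap tw : Bool) : Prop :=
  (∃ l : List V, E.read x.rev x.fst = ↑(x.snd :: l) ∧
    E'.read x.rev (ι x.fst) =
      ↑((x.snd :: l).map ι ++ (if swap = true then [u₁, u₀] else [u₀, u₁]))) ∧
  E'.twist s(ι x.fst, u₀) = (tw ^^ x.rev) ∧ E'.twist s(ι x.fst, u₁) = (tw ^^ x.rev)

/-- In `E'`, edges to `u₀`, `u₁` are inserted in the corner `x` as in `Inserted`, and then a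
crosscap is added near the vertex: the edges from the corner `x` to the corner `y`, together with
the new edge next to them, cross it.  Their order is thereby reversed and each of them is
twisted (the change of `twist` for the old edges is recorded by `crosscapEdges`). -/
def InsertedCrosscap (E : CellEmbedding G) (E' : CellEmbedding H) (ι : V → W) (u₀ u₁ : W)
    (x y : FaceFlag G) (swap tw : Bool) : Prop :=
  ∃ S₁ S₂ : List V, E.IsArc x y S₁ S₂ ∧
    E'.read x.rev (ι x.fst) =
      ↑((S₁.map ι).reverse ++ [if swap = true then u₀ else u₁] ++ S₂.map ι ++
        [if swap = true then u₁ else u₀]) ∧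
    E'.twist s(ι x.fst, if swap = true then u₀ else u₁) = !(tw ^^ x.rev) ∧
    E'.twist s(ι x.fst, if swap = true then u₁ else u₀) = (tw ^^ x.rev)

/-- Attaching two new vertices `u₀`, `u₁` to all vertices `x₁, …, x_m` of one part, through
the face sequence `S = (f₁, …, f_{⌈m/2⌉})`.

First, `u₀` and `u₁` are joined to `x_{m-1}` and `x_m` in the last face, within the face if
`cross = false`, and with the edges at `x_{m-1}` crossing a crosscap if `cross = true`; this creates
a new face `g = (x_m u₀ x_{m-1} u₁)`.  Then, for `1 ≤ i ≤ ⌊(m-2)/2⌋`, a handle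
between `g` and `f_i` carries the edges from `u₀`, `u₁` to `x_{2i-1}`, `x_{2i}`; reversing the
direction in which `f_i` is written changes the kind of the handle (prohandle or antihandle).  If
`m` is odd, there remains `x_{m-2}` (`x₁` if `m = 3`): a crosscap is added near the vertex `x_{m-3}`
(`x₂` if `m = 3`), through which pass the edges from `u₀`, `u₁` to
the remaining vertex, one new edge at `x_{m-3}`, and the old edges at `x_{m-3}` between its two
marked corners.  In the rotation at `u₀` the neighbours come in the order
`x_m, x₁, x₂, …, x_{m-2}, x_{m-1}` across `g`, in that at `u₁` in the reverse order;
`extra₀` and `extra₁` are the further neighbours, on the other side. -/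
structure Attached (E : CellEmbedding G) (E' : CellEmbedding H) (ι : V → W) (S : FaceSeq G) (m : ℕ)
    (u₀ u₁ : W) (cross : Bool) (extra₀ extra₁ : List W) : Prop where
  right_last : Inserted E E' ι u₀ u₁ (S.right ((m + 1) / 2)) true false
  left_last : m ≠ 3 → Inserted E E' ι u₀ u₁ (S.left ((m + 1) / 2)) cross cross
  left_handle : ∀ i, 1 ≤ i → i ≤ (m - 2) / 2 →
    Inserted E E' ι u₀ u₁ (S.left i) false false
  right_handle : ∀ i, 1 ≤ i → i ≤ (m - 2) / 2 → ¬ (Odd m ∧ i = (m - 2) / 2) →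
    Inserted E E' ι u₀ u₁ (S.right i) true false
  shared_odd : Odd m → m ≠ 3 →
    InsertedCrosscap E E' ι u₀ u₁ (S.shared m) (S.left ((m - 1) / 2)) true false
  right_odd : Odd m → m ≠ 3 →
    Inserted E E' ι u₀ u₁ (S.right ((m - 1) / 2)) true false
  shared_three : m = 3 →
    InsertedCrosscap E E' ι u₀ u₁ (S.shared m) (S.left ((m - 1) / 2)) cross cross
  right_three : m = 3 →
    Inserted E E' ι u₀ u₁ (S.right ((m - 1) / 2)) cross cross
  rot₀ : E'.rot u₀ =
    ↑((List.range' 1 (m - 1)).map (fun i => ι (S.vertex i)) ++ extra₀ ++ [ι (S.vertex m)])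
  rot₁ : E'.rot u₁ =
    ↑((List.range' 1 (m - 1)).map (fun i => ι (S.vertex i)) ++ extra₁ ++ [ι (S.vertex m)]).reverse

end Extension

/-- The inclusion of the vertices of a bipartite graph in those of a bipartite join. -/
def joinIncl {A B C D : Type*} : A ⊕ B → (A ⊕ C) ⊕ (B ⊕ D) := Sum.map Sum.inl Sum.inl

/-- `E'` is the extended embedding of `G_{A,B} ⊕ G_{2,2,2}` obtained from `E` through `(FA, FB)`.
The new vertices are `a_{m+1}, a_{m+2}` (`Sum.inl (Sum.inr 0)`, `Sum.inl (Sum.inr 1)`) and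
`b_{n+1}, b_{n+2}` (`Sum.inr (Sum.inr 0)`, `Sum.inr (Sum.inr 1)`).  They are placed, with the edges
`a_{m+1}b_{n+2}` and `a_{m+2}b_{n+1}`, on the boundary of a crosscap in the last face, which is
crossed by the edges from `a_{m-1}` to `b_{n+1}, b_{n+2}` and from `b_{n-1}` to
`a_{m+1}, a_{m+2}`.  An old edge changes its signature iff it crosses exactly one of the further
crosscaps. -/
structure IsExtended222 {m n : ℕ} {R : Fin m → Fin n → Prop} (E : CellEmbedding (bipGraph R))
    (FA FB : FaceSeq (bipGraph R))
    (E' : CellEmbedding (bipGraph (bipJoin R (minusMatching 2 2 2)))) : Prop where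
  attachA : Attached E E' joinIncl FA m (Sum.inr (Sum.inr 0)) (Sum.inr (Sum.inr 1)) true
    [Sum.inl (Sum.inr 1)] [Sum.inl (Sum.inr 0)]
  attachB : Attached E E' joinIncl FB n (Sum.inl (Sum.inr 0)) (Sum.inl (Sum.inr 1)) true
    [Sum.inr (Sum.inr 1)] [Sum.inr (Sum.inr 0)]
  twist_old : ∀ v w, (bipGraph R).Adj v w →
    (E'.twist s(joinIncl v, joinIncl w) ≠ E.twist s(v, w) ↔
      Xor (s(v, w) ∈ crosscapEdges E FA m) (s(v, w) ∈ crosscapEdges E FB n))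
  twist_new₁ : E'.twist s(Sum.inl (Sum.inr 0), Sum.inr (Sum.inr 1)) = true
  twist_new₂ : E'.twist s(Sum.inl (Sum.inr 1), Sum.inr (Sum.inr 0)) = false

/-- `E'` is the extended embedding of `G_{A,B} ⊕ G_{2,0,0}` obtained from `E` through `(FA, FB)`:
the new vertices `a_{m+1}, a_{m+2}` are attached to the vertices of `B`. -/
structure IsExtended200 {m n : ℕ} {R : Fin m → Fin n → Prop} (E : CellEmbedding (bipGraph R))
    (FB : FaceSeq (bipGraph R))
    (E' : CellEmbedding (bipGraph (bipJoin R (minusMatching 2 0 0)))) : Prop where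
  attachB : Attached E E' joinIncl FB n (Sum.inl (Sum.inr 0)) (Sum.inl (Sum.inr 1)) false [] []
  rot_old : ∀ a : Fin m, E'.rot (joinIncl (Sum.inl a)) = (E.rot (Sum.inl a)).map joinIncl
  twist_old : ∀ v w, (bipGraph R).Adj v w →
    (E'.twist s(joinIncl v, joinIncl w) ≠ E.twist s(v, w) ↔ s(v, w) ∈ crosscapEdges E FB n)

/-- `E'` is the extended embedding of `G_{A,B} ⊕ G_{0,2,0}` obtained from `E` through `(FA, FB)`:
the new vertices `b_{n+1}, b_{n+2}` are attached to the vertices of `A`. -/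
structure IsExtended020 {m n : ℕ} {R : Fin m → Fin n → Prop} (E : CellEmbedding (bipGraph R))
    (FA : FaceSeq (bipGraph R))
    (E' : CellEmbedding (bipGraph (bipJoin R (minusMatching 0 2 0)))) : Prop where
  attachA : Attached E E' joinIncl FA m (Sum.inr (Sum.inr 0)) (Sum.inr (Sum.inr 1)) false [] []
  rot_old : ∀ b : Fin n, E'.rot (joinIncl (Sum.inr b)) = (E.rot (Sum.inr b)).map joinIncl
  twist_old : ∀ v w, (bipGraph R).Adj v w →
    (E'.twist s(joinIncl v, joinIncl w) ≠ E.twist s(v, w) ↔ s(v, w) ∈ crosscapEdges E FA m)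

/-!
In a bipartite graph all faces of an embedding have even length, and unless the graph is a single
edge, no face has length two; hence `2 |F| ≤ |E|`.  By Euler's formula, the assumed value of the
Euler genus means that `|E| ≤ 2 |F| + 1` (`CellEmbedding.eulerGenus_eq_iff`), that is, all faces are
quadrilaterals except possibly for one hexagon (`CellEmbedding.quadrilateral_or_near`,
`CellEmbedding.card_edge_le_of_period`).  Such embeddings have the minimum Euler genus
(`CellEmbedding.hasMinimumEulerGenus`).  So two things have to be shown: the extended embeddings have
such faces as well, and extendible pairs exist.

*Faces of the extended embeddings.*  At a marked corner, the boundary walk of an old face now turns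
off to a new vertex, from which it goes on at the other corner of the marked pair
(`Tracing.Gate.pass`, `Attachment.pass`).  Thus a pair cuts a quadrilateral into two quadrilaterals
and a hexagon into a quadrilateral and a hexagon, and two parallel pairs cut a hexagon into two
quadrilaterals and a hexagon (`Tracing.Pairing`).  If both parts receive two new vertices, the last
face is cut at its four marked corners (`Tracing.Cut`).  The faces that contain new edges only are
quadrilaterals between consecutive neighbours of the two new vertices (`Attachment.covered`).
Altogether no face but one hexagon is longer than four (`Attachment.almostFour`,
`Attachment.almostFour_of_two`).  With two new vertices in each part, the embedding is nonorientable: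
the two edges between new vertices have different signatures, while at the last two old vertices both
new edges have the same signature (`IsExtended222.not_orientable`).  The extended embeddings exist
because each old vertex plays only one role in the extendible pair (`exists_attached`).

*Extendible pairs.*  The two neighbours of a vertex at a corner form a pair in the face of this
corner.  Two corners in a face of length at most six that lie at vertices of the same part have a
common neighbour on the face; hence disjoint pairs of the same part that arise in this way belong to
different faces, and only a pair of the one part and a pair of the other have to be compared
(`PairSystem`; an odd part has one additional pair, which shares a vertex with the central one).  For
a vertex that is adjacent to the whole opposite part, every second corner around it gives such a
system (`pairSystem_full`).  If the vertex misses one vertex of the opposite part, one pair has to be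
found elsewhere, under a parity condition (`pairSystem_missing`).  Taking the corners for the two
parts around the ends of one edge, with central pairs in a common face, yields an extendible pair
(`HasConfiguration.exists_extendible`).  The ends of the edge have full degree in both parts
(`hasConfiguration_of_full`), in one part (`hasConfiguration_of_full_left`), or in none
(`hasConfiguration_of_missing`).  In the last two cases the number of edges has a parity that makes
the embedding quadrilateral where this is needed; this also rules out the graphs that are too small
for the argument, since paths with four edges and cycles of length six have no
quadrilateral embedding.
-/

set_option linter.unusedSectionVars false

/-! ### Walking along faces -/

theorem FaceFlag.eq_of {V : Type*} {G : SimpleGraph V} {x y : FaceFlag G} (h₁ : x.fst = y.fst)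
    (h₂ : x.snd = y.snd) (h₃ : x.rev = y.rev) : x = y := by
  cases x; cases y; cases h₁; cases h₂; cases h₃; rfl

instance FaceFlag.instFinite {V : Type*} [Finite V] {G : SimpleGraph V} : Finite (FaceFlag G) :=
  Finite.of_injective (fun x : FaceFlag G => (x.fst, x.snd, x.rev)) fun x y h => by
    simp only [Prod.mk.injEq] at h
    exact FaceFlag.eq_of h.1 h.2.1 h.2.2

/-- `X` is one of the two parts of a bipartition of `G`. -/
def IsPart {V : Type*} (G : SimpleGraph V) (X : Set V) : Prop :=
  ∀ v w, G.Adj v w → (v ∈ X ↔ w ∉ X)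

theorem IsPart.compl {V : Type*} {G : SimpleGraph V} {X : Set V} (h : IsPart G X) :
    IsPart G Xᶜ := fun v w hvw => by
  have := h v w hvw
  simp only [Set.mem_compl_iff]; tauto

/-- A connected graph with an edge whose ends both have degree one consists of this edge. -/
theorem SimpleGraph.Connected.eq_or_eq_of_adj {V : Type*} {G : SimpleGraph V} (hc : G.Connected)
    {v w : V} (hvw : G.Adj v w) (h1 : ∀ u, G.Adj v u → u = w) (h2 : ∀ u, G.Adj w u → u = v) :
    ∀ u, u = v ∨ u = w := by
  intro u
  obtain ⟨p⟩ := hc.preconnected v u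
  have key : ∀ (a b : V), G.Walk a b → (a = v ∨ a = w) → (b = v ∨ b = w) := by
    intro a b p
    induction p with
    | nil => exact id
    | cons h p ih =>
      rintro (rfl | rfl)
      · exact ih (Or.inr (h1 _ h))
      · exact ih (Or.inl (h2 _ h))
  exact key v u p (Or.inl rfl)

namespace CellEmbedding

variable {V : Type*} [DecidableEq V] {G : SimpleGraph V} (E : CellEmbedding G)

/-- The permutation sending each neighbour of `v` to the next one in the rotation at `v`, read
against the local orientation if `r`. -/
def nx (r : Bool) (v : V) : Equiv.Perm V := if r = true then (E.perm v).symm else E.perm v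

theorem adj_nx (r : Bool) {v w : V} (h : G.Adj v w) : G.Adj v (E.nx r v w) := by
  cases r
  · exact E.adj_perm h
  · exact E.adj_perm_symm h

@[simp] theorem nx_nx_not (r : Bool) (v w : V) : E.nx r v (E.nx (!r) v w) = w := by
  cases r <;> simp [nx]

@[simp] theorem nx_not_nx (r : Bool) (v w : V) : E.nx (!r) v (E.nx r v w) = w := by
  cases r <;> simp [nx]

theorem nx_symm (r : Bool) (v : V) : (E.nx r v).symm = E.nx (!r) v := by
  cases r <;> rfl

theorem step_eq (x : FaceFlag G) : E.step x =
    ⟨x.snd, E.nx (x.rev ^^ E.twist s(x.fst, x.snd)) x.snd x.fst, E.adj_nx _ x.adj.symm,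
      x.rev ^^ E.twist s(x.fst, x.snd)⟩ := by
  unfold step
  split_ifs with h
  · apply FaceFlag.eq_of <;> simp [h, nx]
  · rw [Bool.not_eq_true] at h
    apply FaceFlag.eq_of <;> simp [h, nx]

@[simp] theorem step_fst (x : FaceFlag G) : (E.step x).fst = x.snd := by rw [step_eq]
@[simp] theorem step_rev (x : FaceFlag G) :
    (E.step x).rev = (x.rev ^^ E.twist s(x.fst, x.snd)) := by rw [step_eq]
theorem step_snd (x : FaceFlag G) :
    (E.step x).snd = E.nx (x.rev ^^ E.twist s(x.fst, x.snd)) x.snd x.fst := by rw [step_eq]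

theorem back_eq (x : FaceFlag G) : E.back x =
    ⟨x.fst, E.nx (!x.rev) x.fst x.snd, E.adj_nx _ x.adj, !x.rev⟩ := by
  unfold back
  split_ifs with h
  · apply FaceFlag.eq_of <;> simp [h, nx]
  · rw [Bool.not_eq_true] at h
    apply FaceFlag.eq_of <;> simp [h, nx]

@[simp] theorem back_fst (x : FaceFlag G) : (E.back x).fst = x.fst := by rw [back_eq]
@[simp] theorem back_rev (x : FaceFlag G) : (E.back x).rev = !x.rev := by rw [back_eq]
theorem back_snd (x : FaceFlag G) : (E.back x).snd = E.nx (!x.rev) x.fst x.snd := by rw [back_eq]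

@[simp] theorem back_back (x : FaceFlag G) : E.back (E.back x) = x := by
  apply FaceFlag.eq_of <;> simp [back_snd]

@[simp] theorem step_back_step (x : FaceFlag G) : E.step (E.back (E.step x)) = E.back x := by
  have h1 : (E.back (E.step x)).snd = x.fst := by
    rw [back_snd, step_fst, step_snd, step_rev, nx_not_nx]
  have h2 : (E.step (E.back (E.step x))).rev = !x.rev := by
    rw [step_rev, h1, back_rev, step_rev, back_fst, step_fst, Sym2.eq_swap]
    cases x.rev <;> cases E.twist s(x.snd, x.fst) <;> rfl
  apply FaceFlag.eq_of
  · rw [step_fst, h1, back_fst]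
  · rw [step_snd, ← step_rev, h2, h1, back_fst, step_fst, back_snd]
  · rw [h2, back_rev]

/-- The predecessor of a flag in the face traversal. -/
def pre (x : FaceFlag G) : FaceFlag G := E.back (E.step (E.back x))

@[simp] theorem pre_step (x : FaceFlag G) : E.pre (E.step x) = x := by simp [pre]
@[simp] theorem step_pre (x : FaceFlag G) : E.step (E.pre x) = x := by simp [pre]

/-- The same side of the same edge, passed in the opposite direction. -/
def rv (x : FaceFlag G) : FaceFlag G := E.back (E.step x)

@[simp] theorem rv_fst (x : FaceFlag G) : (E.rv x).fst = x.snd := by simp [rv]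
@[simp] theorem rv_snd (x : FaceFlag G) : (E.rv x).snd = x.fst := by
  rw [rv, back_snd, step_fst, step_snd, step_rev, nx_not_nx]
@[simp] theorem rv_rev (x : FaceFlag G) :
    (E.rv x).rev = !(x.rev ^^ E.twist s(x.fst, x.snd)) := by simp [rv]
@[simp] theorem rv_rv (x : FaceFlag G) : E.rv (E.rv x) = x := by simp [rv]
@[simp] theorem step_rv (x : FaceFlag G) : E.step (E.rv x) = E.back x := by simp [rv]
theorem back_pre (x : FaceFlag G) : E.back (E.pre x) = E.step (E.back x) := by simp [pre]
theorem pre_back (x : FaceFlag G) : E.pre (E.back x) = E.back (E.step x) := by simp [pre]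

theorem pre_fst (x : FaceFlag G) : (E.pre x).fst = E.nx (!x.rev) x.fst x.snd := by
  rw [pre, back_fst, step_fst, back_snd]

theorem pre_snd (x : FaceFlag G) : (E.pre x).snd = x.fst := by
  rw [← step_fst, step_pre]

theorem step_injective : Function.Injective E.step :=
  fun x y h => by rw [← E.pre_step x, h, pre_step]

theorem face_step (x : FaceFlag G) : E.face (E.step x) = E.face x :=
  (Quot.sound (r := fun x y : FaceFlag G => y = E.step x ∨ y = E.back x) (Or.inl rfl)).symm

theorem face_back (x : FaceFlag G) : E.face (E.back x) = E.face x :=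
  (Quot.sound (r := fun x y : FaceFlag G => y = E.step x ∨ y = E.back x) (Or.inr rfl)).symm

theorem face_rv (x : FaceFlag G) : E.face (E.rv x) = E.face x := by
  rw [rv, face_back, face_step]

theorem face_pre (x : FaceFlag G) : E.face (E.pre x) = E.face x := by
  rw [← face_step, step_pre]

theorem face_iterate (x : FaceFlag G) (i : ℕ) : E.face (E.step^[i] x) = E.face x := by
  induction i with
  | zero => rfl
  | succ i ih => rw [Function.iterate_succ_apply', face_step, ih]

theorem iterate_back_iterate (x : FaceFlag G) (i : ℕ) :
    E.step^[i] (E.back (E.step^[i] x)) = E.back x := by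
  induction i with
  | zero => rfl
  | succ i ih => rw [Function.iterate_succ_apply, Function.iterate_succ_apply', step_back_step, ih]

section Finite

theorem iterate_walkLength (x : FaceFlag G) : E.step^[E.walkLength x] x = x :=
  Function.iterate_minimalPeriod

variable [Finite V]

theorem exists_iterate_eq_id : ∃ N, 0 < N ∧ ∀ x, E.step^[N] x = x := by
  let σ : Equiv.Perm (FaceFlag G) := ⟨E.step, E.pre, E.pre_step, E.step_pre⟩
  have h : IsOfFinOrder σ := isOfFinOrder_of_finite σ
  obtain ⟨N, hN, h⟩ := h.exists_pow_eq_one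
  refine ⟨N, hN, fun x => ?_⟩
  have := congrArg (fun τ : Equiv.Perm (FaceFlag G) => τ x) h
  rw [← Equiv.Perm.iterate_eq_pow] at this
  exact this

theorem walkLength_pos (x : FaceFlag G) : 0 < E.walkLength x := by
  obtain ⟨N, hN, h⟩ := E.exists_iterate_eq_id
  exact Function.IsPeriodicPt.minimalPeriod_pos hN (h x)

/-- As the face traversal has finite order, walking backwards amounts to walking forwards. -/
theorem exists_back_iterate (x : FaceFlag G) (i : ℕ) :
    ∃ j, E.back (E.step^[i] x) = E.step^[j] (E.back x) := by
  obtain ⟨N, hN, h⟩ := E.exists_iterate_eq_id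
  refine ⟨(N - 1) * i, ?_⟩
  rw [← E.iterate_back_iterate x i, ← Function.iterate_add_apply]
  have h1 : (N - 1) * i + i = N * i := by
    obtain ⟨M, rfl⟩ : ∃ M, N = M + 1 := ⟨N - 1, by omega⟩
    simp; ring
  rw [h1, Function.iterate_mul]
  have h2 : E.step^[N] = id := funext h
  rw [h2, Function.iterate_id, id]

/-- The flags of a face are those on the boundary walk of one of them, in either direction. -/
theorem face_eq_iff {y z : FaceFlag G} : E.face z = E.face y ↔
    ∃ i, z = E.step^[i] y ∨ z = E.step^[i] (E.back y) := by
  constructor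
  · intro h
    obtain ⟨N, hN, hp⟩ := E.exists_iterate_eq_id
    have key : ∀ a b : FaceFlag G, Relation.EqvGen
        (fun x y : FaceFlag G => y = E.step x ∨ y = E.back x) a b →
        ((∃ i, a = E.step^[i] y ∨ a = E.step^[i] (E.back y)) ↔
          (∃ i, b = E.step^[i] y ∨ b = E.step^[i] (E.back y))) := by
      intro a b hab
      induction hab with
      | rel a b h =>
        rcases h with rfl | rfl
        · constructor
          · rintro ⟨i, rfl | rfl⟩
            · exact ⟨i + 1, Or.inl (Function.iterate_succ_apply' _ _ _).symm⟩
            · exact ⟨i + 1, Or.inr (Function.iterate_succ_apply' _ _ _).symm⟩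
          · rintro ⟨i, h⟩
            have h3 : E.step^[N - 1] (E.step a) = a := by
              rw [← Function.iterate_succ_apply, Nat.succ_eq_add_one, Nat.sub_add_cancel hN, hp]
            refine ⟨N - 1 + i, ?_⟩
            rw [Function.iterate_add_apply, Function.iterate_add_apply]
            rcases h with h | h
            · left; rw [← h, h3]
            · right; rw [← h, h3]
        · have aux : ∀ c : FaceFlag G, (∃ i, c = E.step^[i] y ∨ c = E.step^[i] (E.back y)) →
              (∃ i, E.back c = E.step^[i] y ∨ E.back c = E.step^[i] (E.back y)) := by
            rintro c ⟨i, rfl | rfl⟩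
            · obtain ⟨j, hj⟩ := E.exists_back_iterate y i
              exact ⟨j, Or.inr hj⟩
            · obtain ⟨j, hj⟩ := E.exists_back_iterate (E.back y) i
              rw [back_back] at hj
              exact ⟨j, Or.inl hj⟩
          exact ⟨aux a, fun h => by simpa using aux _ h⟩
      | refl a => rfl
      | symm a b _ ih => exact ih.symm
      | trans a b c _ _ ih1 ih2 => exact ih1.trans ih2
    exact (key z y (Quot.eqvGen_exact h)).2 ⟨0, Or.inl rfl⟩
  · rintro ⟨i, rfl | rfl⟩
    · exact E.face_iterate _ _
    · rw [face_iterate, face_back]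

theorem iterate_eq_of_face_eq {y z : FaceFlag G} {k : ℕ} (h : E.face z = E.face y)
    (hy : E.step^[k] y = y) : E.step^[k] z = z := by
  have hb : E.step^[k] (E.back y) = E.back y := by
    conv_lhs => rw [← hy]
    exact E.iterate_back_iterate y k
  rcases E.face_eq_iff.1 h with ⟨i, rfl | rfl⟩
  · rw [← Function.iterate_add_apply, add_comm, Function.iterate_add_apply, hy]
  · rw [← Function.iterate_add_apply, add_comm, Function.iterate_add_apply, hb]

theorem walkLength_eq_of_face_eq {y z : FaceFlag G} (h : E.face z = E.face y) :
    E.walkLength z = E.walkLength y := by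
  apply Nat.dvd_antisymm
  · exact Function.IsPeriodicPt.minimalPeriod_dvd
      (E.iterate_eq_of_face_eq h (E.iterate_walkLength y))
  · exact Function.IsPeriodicPt.minimalPeriod_dvd
      (E.iterate_eq_of_face_eq h.symm (E.iterate_walkLength z))

end Finite

/-! ### Lengths of faces in bipartite graphs -/

variable {X : Set V}

theorem mem_iterate (hX : IsPart G X) (x : FaceFlag G) (i : ℕ) :
    (E.step^[i] x).fst ∈ X ↔ (x.fst ∈ X ↔ Even i) := by
  induction i with
  | zero => simp
  | succ i ih =>
    rw [Function.iterate_succ_apply', step_fst]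
    have := hX _ _ (E.step^[i] x).adj
    rw [Nat.even_add_one]
    tauto

theorem mem_step (hX : IsPart G X) (x : FaceFlag G) : (E.step x).fst ∈ X ↔ x.fst ∉ X := by
  have := E.mem_iterate hX x 1
  simpa using this

theorem mem_pre (hX : IsPart G X) (x : FaceFlag G) : (E.pre x).fst ∈ X ↔ x.fst ∉ X := by
  have := E.mem_step hX (E.pre x)
  rw [step_pre] at this; tauto

/-- A vertex at which the rotation fixes a neighbour has degree one. -/
theorem eq_of_nx_eq_self {r : Bool} {v w : V} (hvw : G.Adj v w) (h : E.nx r v w = w) :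
    ∀ u, G.Adj v u → u = w := by
  have h' : E.perm v w = w := by
    cases r
    · exact h
    · simp only [nx, if_true] at h
      rw [Equiv.symm_apply_eq] at h
      exact h.symm
  intro u hu
  rw [← E.mem_rot] at hvw hu
  unfold perm at h'
  have key : ∀ (c : Cycle V) (hn : c.Nodup), w ∈ c → u ∈ c → c.formPerm hn w = w → u = w := by
    intro c hn hw hu h
    induction c using Quot.inductionOn with
    | h l =>
      change w ∈ l at hw
      change u ∈ l at hu
      change l.Nodup at hn
      change l.formPerm w = w at h
      rw [List.formPerm_apply_mem_eq_self_iff _ hn _ hw] at h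
      rcases l with _ | ⟨a, _ | ⟨b, l⟩⟩
      · simp at hu
      · simp at hu hw; rw [hu, hw]
      · simp at h
  exact key _ (E.nodup v) hvw hu h'

theorem step_step_ne (hV : ∀ v w : V, ∃ u, u ≠ v ∧ u ≠ w) (x : FaceFlag G) :
    E.step (E.step x) ≠ x := by
  intro h
  have h1 : (E.step x).snd = x.fst := by rw [← step_fst, h]
  have h2 := E.eq_of_nx_eq_self (r := x.rev ^^ E.twist s(x.fst, x.snd)) x.adj.symm
    (by rw [← step_snd, h1])
  have h3 : E.nx (x.rev) x.fst x.snd = x.snd := by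
    have h4 := E.step_snd (E.step x)
    have h5 := E.step_rev (E.step x)
    rw [← h5, h, h1, step_fst] at h4
    exact h4.symm
  obtain ⟨u, hu1, hu2⟩ := hV x.fst x.snd
  rcases E.connected.eq_or_eq_of_adj x.adj (E.eq_of_nx_eq_self x.adj h3) h2 u with h | h
  · exact hu1 h
  · exact hu2 h

theorem even_of_iterate_eq (hX : IsPart G X) {x : FaceFlag G} {i : ℕ} (h : E.step^[i] x = x) :
    Even i := by
  have := E.mem_iterate hX x i
  rw [h] at this; tauto

/-- In a bipartite graph, no corner is passed in both directions on one boundary walk. -/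
theorem iterate_ne_back (hX : IsPart G X) (x : FaceFlag G) (i : ℕ) :
    E.step^[i] x ≠ E.back x := by
  intro h
  have h1 := E.mem_iterate hX x i
  rw [h, back_fst] at h1
  have h2 : Even i := by tauto
  obtain ⟨j, rfl⟩ := h2
  rw [Function.iterate_add_apply] at h
  -- halfway between a flag and its reverse, a flag would equal its own reverse
  have h3 := E.iterate_back_iterate x j
  rw [← h] at h3
  have h4 := (E.step_injective.iterate j) h3
  have h5 := congrArg FaceFlag.rev h4
  simp at h5

theorem walkLength_even (hX : IsPart G X) (x : FaceFlag G) : Even (E.walkLength x) :=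
  E.even_of_iterate_eq hX (E.iterate_walkLength x)

variable [Finite V]

/-- A closed walk of length two on the boundary of a face would make its edge the whole graph. -/
theorem four_le_walkLength (hX : IsPart G X) (hV : ∀ v w : V, ∃ u, u ≠ v ∧ u ≠ w)
    (x : FaceFlag G) : 4 ≤ E.walkLength x := by
  have h1 := E.walkLength_even hX x
  have h2 := E.walkLength_pos x
  have h3 : E.walkLength x ≠ 2 := fun h => by
    have := E.iterate_walkLength x
    rw [h] at this
    exact E.step_step_ne hV x this
  obtain ⟨j, hj⟩ := h1
  omega

/-- The number of flags of a face is twice its length, as its boundary walk can be passed in both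
directions. -/
theorem card_fiber (hX : IsPart G X) (x : FaceFlag G) :
    Nat.card {z : FaceFlag G // E.face z = E.face x} = 2 * E.walkLength x := by
  have hL := E.walkLength_pos x
  have hb : E.walkLength (E.back x) = E.walkLength x :=
    E.walkLength_eq_of_face_eq (E.face_back x)
  have key : Function.Bijective (fun p : Bool × Fin (E.walkLength x) =>
      (⟨E.step^[p.2] (if p.1 = true then E.back x else x), by
        rw [face_iterate]; split_ifs <;> simp [face_back]⟩ :
        {z : FaceFlag G // E.face z = E.face x})) := by
    have hinj : ∀ (y : FaceFlag G) (i j : ℕ), i < E.walkLength y → j < E.walkLength y →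
        E.step^[i] y = E.step^[j] y → i = j := fun y i j hi hj h =>
      Function.iterate_injOn_Iio_minimalPeriod hi hj h
    have hdis : ∀ i j : ℕ, E.step^[i] x ≠ E.step^[j] (E.back x) := by
      intro i j h
      obtain ⟨N, hN, hp⟩ := E.exists_iterate_eq_id
      have hp' : E.step^[N] = id := funext hp
      -- walking on for the rest of a multiple of the period returns the right side to its start
      have h2 := congrArg (E.step^[(N - 1) * j]) h
      rw [← Function.iterate_add_apply, ← Function.iterate_add_apply] at h2
      have h1 : (N - 1) * j + j = N * j := by
        obtain ⟨M, rfl⟩ : ∃ M, N = M + 1 := ⟨N - 1, by omega⟩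
        simp; ring
      rw [h1, Function.iterate_mul E.step N j, hp', Function.iterate_id, id] at h2
      exact E.iterate_ne_back hX x _ h2
    constructor
    · rintro ⟨a, i⟩ ⟨b, j⟩ h
      simp only [Subtype.mk.injEq] at h
      cases a <;> cases b <;> simp only [if_true, Bool.false_eq_true, if_false] at h
      · rw [Prod.mk.injEq]; exact ⟨rfl, Fin.ext (hinj x i j i.2 j.2 h)⟩
      · exact absurd h (hdis _ _)
      · exact absurd h.symm (hdis _ _)
      · rw [Prod.mk.injEq]
        exact ⟨rfl, Fin.ext (hinj _ i j (hb.symm ▸ i.2) (hb.symm ▸ j.2) h)⟩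
    · rintro ⟨z, hz⟩
      rcases E.face_eq_iff.1 hz with ⟨i, rfl | rfl⟩
      · refine ⟨(false, ⟨i % E.walkLength x, Nat.mod_lt _ hL⟩), ?_⟩
        simp only [Subtype.mk.injEq, Bool.false_eq_true, if_false]
        exact Function.iterate_mod_minimalPeriod_eq
      · refine ⟨(true, ⟨i % E.walkLength x, Nat.mod_lt _ hL⟩), ?_⟩
        simp only [Subtype.mk.injEq, if_true]
        rw [← hb]
        exact Function.iterate_mod_minimalPeriod_eq
  rw [← Nat.card_congr (Equiv.ofBijective _ key), Nat.card_prod]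
  simp

end CellEmbedding

theorem FaceFlag.card {V : Type*} [Finite V] (G : SimpleGraph V) :
    Nat.card (FaceFlag G) = 4 * Nat.card G.edgeSet := by
  classical
  have := Fintype.ofFinite V
  let e : FaceFlag G ≃ G.Dart × Bool :=
    { toFun := fun x => (⟨(x.fst, x.snd), x.adj⟩, x.rev)
      invFun := fun p => ⟨p.1.fst, p.1.snd, p.1.adj, p.2⟩
      left_inv := fun x => rfl
      right_inv := fun p => rfl }
  rw [Nat.card_congr e, Nat.card_prod, Nat.card_eq_fintype_card (α := G.Dart),
    G.dart_card_eq_twice_card_edges, Nat.card_eq_fintype_card (α := Bool), Fintype.card_bool,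
    Nat.card_eq_fintype_card (α := G.edgeSet), SimpleGraph.edgeFinset_card]
  ring

/-! ### Counting faces -/

namespace CellEmbedding

variable {V : Type*} [DecidableEq V] {G : SimpleGraph V} (E : CellEmbedding G) {X : Set V} [Finite V]

instance instFiniteFace : Finite E.Face := Quot.finite _

/-- Every face of an embedded bipartite graph has length `4 + 2e` for some excess `e ≥ 0`, and
double counting of edges gives `|E| = 2|F| + ∑ e`. -/
theorem exists_excess (hX : IsPart G X) (hV : ∀ v w : V, ∃ u, u ≠ v ∧ u ≠ w) :
    ∃ e : E.Face → ℕ, (∀ x, E.walkLength x = 4 + 2 * e (E.face x)) ∧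
      Nat.card G.edgeSet = 2 * Nat.card E.Face + ∑ᶠ f, e f := by
  classical
  have := Fintype.ofFinite E.Face
  have hout : ∀ f : E.Face, E.face (Quot.out f) = f := fun f => Quot.out_eq f
  have hl : ∀ x, E.walkLength x =
      4 + 2 * ((E.walkLength (Quot.out (E.face x)) - 4) / 2) := by
    intro x
    rw [E.walkLength_eq_of_face_eq (hout (E.face x))]
    have h1 := E.four_le_walkLength hX hV x
    obtain ⟨j, hj⟩ := E.walkLength_even hX x
    omega
  refine ⟨fun f => (E.walkLength (Quot.out f) - 4) / 2, hl, ?_⟩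
  have h1 : Nat.card (FaceFlag G) = ∑ f : E.Face, 2 * E.walkLength (Quot.out f) := by
    rw [← Nat.card_congr (Equiv.sigmaFiberEquiv E.face), Nat.card_sigma]
    refine Finset.sum_congr rfl fun f _ => ?_
    rw [← E.card_fiber hX (Quot.out f), hout]
  rw [FaceFlag.card] at h1
  rw [finsum_eq_sum_of_fintype, Nat.card_eq_fintype_card (α := E.Face)]
  have h2 : ∀ f : E.Face, 2 * E.walkLength (Quot.out f) =
      8 + 4 * ((E.walkLength (Quot.out f) - 4) / 2) := by
    intro f
    have := hl (Quot.out f)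
    rw [hout] at this
    omega
  rw [Finset.sum_congr rfl (fun f _ => h2 f), Finset.sum_add_distrib, ← Finset.mul_sum,
    Finset.sum_const, Finset.card_univ, smul_eq_mul] at h1
  omega

theorem two_mul_card_face_le (hX : IsPart G X) (hV : ∀ v w : V, ∃ u, u ≠ v ∧ u ≠ w) :
    2 * Nat.card E.Face ≤ Nat.card G.edgeSet := by
  obtain ⟨e, -, h⟩ := E.exists_excess hX hV
  omega

/-- An embedding with as many faces as its number of edges allows has excess zero or one in total. -/
theorem quadrilateral_or_near (hX : IsPart G X) (hV : ∀ v w : V, ∃ u, u ≠ v ∧ u ≠ w)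
    (h : Nat.card G.edgeSet ≤ 2 * Nat.card E.Face + 1) :
    (Even (Nat.card G.edgeSet) ∧ E.IsQuadrilateral) ∨
      (¬ Even (Nat.card G.edgeSet) ∧ E.IsNearQuadrilateral) := by
  classical
  have := Fintype.ofFinite E.Face
  obtain ⟨e, he, hs⟩ := E.exists_excess hX hV
  rw [finsum_eq_sum_of_fintype] at hs
  have h1 : ∑ f, e f = 0 ∨ ∑ f, e f = 1 := by omega
  rcases h1 with h1 | h1
  · refine Or.inl ⟨⟨Nat.card E.Face, by omega⟩, fun x => ?_⟩
    rw [Finset.sum_eq_zero_iff] at h1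
    rw [he, h1 _ (Finset.mem_univ _), mul_zero, add_zero]
  · refine Or.inr ⟨fun ⟨j, hj⟩ => by omega, ?_⟩
    obtain ⟨f, -, hf⟩ : ∃ f ∈ Finset.univ, e f ≠ 0 := by
      by_contra! hc
      rw [Finset.sum_eq_zero hc] at h1
      omega
    have h2 := Finset.add_sum_erase Finset.univ e (Finset.mem_univ f)
    rw [h1] at h2
    induction f using Quot.inductionOn with
    | h x₀ =>
      change e (E.face x₀) ≠ 0 at hf
      change e (E.face x₀) + _ = 1 at h2
      refine ⟨x₀, ?_, fun x hx => ?_⟩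
      · rw [he]; omega
      · rw [he]
        have h3 : ∑ x ∈ Finset.univ.erase (E.face x₀), e x = 0 := by
          change _ + ∑ x ∈ Finset.univ.erase (E.face x₀), e x = 1 at h2
          omega
        rw [Finset.sum_eq_zero_iff] at h3
        rw [h3 _ (Finset.mem_erase.2 ⟨hx, Finset.mem_univ _⟩), mul_zero, add_zero]

/-- Faces whose boundary walks close after four steps, and at most one after six, are as many as the
number of edges allows. -/
theorem card_edge_le_of_period (hX : IsPart G X) (hV : ∀ v w : V, ∃ u, u ≠ v ∧ u ≠ w)
    (h : (∀ y, E.step^[4] y = y) ∨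
      ∃ y₀, E.step^[6] y₀ = y₀ ∧ ∀ y, E.step^[4] y = y ∨ E.face y = E.face y₀) :
    Nat.card G.edgeSet ≤ 2 * Nat.card E.Face + 1 := by
  classical
  have := Fintype.ofFinite E.Face
  obtain ⟨e, he, hs⟩ := E.exists_excess hX hV
  rw [finsum_eq_sum_of_fintype] at hs
  have h4 : ∀ y, E.step^[4] y = y → e (E.face y) = 0 := by
    intro y hy
    have h1 : E.walkLength y ∣ 4 := Function.IsPeriodicPt.minimalPeriod_dvd hy
    have h2 := Nat.le_of_dvd (by norm_num) h1
    have := he y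
    omega
  rcases h with h | ⟨y₀, h6, h⟩
  · have : ∑ f, e f = 0 := Finset.sum_eq_zero fun f _ => by
      induction f using Quot.inductionOn with
      | h x => exact h4 x (h x)
    omega
  · have h1 : ∑ f, e f = e (E.face y₀) := by
      refine Finset.sum_eq_single _ (fun f _ hf => ?_) (fun h => absurd (Finset.mem_univ _) h)
      induction f using Quot.inductionOn with
      | h x =>
        rcases h x with h | h
        · exact h4 x h
        · exact absurd h hf
    have h2 : E.walkLength y₀ ∣ 6 := Function.IsPeriodicPt.minimalPeriod_dvd h6
    have h3 := Nat.le_of_dvd (by norm_num) h2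
    have := he y₀
    omega

/-- An embedding with as many faces as its number of edges allows has minimum Euler genus. -/
theorem hasMinimumEulerGenus (hX : IsPart G X) (hV : ∀ v w : V, ∃ u, u ≠ v ∧ u ≠ w)
    (h : Nat.card G.edgeSet ≤ 2 * Nat.card E.Face + 1) : E.HasMinimumEulerGenus := by
  intro E₂
  have h2 := E₂.two_mul_card_face_le hX hV
  unfold eulerGenus
  omega

/-- The Euler genus in terms of the numbers of vertices and edges, for an embedding with as many
faces as its number of edges allows. -/
theorem eulerGenus_eq_iff (hX : IsPart G X) (hV : ∀ v w : V, ∃ u, u ≠ v ∧ u ≠ w) :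
    E.eulerGenus = ⌈(4 - 2 * (Nat.card V : ℚ) + (Nat.card G.edgeSet : ℚ)) / 2⌉ ↔
      Nat.card G.edgeSet ≤ 2 * Nat.card E.Face + 1 := by
  have h2 := E.two_mul_card_face_le hX hV
  unfold eulerGenus
  rw [eq_comm, Int.ceil_eq_iff]
  push_cast
  constructor
  · rintro ⟨h, -⟩
    have : (Nat.card G.edgeSet : ℚ) < 2 * Nat.card E.Face + 2 := by linarith
    have h' : Nat.card G.edgeSet < 2 * Nat.card E.Face + 2 := by exact_mod_cast this
    omega
  · intro h
    have h1 : (Nat.card G.edgeSet : ℚ) ≤ 2 * Nat.card E.Face + 1 := by exact_mod_cast h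
    have h3 : 2 * (Nat.card E.Face : ℚ) ≤ Nat.card G.edgeSet := by exact_mod_cast h2
    constructor <;> linarith

end CellEmbedding

/-! ### The sizes of the graphs -/

theorem isPart_bipGraph {A B : Type*} (R : A → B → Prop) :
    IsPart (bipGraph R) (Set.range Sum.inl) := by
  rintro (a | b) (a' | b') h
  · exact h.elim
  · simp
  · simp
  · exact h.elim

theorem card_edgeSet_bipGraph {A B : Type*} (R : A → B → Prop) :
    Nat.card (bipGraph R).edgeSet = Nat.card {p : A × B // R p.1 p.2} := by
  symm
  refine Nat.card_congr (Equiv.ofBijective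
    (fun p => ⟨s(Sum.inl p.1.1, Sum.inr p.1.2), p.2⟩) ⟨?_, ?_⟩)
  · rintro ⟨⟨a, b⟩, h⟩ ⟨⟨a', b'⟩, h'⟩ he
    have := congrArg Subtype.val he
    simpa using this
  · rintro ⟨e, he⟩
    induction e using Sym2.inductionOn with
    | hf x y =>
      rcases x with a | b <;> rcases y with a' | b'
      · exact he.elim
      · exact ⟨⟨(a, b'), he⟩, rfl⟩
      · exact ⟨⟨(a', b), he⟩, by simp [Sym2.eq_swap]⟩
      · exact he.elim

theorem card_minusMatching {m n k : ℕ} (hkm : k ≤ m) (hkn : k ≤ n) :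
    Nat.card {p : Fin m × Fin n // minusMatching m n k p.1 p.2} + k = m * n := by
  classical
  have h1 : Nat.card {p : Fin m × Fin n // ¬ minusMatching m n k p.1 p.2} = k := by
    refine (Nat.card_congr (Equiv.symm (Equiv.ofBijective
      (fun i : Fin k => ⟨(⟨i, i.2.trans_le hkm⟩, ⟨i, i.2.trans_le hkn⟩), by
        simp [minusMatching]⟩) ⟨?_, ?_⟩))).trans (Nat.card_fin k)
    · intro i j h
      simpa [Fin.ext_iff] using h
    · rintro ⟨⟨i, j⟩, h⟩
      simp only [minusMatching, not_not] at h
      exact ⟨⟨i, h.2⟩, by simp [Fin.ext_iff, h.1]⟩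
  have h2 := Nat.card_congr (Equiv.sumCompl fun p : Fin m × Fin n => minusMatching m n k p.1 p.2)
  rw [Nat.card_sum, h1, Nat.card_prod, Nat.card_fin, Nat.card_fin] at h2
  exact h2

theorem card_bipJoin {A B C D : Type*} [Finite A] [Finite B] [Finite C] [Finite D]
    (R : A → B → Prop) (S : C → D → Prop) :
    Nat.card {p : (A ⊕ C) × (B ⊕ D) // bipJoin R S p.1 p.2} =
      Nat.card {p : A × B // R p.1 p.2} + Nat.card {p : C × D // S p.1 p.2} +
        Nat.card A * Nat.card D + Nat.card C * Nat.card B := by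
  let e : {p : (A ⊕ C) × (B ⊕ D) // bipJoin R S p.1 p.2} ≃
      ((({p : A × B // R p.1 p.2} ⊕ {p : C × D // S p.1 p.2}) ⊕ (A × D)) ⊕ (C × B)) :=
    { toFun := fun p => match p with
        | ⟨(Sum.inl a, Sum.inl b), h⟩ => Sum.inl (Sum.inl (Sum.inl ⟨(a, b), h⟩))
        | ⟨(Sum.inr c, Sum.inr d), h⟩ => Sum.inl (Sum.inl (Sum.inr ⟨(c, d), h⟩))
        | ⟨(Sum.inl a, Sum.inr d), _⟩ => Sum.inl (Sum.inr (a, d))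
        | ⟨(Sum.inr c, Sum.inl b), _⟩ => Sum.inr (c, b)
      invFun := fun q => match q with
        | Sum.inl (Sum.inl (Sum.inl p)) => ⟨(Sum.inl p.1.1, Sum.inl p.1.2), p.2⟩
        | Sum.inl (Sum.inl (Sum.inr p)) => ⟨(Sum.inr p.1.1, Sum.inr p.1.2), p.2⟩
        | Sum.inl (Sum.inr p) => ⟨(Sum.inl p.1, Sum.inr p.2), trivial⟩
        | Sum.inr p => ⟨(Sum.inr p.1, Sum.inl p.2), trivial⟩
      left_inv := by rintro ⟨⟨a | c, b | d⟩, h⟩ <;> rfl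
      right_inv := by rintro (((p | p) | p) | p) <;> rfl }
  rw [Nat.card_congr e]
  simp only [Nat.card_sum, Nat.card_prod]

theorem exists_ne_ne_of_card {V : Type*} [Finite V] (h : 3 ≤ Nat.card V) (v w : V) :
    ∃ u, u ≠ v ∧ u ≠ w := by
  classical
  have := Fintype.ofFinite V
  rw [Nat.card_eq_fintype_card] at h
  by_contra! hc
  have : (Finset.univ : Finset V) ⊆ {v, w} := fun u _ => by
    by_cases hu : u = v
    · simp [hu]
    · simp [hc u hu]
  have h1 := Finset.card_le_card this
  have h2 : ({v, w} : Finset V).card ≤ 2 := Finset.card_le_two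
  rw [Finset.card_univ] at h1
  omega

/-! ### Rotations as lists -/

namespace CellEmbedding

variable {V : Type*} [DecidableEq V] {G : SimpleGraph V} (E : CellEmbedding G)

theorem mem_read {r : Bool} {v w : V} : w ∈ E.read r v ↔ G.Adj v w := by
  rw [← E.mem_rot]
  cases r <;> simp [read]

theorem nodup_read (r : Bool) (v : V) : (E.read r v).Nodup := by
  have := E.nodup v
  cases r <;> simpa [read] using this

theorem nx_of_ends {r : Bool} {v p q : V} {L : List V} (h : E.read r v = ↑L)
    (hq : L.head? = some q) (hp : L.getLast? = some p) : E.nx r v p = q := by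
  have key : ∀ (c : Cycle V) (hc : c.Nodup) (L : List V) (p q : V), c = ↑L → L.head? = some q →
      L.getLast? = some p → c.formPerm hc p = q := by
    rintro c hc L p q rfl hq hp
    rcases L with _ | ⟨a, L⟩
    · simp at hq
    · simp only [List.head?_cons, Option.some.injEq] at hq
      rw [List.getLast?_eq_getLast_of_ne_nil (List.cons_ne_nil _ _), Option.some.injEq] at hp
      subst hq hp
      exact List.formPerm_apply_getLast a L
  cases r
  · exact key _ (E.nodup v) L p q h hq hp
  · simp only [read, if_true] at h
    have h' : E.rot v = ↑L.reverse := by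
      rw [← Cycle.reverse_coe, ← h, Cycle.reverse_reverse]
    have := key _ (E.nodup v) L.reverse q p h' (by simpa using hp) (by simpa using hq)
    simp only [nx, if_true]
    rw [Equiv.symm_apply_eq]
    exact this.symm

theorem nx_of_append {r : Bool} {v p q : V} {A B : List V} (h : E.read r v = ↑(A ++ p :: q :: B)) :
    E.nx r v p = q := by
  refine E.nx_of_ends (L := q :: B ++ (A ++ [p])) ?_ (by simp) (by
    rw [← List.append_assoc, List.getLast?_append]; simp)
  rw [h, Cycle.coe_eq_coe]
  have := List.isRotated_append (l := A ++ [p]) (l' := q :: B)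
  simpa using this

theorem nodup_of_read {r : Bool} {v : V} {L : List V} (h : E.read r v = ↑L) : L.Nodup := by
  have := E.nodup_read r v
  rwa [h, Cycle.nodup_coe_iff] at this

theorem adj_of_read {r : Bool} {v p : V} {L : List V} (h : E.read r v = ↑L) :
    p ∈ L ↔ G.Adj v p := by
  rw [← E.mem_read (r := r), h, Cycle.mem_coe_iff]

theorem exists_append_of_nx {r : Bool} {v p : V} {L : List V} (h : E.read r v = ↑L)
    (hp : G.Adj v p) (hne : L.head? ≠ some (E.nx r v p)) :
    ∃ A B, L = A ++ p :: E.nx r v p :: B := by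
  obtain ⟨A, B, hAB⟩ := List.append_of_mem ((E.adj_of_read h).2 (E.adj_nx r hp))
  rcases List.eq_nil_or_concat A with rfl | ⟨A', p', rfl⟩
  · rw [hAB] at hne; simp at hne
  · have h1 : L = A' ++ p' :: E.nx r v p :: B := by simpa using hAB
    have h2 := E.nx_of_append (h1 ▸ h)
    have h3 := (E.nx r v).injective h2
    subst h3
    exact ⟨A', B, h1⟩

theorem getLast_of_nx {r : Bool} {v p : V} {L : List V} (h : E.read r v = ↑L)
    (hp : L.head? = some (E.nx r v p)) : L.getLast? = some p := by
  rcases hL : L.getLast? with _ | p'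
  · rw [List.getLast?_eq_none_iff] at hL
    rw [hL] at hp; simp at hp
  · have := E.nx_of_ends h hp hL
    rw [(E.nx r v).injective this]

theorem exists_read_eq {r : Bool} {v p : V} (hp : G.Adj v p) :
    ∃ l : List V, E.read r v = ↑(p :: l) := by
  rw [← E.mem_read (r := r)] at hp
  induction hc : E.read r v using Quot.inductionOn with
  | h L =>
    rw [hc] at hp
    change p ∈ L at hp
    obtain ⟨A, B, rfl⟩ := List.append_of_mem hp
    refine ⟨B ++ A, ?_⟩
    change ((A ++ p :: B : List V) : Cycle V) = ↑(p :: (B ++ A))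
    rw [Cycle.coe_eq_coe]
    exact List.isRotated_append

end CellEmbedding

/-! ### Tracing faces in an extension of an embedding -/

section Tracing

variable {V W : Type*} [DecidableEq V] [DecidableEq W] {G : SimpleGraph V} {H : SimpleGraph W}

/-- A graph `G` embedded by `E` sits, by the map `ι`, inside a graph `H` embedded by `E'`.  The
function `flip` tells which ends of old edges are reversed by crosscaps placed near their vertices: the signature of an
old edge changes once for each of its reversed ends. -/
structure Tracing (E : CellEmbedding G) (E' : CellEmbedding H) where
  ι : V → W
  adj : ∀ {v w}, G.Adj v w → H.Adj (ι v) (ι w)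
  flip : V → V → Bool
  twist : ∀ {v w}, G.Adj v w → E'.twist s(ι v, ι w) = (E.twist s(v, w) ^^ flip v w ^^ flip w v)

namespace Tracing

variable {E : CellEmbedding G} {E' : CellEmbedding H} (T : Tracing E E')

/-- The flag of `H` corresponding to a flag of `G`. -/
def lift (x : FaceFlag G) : FaceFlag H :=
  ⟨T.ι x.fst, T.ι x.snd, T.adj x.adj, x.rev ^^ T.flip x.fst x.snd⟩

/-- The walk of `E'` arriving at the corner `z` of `E` leaves it as in `E`. -/
def Kept (z : FaceFlag G) : Prop :=
  E'.nx (z.rev ^^ T.flip z.fst (E.pre z).fst) (T.ι z.fst) (T.ι (E.pre z).fst) = T.ι z.snd ∧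
    T.flip z.fst z.snd = T.flip z.fst (E.pre z).fst

/-- The walk of `E'` arriving at the corner `z` of `E` leaves it along the edge to `w`, and arrives
at `w` in the sense of the local orientation if `d = false`, and against it if `d = true`. -/
def Gate (z : FaceFlag G) (w : W) (d : Bool) : Prop :=
  E'.nx (z.rev ^^ T.flip z.fst (E.pre z).fst) (T.ι z.fst) (T.ι (E.pre z).fst) = w ∧
    (z.rev ^^ T.flip z.fst (E.pre z).fst ^^ E'.twist s(T.ι z.fst, w)) = d

theorem rv_lift (x : FaceFlag G) : E'.rv (T.lift x) = T.lift (E.rv x) := by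
  apply FaceFlag.eq_of
  · simp [lift]
  · simp [lift]
  · simp only [lift, CellEmbedding.rv_rev, CellEmbedding.rv_fst, CellEmbedding.rv_snd,
      T.twist x.adj]
    cases x.rev <;> cases T.flip x.fst x.snd <;> cases T.flip x.snd x.fst <;>
      cases E.twist s(x.fst, x.snd) <;> rfl

theorem step_lift_rev (x : FaceFlag G) :
    (E'.step (T.lift x)).rev = ((E.step x).rev ^^ T.flip x.snd x.fst) := by
  simp only [CellEmbedding.step_rev, lift, T.twist x.adj]
  cases x.rev <;> cases T.flip x.fst x.snd <;> cases T.flip x.snd x.fst <;>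
      cases E.twist s(x.fst, x.snd) <;> rfl

theorem step_lift_snd (x : FaceFlag G) : (E'.step (T.lift x)).snd =
    E'.nx ((E.step x).rev ^^ T.flip x.snd x.fst) (T.ι x.snd) (T.ι x.fst) := by
  rw [CellEmbedding.step_snd, ← CellEmbedding.step_rev, step_lift_rev]; rfl

variable {T}

theorem Kept.step_lift {x : FaceFlag G} (h : T.Kept (E.step x)) :
    E'.step (T.lift x) = T.lift (E.step x) := by
  obtain ⟨h1, h2⟩ := h
  rw [CellEmbedding.pre_step, CellEmbedding.step_fst] at h1 h2
  apply FaceFlag.eq_of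
  · simp [lift]
  · rw [step_lift_snd, h1]; rfl
  · rw [step_lift_rev, ← h2]; simp [lift]

theorem Gate.adj {z : FaceFlag G} {w : W} {d : Bool} (h : T.Gate z w d) : H.Adj (T.ι z.fst) w := by
  rw [← h.1]
  refine E'.adj_nx _ (T.adj ?_)
  have := (E.pre z).adj
  rw [E.pre_snd] at this
  exact this.symm

theorem Gate.step_lift {z : FaceFlag G} {w : W} {d : Bool} (h : T.Gate z w d) :
    E'.step (T.lift (E.pre z)) =
      ⟨T.ι z.fst, w, h.adj, d ^^ E'.twist s(T.ι z.fst, w)⟩ := by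
  have h1 := h.1
  have h2 := h.2
  apply FaceFlag.eq_of
  · simp [lift, E.pre_snd]
  · rw [step_lift_snd, E.step_pre, E.pre_snd]
    exact h1
  · rw [step_lift_rev, E.step_pre, E.pre_snd]
    change _ = (d ^^ E'.twist s(T.ι z.fst, w))
    rw [← h2]
    simp

/-- Reversing a gate: the walk that comes from the new vertex `w` continues at the old corner `z`. -/
theorem Gate.step_exit {z : FaceFlag G} {w : W} {d : Bool} (h : T.Gate (E.back z) w (!d)) :
    E'.step ⟨w, T.ι z.fst, by have := h.adj.symm; simpa using this, d⟩ = T.lift z := by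
  have h1 := h.step_lift
  have h2 : (⟨w, T.ι z.fst, by have := h.adj.symm; simpa using this, d⟩ : FaceFlag H) =
      E'.rv (E'.step (T.lift (E.pre (E.back z)))) := by
    rw [h1]
    apply FaceFlag.eq_of
    · simp
    · simp
    · simp
  rw [h2, CellEmbedding.step_rv]
  change E'.rv _ = _
  rw [rv_lift]
  congr 1
  simp [CellEmbedding.rv]

/-- Passing from a corner of one face through a new vertex `w` to a corner of another face. -/
theorem Gate.pass {z z' : FaceFlag G} {w : W} {d : Bool} (h : T.Gate z w d)
    (h' : T.Gate (E.back z') w (!d)) (hw : E'.nx d w (T.ι z.fst) = T.ι z'.fst) :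
    E'.step^[3] (T.lift (E.pre z)) = T.lift z' := by
  change E'.step (E'.step (E'.step _)) = _
  rw [h.step_lift, ← h'.step_exit]
  congr 1
  have : ∀ t : Bool, (d ^^ t ^^ t) = d := by cases d <;> decide
  apply FaceFlag.eq_of
  · simp
  · simp [CellEmbedding.step_snd, hw]
  · simp

/-- Passing from a corner of one face through two new vertices to a corner of another face. -/
theorem Gate.pass_pass {z z' : FaceFlag G} {w w' : W} {d d' : Bool} (h : T.Gate z w d)
    (hd : (d ^^ E'.twist s(w, w')) = d')
    (h' : T.Gate (E.back z') w' (!d')) (hw : E'.nx d w (T.ι z.fst) = w')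
    (hw' : E'.nx d' w' w = T.ι z'.fst) :
    E'.step^[4] (T.lift (E.pre z)) = T.lift z' := by
  change E'.step (E'.step (E'.step (E'.step _))) = _
  rw [h.step_lift, ← h'.step_exit]
  congr 1
  have h1 : E'.step (⟨T.ι z.fst, w, h.adj, d ^^ E'.twist s(T.ι z.fst, w)⟩ : FaceFlag H) =
      ⟨w, w', by rw [← hw]; exact E'.adj_nx _ h.adj.symm, d⟩ := by
    apply FaceFlag.eq_of
    · simp
    · simp [CellEmbedding.step_snd, hw]
    · simp
  rw [h1]
  apply FaceFlag.eq_of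
  · simp
  · simp [CellEmbedding.step_snd, hd, hw']
  · simp [hd]

theorem face_step_lift_of_gate {z : FaceFlag G} {w : W} {d : Bool} (h : T.Gate z w d) (r : Bool)
    (hr : r = (d ^^ E'.twist s(T.ι z.fst, w))) :
    E'.face ⟨T.ι z.fst, w, h.adj, r⟩ = E'.face (T.lift (E.pre z)) := by
  subst hr
  rw [← h.step_lift, CellEmbedding.face_step]

end Tracing

/-! ### Inserting two edges at a vertex -/

/-- One of the two new vertices. -/
abbrev pick {W : Type*} (u₀ u₁ : W) (s : Bool) : W := if s = true then u₁ else u₀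

variable {E : CellEmbedding G} {E' : CellEmbedding H} {T : Tracing E E'} {u₀ u₁ : W}

section Inserted

variable {x : FaceFlag G} {swap tw : Bool}

theorem Inserted.twist_pick (h : Inserted E E' T.ι u₀ u₁ x swap tw) (s : Bool) :
    E'.twist s(T.ι x.fst, pick u₀ u₁ s) = (tw ^^ x.rev) := by
  cases s
  · exact h.2.1
  · exact h.2.2

theorem Inserted.exists_list (h : Inserted E E' T.ι u₀ u₁ x swap tw) :
    ∃ l : List V, E.read x.rev x.fst = ↑(x.snd :: l) ∧ E'.read x.rev (T.ι x.fst) =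
      ↑((x.snd :: l).map T.ι ++ [pick u₀ u₁ swap, pick u₀ u₁ (!swap)]) := by
  obtain ⟨l, h1, h2⟩ := h.1
  refine ⟨l, h1, ?_⟩
  cases swap <;> exact h2

theorem Inserted.nx_pick (h : Inserted E E' T.ι u₀ u₁ x swap tw) :
    E'.nx x.rev (T.ι x.fst) (pick u₀ u₁ swap) = pick u₀ u₁ (!swap) := by
  obtain ⟨l, -, h2⟩ := h.exists_list
  exact E'.nx_of_append h2

/-- The walk arriving at the corner `x` meets the edge to the first of the two inserted vertices, and
in the other direction (`Inserted.gate_back`) that to the second one. -/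
theorem Inserted.gate (h : Inserted E E' T.ι u₀ u₁ x swap tw)
    (hf : ∀ p, G.Adj x.fst p → T.flip x.fst p = false) :
    T.Gate x (pick u₀ u₁ swap) tw := by
  have ha : G.Adj x.fst (E.pre x).fst := by
    have := (E.pre x).adj.symm
    rwa [E.pre_snd] at this
  unfold Tracing.Gate
  rw [hf _ ha, h.twist_pick]
  refine ⟨?_, by cases x.rev <;> cases tw <;> rfl⟩
  obtain ⟨l, h1, h2⟩ := h.exists_list
  have h3 := E.getLast_of_nx (p := (E.pre x).fst) h1 (by rw [E.pre_fst]; simp)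
  obtain ⟨l', hl'⟩ : ∃ l', x.snd :: l = l' ++ [(E.pre x).fst] := by
    rw [List.getLast?_eq_some_iff] at h3
    exact h3
  rw [hl'] at h2
  rw [Bool.xor_false]
  exact E'.nx_of_append (A := l'.map T.ι) (B := [pick u₀ u₁ (!swap)]) (by rw [h2]; simp)

theorem Inserted.gate_back (h : Inserted E E' T.ι u₀ u₁ x swap tw)
    (hf : ∀ p, G.Adj x.fst p → T.flip x.fst p = false) :
    T.Gate (E.back x) (pick u₀ u₁ (!swap)) (!tw) := by
  have hp : (E.pre (E.back x)).fst = x.snd := by rw [E.pre_back, E.back_fst, E.step_fst]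
  unfold Tracing.Gate
  rw [hp, E.back_fst, E.back_rev, hf _ x.adj, h.twist_pick]
  refine ⟨?_, by cases x.rev <;> cases tw <;> rfl⟩
  obtain ⟨l, h1, h2⟩ := h.exists_list
  rw [Bool.xor_false, ← E'.nx_symm, Equiv.symm_apply_eq]
  symm
  refine E'.nx_of_ends h2 (by simp) ?_
  rw [List.getLast?_append]; simp

/-- No other corner at the vertex is affected by the insertion. -/
theorem Inserted.kept (h : Inserted E E' T.ι u₀ u₁ x swap tw)
    (hf : ∀ p, G.Adj x.fst p → T.flip x.fst p = false) {z : FaceFlag G} (hz : z.fst = x.fst)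
    (h1 : z ≠ x) (h2 : z ≠ E.back x) : T.Kept z := by
  have hadj : G.Adj z.fst (E.pre z).fst := by
    have := (E.pre z).adj.symm
    rwa [E.pre_snd] at this
  have hp : E.nx z.rev z.fst (E.pre z).fst = z.snd := by rw [E.pre_fst, E.nx_nx_not]
  obtain ⟨l, h3, h4⟩ := h.exists_list
  have key : ∀ p, G.Adj x.fst p → E.nx x.rev x.fst p ≠ x.snd →
      E'.nx x.rev (T.ι x.fst) (T.ι p) = T.ι (E.nx x.rev x.fst p) := by
    intro p hp hne
    obtain ⟨A, B, hAB⟩ := E.exists_append_of_nx h3 hp (by simpa using hne.symm)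
    rw [hAB] at h4
    exact E'.nx_of_append (A := A.map T.ι)
      (B := B.map T.ι ++ [pick u₀ u₁ swap, pick u₀ u₁ (!swap)]) (by rw [h4]; simp)
  unfold Tracing.Kept
  rw [hz] at hadj hp ⊢
  rw [hf _ hadj, hf _ (hz ▸ z.adj), Bool.xor_false]
  refine ⟨?_, rfl⟩
  rcases Bool.eq_or_eq_not z.rev x.rev with hr | hr
  · rw [hr] at hp ⊢
    rw [← hp]
    refine key _ hadj fun hc => h1 ?_
    exact FaceFlag.eq_of hz (by rw [← hp, hc]) hr
  · rw [hr] at hp ⊢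
    have hp' : E.nx x.rev x.fst z.snd = (E.pre z).fst := by rw [← hp, E.nx_nx_not]
    rw [← E'.nx_symm, Equiv.symm_apply_eq, ← hp']
    symm
    refine key _ (hz ▸ z.adj) fun hc => h2 ?_
    exact FaceFlag.eq_of (by simpa using hz) (by rw [E.back_snd, ← hc, E.nx_not_nx])
      (by simpa using hr)

end Inserted

section InsertedCrosscap

variable {x y : FaceFlag G} {swap tw : Bool}

/-- The edges that cross a crosscap added near the vertex of the corners `x` and `y` are those
between these two corners. -/
structure CrosscapAt (E : CellEmbedding G) (x y : FaceFlag G) (f : V → Bool) : Prop where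
  fst_eq : y.fst = x.fst
  rev_eq : y.rev = !x.rev
  ne_back : y ≠ E.back x
  flip_iff : ∀ S₁ S₂ : List V, E.IsArc x y S₁ S₂ → ∀ p, f p = true ↔ p ∈ S₁

theorem InsertedCrosscap.exists_list (h : InsertedCrosscap E E' T.ι u₀ u₁ x y swap tw) :
    ∃ S₁ S₂ : List V, E.IsArc x y S₁ S₂ ∧ E'.read x.rev (T.ι x.fst) =
      ↑((S₁.map T.ι).reverse ++ [pick u₀ u₁ (!swap)] ++ S₂.map T.ι ++ [pick u₀ u₁ swap]) ∧
      E'.twist s(T.ι x.fst, pick u₀ u₁ (!swap)) = (!(tw ^^ x.rev)) ∧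
      E'.twist s(T.ι x.fst, pick u₀ u₁ swap) = (tw ^^ x.rev) := by
  obtain ⟨S₁, S₂, h1, h2, h3, h4⟩ := h
  refine ⟨S₁, S₂, h1, ?_⟩
  cases swap <;> exact ⟨h2, h3, h4⟩

theorem CrosscapAt.exists_cons (hc : CrosscapAt E x y (T.flip x.fst)) {S₁ S₂ : List V}
    (h : E.IsArc x y S₁ S₂) : ∃ l, S₂ = E.nx x.rev x.fst y.snd :: l := by
  obtain ⟨h1, h2, h3⟩ := h
  obtain ⟨A, hA⟩ := List.getLast?_eq_some_iff.1 h3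
  rcases S₂ with _ | ⟨q, l⟩
  · exfalso
    rw [List.append_nil] at h1
    have := E.nx_of_ends h1 h2 h3
    refine hc.ne_back (FaceFlag.eq_of ?_ ?_ ?_)
    · rw [hc.fst_eq, E.back_fst]
    · rw [E.back_snd, ← this, E.nx_not_nx]
    · rw [hc.rev_eq, E.back_rev]
  · refine ⟨l, ?_⟩
    rw [E.nx_of_append (A := A) (p := y.snd) (q := q) (B := l) (by rw [h1, hA]; simp)]

theorem CrosscapAt.flip_eq_false (hc : CrosscapAt E x y (T.flip x.fst)) {S₁ S₂ : List V}
    (h : E.IsArc x y S₁ S₂) {p : V} (hp : p ∈ S₂) : T.flip x.fst p = false := by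
  rw [← Bool.not_eq_true, hc.flip_iff _ _ h]
  have h1 := E.nodup_of_read h.1
  rw [List.nodup_append] at h1
  exact fun hp' => h1.2.2 p hp' p hp rfl

/-- At a crosscap, the walks arriving at one of the corners `x` and `y`, in either direction, meet the
edge to one of the two inserted vertices each; this is the first of four such statements. -/
theorem InsertedCrosscap.gate (h : InsertedCrosscap E E' T.ι u₀ u₁ x y swap tw)
    (hc : CrosscapAt E x y (T.flip x.fst)) : T.Gate x (pick u₀ u₁ swap) tw := by
  obtain ⟨S₁, S₂, h1, h2, h3, h4⟩ := h.exists_list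
  obtain ⟨l, hl⟩ := hc.exists_cons h1
  have h5 : (S₁ ++ S₂).getLast? = some (E.pre x).fst := by
    refine E.getLast_of_nx h1.1 ?_
    rw [E.pre_fst, E.nx_nx_not, List.head?_append, h1.2.1]; rfl
  obtain ⟨l', hl'⟩ : ∃ l', S₂ = l' ++ [(E.pre x).fst] := by
    rw [List.getLast?_append] at h5
    rw [← List.getLast?_eq_some_iff]
    rw [hl] at h5 ⊢
    rw [List.getLast?_eq_getLast_of_ne_nil (List.cons_ne_nil _ _)] at h5 ⊢
    simpa using h5
  unfold Tracing.Gate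
  rw [hc.flip_eq_false h1 (by rw [hl']; simp), h4]
  refine ⟨?_, by cases x.rev <;> cases tw <;> rfl⟩
  rw [Bool.xor_false]
  rw [hl'] at h2
  exact E'.nx_of_append (A := (S₁.map T.ι).reverse ++ [pick u₀ u₁ (!swap)] ++ l'.map T.ι)
    (B := []) (by rw [h2]; simp)

theorem InsertedCrosscap.gate_back (h : InsertedCrosscap E E' T.ι u₀ u₁ x y swap tw)
    (hc : CrosscapAt E x y (T.flip x.fst)) :
    T.Gate (E.back x) (pick u₀ u₁ (!swap)) (!tw) := by
  obtain ⟨S₁, S₂, h1, h2, h3, h4⟩ := h.exists_list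
  have hp : (E.pre (E.back x)).fst = x.snd := by rw [E.pre_back, E.back_fst, E.step_fst]
  obtain ⟨l, hl⟩ : ∃ l, S₁ = x.snd :: l := by
    rcases S₁ with _ | ⟨a, l⟩
    · simpa using h1.2.1
    · exact ⟨l, by simpa using h1.2.1⟩
  have hflip : T.flip x.fst x.snd = true := (hc.flip_iff _ _ h1 _).2 (by rw [hl]; simp)
  unfold Tracing.Gate
  rw [hp, E.back_fst, E.back_rev, hflip, h3]
  refine ⟨?_, by cases x.rev <;> cases tw <;> rfl⟩
  rw [Bool.xor_true, Bool.not_not]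
  rw [hl] at h2
  exact E'.nx_of_append (A := (l.map T.ι).reverse) (B := S₂.map T.ι ++ [pick u₀ u₁ swap])
    (by rw [h2]; simp)

theorem InsertedCrosscap.gate_right (h : InsertedCrosscap E E' T.ι u₀ u₁ x y swap tw)
    (hc : CrosscapAt E x y (T.flip x.fst)) : T.Gate y (pick u₀ u₁ (!swap)) tw := by
  obtain ⟨S₁, S₂, h1, h2, h3, h4⟩ := h.exists_list
  obtain ⟨l, hl⟩ := hc.exists_cons h1
  have hp : (E.pre y).fst = E.nx x.rev x.fst y.snd := by
    rw [E.pre_fst, hc.rev_eq, hc.fst_eq, Bool.not_not]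
  unfold Tracing.Gate
  rw [hp, hc.fst_eq, hc.rev_eq, hc.flip_eq_false h1 (by rw [hl]; simp), h3]
  refine ⟨?_, by cases x.rev <;> cases tw <;> rfl⟩
  rw [Bool.xor_false, ← E'.nx_symm, Equiv.symm_apply_eq]
  symm
  rw [hl] at h2
  exact E'.nx_of_append (A := (S₁.map T.ι).reverse) (B := l.map T.ι ++ [pick u₀ u₁ swap])
    (by rw [h2]; simp)

theorem InsertedCrosscap.gate_right_back (h : InsertedCrosscap E E' T.ι u₀ u₁ x y swap tw)
    (hc : CrosscapAt E x y (T.flip x.fst)) :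
    T.Gate (E.back y) (pick u₀ u₁ swap) (!tw) := by
  obtain ⟨S₁, S₂, h1, h2, h3, h4⟩ := h.exists_list
  have hp : (E.pre (E.back y)).fst = y.snd := by rw [E.pre_back, E.back_fst, E.step_fst]
  obtain ⟨l, hl⟩ := List.getLast?_eq_some_iff.1 h1.2.2
  have hflip : T.flip x.fst y.snd = true := (hc.flip_iff _ _ h1 _).2 (by rw [hl]; simp)
  unfold Tracing.Gate
  rw [hp, E.back_fst, E.back_rev, hc.fst_eq, hc.rev_eq, hflip, h4]
  refine ⟨?_, by cases x.rev <;> cases tw <;> rfl⟩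
  rw [Bool.xor_true, Bool.not_not, ← E'.nx_symm, Equiv.symm_apply_eq]
  symm
  exact E'.nx_of_ends h2 (by rw [hl]; simp) (by rw [List.getLast?_append]; simp)

/-- No other corner at the vertex is affected by the crosscap. -/
theorem InsertedCrosscap.kept (h : InsertedCrosscap E E' T.ι u₀ u₁ x y swap tw)
    (hc : CrosscapAt E x y (T.flip x.fst)) {z : FaceFlag G} (hz : z.fst = x.fst)
    (h1 : z ≠ x) (h2 : z ≠ E.back x) (h3 : z ≠ y) (h4 : z ≠ E.back y) : T.Kept z := by
  obtain ⟨S₁, S₂, ha, h5, -, -⟩ := h.exists_list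
  have hadj : G.Adj z.fst (E.pre z).fst := by
    have := (E.pre z).adj.symm
    rwa [E.pre_snd] at this
  have hp : E.nx z.rev z.fst (E.pre z).fst = z.snd := by rw [E.pre_fst, E.nx_nx_not]
  have hhead : ∀ a, a ∈ (S₁ ++ S₂).head? → a = x.snd := fun a h => by
    rw [List.head?_append, ha.2.1] at h
    exact (by simpa using h : x.snd = a).symm
  -- two consecutive edges at the vertex, the corner between which is not one of the two
  -- distinguished ones, cross the crosscap together or not at all
  have key : ∀ a b, G.Adj x.fst a → E.nx x.rev x.fst a = b → b ≠ x.snd → a ≠ y.snd →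
      (T.flip x.fst a = true ∧ T.flip x.fst b = true ∧
        E'.nx x.rev (T.ι x.fst) (T.ι b) = T.ι a) ∨
      (T.flip x.fst a = false ∧ T.flip x.fst b = false ∧
        E'.nx x.rev (T.ι x.fst) (T.ι a) = T.ι b) := by
    rintro a b hab rfl hb hay
    obtain ⟨A, B, hAB⟩ := E.exists_append_of_nx ha.1 hab (fun h => hb (hhead _ h))
    rcases List.append_eq_append_iff.1 hAB with ⟨C, hA, hS⟩ | ⟨C, hS, hB⟩
    · right
      refine ⟨hc.flip_eq_false ha (by rw [hS]; simp), hc.flip_eq_false ha (by rw [hS]; simp), ?_⟩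
      rw [hS] at h5
      exact E'.nx_of_append (A := (S₁.map T.ι).reverse ++ [pick u₀ u₁ (!swap)] ++ C.map T.ι)
        (B := B.map T.ι ++ [pick u₀ u₁ swap]) (by rw [h5]; simp)
    · rcases C with _ | ⟨c, _ | ⟨d, C⟩⟩
      · right
        rw [List.nil_append] at hB
        refine ⟨hc.flip_eq_false ha (by rw [← hB]; simp),
          hc.flip_eq_false ha (by rw [← hB]; simp), ?_⟩
        rw [← hB] at h5
        exact E'.nx_of_append (A := (S₁.map T.ι).reverse ++ [pick u₀ u₁ (!swap)])
          (B := B.map T.ι ++ [pick u₀ u₁ swap]) (by rw [h5]; simp)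
      · exfalso
        have h6 := ha.2.2
        rw [hS] at h6
        simp only [List.cons_append, List.cons.injEq] at hB
        rw [← hB.1] at h6
        exact hay (by simpa using h6)
      · left
        simp only [List.cons_append, List.cons.injEq] at hB
        obtain ⟨rfl, rfl, hB⟩ := hB
        refine ⟨(hc.flip_iff _ _ ha _).2 (by rw [hS]; simp),
          (hc.flip_iff _ _ ha _).2 (by rw [hS]; simp), ?_⟩
        rw [hS] at h5
        exact E'.nx_of_append (A := (C.map T.ι).reverse) (B := (A.map T.ι).reverse ++
          [pick u₀ u₁ (!swap)] ++ S₂.map T.ι ++ [pick u₀ u₁ swap]) (by rw [h5]; simp)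
  unfold Tracing.Kept
  rw [hz] at hadj hp ⊢
  rcases Bool.eq_or_eq_not z.rev x.rev with hr | hr
  · rw [hr] at hp ⊢
    rcases key _ _ hadj hp (fun h => h1 (FaceFlag.eq_of hz h hr)) (fun h => h4 (FaceFlag.eq_of
        (by rw [hz, E.back_fst, hc.fst_eq])
        (by rw [E.back_snd, hc.rev_eq, hc.fst_eq, Bool.not_not, ← hp, h])
        (by rw [E.back_rev, hc.rev_eq, hr, Bool.not_not]))) with ⟨e1, e2, e3⟩ | ⟨e1, e2, e3⟩
    · refine ⟨?_, by rw [e1, e2]⟩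
      rw [e1, Bool.xor_true, ← E'.nx_symm, Equiv.symm_apply_eq, e3]
    · exact ⟨by rw [e1, Bool.xor_false, e3], by rw [e1, e2]⟩
  · rw [hr] at hp ⊢
    have hp' : E.nx x.rev x.fst z.snd = (E.pre z).fst := by rw [← hp, E.nx_nx_not]
    rcases key _ _ (hz ▸ z.adj) hp' (fun h => h2 (FaceFlag.eq_of (by simpa using hz)
        (by rw [E.back_snd, ← hp, h]) (by simpa using hr)))
        (fun h => h3 (FaceFlag.eq_of (by rw [hz, hc.fst_eq]) h (by rw [hr, hc.rev_eq])))
      with ⟨e1, e2, e3⟩ | ⟨e1, e2, e3⟩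
    · refine ⟨?_, by rw [e1, e2]⟩
      rw [e2, Bool.xor_true, Bool.not_not, e3]
    · refine ⟨?_, by rw [e1, e2]⟩
      rw [e2, Bool.xor_false, ← E'.nx_symm, Equiv.symm_apply_eq, e3]

end InsertedCrosscap

end Tracing

/-! ### Surgery on faces of length four and six -/

namespace CellEmbedding

variable {V : Type*} [DecidableEq V] {G : SimpleGraph V} (E : CellEmbedding G) {X : Set V} [Finite V]

theorem iterate_mod_walkLength (x : FaceFlag G) (i : ℕ) :
    E.step^[i % E.walkLength x] x = E.step^[i] x :=
  Function.iterate_mod_minimalPeriod_eq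

theorem iterate_inj {x : FaceFlag G} {i j : ℕ} (hi : i < E.walkLength x) (hj : j < E.walkLength x)
    (h : E.step^[i] x = E.step^[j] x) : i = j :=
  Function.iterate_injOn_Iio_minimalPeriod hi hj h

theorem exists_iterate_or_rv {y z : FaceFlag G} (h : E.face z = E.face y) :
    ∃ i < E.walkLength y, z = E.step^[i] y ∨ z = E.rv (E.step^[i] y) := by
  have hL := E.walkLength_pos y
  rcases E.face_eq_iff.1 h with ⟨i, hz | hz⟩
  · exact ⟨i % E.walkLength y, Nat.mod_lt _ hL, Or.inl (by rw [iterate_mod_walkLength, hz])⟩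
  · obtain ⟨j, hj⟩ := E.exists_back_iterate (E.back y) (i + 1)
    rw [back_back, Function.iterate_succ_apply', ← hz] at hj
    refine ⟨j % E.walkLength y, Nat.mod_lt _ hL, Or.inr ?_⟩
    rw [iterate_mod_walkLength, ← hj]
    change z = E.rv (E.rv z)
    rw [rv_rv]

theorem iterate_ne_back_iterate (hX : IsPart G X) (x : FaceFlag G) (i j : ℕ) :
    E.step^[i] x ≠ E.back (E.step^[j] x) := by
  intro h
  obtain ⟨k, hk⟩ := E.exists_back_iterate x j
  rw [hk] at h
  obtain ⟨N, hN, hp⟩ := E.exists_iterate_eq_id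
  have h1 : (N - 1) * k + k = N * k := by
    obtain ⟨M, rfl⟩ : ∃ M, N = M + 1 := ⟨N - 1, by omega⟩
    simp; ring
  have h2 := congrArg (E.step^[(N - 1) * k]) h
  rw [← Function.iterate_add_apply, ← Function.iterate_add_apply, h1,
    Function.iterate_mul E.step N k, (funext hp : E.step^[N] = id), Function.iterate_id, id] at h2
  exact E.iterate_ne_back hX x _ h2

theorem sameCorner_iterate (hX : IsPart G X) {x : FaceFlag G} {i j : ℕ} (hi : i < E.walkLength x)
    (hj : j < E.walkLength x) (h : E.SameCorner (E.step^[i] x) (E.step^[j] x)) : i = j := by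
  rcases h with h | h
  · exact (E.iterate_inj hj hi h).symm
  · exact absurd h (E.iterate_ne_back_iterate hX x j i)

theorem SameCorner.fst_eq {E : CellEmbedding G} {x y : FaceFlag G} (h : E.SameCorner x y) :
    y.fst = x.fst := by
  rcases h with rfl | rfl
  · rfl
  · simp

theorem SameCorner.symm {E : CellEmbedding G} {x y : FaceFlag G} (h : E.SameCorner x y) :
    E.SameCorner y x := by
  rcases h with rfl | rfl
  · exact Or.inl rfl
  · exact Or.inr (by simp)

theorem SameCorner.trans {E : CellEmbedding G} {x y z : FaceFlag G} (h : E.SameCorner x y)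
    (h' : E.SameCorner y z) : E.SameCorner x z := by
  rcases h with rfl | rfl <;> rcases h' with rfl | rfl
  · exact Or.inl rfl
  · exact Or.inr rfl
  · exact Or.inr rfl
  · exact Or.inl (by simp)

theorem pre_eq_iterate (x : FaceFlag G) : E.pre x = E.step^[E.walkLength x - 1] x := by
  apply E.step_injective
  rw [step_pre, ← Function.iterate_succ_apply' (f := E.step), Nat.succ_eq_add_one,
    Nat.sub_add_cancel (E.walkLength_pos x), iterate_walkLength]

/-- In a face of length at most six, a pair of corners at vertices of one part is parallel only to
a pair in the other part. -/
theorem Parallel.mem_iff (hX : IsPart G X) {x₁ x₂ y₁ y₂ : FaceFlag G} (h : E.Parallel x₁ x₂ y₁ y₂)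
    (hL : E.walkLength x₁ ≤ 6) (hx : x₂.fst ∈ X ↔ x₁.fst ∈ X) (hy : y₂.fst ∈ X ↔ y₁.fst ∈ X) :
    E.walkLength x₁ = 6 ∧ (y₁.fst ∈ X ↔ x₁.fst ∉ X) ∧ ∃ z, E.SameCorner x₁ z ∧
      E.SameCorner x₂ (E.step^[2] z) ∧
      ((E.SameCorner y₁ (E.step^[3] z) ∧ E.SameCorner y₂ (E.step^[5] z)) ∨
        (E.SameCorner y₂ (E.step^[3] z) ∧ E.SameCorner y₁ (E.step^[5] z))) := by
  obtain ⟨z, hz, p, q, r, h1, h2, h3, h4, h5, h6⟩ := h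
  have hz' : E.walkLength z = E.walkLength x₁ := by
    rcases hz with rfl | rfl
    · rfl
    · exact E.walkLength_eq_of_face_eq (E.face_back _)
  have hp := E.mem_iterate hX z p
  rw [h5.fst_eq, hz.fst_eq, hx] at hp
  have hp' : Even p := by
    by_cases hzX : x₁.fst ∈ X <;> simpa [hzX] using hp
  have hqr : (E.step^[r] z).fst ∈ X ↔ (E.step^[q] z).fst ∈ X := by
    rcases h6 with ⟨ha, hb⟩ | ⟨ha, hb⟩
    · rw [ha.fst_eq, hb.fst_eq, hy]
    · rw [ha.fst_eq, hb.fst_eq, hy]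
  have hq := E.mem_iterate hX z q
  have hr := E.mem_iterate hX z r
  have hqr' : Even q ↔ Even r := by
    rw [hq, hr] at hqr
    by_cases hzX : z.fst ∈ X <;> simp only [hzX, true_iff, false_iff] at hqr
    · exact hqr.symm
    · exact (not_iff_not.1 hqr).symm
  have hL6 := E.walkLength_even hX x₁
  have harith : E.walkLength x₁ = 6 ∧ p = 2 ∧ q = 3 ∧ r = 5 := by
    rw [Nat.even_iff] at hp' hL6
    rw [Nat.even_iff, Nat.even_iff] at hqr'
    omega
  obtain ⟨hL6', hp2, hq3, hr5⟩ := harith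
  have e3 : ¬ Even q := by rw [hq3]; decide
  have key : ∀ a b c : Prop, ¬ c → (a ↔ (b ↔ c)) → (a ↔ ¬ b) := fun a b c hc h => by
    rw [h, iff_false_right hc]
  have hfin : y₁.fst ∈ X ↔ x₁.fst ∉ X := by
    rcases h6 with ⟨ha, hb⟩ | ⟨ha, hb⟩
    · rw [ha.fst_eq, hz.fst_eq] at hq
      exact key _ _ _ e3 hq
    · rw [ha.fst_eq, hz.fst_eq, hy] at hq
      exact key _ _ _ e3 hq
  refine ⟨hL6', hfin, z, hz, ?_, ?_⟩
  · rw [← hp2]; exact h5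
  · rw [← hq3, ← hr5]; exact h6

end CellEmbedding

section Surgery

variable {V W : Type*} [DecidableEq V] [DecidableEq W] {G : SimpleGraph V} {H : SimpleGraph W}
  [Finite V] [Finite W] {E : CellEmbedding G} {E' : CellEmbedding H} (T : Tracing E E') {X : Set V}

namespace Tracing

/-- The old flag `x` lies in a face of `E'` of length (dividing) four. -/
def Short (x : FaceFlag G) : Prop := E'.step^[4] (T.lift x) = T.lift x

/-- All flags of a face of `E` lie in faces of `E'` of length four, except perhaps in one of
length six. -/
def FewLong (f : E.Face) : Prop :=
  ∃ y₀, E'.step^[6] y₀ = y₀ ∧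
    ∀ x, E.face x = f → T.Short x ∨ E'.face (T.lift x) = E'.face y₀

variable {T}

theorem face_lift_rv (x : FaceFlag G) : E'.face (T.lift (E.rv x)) = E'.face (T.lift x) := by
  rw [← T.rv_lift, E'.face_rv]

theorem Short.of_face {x y : FaceFlag G} (h : T.Short x)
    (hf : E'.face (T.lift y) = E'.face (T.lift x)) : T.Short y :=
  E'.iterate_eq_of_face_eq hf h

theorem short_of_iterate {x : FaceFlag G}
    (h : ∀ i < E.walkLength x, T.Short (E.step^[i] x)) {z : FaceFlag G}
    (hz : E.face z = E.face x) : T.Short z := by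
  obtain ⟨i, hi, rfl | rfl⟩ := E.exists_iterate_or_rv hz
  · exact h i hi
  · exact (h i hi).of_face (face_lift_rv _)

theorem fewLong_of_iterate {x : FaceFlag G} {y₀ : FaceFlag H} (h6 : E'.step^[6] y₀ = y₀)
    (h : ∀ i < E.walkLength x,
      T.Short (E.step^[i] x) ∨ E'.face (T.lift (E.step^[i] x)) = E'.face y₀) :
    T.FewLong (E.face x) := by
  refine ⟨y₀, h6, fun z hz => ?_⟩
  obtain ⟨i, hi, rfl | rfl⟩ := E.exists_iterate_or_rv hz
  · exact h i hi
  · rcases h i hi with h | h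
    · exact Or.inl (h.of_face (face_lift_rv _))
    · exact Or.inr ((face_lift_rv _).trans h)

/-- A walk stays the same in `E'` as long as it meets only corners that are kept. -/
theorem iterate_lift {x : FaceFlag G} {k : ℕ} (h : ∀ i, 1 ≤ i → i ≤ k → T.Kept (E.step^[i] x)) :
    E'.step^[k] (T.lift x) = T.lift (E.step^[k] x) := by
  induction k with
  | zero => rfl
  | succ k ih =>
    rw [Function.iterate_succ_apply', ih fun i h1 h2 => h i h1 (by omega),
      Function.iterate_succ_apply']
    apply Kept.step_lift
    rw [← Function.iterate_succ_apply' (f := E.step)]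
    exact h _ (by omega) le_rfl

theorem face_lift_iterate {x : FaceFlag G} {k : ℕ}
    (h : ∀ i, 1 ≤ i → i ≤ k → T.Kept (E.step^[i] x)) :
    E'.face (T.lift (E.step^[k] x)) = E'.face (T.lift x) := by
  rw [← iterate_lift h, E'.face_iterate]

variable (T)

/-- Pairs of marked corners that exchange their continuations: the walk of `E'` arriving at one
corner of the pair continues, after two new edges, at the other one. -/
structure Pairing (X : Set V) (P : FaceFlag G → FaceFlag G → Prop) : Prop where
  symm : ∀ {z w}, P z w → P w z
  walk : ∀ {z w}, P z w → ∃ t, E.step^[t] z = w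
  ne : ∀ {z w}, P z w → z ≠ w
  mem_iff : ∀ {z w}, P z w → (w.fst ∈ X ↔ z.fst ∈ X)
  pass : ∀ {z w}, P z w → E'.step^[3] (T.lift (E.pre z)) = T.lift w
  parallel : ∀ {z w z' w'}, P z w → P z' w' → E.face z = E.face z' →
    (E.SameCorner z z' ∧ E.SameCorner w w') ∨ (E.SameCorner z w' ∧ E.SameCorner w z') ∨
      E.Parallel z w z' w'

variable {T} {P : FaceFlag G → FaceFlag G → Prop}

/-- The part of the boundary between two marked corners at distance two closes up to a
quadrilateral. -/
theorem Pairing.short_segment (hP : T.Pairing X P) {z w : FaceFlag G} (h : P z w)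
    (hw : E.step^[2] z = w) (hk : T.Kept (E.step z)) : T.Short z ∧ T.Short (E.step z) := by
  have h1 := hP.pass (hP.symm h)
  have h2 : E.pre w = E.step z := by
    rw [← hw]
    change E.pre (E.step (E.step z)) = _
    rw [E.pre_step]
  rw [h2, ← hk.step_lift] at h1
  have h3 : T.Short z := h1
  exact ⟨h3, h3.of_face (by rw [← hk.step_lift, E'.face_step])⟩

/-- A quadrilateral with a pair of marked corners is cut into two quadrilaterals. -/
theorem Pairing.short_of_quadrilateral (hX : IsPart G X) (hP : T.Pairing X P) {x : FaceFlag G}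
    (hL : E.walkLength x = 4) (hK : ∀ z, E.face z = E.face x → (∃ w, P z w) ∨ T.Kept z) :
    T.Short x := by
  by_cases hm : ∃ z w, E.face z = E.face x ∧ P z w
  · obtain ⟨z, w, hz, hzw⟩ := hm
    have hLz : E.walkLength z = 4 := by rw [E.walkLength_eq_of_face_eq hz, hL]
    obtain ⟨t, ht⟩ := hP.walk hzw
    have hmem := hP.mem_iff hzw
    have h2 : E.step^[2] z = w := by
      rw [← E.iterate_mod_walkLength, hLz] at ht
      have h1 := E.mem_iterate hX z (t % 4)
      rw [ht] at h1
      have h3 : Even (t % 4) := by tauto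
      have h4 : t % 4 ≠ 0 := fun h => hP.ne hzw (by rw [← ht, h]; rfl)
      rw [Nat.even_iff] at h3
      have h5 : t % 4 = 2 := by omega
      rw [h5] at ht; exact ht
    have h4 : E.step^[4] z = z := by
      have := E.iterate_walkLength z
      rwa [hLz] at this
    have hkept : ∀ i, Odd i → T.Kept (E.step^[i] z) := by
      intro i hi
      rcases hK (E.step^[i] z) (by rw [E.face_iterate, hz]) with ⟨w', hw'⟩ | h
      · exfalso
        have hpar := E.mem_iterate hX z i
        have hi' : ¬ Even i := Nat.not_even_iff_odd.2 hi
        have hmem' := hP.mem_iff hw'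
        rcases hP.parallel hzw hw' (by rw [E.face_iterate]) with ⟨h, -⟩ | ⟨-, h⟩ | h
        · rw [h.fst_eq] at hpar; tauto
        · rw [h.fst_eq, hmem] at hpar; tauto
        · have := (h.mem_iff E hX (by omega) (hP.mem_iff hzw) (hP.mem_iff hw')).1
          omega
      · exact h
    have hwz : E.step^[2] w = z := by
      rw [← h2, ← Function.iterate_add_apply]; exact h4
    have s1 := hP.short_segment hzw h2 (hkept 1 (by decide))
    have s2 := hP.short_segment (hP.symm hzw) hwz (by rw [← h2]; exact hkept 3 (by decide))
    refine short_of_iterate (x := z) (fun i hi => ?_) hz.symm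
    rw [hLz] at hi
    interval_cases i
    · exact s1.1
    · exact s1.2
    · rw [h2]; exact s2.1
    · have : E.step^[3] z = E.step w := by rw [← h2]; rfl
      rw [this]; exact s2.2
  · have hk : ∀ i, T.Kept (E.step^[i] x) := fun i =>
      (hK _ (E.face_iterate _ _)).resolve_left fun ⟨w, hw⟩ => hm ⟨_, w, E.face_iterate _ _, hw⟩
    unfold Short
    rw [iterate_lift fun i _ _ => hk i]
    have := E.iterate_walkLength x
    rw [hL] at this
    rw [this]

/-- A hexagon with a pair of marked corners is cut into a quadrilateral and a hexagon; if there are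
two parallel pairs, it is cut into two quadrilaterals and a hexagon. -/
theorem Pairing.fewLong_of_hexagon (hX : IsPart G X) (hP : T.Pairing X P) {x : FaceFlag G}
    (hL : E.walkLength x = 6) (hK : ∀ z, E.face z = E.face x → (∃ w, P z w) ∨ T.Kept z) :
    T.FewLong (E.face x) := by
  by_cases hm : ∃ z w, E.face z = E.face x ∧ P z w ∧ E.step^[2] z = w
  · obtain ⟨z, w, hz, hzw, h2⟩ := hm
    have hLz : E.walkLength z = 6 := by rw [E.walkLength_eq_of_face_eq hz, hL]
    have h6 : E.step^[6] z = z := by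
      have := E.iterate_walkLength z
      rwa [hLz] at this
    have hmem := hP.mem_iff hzw
    -- the only corners that may be marked besides `z` and `w` are those at positions 3 and 5
    have hmark : ∀ i, i < 6 → i ≠ 0 → i ≠ 2 → ∀ w', P (E.step^[i] z) w' →
        (i = 3 ∧ w' = E.step^[5] z) ∨ (i = 5 ∧ w' = E.step^[3] z) := by
      intro i hi h0 hi2 w' hw'
      obtain ⟨t, ht⟩ := hP.walk hw'
      rw [← Function.iterate_add_apply, ← E.iterate_mod_walkLength, hLz] at ht
      have hj : (t + i) % 6 < 6 := Nat.mod_lt _ (by norm_num)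
      generalize (t + i) % 6 = j at ht hj
      have hsc : ∀ a b, a < 6 → b < 6 → E.SameCorner (E.step^[a] z) (E.step^[b] z) → a = b :=
        fun a b ha hb h => E.sameCorner_iterate hX (hLz ▸ ha) (hLz ▸ hb) h
      rcases hP.parallel hzw hw' (by rw [E.face_iterate]) with ⟨h, -⟩ | ⟨-, h⟩ | h
      · exact absurd (hsc 0 i (by norm_num) hi h).symm h0
      · rw [← h2] at h
        exact absurd (hsc 2 i (by norm_num) hi h).symm hi2
      · obtain ⟨-, -, z', hz', h5, h7⟩ :=
          h.mem_iff E hX (by omega) (hP.mem_iff hzw) (hP.mem_iff hw')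
        rcases hz' with rfl | rfl
        · rw [← ht] at h7 ⊢
          rcases h7 with ⟨ha, hb⟩ | ⟨ha, hb⟩
          · left
            exact ⟨hsc _ _ hi (by norm_num) ha, by rw [hsc _ _ hj (by norm_num) hb]⟩
          · right
            exact ⟨hsc _ _ hi (by norm_num) hb, by rw [hsc _ _ hj (by norm_num) ha]⟩
        · exfalso
          have e1 : E.step^[2] (E.back z) = E.back (E.step^[4] z) := by
            have := E.iterate_back_iterate (E.step^[4] z) 2
            rw [← Function.iterate_add_apply] at this
            rw [← this]
            change _ = E.step^[2] (E.back (E.step^[6] z))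
            rw [h6]
          rw [e1, ← h2] at h5
          have := hsc 2 4 (by norm_num) (by norm_num) (h5.trans (Or.inr (by rw [E.back_back])))
          omega
    have hk : ∀ i, i = 1 ∨ i = 4 → T.Kept (E.step^[i] z) := by
      intro i hi
      refine (hK _ (by rw [E.face_iterate, hz])).resolve_left ?_
      rintro ⟨w', hw'⟩
      have := hmark i (by omega) (by omega) (by omega) w' hw'
      omega
    have s1 := hP.short_segment hzw h2 (hk 1 (Or.inl rfl))
    have hpz : E.pre z = E.step^[5] z := by rw [E.pre_eq_iterate, hLz]
    have hback : E'.step^[3] (T.lift (E.step^[5] z)) = T.lift (E.step^[2] z) := by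
      rw [← hpz, h2]; exact hP.pass hzw
    by_cases h35 : P (E.step^[3] z) (E.step^[5] z)
    · have s2 := hP.short_segment h35 rfl (hk 4 (Or.inr rfl))
      have h8 : E'.step^[3] (T.lift (E.step^[2] z)) = T.lift (E.step^[5] z) := by
        rw [← hP.pass h35]
        congr 2
        exact (E.pre_step _).symm
      rw [← hz]
      refine fewLong_of_iterate (y₀ := T.lift (E.step^[2] z)) ?_ fun i hi => ?_
      · rw [show 6 = 3 + 3 from rfl, Function.iterate_add_apply, h8, hback]
      · rw [hLz] at hi
        interval_cases i
        · exact Or.inl s1.1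
        · exact Or.inl s1.2
        · exact Or.inr rfl
        · exact Or.inl s2.1
        · exact Or.inl s2.2
        · exact Or.inr (by rw [← h8, E'.face_iterate])
    · have hk' : ∀ i, 3 ≤ i → i < 6 → T.Kept (E.step^[i] z) := by
        intro i hi hi'
        refine (hK _ (by rw [E.face_iterate, hz])).resolve_left ?_
        rintro ⟨w', hw'⟩
        rcases hmark i hi' (by omega) (by omega) w' hw' with ⟨rfl, rfl⟩ | ⟨rfl, rfl⟩
        · exact h35 hw'
        · exact h35 (hP.symm hw')
      have h8 : ∀ k, k ≤ 3 → E'.step^[k] (T.lift (E.step^[2] z)) = T.lift (E.step^[k + 2] z) := by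
        intro k hk
        rw [iterate_lift, ← Function.iterate_add_apply]
        intro i hi1 hi2
        rw [← Function.iterate_add_apply]
        exact hk' _ (by omega) (by omega)
      rw [← hz]
      refine fewLong_of_iterate (y₀ := T.lift (E.step^[2] z)) ?_ fun i hi => ?_
      · rw [show 6 = 3 + 3 from rfl, Function.iterate_add_apply, h8 3 le_rfl, hback]
      · rw [hLz] at hi
        rcases Nat.lt_or_ge i 2 with h | h
        · interval_cases i
          · exact Or.inl s1.1
          · exact Or.inl s1.2
        · obtain ⟨k, rfl⟩ := Nat.exists_eq_add_of_le' h
          exact Or.inr (by rw [← h8 k (by omega), E'.face_iterate])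
  · have hnone : ∀ z w, E.face z = E.face x → ¬ P z w := by
      intro z w hz hzw
      have hLz : E.walkLength z = 6 := by rw [E.walkLength_eq_of_face_eq hz, hL]
      obtain ⟨t, ht⟩ := hP.walk hzw
      have hmem := hP.mem_iff hzw
      have hfw : E.face w = E.face x := by rw [← ht, E.face_iterate, hz]
      rw [← E.iterate_mod_walkLength, hLz] at ht
      have h1 := E.mem_iterate hX z (t % 6)
      rw [ht] at h1
      have h3 : Even (t % 6) := by tauto
      have h4 : t % 6 ≠ 0 := fun h => hP.ne hzw (by rw [← ht, h]; rfl)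
      rw [Nat.even_iff] at h3
      have h5 : t % 6 = 2 ∨ t % 6 = 4 := by omega
      rcases h5 with h5 | h5 <;> rw [h5] at ht
      · exact hm ⟨z, w, hz, hzw, ht⟩
      · refine hm ⟨w, z, hfw, hP.symm hzw, ?_⟩
        rw [← ht, ← Function.iterate_add_apply]
        have := E.iterate_walkLength z
        rwa [hLz] at this
    have hk : ∀ i, T.Kept (E.step^[i] x) := fun i =>
      (hK _ (E.face_iterate _ _)).resolve_left fun ⟨w, hw⟩ => hnone _ w (E.face_iterate _ _) hw
    refine fewLong_of_iterate (y₀ := T.lift x) ?_ fun i _ => Or.inr ?_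
    · rw [iterate_lift fun i _ _ => hk i]
      have := E.iterate_walkLength x
      rw [hL] at this
      rw [this]
    · exact face_lift_iterate fun i _ _ => hk i

/-- Four corners of a face, in this cyclic order, at which the face is cut into four pieces: a walk
arriving at one of them continues, after three new edges, at the preceding one. -/
structure Cut (c₀ c₁ c₂ c₃ : FaceFlag G) : Prop where
  order : E.CyclicOrder c₀ c₁ c₂ c₃
  pass₁ : E'.step^[4] (T.lift (E.pre c₁)) = T.lift c₀
  pass₂ : E'.step^[4] (T.lift (E.pre c₂)) = T.lift c₁
  pass₃ : E'.step^[4] (T.lift (E.pre c₃)) = T.lift c₂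
  pass₀ : E'.step^[4] (T.lift (E.pre c₀)) = T.lift c₃

/-- A hexagon that is cut at four consecutive corners. -/
theorem Cut.fewLong_aux {c₀ c₁ c₂ c₃ : FaceFlag G} (hL : E.walkLength c₀ = 6)
    (h1 : E.step^[1] c₀ = c₁) (h2 : E.step^[2] c₀ = c₂) (h3 : E.step^[3] c₀ = c₃)
    (pass₁ : E'.step^[4] (T.lift (E.pre c₁)) = T.lift c₀)
    (pass₂ : E'.step^[4] (T.lift (E.pre c₂)) = T.lift c₁)
    (pass₃ : E'.step^[4] (T.lift (E.pre c₃)) = T.lift c₂)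
    (pass₀ : E'.step^[4] (T.lift (E.pre c₀)) = T.lift c₃)
    (hk : ∀ i, 4 ≤ i → i < 6 → T.Kept (E.step^[i] c₀)) : T.FewLong (E.face c₀) := by
  have h8 : ∀ k, k ≤ 2 → E'.step^[k] (T.lift c₃) = T.lift (E.step^[k + 3] c₀) := by
    intro k hk'
    rw [iterate_lift, ← h3, ← Function.iterate_add_apply]
    intro i hi1 hi2
    rw [← h3, ← Function.iterate_add_apply]
    exact hk _ (by omega) (by omega)
  have hp : E.pre c₀ = E.step^[5] c₀ := by rw [E.pre_eq_iterate, hL]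
  refine fewLong_of_iterate (y₀ := T.lift c₃) ?_ fun i hi => ?_
  · rw [show 6 = 4 + 2 from rfl, Function.iterate_add_apply, h8 2 le_rfl, ← pass₀, hp]
  · rw [hL] at hi
    rcases Nat.lt_or_ge i 3 with h | h
    · left
      interval_cases i
      · rw [← h1] at pass₁
        change E'.step^[4] (T.lift (E.pre (E.step c₀))) = _ at pass₁
        rwa [E.pre_step] at pass₁
      · rw [← h2, ← h1] at pass₂
        change E'.step^[4] (T.lift (E.pre (E.step (E.step^[1] c₀)))) = _ at pass₂
        rwa [E.pre_step] at pass₂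
      · rw [← h3, ← h2] at pass₃
        change E'.step^[4] (T.lift (E.pre (E.step (E.step^[2] c₀)))) = _ at pass₃
        rwa [E.pre_step] at pass₃
    · obtain ⟨k, rfl⟩ := Nat.exists_eq_add_of_le' h
      exact Or.inr (by rw [← h8 k (by omega), E'.face_iterate])

/-- The corners of a cut belong alternately to the two parts. -/
theorem Cut.positions (hX : IsPart G X) {c₀ c₁ c₂ c₃ : FaceFlag G} (h : E.CyclicOrder c₀ c₁ c₂ c₃)
    (m1 : c₁.fst ∈ X ↔ c₀.fst ∉ X) (m2 : c₂.fst ∈ X ↔ c₀.fst ∈ X) (m3 : c₃.fst ∈ X ↔ c₀.fst ∉ X) :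
    ∃ p q r : ℕ, 0 < p ∧ p < q ∧ q < r ∧ r < E.walkLength c₀ ∧ p % 2 = 1 ∧ q % 2 = 0 ∧ r % 2 = 1 ∧
    E.step^[p] c₀ = c₁ ∧ E.step^[q] c₀ = c₂ ∧ E.step^[r] c₀ = c₃ := by
  obtain ⟨p, q, r, h1, h2, h3, h4, rfl, rfl, rfl⟩ := h
  have hp := E.mem_iterate hX c₀ p
  have hq := E.mem_iterate hX c₀ q
  have hr := E.mem_iterate hX c₀ r
  refine ⟨p, q, r, h1, h2, h3, h4, ?_, ?_, ?_, rfl, rfl, rfl⟩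
  · rw [← Nat.odd_iff, ← Nat.not_even_iff_odd]; tauto
  · rw [← Nat.even_iff]; tauto
  · rw [← Nat.odd_iff, ← Nat.not_even_iff_odd]; tauto

theorem Cut.short_of_quadrilateral (hX : IsPart G X) {c₀ c₁ c₂ c₃ : FaceFlag G}
    (h : T.Cut c₀ c₁ c₂ c₃) (m1 : c₁.fst ∈ X ↔ c₀.fst ∉ X) (m2 : c₂.fst ∈ X ↔ c₀.fst ∈ X)
    (m3 : c₃.fst ∈ X ↔ c₀.fst ∉ X) (hL : E.walkLength c₀ = 4) {x : FaceFlag G}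
    (hx : E.face x = E.face c₀) : T.Short x := by
  obtain ⟨p, q, r, h1, h2, h3, h4, -, -, -, hp, hq, hr⟩ := Cut.positions hX h.order m1 m2 m3
  obtain ⟨rfl, rfl, rfl⟩ : p = 1 ∧ q = 2 ∧ r = 3 := by omega
  refine short_of_iterate (fun i hi => ?_) hx
  rw [hL] at hi
  interval_cases i
  · have := h.pass₁
    rw [← hp] at this
    change E'.step^[4] (T.lift (E.pre (E.step c₀))) = _ at this
    rwa [E.pre_step] at this
  · have := h.pass₂
    rw [← hp, ← hq] at this
    change E'.step^[4] (T.lift (E.pre (E.step (E.step^[1] c₀)))) = _ at this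
    rwa [E.pre_step] at this
  · have := h.pass₃
    rw [← hq, ← hr] at this
    change E'.step^[4] (T.lift (E.pre (E.step (E.step^[2] c₀)))) = _ at this
    rwa [E.pre_step] at this
  · have := h.pass₀
    rw [E.pre_eq_iterate, hL, ← hr] at this
    exact this

theorem Cut.fewLong_of_hexagon (hX : IsPart G X) {c₀ c₁ c₂ c₃ : FaceFlag G}
    (h : T.Cut c₀ c₁ c₂ c₃) (m1 : c₁.fst ∈ X ↔ c₀.fst ∉ X) (m2 : c₂.fst ∈ X ↔ c₀.fst ∈ X)
    (m3 : c₃.fst ∈ X ↔ c₀.fst ∉ X) (hL : E.walkLength c₀ = 6)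
    (hK : ∀ z, E.face z = E.face c₀ → (E.SameCorner c₀ z ∨ E.SameCorner c₁ z ∨
      E.SameCorner c₂ z ∨ E.SameCorner c₃ z) ∨ T.Kept z) : T.FewLong (E.face c₀) := by
  obtain ⟨p, q, r, h1, h2, h3, h4, o1, o2, o3, hp, hq, hr⟩ := Cut.positions hX h.order m1 m2 m3
  rw [hL] at h4
  have h6 : E.step^[6] c₀ = c₀ := by
    have := E.iterate_walkLength c₀
    rwa [hL] at this
  have hk : ∀ i, i < 6 → i ≠ 0 → i ≠ p → i ≠ q → i ≠ r → T.Kept (E.step^[i] c₀) := by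
    intro i hi i0 ip iq ir
    refine (hK _ (E.face_iterate _ _)).resolve_left ?_
    rintro (hc | hc | hc | hc)
    · exact i0 (E.sameCorner_iterate hX (i := 0) (by omega) (by omega) hc).symm
    · rw [← hp] at hc
      exact ip (E.sameCorner_iterate hX (by omega) (by omega) hc).symm
    · rw [← hq] at hc
      exact iq (E.sameCorner_iterate hX (by omega) (by omega) hc).symm
    · rw [← hr] at hc
      exact ir (E.sameCorner_iterate hX (by omega) (by omega) hc).symm
  have hk' : ∀ i, i % 6 ≠ 0 → i % 6 ≠ p → i % 6 ≠ q → i % 6 ≠ r → T.Kept (E.step^[i] c₀) := by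
    intro i
    rw [← E.iterate_mod_walkLength c₀ i, hL]
    exact hk _ (Nat.mod_lt _ (by norm_num))
  have hadd : ∀ i j, E.step^[i] (E.step^[j] c₀) = E.step^[(i + j) % 6] c₀ := by
    intro i j
    rw [← Function.iterate_add_apply, ← E.iterate_mod_walkLength, hL]
  have hLi : ∀ i, E.walkLength (E.step^[i] c₀) = 6 := fun i => by
    rw [E.walkLength_eq_of_face_eq (E.face_iterate _ _), hL]
  obtain ⟨i1, i2, i3, i0⟩ := (⟨h.pass₁, h.pass₂, h.pass₃, h.pass₀⟩ : _ ∧ _ ∧ _ ∧ _)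
  have hcases : (p = 1 ∧ q = 2 ∧ r = 3) ∨ (p = 1 ∧ q = 2 ∧ r = 5) ∨ (p = 1 ∧ q = 4 ∧ r = 5) ∨
      (p = 3 ∧ q = 4 ∧ r = 5) := by omega
  rcases hcases with ⟨rfl, rfl, rfl⟩ | ⟨rfl, rfl, rfl⟩ | ⟨rfl, rfl, rfl⟩ | ⟨rfl, rfl, rfl⟩
  · exact Cut.fewLong_aux hL hp hq hr i1 i2 i3 i0 fun i hi hi' =>
      hk i hi' (by omega) (by omega) (by omega) (by omega)
  · rw [← E.face_iterate c₀ 5, hr]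
    refine Cut.fewLong_aux (hr ▸ hLi 5) ?_ ?_ ?_ i0 i1 i2 i3 fun i hi hi' => ?_
    · rw [← hr, hadd]; rfl
    · rw [← hr, hadd]; exact hp
    · rw [← hr, hadd]; exact hq
    · rw [← hr, ← Function.iterate_add_apply]
      exact hk' _ (by omega) (by omega) (by omega) (by omega)
  · rw [← E.face_iterate c₀ 4, hq]
    refine Cut.fewLong_aux (hq ▸ hLi 4) ?_ ?_ ?_ i3 i0 i1 i2 fun i hi hi' => ?_
    · rw [← hq, hadd]; exact hr
    · rw [← hq, hadd]; rfl
    · rw [← hq, hadd]; exact hp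
    · rw [← hq, ← Function.iterate_add_apply]
      exact hk' _ (by omega) (by omega) (by omega) (by omega)
  · rw [← E.face_iterate c₀ 3, hp]
    refine Cut.fewLong_aux (hp ▸ hLi 3) ?_ ?_ ?_ i2 i3 i0 i1 fun i hi hi' => ?_
    · rw [← hp, hadd]; exact hq
    · rw [← hp, hadd]; exact hr
    · rw [← hp, hadd]; rfl
    · rw [← hp, ← Function.iterate_add_apply]
      exact hk' _ (by omega) (by omega) (by omega) (by omega)

end Tracing

end Surgery

/-! ### Attaching two vertices to one part -/

theorem pairLeft_last (m : ℕ) : pairLeft m ((m + 1) / 2) = m - 1 := by simp [pairLeft]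
theorem pairRight_last (m : ℕ) : pairRight m ((m + 1) / 2) = m := by simp [pairRight]

theorem pairLeft_of_le {m i : ℕ} (hm : 2 ≤ m) (h : i ≤ (m - 2) / 2) : pairLeft m i = 2 * i - 1 := by
  unfold pairLeft
  rw [if_neg (by omega), if_neg]
  rintro ⟨h1, h2⟩
  rw [Nat.odd_iff] at h1; omega

theorem pairRight_of_le {m i : ℕ} (hm : 2 ≤ m) (h : i ≤ (m - 2) / 2) : pairRight m i = 2 * i := by
  unfold pairRight
  rw [if_neg (by omega), if_neg]
  rintro ⟨h1, h2⟩
  rw [Nat.odd_iff] at h1; omega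

theorem pairLeft_odd {m : ℕ} (hm : Odd m) (h3 : m ≠ 3) : pairLeft m ((m - 1) / 2) = m - 3 := by
  have h1 := Nat.odd_iff.1 hm
  unfold pairLeft
  rw [if_neg (by omega), if_pos ⟨hm, rfl⟩, if_neg h3]

theorem pairRight_odd {m : ℕ} (hm : Odd m) : pairRight m ((m - 1) / 2) = m - 2 := by
  have h1 := Nat.odd_iff.1 hm
  unfold pairRight
  rw [if_neg (by omega), if_pos ⟨hm, rfl⟩]

/-- The edges between two corners at a vertex do not depend on where the rotation is cut open. -/
theorem CellEmbedding.IsArc.unique {V : Type*} {G : SimpleGraph V}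
    {E : CellEmbedding G} {x y : FaceFlag G} {S₁ S₂ S₁' S₂' : List V} (h : E.IsArc x y S₁ S₂)
    (h' : E.IsArc x y S₁' S₂') : S₁ = S₁' := by
  classical
  have hnd := E.nodup_of_read h.1
  have hnd' := E.nodup_of_read h'.1
  have heq : S₁ ++ S₂ = S₁' ++ S₂' := by
    have h1 : (S₁ ++ S₂) ~r (S₁' ++ S₂') := by
      rw [← Cycle.coe_eq_coe, ← h.1, h'.1]
    obtain ⟨k, hk⟩ := h1
    have h2 : (S₁ ++ S₂).head? = some x.snd := by rw [List.head?_append, h.2.1]; rfl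
    have h3 : (S₁' ++ S₂').head? = some x.snd := by rw [List.head?_append, h'.2.1]; rfl
    have hlen : 0 < (S₁ ++ S₂).length := by
      rcases hS : S₁ ++ S₂ with _ | ⟨a, l⟩
      · rw [hS] at h2; simp at h2
      · simp
    have hlt : k % (S₁ ++ S₂).length < (S₁ ++ S₂).length := Nat.mod_lt _ hlen
    rw [← List.rotate_mod] at hk
    rw [← hk, List.head?_rotate hlt] at h3
    rw [List.head?_eq_getElem?, ← h3] at h2
    have h0 := (List.getElem?_inj hlen hnd).1 h2
    rw [← h0, List.rotate_zero] at hk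
    exact hk
  rcases List.append_eq_append_iff.1 heq with ⟨C, hC, hS⟩ | ⟨C, hC, hS⟩
  · rcases List.eq_nil_or_concat C with rfl | ⟨C', c, rfl⟩
    · simpa using hC.symm
    · exfalso
      have h4 := h'.2.2
      rw [hC] at h4
      have h5 : c = y.snd := by simpa using h4
      rw [List.nodup_append] at hnd
      exact hnd.2.2 y.snd (List.mem_of_getLast? h.2.2) c (by rw [hS]; simp) h5.symm
  · rcases List.eq_nil_or_concat C with rfl | ⟨C', c, rfl⟩
    · simpa using hC
    · exfalso
      have h4 := h.2.2
      rw [hC] at h4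
      have h5 : c = y.snd := by simpa using h4
      rw [List.nodup_append] at hnd'
      exact hnd'.2.2 y.snd (List.mem_of_getLast? h'.2.2) c (by rw [hS]; simp) h5.symm

section Attaching

variable {V W : Type*} [DecidableEq V] [DecidableEq W] {G : SimpleGraph V} {H : SimpleGraph W}
  {E : CellEmbedding G} {E' : CellEmbedding H}

/-- In the embedding `E'`, the vertices `u₀` and `u₁` are attached, through the face sequence `S`
of the embedding `E`, to the vertices of the part `X`.  The old edges at vertices of `X` that are flipped by `T` are those
that cross the crosscap of the attachment. -/
structure Attachment (T : Tracing E E') (S : FaceSeq G) (X : Set V) (m : ℕ) (u₀ u₁ : W)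
    (cross : Bool) (extra₀ extra₁ : List W) : Prop where
  two_le : 2 ≤ m
  part : IsPart G X
  seq : S.IsFaceSeq E m X
  att : Attached E E' T.ι S m u₀ u₁ cross extra₀ extra₁
  flip_iff : ∀ v ∈ X, ∀ p, T.flip v p = true ↔ s(v, p) ∈ crosscapEdges E S m
  ne_back : Odd m → S.left ((m - 1) / 2) ≠ E.back (S.shared m)

/-- The old flag `x` is marked, up to its direction, as the left or right corner of one of the first
`t` pairs of the face sequence `S`. -/
def FaceSeq.Marked (E : CellEmbedding G) (S : FaceSeq G) (t : ℕ) (x : FaceFlag G) : Prop :=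
  ∃ i, 1 ≤ i ∧ i ≤ t ∧ (E.SameCorner (S.left i) x ∨ E.SameCorner (S.right i) x)

/-- The walks of `E'` arriving at the corner `z`, in either direction, turn to one of the new
vertices each. -/
def Tracing.Gates (T : Tracing E E') (u₀ u₁ : W) (z : FaceFlag G) (s t : Bool) : Prop :=
  T.Gate z (pick u₀ u₁ s) t ∧ T.Gate (E.back z) (pick u₀ u₁ (!s)) (!t)

/-- The flag `y` of `E'` lies in a quadrilateral, or in the face of an old flag. -/
def Tracing.Covered (T : Tracing E E') (y : FaceFlag H) : Prop :=
  E'.step^[4] y = y ∨ ∃ x, E'.face y = E'.face (T.lift x)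

/-- At the old vertex `v`, the edges to the new vertices are consecutive and have the same
signature `σ`; the edge to `u₀` comes first, with respect to the direction given by `σ`,
if `e = false`. -/
def Tracing.PlainAt (T : Tracing E E') (u₀ u₁ : W) (v : V) (e : Bool) : Prop :=
  ∃ σ : Bool, (∀ w, E'.twist s(T.ι v, pick u₀ u₁ w) = σ) ∧
    E'.nx σ (T.ι v) (pick u₀ u₁ e) = pick u₀ u₁ (!e) ∧
    ∀ (w : Bool) (y : FaceFlag H), y.fst = T.ι v → y.snd = pick u₀ u₁ w →
      y.rev = (σ ^^ w ^^ e) → ∃ x, E'.face y = E'.face (T.lift x)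

theorem Tracing.Gate.covers {T : Tracing E E'} {z : FaceFlag G} {w : W} {d : Bool}
    (h : T.Gate z w d) {y : FaceFlag H} (h1 : y.fst = T.ι z.fst) (h2 : y.snd = w)
    (h3 : y.rev = (d ^^ E'.twist s(T.ι z.fst, w))) : ∃ x, E'.face y = E'.face (T.lift x) := by
  refine ⟨E.pre z, ?_⟩
  rw [← T.face_step_lift_of_gate h y.rev h3]
  congr 1
  exact FaceFlag.eq_of h1 h2 rfl

theorem Inserted.plainAt {T : Tracing E E'} {u₀ u₁ : W} {x : FaceFlag G} {swap tw : Bool}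
    (h : Inserted E E' T.ι u₀ u₁ x swap tw) (hg : T.Gates u₀ u₁ x swap tw) :
    T.PlainAt u₀ u₁ x.fst (swap ^^ tw) := by
  refine ⟨tw ^^ x.rev, h.twist_pick, ?_, ?_⟩
  · have := h.nx_pick
    cases tw
    · simpa using this
    · rw [Bool.true_xor, Bool.xor_true, Bool.not_not, ← E'.nx_symm, Equiv.symm_apply_eq, this]
  · intro w y h1 h2 h3
    rcases Bool.eq_or_eq_not w swap with rfl | rfl
    · refine hg.1.covers h1 h2 ?_
      rw [h3, h.twist_pick]
      cases w <;> cases tw <;> cases x.rev <;> rfl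
    · refine hg.2.covers (by simpa using h1) h2 ?_
      rw [h3, E.back_fst, h.twist_pick]
      cases swap <;> cases tw <;> cases x.rev <;> rfl

namespace Attachment

variable {T : Tracing E E'} {S : FaceSeq G} {X : Set V} {m : ℕ} {u₀ u₁ : W} {cross : Bool}
  {extra₀ extra₁ : List W} (h : Attachment T S X m u₀ u₁ cross extra₀ extra₁)

include h

theorem vertex_inj {i j : ℕ} (hi : 1 ≤ i) (hi' : i ≤ m) (hj : 1 ≤ j) (hj' : j ≤ m)
    (he : S.vertex i = S.vertex j) : i = j :=
  h.seq.names.injOn ⟨hi, hi'⟩ ⟨hj, hj'⟩ he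

theorem vertex_mem {i : ℕ} (hi : 1 ≤ i) (hi' : i ≤ m) : S.vertex i ∈ X :=
  h.seq.names.mapsTo ⟨hi, hi'⟩

theorem shared_fst (hm : Odd m) :
    (S.shared m).fst = S.vertex (if m = 3 then 2 else m - 3) := by
  have h1 := Nat.odd_iff.1 hm
  have h2 := h.two_le
  unfold FaceSeq.shared
  split_ifs with h3
  · subst h3
    rw [h.seq.left_fst 2 (by norm_num) (by norm_num)]; rfl
  · rw [h.seq.right_fst _ (by omega) (by omega), pairRight_of_le h2 (by omega)]
    congr 1; omega

theorem left_odd_fst (hm : Odd m) :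
    (S.left ((m - 1) / 2)).fst = (S.shared m).fst := by
  have h1 := Nat.odd_iff.1 hm
  have h2 := h.two_le
  rw [h.shared_fst hm, h.seq.left_fst _ (by omega) (by omega)]
  split_ifs with h3
  · subst h3; rfl
  · rw [pairLeft_odd hm h3]

theorem crosscapAt (hm : Odd m) :
    CrosscapAt E (S.shared m) (S.left ((m - 1) / 2)) (T.flip (S.shared m).fst) where
  fst_eq := h.left_odd_fst hm
  rev_eq := h.seq.direction hm
  ne_back := h.ne_back hm
  flip_iff S₁ S₂ ha p := by
    have h1 := Nat.odd_iff.1 hm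
    have h2 := h.two_le
    have hmem : (S.shared m).fst ∈ X := by
      rw [h.shared_fst hm]
      split_ifs <;> exact h.vertex_mem (by omega) (by omega)
    rw [h.flip_iff _ hmem]
    constructor
    · rintro ⟨-, S₁', S₂', ha', w, hw, he⟩
      rw [ha.unique ha']
      rw [Sym2.eq_iff] at he
      rcases he with ⟨-, rfl⟩ | ⟨he, rfl⟩
      · exact hw
      · rwa [he]
    · intro hp
      exact ⟨hm, S₁, S₂, ha, p, hp, rfl⟩

theorem flip_eq_false {v p : V} (hv : v ∈ X) (hp : G.Adj v p)
    (hne : Odd m → v ≠ (S.shared m).fst) : T.flip v p = false := by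
  rw [← Bool.not_eq_true, h.flip_iff v hv]
  rintro ⟨hm, S₁, S₂, ha, w, hw, he⟩
  have h1 := Nat.odd_iff.1 hm
  have h2 := h.two_le
  have hmem : (S.shared m).fst ∈ X := by
    rw [h.shared_fst hm]
    split_ifs <;> exact h.vertex_mem (by omega) (by omega)
  rw [Sym2.eq_iff] at he
  rcases he with ⟨rfl, -⟩ | ⟨-, rfl⟩
  · exact hne hm rfl
  · exact (h.part _ _ hp).1 hv hmem

theorem ne_shared {j : ℕ} (hj : 1 ≤ j) (hj' : j ≤ m)
    (hne : Odd m → j ≠ if m = 3 then 2 else m - 3) (hm : Odd m) :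
    S.vertex j ≠ (S.shared m).fst := by
  rw [h.shared_fst hm]
  intro he
  have h1 := Nat.odd_iff.1 hm
  have h2 := h.two_le
  refine hne hm (h.vertex_inj hj hj' ?_ ?_ he) <;> split_ifs <;> omega

theorem gates_of_inserted {x : FaceFlag G} {s t : Bool} {j : ℕ}
    (hi : Inserted E E' T.ι u₀ u₁ x s t) (hx : x.fst = S.vertex j) (hj : 1 ≤ j) (hj' : j ≤ m)
    (hne : Odd m → j ≠ if m = 3 then 2 else m - 3) : T.Gates u₀ u₁ x s t := by
  have hf : ∀ p, G.Adj x.fst p → T.flip x.fst p = false := fun p hp => by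
    rw [hx] at hp ⊢
    exact h.flip_eq_false (h.vertex_mem hj hj') hp (h.ne_shared hj hj' hne)
  exact ⟨hi.gate hf, hi.gate_back hf⟩

theorem left_last_fst : (S.left ((m + 1) / 2)).fst = S.vertex (m - 1) := by
  have := h.two_le
  rw [h.seq.left_fst _ (by omega) le_rfl, pairLeft_last]

theorem right_last_fst : (S.right ((m + 1) / 2)).fst = S.vertex m := by
  have := h.two_le
  rw [h.seq.right_fst _ (by omega) le_rfl, pairRight_last]

theorem left_handle_fst {i : ℕ} (hi : 1 ≤ i) (hi' : i ≤ (m - 2) / 2) :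
    (S.left i).fst = S.vertex (2 * i - 1) := by
  have := h.two_le
  rw [h.seq.left_fst _ hi (by omega), pairLeft_of_le h.two_le hi']

theorem right_handle_fst {i : ℕ} (hi : 1 ≤ i) (hi' : i ≤ (m - 2) / 2) :
    (S.right i).fst = S.vertex (2 * i) := by
  have := h.two_le
  rw [h.seq.right_fst _ hi (by omega), pairRight_of_le h.two_le hi']

theorem right_odd_fst (hm : Odd m) :
    (S.right ((m - 1) / 2)).fst = S.vertex (m - 2) := by
  have := h.two_le
  have h1 := Nat.odd_iff.1 hm
  rw [h.seq.right_fst _ (by omega) (by omega), pairRight_odd hm]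

theorem gates_right_last : T.Gates u₀ u₁ (S.right ((m + 1) / 2)) true false := by
  have := h.two_le
  exact h.gates_of_inserted h.att.right_last h.right_last_fst (by omega) le_rfl
    fun hm => by split_ifs <;> omega

theorem gates_left_last : T.Gates u₀ u₁ (S.left ((m + 1) / 2)) cross cross := by
  have := h.two_le
  by_cases h3 : m = 3
  · subst h3
    have hodd : Odd 3 := by decide
    have h1 := h.att.shared_three rfl
    exact ⟨h1.gate (h.crosscapAt hodd), h1.gate_back (h.crosscapAt hodd)⟩
  · exact h.gates_of_inserted (h.att.left_last h3) h.left_last_fst (by omega) (by omega)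
      fun hm => by rw [if_neg h3]; omega

theorem gates_left_handle {i : ℕ} (hi : 1 ≤ i) (hi' : i ≤ (m - 2) / 2) :
    T.Gates u₀ u₁ (S.left i) false false :=
  h.gates_of_inserted (h.att.left_handle i hi hi') (h.left_handle_fst hi hi') (by omega) (by omega)
    fun hm => by have := Nat.odd_iff.1 hm; split_ifs <;> omega

theorem gates_right_handle {i : ℕ} (hi : 1 ≤ i) (hi' : i ≤ (m - 2) / 2) :
    T.Gates u₀ u₁ (S.right i) true false := by
  by_cases hm : Odd m ∧ i = (m - 2) / 2
  · obtain ⟨hodd, rfl⟩ := hm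
    have h1 := Nat.odd_iff.1 hodd
    have h3 : m ≠ 3 := by omega
    have h2 := h.att.shared_odd hodd h3
    have h4 : S.right ((m - 2) / 2) = S.shared m := by
      unfold FaceSeq.shared
      rw [if_neg h3]; congr 1; omega
    rw [h4]
    exact ⟨h2.gate (h.crosscapAt hodd), h2.gate_back (h.crosscapAt hodd)⟩
  · exact h.gates_of_inserted (h.att.right_handle i hi hi' hm) (h.right_handle_fst hi hi')
      (by omega) (by omega) fun hm' => by
        have := Nat.odd_iff.1 hm'
        have : i ≠ (m - 2) / 2 := fun hc => hm ⟨hm', hc⟩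
        split_ifs <;> omega

theorem gates_left_odd (hm : Odd m) (h3 : m ≠ 3) :
    T.Gates u₀ u₁ (S.left ((m - 1) / 2)) false false := by
  have h2 := h.att.shared_odd hm h3
  exact ⟨h2.gate_right (h.crosscapAt hm), h2.gate_right_back (h.crosscapAt hm)⟩

theorem gates_right_odd (hm : Odd m) (h3 : m ≠ 3) :
    T.Gates u₀ u₁ (S.right ((m - 1) / 2)) true false := by
  have h1 := Nat.odd_iff.1 hm
  have := h.two_le
  exact h.gates_of_inserted (h.att.right_odd hm h3) (h.right_odd_fst hm) (by omega) (by omega)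
    fun hm => by rw [if_neg h3]; omega

theorem gates_left_three (h3 : m = 3) :
    T.Gates u₀ u₁ (S.left ((m - 1) / 2)) (!cross) cross := by
  have hm : Odd m := by rw [h3]; decide
  have h2 := h.att.shared_three h3
  refine ⟨h2.gate_right (h.crosscapAt hm), ?_⟩
  have := h2.gate_right_back (h.crosscapAt hm)
  rwa [Bool.not_not]

theorem gates_right_three (h3 : m = 3) :
    T.Gates u₀ u₁ (S.right ((m - 1) / 2)) cross cross := by
  have hm : Odd m := by rw [h3]; decide
  exact h.gates_of_inserted (h.att.right_three h3) (h.right_odd_fst hm) (by omega) (by omega)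
    fun hm => by rw [if_pos h3]; omega

/-! ### Faces at the attached vertices -/

/-- With the rotation at `u₁` read backwards, the two new vertices meet `X` in the same order. -/
theorem rot_eq (w : Bool) : E'.read w (pick u₀ u₁ w) =
    ↑((List.range' 1 (m - 1)).map (fun i => T.ι (S.vertex i)) ++ (if w = true then extra₁ else extra₀)
      ++ [T.ι (S.vertex m)]) := by
  cases w
  · exact h.att.rot₀
  · change (E'.rot u₁).reverse = _
    rw [h.att.rot₁, Cycle.reverse_coe, List.reverse_reverse]; rfl

theorem nx_succ (w : Bool) {j : ℕ} (hj : 1 ≤ j) (hj' : j + 1 ≤ m - 1) :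
    E'.nx w (pick u₀ u₁ w) (T.ι (S.vertex j)) = T.ι (S.vertex (j + 1)) := by
  have h1 : List.range' 1 (m - 1) = List.range' 1 (j - 1) ++ j :: (j + 1) ::
      List.range' (j + 2) (m - 2 - j) := by
    have e1 : m - 1 = (j - 1) + ((m - 2 - j) + 1 + 1) := by omega
    conv_lhs => rw [e1, ← List.range'_append_1, List.range'_succ, List.range'_succ]
    have e2 : 1 + (j - 1) = j := by omega
    rw [e2]
  refine E'.nx_of_append (A := (List.range' 1 (j - 1)).map (fun i => T.ι (S.vertex i)))
    (B := (List.range' (j + 2) (m - 2 - j)).map (fun i => T.ι (S.vertex i)) ++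
      (if w = true then extra₁ else extra₀) ++ [T.ι (S.vertex m)]) ?_
  rw [h.rot_eq, h1]; simp

theorem nx_last (w : Bool) :
    E'.nx w (pick u₀ u₁ w) (T.ι (S.vertex m)) = T.ι (S.vertex 1) := by
  have h1 : List.range' 1 (m - 1) = 1 :: List.range' 2 (m - 2) := by
    have := h.two_le
    have e1 : m - 1 = (m - 2) + 1 := by omega
    rw [e1, List.range'_succ]
  refine E'.nx_of_ends (h.rot_eq w) ?_ (by simp)
  rw [h1]; simp

theorem range_split : List.range' 1 (m - 1) = List.range' 1 (m - 2) ++ [m - 1] := by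
  have := h.two_le
  have e1 : m - 1 = (m - 2) + 1 := by omega
  conv_lhs => rw [e1, List.range'_concat]
  congr 2; omega

theorem nx_pred_last (w : Bool) (he : (if w = true then extra₁ else extra₀) = []) :
    E'.nx w (pick u₀ u₁ w) (T.ι (S.vertex (m - 1))) = T.ι (S.vertex m) := by
  refine E'.nx_of_append (A := (List.range' 1 (m - 2)).map (fun i => T.ι (S.vertex i)))
    (B := []) ?_
  rw [h.rot_eq, h.range_split, he]; simp

theorem nx_extra (w : Bool) {v : W} (he : (if w = true then extra₁ else extra₀) = [v]) :
    E'.nx w (pick u₀ u₁ w) (T.ι (S.vertex (m - 1))) = v ∧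
      E'.nx w (pick u₀ u₁ w) v = T.ι (S.vertex m) := by
  constructor
  · refine E'.nx_of_append (A := (List.range' 1 (m - 2)).map (fun i => T.ι (S.vertex i)))
      (B := [T.ι (S.vertex m)]) ?_
    rw [h.rot_eq, h.range_split, he]; simp
  · refine E'.nx_of_append (A := (List.range' 1 (m - 1)).map (fun i => T.ι (S.vertex i)))
      (B := []) ?_
    rw [h.rot_eq, he]; simp

/-- Between a position where `u₁` precedes `u₀` and a following one where `u₀` precedes `u₁`
there is a quadrilateral through both new vertices. -/
theorem quadrilateral_between {v v' : V} (hv : T.PlainAt u₀ u₁ v true)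
    (hv' : T.PlainAt u₀ u₁ v' false)
    (hn : ∀ w, E'.nx w (pick u₀ u₁ w) (T.ι v) = T.ι v') {y : FaceFlag H}
    (hy : (y.fst = T.ι v ∨ y.fst = T.ι v') ∧ (y.snd = u₀ ∨ y.snd = u₁)) : T.Covered y := by
  obtain ⟨σ, h1, h2, h3⟩ := hv
  obtain ⟨σ', h1', h2', h3'⟩ := hv'
  have hn0 : E'.nx false u₀ (T.ι v) = T.ι v' := hn false
  have hn1 : E'.nx true u₁ (T.ι v) = T.ι v' := hn true
  have hn1' : E'.nx false u₁ (T.ι v') = T.ι v := by rw [← hn1]; exact E'.nx_nx_not false u₁ _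
  have h2 : E'.nx σ (T.ι v) u₁ = u₀ := h2
  have h2' : E'.nx σ' (T.ι v') u₀ = u₁ := h2'
  have h10 : E'.twist s(T.ι v, u₀) = σ := h1 false
  have h11 : E'.twist s(T.ι v, u₁) = σ := h1 true
  have h10' : E'.twist s(T.ι v', u₀) = σ' := h1' false
  have h11' : E'.twist s(T.ι v', u₁) = σ' := h1' true
  -- the two flags leaving `v` and `v'` inside the quadrilateral
  have hq : ∀ z : FaceFlag H, z.fst = T.ι v → z.snd = u₀ → z.rev = σ →
      E'.step^[4] z = z ∧ (E'.step^[2] z).fst = T.ι v' ∧ (E'.step^[2] z).snd = u₁ ∧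
        (E'.step^[2] z).rev = σ' := by
    intro z z1 z2 z3
    have a1 : (E'.step z).fst = u₀ ∧ (E'.step z).snd = T.ι v' ∧ (E'.step z).rev = false := by
      have hr : (E'.step z).rev = false := by rw [E'.step_rev, z1, z2, z3, h10, Bool.xor_self]
      refine ⟨by rw [E'.step_fst, z2], ?_, hr⟩
      rw [E'.step_snd, ← E'.step_rev, hr, z1, z2, hn0]
    have a2 : (E'.step^[2] z).fst = T.ι v' ∧ (E'.step^[2] z).snd = u₁ ∧
        (E'.step^[2] z).rev = σ' := by
      change (E'.step (E'.step z)).fst = _ ∧ (E'.step (E'.step z)).snd = _ ∧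
        (E'.step (E'.step z)).rev = _
      have hr : (E'.step (E'.step z)).rev = σ' := by
        rw [E'.step_rev, a1.1, a1.2.1, a1.2.2, Sym2.eq_swap, h10', Bool.false_xor]
      refine ⟨by rw [E'.step_fst, a1.2.1], ?_, hr⟩
      rw [E'.step_snd, ← E'.step_rev, hr, a1.1, a1.2.1, h2']
    refine ⟨?_, a2⟩
    obtain ⟨b1, b2, b3⟩ := a2
    have a3 : (E'.step (E'.step^[2] z)).fst = u₁ ∧ (E'.step (E'.step^[2] z)).snd = T.ι v ∧
        (E'.step (E'.step^[2] z)).rev = false := by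
      have hr : (E'.step (E'.step^[2] z)).rev = false := by
        rw [E'.step_rev, b1, b2, b3, h11', Bool.xor_self]
      refine ⟨by rw [E'.step_fst, b2], ?_, hr⟩
      rw [E'.step_snd, ← E'.step_rev, hr, b1, b2, hn1']
    change E'.step (E'.step (E'.step^[2] z)) = z
    obtain ⟨c1, c2, c3⟩ := a3
    have hr : (E'.step (E'.step (E'.step^[2] z))).rev = σ := by
      rw [E'.step_rev, c1, c2, c3, Sym2.eq_swap, h11, Bool.false_xor]
    refine FaceFlag.eq_of (by rw [E'.step_fst, c2, z1]) ?_ (by rw [hr, z3])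
    rw [E'.step_snd, ← E'.step_rev, hr, c1, c2, h2, z2]
  have hadj : ∀ z : FaceFlag H, z.fst = T.ι v → z.snd = u₀ ∨ z.snd = u₁ → H.Adj (T.ι v) u₀ := by
    intro z z1 z2
    rcases z2 with z2 | z2
    · rw [← z1, ← z2]; exact z.adj
    · rw [← h2]; refine E'.adj_nx _ ?_
      rw [← z1, ← z2]; exact z.adj
  have back4 : ∀ z : FaceFlag H, E'.step^[4] z = z → E'.step^[4] (E'.back z) = E'.back z := by
    intro z hz
    have := E'.iterate_back_iterate z 4
    rwa [hz] at this
  obtain ⟨hy1 | hy1, hy2⟩ := hy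
  · rcases hy2 with hy2 | hy2
    · rcases Bool.eq_or_eq_not y.rev σ with hr | hr
      · exact Or.inl (hq y hy1 hy2 hr).1
      · exact Or.inr (h3 false y hy1 hy2 (by rw [hr]; simp))
    · rcases Bool.eq_or_eq_not y.rev σ with hr | hr
      · exact Or.inr (h3 true y hy1 hy2 (by rw [hr]; simp))
      · left
        have h4 := (hq (E'.back y) (by simpa using hy1)
          (by rw [E'.back_snd, hr, hy1, hy2, Bool.not_not, h2]) (by simp [hr])).1
        simpa using back4 _ h4
  · -- at `v'`, the flags are two steps behind those at `v`
    have hstep : ∀ z : FaceFlag H, z.fst = T.ι v' → z.snd = u₁ → z.rev = σ' →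
        E'.step^[4] z = z := by
      intro z z1 z2 z3
      have hA : H.Adj (T.ι v) u₀ := by
        rw [← h2]
        refine E'.adj_nx _ ?_
        have : H.Adj u₁ (T.ι v) := by
          rw [← hn1']
          refine E'.adj_nx _ ?_
          rw [← z1, ← z2]; exact z.adj.symm
        exact this.symm
      obtain ⟨b0, b1, b2, b3⟩ := hq ⟨T.ι v, u₀, hA, σ⟩ rfl rfl rfl
      have hz : z = E'.step^[2] ⟨T.ι v, u₀, hA, σ⟩ :=
        FaceFlag.eq_of (by rw [z1, b1]) (by rw [z2, b2]) (by rw [z3, b3])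
      rw [hz, ← Function.iterate_add_apply, add_comm, Function.iterate_add_apply, b0]
    rcases hy2 with hy2 | hy2
    · rcases Bool.eq_or_eq_not y.rev σ' with hr | hr
      · exact Or.inr (h3' false y hy1 hy2 (by rw [hr]; simp))
      · left
        have h4 := hstep (E'.back y) (by simpa using hy1)
          (by rw [E'.back_snd, hr, hy1, hy2, Bool.not_not, h2']) (by simp [hr])
        simpa using back4 _ h4
    · rcases Bool.eq_or_eq_not y.rev σ' with hr | hr
      · exact Or.inl (hstep y hy1 hy2 hr)
      · exact Or.inr (h3' true y hy1 hy2 (by rw [hr]; simp))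

theorem plainAt_of_inserted {x : FaceFlag G} {s t : Bool} {j : ℕ} {e : Bool}
    (hi : Inserted E E' T.ι u₀ u₁ x s t) (hg : T.Gates u₀ u₁ x s t) (hx : x.fst = S.vertex j)
    (he : (s ^^ t) = e) : T.PlainAt u₀ u₁ (S.vertex j) e := by
  rw [← hx, ← he]; exact hi.plainAt hg

/-- The positions that come first in the quadrilateral between two consecutive positions. -/
theorem plainAt_true {j : ℕ} (hj : 1 ≤ j) (hj' : j = m ∨ (j + 2 ≤ m ∧ Even j ∧
    (Even m ∨ j + 5 ≤ m)) ∨ (Odd m ∧ 5 ≤ m ∧ j + 2 = m)) :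
    T.PlainAt u₀ u₁ (S.vertex j) true := by
  have h2 := h.two_le
  rcases hj' with rfl | ⟨h1, h3, h4⟩ | ⟨h1, h3, h4⟩
  · exact h.plainAt_of_inserted h.att.right_last h.gates_right_last h.right_last_fst rfl
  · obtain ⟨i, hi⟩ := h3
    have hne : ¬ (Odd m ∧ i = (m - 2) / 2) := by
      rintro ⟨ho, h5⟩
      rw [Nat.odd_iff] at ho
      rw [Nat.even_iff] at h4
      omega
    refine h.plainAt_of_inserted (h.att.right_handle i (by omega) (by omega) hne)
      (h.gates_right_handle (by omega) (by omega)) ?_ rfl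
    rw [h.right_handle_fst (by omega) (by omega)]
    congr 1; omega
  · refine h.plainAt_of_inserted (h.att.right_odd h1 (by omega))
      (h.gates_right_odd h1 (by omega)) ?_ rfl
    rw [h.right_odd_fst h1]
    congr 1; omega

/-- The positions that come second in the quadrilateral between two consecutive positions. -/
theorem plainAt_false {j : ℕ} (hj : 1 ≤ j) (hj' : (m ≠ 3 ∧ j + 1 = m) ∨ (j + 2 ≤ m ∧ Odd j ∧
    (Even m ∨ j + 4 ≤ m)) ∨ (m = 3 ∧ j = 1)) :
    T.PlainAt u₀ u₁ (S.vertex j) false := by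
  have h2 := h.two_le
  rcases hj' with ⟨h1, h3⟩ | ⟨h1, h3, h4⟩ | ⟨rfl, rfl⟩
  · refine h.plainAt_of_inserted (h.att.left_last h1) h.gates_left_last ?_ (Bool.xor_self _)
    rw [h.left_last_fst]; congr 1; omega
  · obtain ⟨i, hi⟩ := h3
    have hle : i + 1 ≤ (m - 2) / 2 := by
      rw [Nat.even_iff] at h4
      omega
    refine h.plainAt_of_inserted (h.att.left_handle (i + 1) (by omega) hle)
      (h.gates_left_handle (by omega) hle) ?_ rfl
    rw [h.left_handle_fst (by omega) hle]
    congr 1; omega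
  · exact h.plainAt_of_inserted (h.att.right_three rfl) (h.gates_right_three rfl)
      (h.right_odd_fst (by decide)) (Bool.xor_self _)

/-- At the crosscap, both sides of each new edge lie in faces of old flags. -/
theorem covered_of_crosscap {s t : Bool} (hm : Odd m)
    (hi : InsertedCrosscap E E' T.ι u₀ u₁ (S.shared m) (S.left ((m - 1) / 2)) s t)
    {y : FaceFlag H} (hy : y.fst = T.ι (S.shared m).fst) (hy' : y.snd = u₀ ∨ y.snd = u₁) :
    T.Covered y := by
  right
  have hc := h.crosscapAt hm
  obtain ⟨S₁, S₂, h1, h2, h3, h4⟩ := hi.exists_list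
  have hrev := hc.rev_eq
  have hfst := hc.fst_eq
  have hpick : y.snd = pick u₀ u₁ s ∨ y.snd = pick u₀ u₁ (!s) := by
    cases s
    · exact hy'
    · exact hy'.symm
  rcases hpick with hp | hp
  · rcases Bool.eq_or_eq_not y.rev (S.shared m).rev with hr | hr
    · refine (hi.gate hc).covers hy hp ?_
      rw [hr, h4, ← Bool.xor_assoc, Bool.xor_self, Bool.false_xor]
    · refine (hi.gate_right_back hc).covers (by simpa [hfst] using hy) hp ?_
      rw [hr, E.back_fst, hfst, h4]
      cases t <;> cases (S.shared m).rev <;> rfl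
  · rcases Bool.eq_or_eq_not y.rev (S.shared m).rev with hr | hr
    · refine (hi.gate_back hc).covers (by simpa using hy) hp ?_
      rw [hr, E.back_fst, h3]
      cases t <;> cases (S.shared m).rev <;> rfl
    · refine (hi.gate_right hc).covers (by rw [hy, hfst]) hp ?_
      rw [hr, hfst, h3]
      cases t <;> cases (S.shared m).rev <;> rfl

/-- No face of length greater than four consists only of new edges. -/
theorem covered {v : V} (hv : v ∈ X) {y : FaceFlag H} (hy : y.fst = T.ι v)
    (hy' : y.snd = u₀ ∨ y.snd = u₁) : T.Covered y := by
  have h2 := h.two_le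
  obtain ⟨j, ⟨hj, hj'⟩, rfl⟩ := h.seq.names.surjOn hv
  -- the position `j` is at the crosscap, or the first or the second one of its quadrilateral
  have hcases : (Odd m ∧ j = if m = 3 then 2 else m - 3) ∨
      (j = m ∨ (j + 2 ≤ m ∧ Even j ∧ (Even m ∨ j + 5 ≤ m)) ∨ (Odd m ∧ 5 ≤ m ∧ j + 2 = m)) ∨
      ((m ≠ 3 ∧ j + 1 = m) ∨ (j + 2 ≤ m ∧ Odd j ∧ (Even m ∨ j + 4 ≤ m)) ∨ (m = 3 ∧ j = 1)) := by
    rw [Nat.odd_iff, Nat.even_iff, Nat.even_iff, Nat.odd_iff]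
    split_ifs <;> omega
  rcases hcases with ⟨hm, h3⟩ | hR | hL
  · rw [h3, ← h.shared_fst hm] at hy
    by_cases h4 : m = 3
    · exact h.covered_of_crosscap hm (h.att.shared_three h4) hy hy'
    · exact h.covered_of_crosscap hm (h.att.shared_odd hm h4) hy hy'
  · have hR' := h.plainAt_true hj hR
    rcases Nat.lt_or_ge j m with hlt | hge
    · refine h.quadrilateral_between hR' (h.plainAt_false (j := j + 1) (by omega) ?_)
        (fun w => h.nx_succ w hj ?_) ⟨Or.inl hy, hy'⟩
      · rw [Nat.odd_iff, Nat.even_iff, Nat.even_iff] at hR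
        rw [Nat.odd_iff, Nat.even_iff]
        omega
      · rw [Nat.odd_iff, Nat.even_iff, Nat.even_iff] at hR
        omega
    · obtain rfl : j = m := by omega
      refine h.quadrilateral_between hR' (h.plainAt_false (j := 1) le_rfl ?_)
        (fun w => h.nx_last w) ⟨Or.inl hy, hy'⟩
      rw [Nat.odd_iff, Nat.even_iff]
      omega
  · have hL' := h.plainAt_false hj hL
    rcases Nat.lt_or_ge 1 j with hlt | hge
    · refine h.quadrilateral_between (h.plainAt_true (j := j - 1) (by omega) ?_) hL'
        (fun w => ?_) ⟨Or.inr hy, hy'⟩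
      · rw [Nat.odd_iff, Nat.even_iff] at hL
        rw [Nat.odd_iff, Nat.even_iff, Nat.even_iff]
        omega
      · have := h.nx_succ w (j := j - 1) (by omega) (by omega)
        rwa [Nat.sub_add_cancel hj] at this
    · obtain rfl : j = 1 := by omega
      exact h.quadrilateral_between (h.plainAt_true (j := m) (by omega) (Or.inl rfl)) hL'
        (fun w => h.nx_last w) ⟨Or.inr hy, hy'⟩

/-! ### Transitions through the attached vertices -/

/-- All corners that are not marked are kept. -/
theorem kept {z : FaceFlag G} (hz : z.fst ∈ X) (hm : ¬ S.Marked E ((m + 1) / 2) z) : T.Kept z := by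
  have h2 := h.two_le
  have hne : ∀ i, 1 ≤ i → i ≤ (m + 1) / 2 → (z ≠ S.left i ∧ z ≠ E.back (S.left i)) ∧
      (z ≠ S.right i ∧ z ≠ E.back (S.right i)) := by
    intro i h1 h2
    by_contra hc
    refine hm ⟨i, h1, h2, ?_⟩
    unfold CellEmbedding.SameCorner
    tauto
  have plain : ∀ {x : FaceFlag G} {s t : Bool} {j : ℕ}, z.fst = S.vertex j →
      Inserted E E' T.ι u₀ u₁ x s t → x.fst = S.vertex j → 1 ≤ j → j ≤ m →
      (Odd m → j ≠ if m = 3 then 2 else m - 3) → (z ≠ x ∧ z ≠ E.back x) → T.Kept z := by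
    intro x s t j hzj hi hx hj hj' hn hzx
    have hf : ∀ p, G.Adj x.fst p → T.flip x.fst p = false := fun p hp => by
      rw [hx] at hp ⊢
      exact h.flip_eq_false (h.vertex_mem hj hj') hp (h.ne_shared hj hj' hn)
    exact hi.kept hf (by rw [hzj, hx]) hzx.1 hzx.2
  obtain ⟨j, ⟨hj, hj'⟩, hzj⟩ := h.seq.names.surjOn hz
  have hcases : (Odd m ∧ j = if m = 3 then 2 else m - 3) ∨
      ((Odd m → j ≠ if m = 3 then 2 else m - 3) ∧ (j = m ∨ (m ≠ 3 ∧ j + 1 = m) ∨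
      (j + 2 ≤ m ∧ Even j ∧ (Even m ∨ j + 5 ≤ m)) ∨ (Odd m ∧ 5 ≤ m ∧ j + 2 = m) ∨
       (j + 2 ≤ m ∧ Odd j ∧ (Even m ∨ j + 4 ≤ m)) ∨ (m = 3 ∧ j = 1))) := by
    rw [Nat.odd_iff, Nat.even_iff, Nat.even_iff, Nat.odd_iff]
    split_ifs <;> omega
  rcases hcases with ⟨ho, h3⟩ | ⟨hns, rfl | ⟨h3, h4⟩ | ⟨h3, h4, h5⟩ | ⟨h3, h4, h5⟩ | ⟨h3, h4, h5⟩ |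
    ⟨rfl, rfl⟩⟩
  · have hzs : z.fst = (S.shared m).fst := by rw [← hzj, h3, h.shared_fst ho]
    have h1 := Nat.odd_iff.1 ho
    have hs : z ≠ S.shared m ∧ z ≠ E.back (S.shared m) := by
      unfold FaceSeq.shared
      split_ifs with h4
      · exact (hne 2 (by norm_num) (by omega)).1
      · exact (hne _ (by omega) (by omega)).2
    have hl := (hne ((m - 1) / 2) (by omega) (by omega)).1
    by_cases h4 : m = 3
    · exact (h.att.shared_three h4).kept (h.crosscapAt ho) hzs hs.1 hs.2 hl.1 hl.2
    · exact (h.att.shared_odd ho h4).kept (h.crosscapAt ho) hzs hs.1 hs.2 hl.1 hl.2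
  · exact plain hzj.symm h.att.right_last h.right_last_fst hj le_rfl hns
      (hne _ (by omega) le_rfl).2
  · exact plain hzj.symm (h.att.left_last h3) (by rw [h.left_last_fst]; congr 1; omega) hj hj' hns
      (hne _ (by omega) le_rfl).1
  · obtain ⟨i, hi⟩ := h4
    have hi2 : ¬ (Odd m ∧ i = (m - 2) / 2) := by
      rintro ⟨ho, h6⟩
      rw [Nat.odd_iff] at ho
      rw [Nat.even_iff] at h5
      omega
    refine plain hzj.symm (h.att.right_handle i (by omega) (by omega) hi2) ?_ hj hj' hns
      (hne _ (by omega) (by omega)).2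
    rw [h.right_handle_fst (by omega) (by omega)]
    congr 1; omega
  · refine plain hzj.symm (h.att.right_odd h3 (by omega)) ?_ hj hj' hns
      (hne _ (by omega) (by omega)).2
    rw [h.right_odd_fst h3]
    congr 1; omega
  · obtain ⟨i, hi⟩ := h4
    have hle : i + 1 ≤ (m - 2) / 2 := by
      rw [Nat.even_iff] at h5
      omega
    refine plain hzj.symm (h.att.left_handle (i + 1) (by omega) hle) ?_ hj hj' hns
      (hne _ (by omega) (by omega)).1
    rw [h.left_handle_fst (by omega) hle]
    congr 1; omega
  · exact plain hzj.symm (h.att.right_three rfl) (h.right_odd_fst (by decide)) hj hj' hns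
      (hne 1 le_rfl (by omega)).2

/-- The two corners `l`, `r` exchange the continuations of the walks arriving there. -/
theorem pass_of_gates {l r : FaceFlag G} {s t : Bool} (hl : T.Gates u₀ u₁ l s t)
    (hr : T.Gates u₀ u₁ r (!s) t)
    (h1 : E'.nx t (pick u₀ u₁ s) (T.ι l.fst) = T.ι r.fst)
    (h2 : E'.nx (!t) (pick u₀ u₁ (!s)) (T.ι l.fst) = T.ι r.fst) :
    E'.step^[3] (T.lift (E.pre l)) = T.lift r ∧
    E'.step^[3] (T.lift (E.pre r)) = T.lift l ∧
    E'.step^[3] (T.lift (E.pre (E.back l))) = T.lift (E.back r) ∧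
    E'.step^[3] (T.lift (E.pre (E.back r))) = T.lift (E.back l) := by
  obtain ⟨hl1, hl2⟩ := hl
  obtain ⟨hr1, hr2⟩ := hr
  rw [Bool.not_not] at hr2
  refine ⟨hl1.pass hr2 h1, hr1.pass hl2 ?_, hl2.pass (z' := E.back r) ?_ ?_,
    hr2.pass (z' := E.back l) ?_ ?_⟩
  · rw [← h2, CellEmbedding.nx_nx_not]
  · rw [E.back_back, Bool.not_not]; exact hr1
  · rw [E.back_fst, E.back_fst, h2]
  · rw [E.back_back, Bool.not_not]; exact hl1
  · rw [E.back_fst, E.back_fst, ← h1, CellEmbedding.nx_not_nx]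

/-- Within each pair of marked corners, walks pass from one corner to the other.  For the last pair this
holds only if its face is not cut by a crosscap. -/
theorem pass {i : ℕ} (hi : 1 ≤ i) (hi' : i ≤ (m + 1) / 2)
    (hlast : i = (m + 1) / 2 → cross = false ∧ extra₀ = [] ∧ extra₁ = []) :
    E'.step^[3] (T.lift (E.pre (S.left i))) = T.lift (S.right i) ∧
    E'.step^[3] (T.lift (E.pre (S.right i))) = T.lift (S.left i) ∧
    E'.step^[3] (T.lift (E.pre (E.back (S.left i)))) = T.lift (E.back (S.right i)) ∧
    E'.step^[3] (T.lift (E.pre (E.back (S.right i)))) = T.lift (E.back (S.left i)) := by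
  have h2 := h.two_le
  have hcases : i = (m + 1) / 2 ∨ i ≤ (m - 2) / 2 ∨ (Odd m ∧ i = (m - 1) / 2) := by
    rw [Nat.odd_iff]; omega
  rcases hcases with rfl | hle | ⟨ho, rfl⟩
  · obtain ⟨rfl, rfl, rfl⟩ := hlast rfl
    refine h.pass_of_gates h.gates_left_last h.gates_right_last ?_ ?_
    · rw [h.left_last_fst, h.right_last_fst]; exact h.nx_pred_last false rfl
    · rw [h.left_last_fst, h.right_last_fst]; exact h.nx_pred_last true rfl
  · have key := fun w => h.nx_succ w (j := 2 * i - 1) (by omega) (by omega)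
    have e : 2 * i - 1 + 1 = 2 * i := by omega
    rw [e] at key
    refine h.pass_of_gates (h.gates_left_handle hi hle) (h.gates_right_handle hi hle) ?_ ?_
    · rw [h.left_handle_fst hi hle, h.right_handle_fst hi hle]; exact key false
    · rw [h.left_handle_fst hi hle, h.right_handle_fst hi hle]; exact key true
  · by_cases h3 : m = 3
    · subst h3
      have hl : (S.left ((3 - 1) / 2)).fst = S.vertex 2 := by
        rw [h.left_odd_fst ho, h.shared_fst ho]; rfl
      have hr : (S.right ((3 - 1) / 2)).fst = S.vertex 1 := h.right_odd_fst ho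
      have key := fun w => h.nx_succ w (j := 1) le_rfl (by norm_num)
      refine h.pass_of_gates (h.gates_left_three rfl) (by simpa using h.gates_right_three rfl) ?_ ?_
      · rw [hl, hr, ← key (!cross)]
        exact E'.nx_nx_not cross _ _
      · rw [hl, hr, Bool.not_not, ← key cross]
        exact E'.nx_not_nx _ _ _
    · have h1 := Nat.odd_iff.1 ho
      have hl : (S.left ((m - 1) / 2)).fst = S.vertex (m - 3) := by
        rw [h.left_odd_fst ho, h.shared_fst ho, if_neg h3]
      have key := fun w => h.nx_succ w (j := m - 3) (by omega) (by omega)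
      have e : m - 3 + 1 = m - 2 := by omega
      rw [e] at key
      refine h.pass_of_gates (h.gates_left_odd ho h3) (h.gates_right_odd ho h3) ?_ ?_
      · rw [hl, h.right_odd_fst ho]; exact key false
      · rw [hl, h.right_odd_fst ho]; exact key true

end Attachment

end Attaching

/-! ### Faces of the extended embeddings -/

section Opposite

variable {V : Type*} [DecidableEq V] {G : SimpleGraph V} {E : CellEmbedding G} {X : Set V} [Finite V]

/-- The pairs `x₁, x₂` and `y₁, y₂` are the two ends of disjoint paths of length two on the boundary
of a hexagon. -/
def CellEmbedding.Opposite (E : CellEmbedding G) (x₁ x₂ y₁ y₂ : FaceFlag G) : Prop :=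
  ∃ z, E.walkLength z = 6 ∧
    ((E.SameCorner x₁ z ∧ E.SameCorner x₂ (E.step^[2] z)) ∨
      (E.SameCorner x₂ z ∧ E.SameCorner x₁ (E.step^[2] z))) ∧
    ((E.SameCorner y₁ (E.step^[3] z) ∧ E.SameCorner y₂ (E.step^[5] z)) ∨
      (E.SameCorner y₂ (E.step^[3] z) ∧ E.SameCorner y₁ (E.step^[5] z)))

namespace CellEmbedding

theorem SameCorner.walkLength_eq {x y : FaceFlag G} (h : E.SameCorner x y) :
    E.walkLength y = E.walkLength x := by
  rcases h with rfl | rfl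
  · rfl
  · exact E.walkLength_eq_of_face_eq (E.face_back _)

theorem SameCorner.back {x y : FaceFlag G} (h : E.SameCorner x y) : E.SameCorner x (E.back y) :=
  h.trans (Or.inr rfl)

theorem Parallel.opposite (hX : IsPart G X) {x₁ x₂ y₁ y₂ : FaceFlag G} (h : E.Parallel x₁ x₂ y₁ y₂)
    (hL : E.walkLength x₁ ≤ 6) (hx : x₂.fst ∈ X ↔ x₁.fst ∈ X) (hy : y₂.fst ∈ X ↔ y₁.fst ∈ X) :
    E.Opposite x₁ x₂ y₁ y₂ := by
  obtain ⟨h6, -, z, h1, h2, h3⟩ := h.mem_iff E hX hL hx hy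
  exact ⟨z, by rw [h1.walkLength_eq, h6], Or.inl ⟨h1, h2⟩, h3⟩

theorem Opposite.swap_left {x₁ x₂ y₁ y₂ : FaceFlag G} (h : E.Opposite x₁ x₂ y₁ y₂) :
    E.Opposite x₂ x₁ y₁ y₂ := by
  obtain ⟨z, h1, h2, h3⟩ := h
  exact ⟨z, h1, h2.symm, h3⟩

theorem Opposite.swap_right {x₁ x₂ y₁ y₂ : FaceFlag G} (h : E.Opposite x₁ x₂ y₁ y₂) :
    E.Opposite x₁ x₂ y₂ y₁ := by
  obtain ⟨z, h1, h2, h3⟩ := h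
  exact ⟨z, h1, h2, h3.symm⟩

theorem Opposite.symm {x₁ x₂ y₁ y₂ : FaceFlag G} (h : E.Opposite x₁ x₂ y₁ y₂) :
    E.Opposite y₁ y₂ x₁ x₂ := by
  obtain ⟨z, h1, h2, h3⟩ := h
  have h6 : E.step^[6] z = z := by
    have := E.iterate_walkLength z
    rwa [h1] at this
  have e3 : E.step^[3] (E.step^[3] z) = z := by rw [← Function.iterate_add_apply]; exact h6
  have e5 : E.step^[5] (E.step^[3] z) = E.step^[2] z := by
    rw [← Function.iterate_add_apply, show 5 + 3 = 2 + 6 from rfl, Function.iterate_add_apply, h6]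
  refine ⟨E.step^[3] z, by rw [E.walkLength_eq_of_face_eq (E.face_iterate _ _), h1], ?_, ?_⟩
  · rw [← Function.iterate_add_apply]; exact h3
  · rw [e3, e5]; exact h2

theorem Opposite.congr {x₁ x₂ y₁ y₂ x₁' x₂' y₁' y₂' : FaceFlag G} (h : E.Opposite x₁ x₂ y₁ y₂)
    (h1 : E.SameCorner x₁' x₁) (h2 : E.SameCorner x₂' x₂) (h3 : E.SameCorner y₁' y₁)
    (h4 : E.SameCorner y₂' y₂) : E.Opposite x₁' x₂' y₁' y₂' := by
  obtain ⟨z, h5, h6, h7⟩ := h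
  refine ⟨z, h5, h6.imp ?_ ?_, h7.imp ?_ ?_⟩
  · exact fun h => ⟨h1.trans h.1, h2.trans h.2⟩
  · exact fun h => ⟨h2.trans h.1, h1.trans h.2⟩
  · exact fun h => ⟨h3.trans h.1, h4.trans h.2⟩
  · exact fun h => ⟨h4.trans h.1, h3.trans h.2⟩

theorem Opposite.parallel {x₁ x₂ y₁ y₂ : FaceFlag G} (h : E.Opposite x₁ x₂ y₁ y₂) :
    E.Parallel x₁ x₂ y₁ y₂ := by
  obtain ⟨z, h1, ⟨ha, hb⟩ | ⟨ha, hb⟩, h3⟩ := h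
  · exact ⟨z, ha, 2, 3, 5, by norm_num, by norm_num, by norm_num, by rw [h1]; norm_num, hb, h3⟩
  · -- the same four corners, met in the opposite direction
    have h6 : E.step^[6] z = z := by
      have := E.iterate_walkLength z
      rwa [h1] at this
    have key : ∀ i j, E.step^[i] (E.back (E.step^[i + j] z)) = E.back (E.step^[j] z) := by
      intro i j
      rw [Function.iterate_add_apply]; exact E.iterate_back_iterate _ i
    have e8 : E.step^[8] z = E.step^[2] z := by
      rw [show 8 = 2 + 6 from rfl, Function.iterate_add_apply, h6]
    refine ⟨E.back (E.step^[2] z), hb.back, 2, 3, 5, by norm_num, by norm_num, by norm_num,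
      ?_, ?_, ?_⟩
    · rw [E.walkLength_eq_of_face_eq (E.face_back _),
        E.walkLength_eq_of_face_eq (E.face_iterate _ _), h1]; norm_num
    · have := key 2 0
      rw [this]; exact ha.back
    · have k3 := key 3 5
      have k5 := key 5 3
      rw [e8] at k3 k5
      rw [k3, k5]
      exact h3.symm.imp (fun h => ⟨h.2.back, h.1.back⟩) fun h => ⟨h.2.back, h.1.back⟩

end CellEmbedding

end Opposite

section Extended

variable {V W : Type*} [DecidableEq V] [DecidableEq W] {G : SimpleGraph V} {H : SimpleGraph W}
  {E : CellEmbedding G} {E' : CellEmbedding H} [Finite V] [Finite W] {T : Tracing E E'}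
  {X : Set V}

/-- The corners `z` and `w` are the two marked corners, passed in the same direction of the walk,
in one of the first `t` faces of the face sequence `S`. -/
def FaceSeq.Partner (E : CellEmbedding G) (S : FaceSeq G) (t : ℕ) (z w : FaceFlag G) : Prop :=
  ∃ i, 1 ≤ i ∧ i ≤ t ∧ ((z = S.left i ∧ w = S.right i) ∨ (z = S.right i ∧ w = S.left i) ∨
    (z = E.back (S.left i) ∧ w = E.back (S.right i)) ∨
    (z = E.back (S.right i) ∧ w = E.back (S.left i)))

theorem FaceSeq.Marked.exists_partner {S : FaceSeq G} {t : ℕ} {z : FaceFlag G}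
    (h : S.Marked E t z) : ∃ w, S.Partner E t z w := by
  obtain ⟨i, h1, h2, (h | h) | (h | h)⟩ := h
  · exact ⟨_, i, h1, h2, Or.inl ⟨h, rfl⟩⟩
  · exact ⟨_, i, h1, h2, Or.inr (Or.inr (Or.inl ⟨h, rfl⟩))⟩
  · exact ⟨_, i, h1, h2, Or.inr (Or.inl ⟨h, rfl⟩)⟩
  · exact ⟨_, i, h1, h2, Or.inr (Or.inr (Or.inr ⟨h, rfl⟩))⟩

theorem FaceSeq.Partner.sameCorner {S : FaceSeq G} {t : ℕ} {z w : FaceFlag G}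
    (h : S.Partner E t z w) : ∃ i, 1 ≤ i ∧ i ≤ t ∧
      ((E.SameCorner z (S.left i) ∧ E.SameCorner w (S.right i)) ∨
        (E.SameCorner z (S.right i) ∧ E.SameCorner w (S.left i))) := by
  obtain ⟨i, h1, h2, ⟨rfl, rfl⟩ | ⟨rfl, rfl⟩ | ⟨rfl, rfl⟩ | ⟨rfl, rfl⟩⟩ := h
  · exact ⟨i, h1, h2, Or.inl ⟨Or.inl rfl, Or.inl rfl⟩⟩
  · exact ⟨i, h1, h2, Or.inr ⟨Or.inl rfl, Or.inl rfl⟩⟩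
  · exact ⟨i, h1, h2, Or.inl ⟨Or.inr (by simp), Or.inr (by simp)⟩⟩
  · exact ⟨i, h1, h2, Or.inr ⟨Or.inr (by simp), Or.inr (by simp)⟩⟩

theorem CellEmbedding.SameCorner.face_eq {x y : FaceFlag G} (h : E.SameCorner x y) :
    E.face y = E.face x := by
  rcases h with rfl | rfl
  · rfl
  · exact E.face_back _

/-- The length of every face is four or six. -/
def CellEmbedding.FourOrSix (E : CellEmbedding G) : Prop :=
  ∀ x, E.walkLength x = 4 ∨ E.walkLength x = 6

theorem CellEmbedding.exists_walk_back {l r : FaceFlag G} (h : ∃ t, E.step^[t] l = r) :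
    ∃ t, E.step^[t] r = l := by
  obtain ⟨t, rfl⟩ := h
  obtain ⟨N, hN, hp⟩ := E.exists_iterate_eq_id
  refine ⟨(N - 1) * t, ?_⟩
  rw [← Function.iterate_add_apply]
  have h1 : (N - 1) * t + t = N * t := by
    obtain ⟨M, rfl⟩ : ∃ M, N = M + 1 := ⟨N - 1, by omega⟩
    simp; ring
  rw [h1, Function.iterate_mul E.step N t, (funext hp : E.step^[N] = id), Function.iterate_id, id]

namespace Attachment

variable {S : FaceSeq G} {m : ℕ} {u₀ u₁ : W} {cross : Bool} {extra₀ extra₁ : List W}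
  (h : Attachment T S X m u₀ u₁ cross extra₀ extra₁)

include h

theorem left_mem {i : ℕ} (hi : 1 ≤ i) (hi' : i ≤ (m + 1) / 2) : (S.left i).fst ∈ X := by
  have := h.two_le
  rw [h.seq.left_fst i hi hi']
  refine h.vertex_mem ?_ ?_ <;> unfold pairLeft <;> split_ifs <;> omega

theorem right_mem {i : ℕ} (hi : 1 ≤ i) (hi' : i ≤ (m + 1) / 2) : (S.right i).fst ∈ X := by
  have := h.two_le
  rw [h.seq.right_fst i hi hi']
  refine h.vertex_mem ?_ ?_ <;> unfold pairRight <;> split_ifs with h1 h2 <;> try omega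

theorem left_ne_right {i : ℕ} (hi : 1 ≤ i) (hi' : i ≤ (m + 1) / 2) :
    (S.left i).fst ≠ (S.right i).fst := by
  have := h.two_le
  rw [h.seq.left_fst i hi hi', h.seq.right_fst i hi hi']
  intro he
  have hodd : ∀ j, Odd m ∧ j → m % 2 = 1 ∧ j := fun j h => ⟨Nat.odd_iff.1 h.1, h.2⟩
  have := h.vertex_inj (i := pairLeft m i) (j := pairRight m i) ?_ ?_ ?_ ?_ he
  · revert this
    unfold pairLeft pairRight
    split_ifs with h1 h2 h3
    · omega
    · have := hodd _ h2; omega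
    · have := hodd _ h2; omega
    · omega
  · unfold pairLeft
    split_ifs with h1 h2 h3
    · omega
    · have := hodd _ h2; omega
    · have := hodd _ h2; omega
    · omega
  · unfold pairLeft
    split_ifs with h1 h2 h3
    · omega
    · have := hodd _ h2; omega
    · have := hodd _ h2; omega
    · omega
  · unfold pairRight
    split_ifs with h1 h2
    · omega
    · have := hodd _ h2; omega
    · omega
  · unfold pairRight
    split_ifs with h1 h2
    · omega
    · have := hodd _ h2; omega
    · omega

theorem partner_mem {t : ℕ} (ht : t ≤ (m + 1) / 2) {z w : FaceFlag G} (hzw : S.Partner E t z w) :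
    z.fst ∈ X ∧ w.fst ∈ X := by
  obtain ⟨i, h1, h2, h3⟩ := hzw
  have hl := h.left_mem h1 (h2.trans ht)
  have hr := h.right_mem h1 (h2.trans ht)
  rcases h3 with ⟨rfl, rfl⟩ | ⟨rfl, rfl⟩ | ⟨rfl, rfl⟩ | ⟨rfl, rfl⟩ <;> simp [hl, hr]

/-- Two pairs of the same part lie in different faces, since in a face of length at most six a pair can
be parallel only to a pair of the other part. -/
theorem index_eq_of_face (h46 : E.FourOrSix)
    (hpar : ∀ s t, 1 ≤ s → s < t → t ≤ (m + 1) / 2 → E.face (S.left s) = E.face (S.left t) →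
      E.Parallel (S.left s) (S.right s) (S.left t) (S.right t))
    {s t : ℕ} (hs : 1 ≤ s) (hs' : s ≤ (m + 1) / 2) (ht : 1 ≤ t) (ht' : t ≤ (m + 1) / 2)
    (hf : E.face (S.left s) = E.face (S.left t)) : s = t := by
  have key : ∀ s t, 1 ≤ s → s < t → t ≤ (m + 1) / 2 → E.face (S.left s) ≠ E.face (S.left t) := by
    intro s t h1 h2 h3 hf
    have hx := h.left_mem h1 (by omega)
    have hx' := h.right_mem h1 (by omega)
    have hy := h.left_mem (i := t) (by omega) h3
    have hy' := h.right_mem (i := t) (by omega) h3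
    have := ((hpar s t h1 h2 h3 hf).mem_iff E h.part
      (by rcases h46 (S.left s) with h | h <;> omega) (by simp [hx, hx']) (by simp [hy, hy'])).2.1
    exact this.1 hy hx
  rcases Nat.lt_trichotomy s t with h1 | h1 | h1
  · exact absurd hf (key s t hs h1 ht')
  · exact h1
  · exact absurd hf.symm (key t s ht h1 hs')

theorem face_right {i : ℕ} (hi : 1 ≤ i) (hi' : i ≤ (m + 1) / 2) :
    E.face (S.right i) = E.face (S.left i) := by
  obtain ⟨t, ht⟩ := h.seq.same_walk i hi hi'
  rw [← ht, E.face_iterate]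

theorem partner_face {t : ℕ} (ht : t ≤ (m + 1) / 2) {z w : FaceFlag G} (hzw : S.Partner E t z w) :
    ∃ i, 1 ≤ i ∧ i ≤ t ∧ E.face z = E.face (S.left i) ∧
      ((E.SameCorner z (S.left i) ∧ E.SameCorner w (S.right i)) ∨
        (E.SameCorner z (S.right i) ∧ E.SameCorner w (S.left i))) := by
  obtain ⟨i, h1, h2, h3⟩ := hzw.sameCorner
  refine ⟨i, h1, h2, ?_, h3⟩
  rcases h3 with ⟨h3, -⟩ | ⟨h3, -⟩
  · rw [h3.face_eq]
  · rw [← h3.face_eq, h.face_right h1 (h2.trans ht)]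

theorem partner_walk {t : ℕ} (ht : t ≤ (m + 1) / 2) {z w : FaceFlag G} (hzw : S.Partner E t z w) :
    ∃ t, E.step^[t] z = w := by
  obtain ⟨i, h1, h2, h3⟩ := hzw
  have h4 := h.seq.same_walk i h1 (h2.trans ht)
  have h5 := E.exists_walk_back h4
  have hb : ∀ {l r : FaceFlag G}, (∃ t, E.step^[t] r = l) →
      ∃ t, E.step^[t] (E.back l) = E.back r := by
    rintro l r ⟨t, rfl⟩
    exact ⟨t, E.iterate_back_iterate r t⟩
  rcases h3 with ⟨rfl, rfl⟩ | ⟨rfl, rfl⟩ | ⟨rfl, rfl⟩ | ⟨rfl, rfl⟩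
  · exact h4
  · exact h5
  · exact hb h5
  · exact hb h4

theorem partner_pass {t : ℕ} (ht : t ≤ (m + 1) / 2)
    (hlast : t = (m + 1) / 2 → cross = false ∧ extra₀ = [] ∧ extra₁ = [])
    {z w : FaceFlag G} (hzw : S.Partner E t z w) :
    E'.step^[3] (T.lift (E.pre z)) = T.lift w := by
  obtain ⟨i, h1, h2, h3⟩ := hzw
  obtain ⟨p1, p2, p3, p4⟩ := h.pass h1 (h2.trans ht) fun hi => hlast (by omega)
  rcases h3 with ⟨rfl, rfl⟩ | ⟨rfl, rfl⟩ | ⟨rfl, rfl⟩ | ⟨rfl, rfl⟩ <;> assumption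

theorem partner_ne {t : ℕ} (ht : t ≤ (m + 1) / 2) {z w : FaceFlag G} (hzw : S.Partner E t z w) :
    z ≠ w := by
  obtain ⟨i, h1, h2, h3⟩ := hzw
  have h4 := h.left_ne_right h1 (h2.trans ht)
  intro he
  have h5 := congrArg FaceFlag.fst he
  rcases h3 with ⟨rfl, rfl⟩ | ⟨rfl, rfl⟩ | ⟨rfl, rfl⟩ | ⟨rfl, rfl⟩
  · exact h4 h5
  · exact h4 h5.symm
  · exact h4 (by simpa using h5)
  · exact h4 (by simpa using h5.symm)

end Attachment

theorem FaceSeq.Partner.symm {S : FaceSeq G} {t : ℕ} {z w : FaceFlag G}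
    (h : S.Partner E t z w) : S.Partner E t w z := by
  obtain ⟨i, h1, h2, h3⟩ := h
  refine ⟨i, h1, h2, ?_⟩
  tauto

theorem sameCorners_of_partner {S : FaceSeq G} {i : ℕ} {z w z' w' : FaceFlag G}
    (h : (E.SameCorner z (S.left i) ∧ E.SameCorner w (S.right i)) ∨
        (E.SameCorner z (S.right i) ∧ E.SameCorner w (S.left i)))
    (h' : (E.SameCorner z' (S.left i) ∧ E.SameCorner w' (S.right i)) ∨
        (E.SameCorner z' (S.right i) ∧ E.SameCorner w' (S.left i))) :
    (E.SameCorner z z' ∧ E.SameCorner w w') ∨ (E.SameCorner z w' ∧ E.SameCorner w z') := by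
  rcases h with ⟨h1, h2⟩ | ⟨h1, h2⟩ <;> rcases h' with ⟨h3, h4⟩ | ⟨h3, h4⟩
  · exact Or.inl ⟨h1.trans h3.symm, h2.trans h4.symm⟩
  · exact Or.inr ⟨h1.trans h4.symm, h2.trans h3.symm⟩
  · exact Or.inr ⟨h1.trans h4.symm, h2.trans h3.symm⟩
  · exact Or.inl ⟨h1.trans h3.symm, h2.trans h4.symm⟩

/-- All faces of `E'` are quadrilaterals, except perhaps for one hexagon. -/
def CellEmbedding.AlmostFour (E' : CellEmbedding H) : Prop :=
  (∀ y, E'.step^[4] y = y) ∨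
    ∃ y₀, E'.step^[6] y₀ = y₀ ∧ ∀ y, E'.step^[4] y = y ∨ E'.face y = E'.face y₀

/-- Quadrilaterals of `E` give rise to quadrilaterals of `E'`, and a hexagon of `E` to at most one
hexagon besides quadrilaterals. -/
theorem Tracing.almostFour (hE : E.IsQuadrilateral ∨ E.IsNearQuadrilateral)
    (hS : ∀ x, E.walkLength x = 4 → T.Short x)
    (hF : ∀ x, E.walkLength x = 6 → T.FewLong (E.face x)) (hcov : ∀ y, T.Covered y) :
    E'.AlmostFour := by
  have key : ∀ y, E'.step^[4] y = y ∨ ∃ x, ¬ T.Short x ∧ E'.face y = E'.face (T.lift x) := by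
    intro y
    rcases hcov y with h | ⟨x, hx⟩
    · exact Or.inl h
    · by_cases hs : T.Short x
      · exact Or.inl (E'.iterate_eq_of_face_eq hx hs)
      · exact Or.inr ⟨x, hs, hx⟩
  rcases hE with hE | ⟨x₀, h6, hE⟩
  · left
    intro y
    rcases key y with h | ⟨x, hx, -⟩
    · exact h
    · exact absurd (hS x (hE x)) hx
  · right
    obtain ⟨y₀, hy₀, h⟩ := hF x₀ h6
    refine ⟨y₀, hy₀, fun y => ?_⟩
    rcases key y with h' | ⟨x, hx, hy⟩
    · exact Or.inl h'
    · by_cases hx0 : E.face x = E.face x₀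
      · exact Or.inr (hy.trans ((h x hx0).resolve_left hx))
      · exact absurd (hS x (hE x hx0)) hx

theorem CellEmbedding.fourOrSix (hE : E.IsQuadrilateral ∨ E.IsNearQuadrilateral) :
    E.FourOrSix := by
  intro x
  rcases hE with hE | ⟨x₀, h6, hE⟩
  · exact Or.inl (hE x)
  · by_cases hx : E.face x = E.face x₀
    · exact Or.inr (by rw [E.walkLength_eq_of_face_eq hx, h6])
    · exact Or.inl (hE x hx)

/-- The faces after attaching two vertices to one part. -/
theorem Attachment.almostFour {S : FaceSeq G} {m : ℕ} {u₀ u₁ : W}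
    (h : Attachment T S X m u₀ u₁ false [] []) (hE : E.IsQuadrilateral ∨ E.IsNearQuadrilateral)
    (hpar : ∀ s t, 1 ≤ s → s < t → t ≤ (m + 1) / 2 → E.face (S.left s) = E.face (S.left t) →
      E.Parallel (S.left s) (S.right s) (S.left t) (S.right t))
    (hold : ∀ z : FaceFlag G, z.fst ∉ X → T.Kept z) (hcov : ∀ y, T.Covered y) :
    E'.AlmostFour := by
  have h46 := CellEmbedding.fourOrSix hE
  have hP : T.Pairing X (S.Partner E ((m + 1) / 2)) :=
    { symm := FaceSeq.Partner.symm
      walk := h.partner_walk le_rfl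
      ne := h.partner_ne le_rfl
      mem_iff := fun hzw => by
        have := h.partner_mem le_rfl hzw
        simp [this]
      pass := h.partner_pass le_rfl fun _ => ⟨rfl, rfl, rfl⟩
      parallel := by
        intro z w z' w' hzw hzw' hf
        obtain ⟨i, h1, h2, h3, h4⟩ := h.partner_face le_rfl hzw
        obtain ⟨j, h1', h2', h3', h4'⟩ := h.partner_face le_rfl hzw'
        have : i = j := h.index_eq_of_face h46 hpar h1 h2 h1' h2' (by rw [← h3, ← h3', hf])
        subst this
        exact (sameCorners_of_partner h4 h4').imp_right Or.inl }
  have hK : ∀ z, (∃ w, S.Partner E ((m + 1) / 2) z w) ∨ T.Kept z := by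
    intro z
    by_cases hz : z.fst ∈ X
    · by_cases hm : S.Marked E ((m + 1) / 2) z
      · exact Or.inl hm.exists_partner
      · exact Or.inr (h.kept hz hm)
    · exact Or.inr (hold z hz)
  exact T.almostFour hE (fun x hx => hP.short_of_quadrilateral h.part hx fun z _ => hK z)
    (fun x hx => hP.fewLong_of_hexagon h.part hx fun z _ => hK z) hcov

/-- The faces after attaching two vertices to each part, the four new vertices lying on the
boundary of a crosscap in the common last face. -/
theorem Attachment.almostFour_of_two {SA SB : FaceSeq G} {m n : ℕ} {u₀ u₁ v₀ v₁ : W}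
    (hA : Attachment T SA X m u₀ u₁ true [v₁] [v₀])
    (hB : Attachment T SB Xᶜ n v₀ v₁ true [u₁] [u₀])
    (t₁ : E'.twist s(v₀, u₁) = true) (t₂ : E'.twist s(v₁, u₀) = false)
    (hE : E.IsQuadrilateral ∨ E.IsNearQuadrilateral)
    (central : E.CyclicOrder (SA.left ((m + 1) / 2)) (SB.left ((n + 1) / 2))
      (SA.right ((m + 1) / 2)) (SB.right ((n + 1) / 2)))
    (parA : ∀ s t, 1 ≤ s → s < t → t ≤ (m + 1) / 2 → E.face (SA.left s) = E.face (SA.left t) →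
      E.Parallel (SA.left s) (SA.right s) (SA.left t) (SA.right t))
    (parB : ∀ s t, 1 ≤ s → s < t → t ≤ (n + 1) / 2 → E.face (SB.left s) = E.face (SB.left t) →
      E.Parallel (SB.left s) (SB.right s) (SB.left t) (SB.right t))
    (parAB : ∀ i j, 1 ≤ i → i < (m + 1) / 2 → 1 ≤ j → j ≤ (n + 1) / 2 →
      E.face (SA.left i) = E.face (SB.left j) →
      E.Parallel (SA.left i) (SA.right i) (SB.left j) (SB.right j))
    (hcov : ∀ y, T.Covered y) : E'.AlmostFour := by
  have hm := hA.two_le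
  have hn := hB.two_le
  have h46 := CellEmbedding.fourOrSix hE
  set M := (m + 1) / 2 with hM
  set N := (n + 1) / 2 with hN
  have hM1 : M - 1 ≤ M := Nat.sub_le _ _
  have hN1 : N - 1 ≤ N := Nat.sub_le _ _
  have opp : ∀ {i j : ℕ}, 1 ≤ i → i ≤ M - 1 → 1 ≤ j → j ≤ N - 1 →
      E.face (SA.left i) = E.face (SB.left j) →
      E.Opposite (SA.left i) (SA.right i) (SB.left j) (SB.right j) := by
    intro i j hi hi' hj hj' hf
    have a1 := hA.left_mem hi (by omega)
    have a2 := hA.right_mem hi (by omega)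
    have a3 := hB.left_mem hj (by omega)
    have a4 := hB.right_mem hj (by omega)
    simp only [Set.mem_compl_iff] at a3 a4
    exact (parAB i j hi (by omega) hj (by omega) hf).opposite hA.part
      (by rcases h46 (SA.left i) with h | h <;> omega) (by simp [a1, a2]) (by simp [a3, a4])
  have oppU : ∀ {z w z' w' l r l' r' : FaceFlag G}, E.Opposite l r l' r' →
      (E.SameCorner z l ∧ E.SameCorner w r) ∨ (E.SameCorner z r ∧ E.SameCorner w l) →
      (E.SameCorner z' l' ∧ E.SameCorner w' r') ∨ (E.SameCorner z' r' ∧ E.SameCorner w' l') →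
      E.Opposite z w z' w' := by
    rintro z w z' w' l r l' r' ho (⟨h1, h2⟩ | ⟨h1, h2⟩) (⟨h3, h4⟩ | ⟨h3, h4⟩)
    · exact ho.congr h1 h2 h3 h4
    · exact ho.swap_right.congr h1 h2 h3 h4
    · exact ho.swap_left.congr h1 h2 h3 h4
    · exact ho.swap_left.swap_right.congr h1 h2 h3 h4
  have hP : T.Pairing X (fun z w => SA.Partner E (M - 1) z w ∨ SB.Partner E (N - 1) z w) :=
    { symm := fun h => h.imp FaceSeq.Partner.symm FaceSeq.Partner.symm
      walk := by
        rintro z w (h | h)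
        · exact hA.partner_walk hM1 h
        · exact hB.partner_walk hN1 h
      ne := by
        rintro z w (h | h)
        · exact hA.partner_ne hM1 h
        · exact hB.partner_ne hN1 h
      mem_iff := by
        rintro z w (h | h)
        · have := hA.partner_mem hM1 h
          simp [this]
        · have := hB.partner_mem hN1 h
          simp only [Set.mem_compl_iff] at this
          simp [this]
      pass := by
        rintro z w (h | h)
        · exact hA.partner_pass hM1 (fun h => by omega) h
        · exact hB.partner_pass hN1 (fun h => by omega) h
      parallel := by
        rintro z w z' w' (hz | hz) (hz' | hz') hf
        · obtain ⟨i, h1, h2, h3, h4⟩ := hA.partner_face hM1 hz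
          obtain ⟨j, h1', h2', h3', h4'⟩ := hA.partner_face hM1 hz'
          have : i = j := hA.index_eq_of_face h46 parA h1 (by omega) h1' (by omega)
            (by rw [← h3, ← h3', hf])
          subst this
          exact (sameCorners_of_partner h4 h4').imp_right Or.inl
        · obtain ⟨i, h1, h2, h3, h4⟩ := hA.partner_face hM1 hz
          obtain ⟨j, h1', h2', h3', h4'⟩ := hB.partner_face hN1 hz'
          exact Or.inr (Or.inr (oppU (opp h1 h2 h1' h2' (by rw [← h3, ← h3', hf])) h4 h4').parallel)
        · obtain ⟨i, h1, h2, h3, h4⟩ := hB.partner_face hN1 hz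
          obtain ⟨j, h1', h2', h3', h4'⟩ := hA.partner_face hM1 hz'
          exact Or.inr (Or.inr (oppU (opp h1' h2' h1 h2 (by rw [← h3, ← h3', hf])).symm
            h4 h4').parallel)
        · obtain ⟨i, h1, h2, h3, h4⟩ := hB.partner_face hN1 hz
          obtain ⟨j, h1', h2', h3', h4'⟩ := hB.partner_face hN1 hz'
          have : i = j := hB.index_eq_of_face h46 parB h1 (by omega) h1' (by omega)
            (by rw [← h3, ← h3', hf])
          subst this
          exact (sameCorners_of_partner h4 h4').imp_right Or.inl }
  obtain ⟨gA1, gA2⟩ := hA.gates_left_last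
  obtain ⟨gA3, gA4⟩ := hA.gates_right_last
  obtain ⟨gB1, gB2⟩ := hB.gates_left_last
  obtain ⟨gB3, gB4⟩ := hB.gates_right_last
  have lA := hA.left_last_fst
  have rA := hA.right_last_fst
  have lB := hB.left_last_fst
  have rB := hB.right_last_fst
  rw [← hM] at gA1 gA2 gA3 gA4 lA rA
  rw [← hN] at gB1 gB2 gB3 gB4 lB rB
  obtain ⟨xA0, xA0'⟩ := hA.nx_extra false rfl
  obtain ⟨xA1, xA1'⟩ := hA.nx_extra true rfl
  obtain ⟨xB0, xB0'⟩ := hB.nx_extra false rfl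
  obtain ⟨xB1, xB1'⟩ := hB.nx_extra true rfl
  simp only [pick, Bool.false_eq_true, if_false, if_true, Bool.not_true, Bool.not_false]
    at gA1 gA2 gA3 gA4 gB1 gB2 gB3 gB4 xA0 xA0' xA1 xA1' xB0 xB0' xB1 xB1'
  have neg : ∀ {r : Bool} {a b c : W}, E'.nx r a b = c → E'.nx (!r) a c = b := by
    rintro r a b c rfl; exact E'.nx_not_nx _ _ _
  have hcut : T.Cut (SA.left M) (SB.left N) (SA.right M) (SB.right N) :=
    { order := central
      pass₁ := gB1.pass_pass (w' := u₀) (d' := true) (by rw [t₂]; rfl) gA2 (by rw [lB]; exact xB1)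
        (by rw [lA]; exact neg xA0)
      pass₂ := gA3.pass_pass (w' := v₀) (d' := true) (by rw [Sym2.eq_swap, t₁]; rfl) gB2
        (by rw [rA]; exact neg xA1') (by rw [lB]; exact neg xB0)
      pass₃ := gB3.pass_pass (w' := u₀) (d' := false) (by rw [t₂]; rfl) gA4
        (by rw [rB]; exact neg xB1') (by rw [rA]; exact xA0')
      pass₀ := gA1.pass_pass (w' := v₀) (d' := false) (by rw [Sym2.eq_swap, t₁]; rfl) gB4
        (by rw [lA]; exact xA1) (by rw [rB]; exact xB0') }
  have fB : E.face (SB.left N) = E.face (SA.left M) := by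
    obtain ⟨p, q, r, -, -, -, -, hp, -, -⟩ := central
    rw [← hp, E.face_iterate]
  have kept : ∀ z, T.Kept z ∨ (z.fst ∈ X ∧ SA.Marked E M z) ∨ (z.fst ∉ X ∧ SB.Marked E N z) := by
    intro z
    by_cases hz : z.fst ∈ X
    · by_cases hmk : SA.Marked E M z
      · exact Or.inr (Or.inl ⟨hz, hmk⟩)
      · exact Or.inl (hA.kept hz hmk)
    · by_cases hmk : SB.Marked E N z
      · exact Or.inr (Or.inr ⟨hz, hmk⟩)
      · exact Or.inl (hB.kept hz hmk)
  have markedA : ∀ {z : FaceFlag G} {i}, 1 ≤ i → i ≤ M →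
      (E.SameCorner (SA.left i) z ∨ E.SameCorner (SA.right i) z) →
      E.face z = E.face (SA.left i) := by
    rintro z i hi hi' (hz | hz)
    · exact hz.face_eq
    · rw [hz.face_eq, hA.face_right hi hi']
  have markedB : ∀ {z : FaceFlag G} {i}, 1 ≤ i → i ≤ N →
      (E.SameCorner (SB.left i) z ∨ E.SameCorner (SB.right i) z) →
      E.face z = E.face (SB.left i) := by
    rintro z i hi hi' (hz | hz)
    · exact hz.face_eq
    · rw [hz.face_eq, hB.face_right hi hi']
  -- away from the common last face, all marked corners belong to the other pairs
  have hK : ∀ z, E.face z ≠ E.face (SA.left M) →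
      (∃ w, SA.Partner E (M - 1) z w ∨ SB.Partner E (N - 1) z w) ∨ T.Kept z := by
    intro z hz
    rcases kept z with hk | ⟨-, i, h1, h2, h3⟩ | ⟨-, i, h1, h2, h3⟩
    · exact Or.inr hk
    · have hi : i ≠ M := by
        rintro rfl
        exact hz (markedA h1 h2 h3)
      obtain ⟨w, hw⟩ := FaceSeq.Marked.exists_partner ⟨i, h1, (by omega : i ≤ M - 1), h3⟩
      exact Or.inl ⟨w, Or.inl hw⟩
    · have hi : i ≠ N := by
        rintro rfl
        exact hz ((markedB h1 h2 h3).trans fB)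
      obtain ⟨w, hw⟩ := FaceSeq.Marked.exists_partner ⟨i, h1, (by omega : i ≤ N - 1), h3⟩
      exact Or.inl ⟨w, Or.inr hw⟩
  -- in the common last face, only its own four corners are marked
  have hK' : ∀ z, E.face z = E.face (SA.left M) → (E.SameCorner (SA.left M) z ∨
      E.SameCorner (SB.left N) z ∨ E.SameCorner (SA.right M) z ∨ E.SameCorner (SB.right N) z) ∨
      T.Kept z := by
    intro z hz
    rcases kept z with hk | ⟨-, i, h1, h2, h3⟩ | ⟨-, i, h1, h2, h3⟩
    · exact Or.inr hk
    · left
      have : i = M := hA.index_eq_of_face h46 parA h1 h2 (by omega) le_rfl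
        (by rw [← markedA h1 h2 h3, hz])
      subst this
      tauto
    · left
      have : i = N := hB.index_eq_of_face h46 parB h1 h2 (by omega) le_rfl
        (by rw [← markedB h1 h2 h3, hz, fB])
      subst this
      tauto
  have a1 := hA.left_mem (i := M) (by omega) le_rfl
  have a2 := hA.right_mem (i := M) (by omega) le_rfl
  have a3 := hB.left_mem (i := N) (by omega) le_rfl
  have a4 := hB.right_mem (i := N) (by omega) le_rfl
  simp only [Set.mem_compl_iff] at a3 a4
  refine T.almostFour hE (fun x hx => ?_) (fun x hx => ?_) hcov
  · by_cases hf : E.face x = E.face (SA.left M)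
    · exact hcut.short_of_quadrilateral hA.part (by simp [a1, a3]) (by simp [a1, a2])
        (by simp [a1, a4]) (by rw [← E.walkLength_eq_of_face_eq hf, hx]) hf
    · exact hP.short_of_quadrilateral hA.part hx fun z hz => hK z (by rwa [hz])
  · by_cases hf : E.face x = E.face (SA.left M)
    · rw [hf]
      exact hcut.fewLong_of_hexagon hA.part (by simp [a1, a3]) (by simp [a1, a2])
        (by simp [a1, a4]) (by rw [← E.walkLength_eq_of_face_eq hf, hx]) hK'
    · exact hP.fewLong_of_hexagon hA.part hx fun z hz => hK z (by rwa [hz])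

theorem Tracing.Covered.of_face {y z : FaceFlag H} (h : T.Covered z)
    (hf : E'.face y = E'.face z) : T.Covered y := by
  rcases h with h | ⟨x, hx⟩
  · exact Or.inl (E'.iterate_eq_of_face_eq hf h)
  · exact Or.inr ⟨x, hf.trans hx⟩

/-- As every walk meets an old vertex, only the new edges at old vertices have to be checked. -/
theorem Tracing.covered_of (hold : ∀ v w, H.Adj (T.ι v) (T.ι w) → G.Adj v w)
    (hnew : ∀ y : FaceFlag H, (∃ v, y.fst = T.ι v) → (∃ w, y.snd = T.ι w) ∨ T.Covered y)
    (hstep : ∀ y : FaceFlag H, ∃ i v, (E'.step^[i] y).fst = T.ι v) (y : FaceFlag H) :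
    T.Covered y := by
  obtain ⟨i, hi⟩ := hstep y
  refine Tracing.Covered.of_face ?_ (E'.face_iterate y i).symm
  rcases hnew _ hi with ⟨w, hw⟩ | h
  · obtain ⟨v, hv⟩ := hi
    have hadj : G.Adj v w := hold v w (by rw [← hv, ← hw]; exact (E'.step^[i] y).adj)
    refine Or.inr ⟨⟨v, w, hadj, (E'.step^[i] y).rev ^^ T.flip v w⟩, ?_⟩
    congr 1
    refine FaceFlag.eq_of hv hw ?_
    simp [Tracing.lift]
  · exact h

end Extended

/-! ### Genus and faces of the extended embeddings -/

section Tracing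

variable {V W : Type*} [DecidableEq V] [DecidableEq W] {G : SimpleGraph V} {H : SimpleGraph W}
  {E : CellEmbedding G} {E' : CellEmbedding H} {X : Set V}

open Classical in
/-- Old edges in `CA` pass a crosscap near their end in `X`, those in `CB` a crosscap near their
other end. -/
noncomputable def Tracing.ofCrosscaps (hX : IsPart G X) (CA CB : Set (Sym2 V)) (ι : V → W)
    (hadj : ∀ v w, H.Adj (ι v) (ι w) ↔ G.Adj v w)
    (htw : ∀ v w, G.Adj v w → (E'.twist s(ι v, ι w) ≠ E.twist s(v, w) ↔
      Xor (s(v, w) ∈ CA) (s(v, w) ∈ CB))) : Tracing E E' where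
  ι := ι
  adj h := (hadj _ _).2 h
  flip v w := decide (if v ∈ X then s(v, w) ∈ CA else s(v, w) ∈ CB)
  twist {v w} h := by
    have h1 := htw v w h
    have h2 := hX v w h
    rw [Sym2.eq_swap (a := w) (b := v)]
    unfold Xor at h1
    by_cases hv : v ∈ X
    · have hw : w ∉ X := h2.1 hv
      by_cases ha : s(v, w) ∈ CA <;> by_cases hb : s(v, w) ∈ CB <;>
        simp only [hv, hw, ha, hb, if_true, if_false, decide_true, decide_false] at h1 ⊢ <;>
        revert h1 <;> cases E'.twist s(ι v, ι w) <;> cases E.twist s(v, w) <;> simp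
    · have hw : w ∈ X := by by_contra hw; exact hv (h2.2 hw)
      by_cases ha : s(v, w) ∈ CA <;> by_cases hb : s(v, w) ∈ CB <;>
        simp only [hv, hw, ha, hb, if_true, if_false, decide_true, decide_false] at h1 ⊢ <;>
        revert h1 <;> cases E'.twist s(ι v, ι w) <;> cases E.twist s(v, w) <;> simp

theorem Tracing.kept_of_rot_eq (T : Tracing E E') {z : FaceFlag G}
    (hrot : E'.rot (T.ι z.fst) = (E.rot z.fst).map T.ι)
    (hf : ∀ w, T.flip z.fst w = false) : T.Kept z := by
  unfold Tracing.Kept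
  rw [hf, hf, Bool.xor_false]
  refine ⟨?_, rfl⟩
  obtain ⟨l, hl⟩ := E.exists_read_eq (r := z.rev) z.adj
  have hlast : (z.snd :: l).getLast? = some (E.pre z).fst := by
    refine E.getLast_of_nx hl ?_
    rw [E.pre_fst, E.nx_nx_not]; rfl
  have hread : E'.read z.rev (T.ι z.fst) = ↑((z.snd :: l).map T.ι) := by
    rw [← Cycle.map_coe, ← hl]
    unfold CellEmbedding.read
    split_ifs
    · rw [hrot]
      induction E.rot z.fst using Quot.inductionOn
      simp
    · exact hrot
  exact E'.nx_of_ends hread (by simp) (by rw [List.getLast?_map, hlast]; rfl)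

/-- The two marked corners at a vertex shared by two pairs are different. -/
theorem FaceSeq.IsFaceSeq.ne_back [Finite V] {S : FaceSeq G} {m : ℕ} (hS : S.IsFaceSeq E m X)
    (hX : IsPart G X) (hm : 2 ≤ m) (h46 : E.FourOrSix)
    (hpar : ∀ s t, 1 ≤ s → s < t → t ≤ (m + 1) / 2 → E.face (S.left s) = E.face (S.left t) →
      E.Parallel (S.left s) (S.right s) (S.left t) (S.right t)) (hodd : Odd m) :
    S.left ((m - 1) / 2) ≠ E.back (S.shared m) := by
  have h1 := Nat.odd_iff.1 hodd
  intro he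
  have hmem : ∀ i, 1 ≤ i → i ≤ m → S.vertex i ∈ X := fun i hi hi' => hS.names.mapsTo ⟨hi, hi'⟩
  have hl : ∀ i, 1 ≤ i → i ≤ (m + 1) / 2 → (S.left i).fst ∈ X := by
    intro i hi hi'
    rw [hS.left_fst i hi hi']
    refine hmem _ ?_ ?_ <;> unfold pairLeft <;> split_ifs <;> omega
  have hr : ∀ i, 1 ≤ i → i ≤ (m + 1) / 2 → (S.right i).fst ∈ X := by
    intro i hi hi'
    rw [hS.right_fst i hi hi']
    refine hmem _ ?_ ?_ <;> unfold pairRight <;> split_ifs <;> omega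
  have key : ∀ s t, 1 ≤ s → s < t → t ≤ (m + 1) / 2 → E.face (S.left s) ≠ E.face (S.left t) := by
    intro s t h1 h2 h3 hf
    have hx := hl s h1 (by omega)
    have hx' := hr s h1 (by omega)
    have hy := hl t (by omega) h3
    have hy' := hr t (by omega) h3
    exact ((hpar s t h1 h2 h3 hf).mem_iff E hX
      (by rcases h46 (S.left s) with h | h <;> omega) (by simp [hx, hx'])
        (by simp [hy, hy'])).2.1.1 hy hx
  unfold FaceSeq.shared at he
  split_ifs at he with h3
  · subst h3
    refine key 1 2 (by norm_num) (by norm_num) (by norm_num) ?_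
    rw [show (3 - 1) / 2 = 1 from rfl] at he
    rw [he, E.face_back]
  · have h5 : (m - 3) / 2 < (m - 1) / 2 := by omega
    refine key _ _ (by omega) h5 (by omega) ?_
    obtain ⟨t, ht⟩ := hS.same_walk ((m - 3) / 2) (by omega) (by omega)
    rw [he, E.face_back, ← ht, E.face_iterate]

/-- The faces after attaching two vertices to one part, in terms of the graphs. -/
theorem almostFour_of_attached [Finite V] [Finite W] {S : FaceSeq G} {m : ℕ} {u₀ u₁ : W}
    {ι : V → W} (hX : IsPart G X) (hm : 2 ≤ m)
    (hE : E.IsQuadrilateral ∨ E.IsNearQuadrilateral) (hS : S.IsFaceSeq E m X)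
    (hpar : ∀ s t, 1 ≤ s → s < t → t ≤ (m + 1) / 2 → E.face (S.left s) = E.face (S.left t) →
      E.Parallel (S.left s) (S.right s) (S.left t) (S.right t))
    (hadj : ∀ v w, H.Adj (ι v) (ι w) ↔ G.Adj v w)
    (hW : ∀ w, (∃ v, w = ι v) ∨ w = u₀ ∨ w = u₁)
    (hnew : ∀ v w, w = u₀ ∨ w = u₁ → H.Adj (ι v) w → v ∈ X)
    (huu : ∀ w w', w = u₀ ∨ w = u₁ → w' = u₀ ∨ w' = u₁ → ¬ H.Adj w w')
    (hatt : Attached E E' ι S m u₀ u₁ false [] [])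
    (hrot : ∀ v ∉ X, E'.rot (ι v) = (E.rot v).map ι)
    (htw : ∀ v w, G.Adj v w → (E'.twist s(ι v, ι w) ≠ E.twist s(v, w) ↔
      s(v, w) ∈ crosscapEdges E S m)) : E'.AlmostFour := by
  classical
  let T : Tracing E E' := Tracing.ofCrosscaps hX (crosscapEdges E S m) ∅ ι hadj
    (fun v w h => by rw [htw v w h]; unfold Xor; simp)
  have hA : Attachment T S X m u₀ u₁ false [] [] :=
    { two_le := hm
      part := hX
      seq := hS
      att := hatt
      flip_iff := fun v hv p => by simp [T, Tracing.ofCrosscaps, hv]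
      ne_back := hS.ne_back hX hm (CellEmbedding.fourOrSix hE) hpar }
  refine hA.almostFour hE hpar ?_ (T.covered_of (fun v w => (hadj v w).1) ?_ ?_)
  · intro z hz
    exact T.kept_of_rot_eq (hrot _ hz) fun w => by simp [T, Tracing.ofCrosscaps, hz]
  · rintro y ⟨v, hv⟩
    rcases hW y.snd with h | h
    · exact Or.inl h
    · exact Or.inr (hA.covered (hnew v y.snd h (by have := y.adj; rwa [hv] at this)) hv h)
  · intro y
    rcases hW y.fst with ⟨v, h⟩ | h
    · exact ⟨0, v, h⟩
    · rcases hW y.snd with ⟨v, h'⟩ | h'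
      · exact ⟨1, v, by rw [Function.iterate_one, E'.step_fst]; exact h'⟩
      · exact absurd y.adj (huu _ _ h h')

/-- The faces after attaching two vertices to each part, in terms of the graphs. -/
theorem almostFour_of_attached_two [Finite V] [Finite W] {SA SB : FaceSeq G} {m n : ℕ}
    {u₀ u₁ v₀ v₁ : W} {ι : V → W} (hX : IsPart G X) (hm : 2 ≤ m) (hn : 2 ≤ n)
    (hE : E.IsQuadrilateral ∨ E.IsNearQuadrilateral) (hSA : SA.IsFaceSeq E m X)
    (hSB : SB.IsFaceSeq E n Xᶜ)
    (central : E.CyclicOrder (SA.left ((m + 1) / 2)) (SB.left ((n + 1) / 2))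
      (SA.right ((m + 1) / 2)) (SB.right ((n + 1) / 2)))
    (parA : ∀ s t, 1 ≤ s → s < t → t ≤ (m + 1) / 2 → E.face (SA.left s) = E.face (SA.left t) →
      E.Parallel (SA.left s) (SA.right s) (SA.left t) (SA.right t))
    (parB : ∀ s t, 1 ≤ s → s < t → t ≤ (n + 1) / 2 → E.face (SB.left s) = E.face (SB.left t) →
      E.Parallel (SB.left s) (SB.right s) (SB.left t) (SB.right t))
    (parAB : ∀ i j, 1 ≤ i → i < (m + 1) / 2 → 1 ≤ j → j ≤ (n + 1) / 2 →
      E.face (SA.left i) = E.face (SB.left j) →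
      E.Parallel (SA.left i) (SA.right i) (SB.left j) (SB.right j))
    (hadj : ∀ v w, H.Adj (ι v) (ι w) ↔ G.Adj v w)
    (hW : ∀ w, (∃ v, w = ι v) ∨ (w = u₀ ∨ w = u₁) ∨ (w = v₀ ∨ w = v₁))
    (hu : ∀ v w, w = u₀ ∨ w = u₁ → H.Adj (ι v) w → v ∈ X)
    (hv : ∀ v w, w = v₀ ∨ w = v₁ → H.Adj (ι v) w → v ∉ X)
    (huv : ∀ w w', w = u₀ ∨ w = u₁ ∨ w = v₀ ∨ w = v₁ → w' = u₀ ∨ w' = u₁ ∨ w' = v₀ ∨ w' = v₁ →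
      H.Adj w w' → s(w, w') = s(v₀, u₁) ∨ s(w, w') = s(v₁, u₀))
    (hA : Attached E E' ι SA m u₀ u₁ true [v₁] [v₀])
    (hB : Attached E E' ι SB n v₀ v₁ true [u₁] [u₀])
    (htw : ∀ v w, G.Adj v w → (E'.twist s(ι v, ι w) ≠ E.twist s(v, w) ↔
      Xor (s(v, w) ∈ crosscapEdges E SA m) (s(v, w) ∈ crosscapEdges E SB n)))
    (t₁ : E'.twist s(v₀, u₁) = true) (t₂ : E'.twist s(v₁, u₀) = false) : E'.AlmostFour := by
  classical
  let T : Tracing E E' := Tracing.ofCrosscaps hX (crosscapEdges E SA m) (crosscapEdges E SB n) ι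
    hadj htw
  have hA' : Attachment T SA X m u₀ u₁ true [v₁] [v₀] :=
    { two_le := hm
      part := hX
      seq := hSA
      att := hA
      flip_iff := fun v hv p => by simp [T, Tracing.ofCrosscaps, hv]
      ne_back := hSA.ne_back hX hm (CellEmbedding.fourOrSix hE) parA }
  have hB' : Attachment T SB Xᶜ n v₀ v₁ true [u₁] [u₀] :=
    { two_le := hn
      part := hX.compl
      seq := hSB
      att := hB
      flip_iff := fun v hv p => by
        rw [Set.mem_compl_iff] at hv
        simp [T, Tracing.ofCrosscaps, hv]
      ne_back := hSB.ne_back hX.compl hn (CellEmbedding.fourOrSix hE) parB }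
  refine hA'.almostFour_of_two hB' t₁ t₂ hE central parA parB parAB
    (T.covered_of (fun v w => (hadj v w).1) ?_ ?_)
  · rintro y ⟨v, h1⟩
    have h2 := y.adj
    rw [h1] at h2
    rcases hW y.snd with h | h | h
    · exact Or.inl h
    · exact Or.inr (hA'.covered (hu v y.snd h h2) h1 h)
    · exact Or.inr (hB'.covered (hv v y.snd h h2) h1 h)
  · -- from an edge between two new vertices, the walk goes to an old vertex after two steps
    have key : ∀ (S : FaceSeq G) (Y : Set V) (k : ℕ) (w₀ w₁ x : W) (e₀ e₁ : List W) (c : Bool),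
        Attachment T S Y k w₀ w₁ true e₀ e₁ →
        ((if c = true then e₁ else e₀) = [x]) → ∀ r, ∃ v, E'.nx r (pick w₀ w₁ c) x = T.ι v := by
      intro S Y k w₀ w₁ x e₀ e₁ c h he r
      have := h.nx_extra c he
      rcases Bool.eq_or_eq_not r c with rfl | rfl
      · exact ⟨_, this.2⟩
      · refine ⟨S.vertex (k - 1), ?_⟩
        rw [← this.1, E'.nx_not_nx]
    intro y
    rcases hW y.fst with ⟨v, h⟩ | h
    · exact ⟨0, v, h⟩
    rcases hW y.snd with ⟨v, h'⟩ | h'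
    · exact ⟨1, v, by rw [Function.iterate_one, E'.step_fst]; exact h'⟩
    refine ⟨2, ?_⟩
    rw [show (2 : ℕ) = 1 + 1 from rfl, Function.iterate_add_apply]
    simp only [Function.iterate_one, E'.step_fst, E'.step_snd]
    have h2 := huv y.fst y.snd (by tauto) (by tauto) y.adj
    simp only [Sym2.eq_iff] at h2
    rcases h2 with (⟨h3, h4⟩ | ⟨h3, h4⟩) | (⟨h3, h4⟩ | ⟨h3, h4⟩) <;> rw [h3, h4]
    · exact key _ _ _ _ _ _ _ _ true hA' rfl _
    · exact key _ _ _ _ _ _ _ _ false hB' rfl _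
    · exact key _ _ _ _ _ _ _ _ false hA' rfl _
    · exact key _ _ _ _ _ _ _ _ true hB' rfl _

/-- At a vertex where edges to `u₀` and `u₁` are inserted in one corner, both have the same
signature. -/
theorem CellEmbedding.Orientable.eq_of_inserted {ι : V → W} {o : W → Bool}
    (ho : ∀ v w, H.Adj v w → E'.twist s(v, w) = (o v ^^ o w)) {x : FaceFlag G} {u₀ u₁ : W}
    {swap tw : Bool} (h : Inserted E E' ι u₀ u₁ x swap tw) (h₀ : H.Adj (ι x.fst) u₀)
    (h₁ : H.Adj (ι x.fst) u₁) : o u₀ = o u₁ := by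
  have h2 := h.2.1.trans h.2.2.symm
  rw [ho _ _ h₀, ho _ _ h₁] at h2
  exact Bool.xor_right_inj.1 h2

end Tracing

section Join

variable {m n k : ℕ}

theorem card_minusMatching_edgeSet (hkm : k ≤ m) (hkn : k ≤ n) :
    Nat.card (bipGraph (minusMatching m n k)).edgeSet + k = m * n := by
  rw [card_edgeSet_bipGraph, card_minusMatching hkm hkn]

theorem card_join_edgeSet (hkm : k ≤ m) (hkn : k ≤ n) (p q l : ℕ) (hp : l ≤ p) (hq : l ≤ q) :
    Nat.card (bipGraph (bipJoin (minusMatching m n k) (minusMatching p q l))).edgeSet + k + l =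
      (m + p) * (n + q) := by
  rw [card_edgeSet_bipGraph, card_bipJoin]
  have h1 := card_minusMatching hkm hkn
  have h2 := card_minusMatching hp hq
  simp only [Nat.card_fin]
  linarith [show (m + p) * (n + q) = m * n + p * q + m * q + p * n by ring]

theorem bipGraph_joinIncl {A B C D : Type*} (R : A → B → Prop) (S : C → D → Prop) (v w : A ⊕ B) :
    (bipGraph (bipJoin R S)).Adj (joinIncl v) (joinIncl w) ↔ (bipGraph R).Adj v w := by
  rcases v with v | v <;> rcases w with w | w <;> exact Iff.rfl

/-- The assumed Euler genus is the one of an embedding with as many faces as possible. -/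
theorem CellEmbedding.isQuadrilateral_or (hm : 2 ≤ m) (hn : 2 ≤ n) (hkm : k ≤ m) (hkn : k ≤ n)
    (E : CellEmbedding (bipGraph (minusMatching m n k)))
    (hE : E.eulerGenus = ⌈(((m : ℚ) - 2) * ((n : ℚ) - 2) - (k : ℚ)) / 2⌉) :
    (Even (m * n - k) ∧ E.IsQuadrilateral) ∨ (¬ Even (m * n - k) ∧ E.IsNearQuadrilateral) := by
  have hc := card_minusMatching_edgeSet hkm hkn
  have hV : ∀ v w : Fin m ⊕ Fin n, ∃ u, u ≠ v ∧ u ≠ w :=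
    exists_ne_ne_of_card (by simp only [Nat.card_sum, Nat.card_fin]; omega)
  have he : Nat.card (bipGraph (minusMatching m n k)).edgeSet = m * n - k := by omega
  rw [← he]
  refine E.quadrilateral_or_near (isPart_bipGraph _) hV ?_
  rw [← E.eulerGenus_eq_iff (isPart_bipGraph _) hV, hE]
  congr 2
  have hc' : (Nat.card (bipGraph (minusMatching m n k)).edgeSet : ℚ) + k = m * n := by
    exact_mod_cast hc
  rw [Nat.card_sum, Nat.card_fin, Nat.card_fin]
  push_cast
  linarith [hc']

/-- An embedding of a bipartite join, with at most one face that is not a quadrilateral and which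
is then a hexagon, has minimum Euler genus. -/
theorem CellEmbedding.AlmostFour.conclude (hm : 2 ≤ m) (hkm : k ≤ m) (hkn : k ≤ n) {p q l : ℕ}
    (hp : l ≤ p) (hq : l ≤ q) (hn : 2 ≤ n)
    {E' : CellEmbedding (bipGraph (bipJoin (minusMatching m n k) (minusMatching p q l)))}
    (h : E'.AlmostFour) {g : ℚ}
    (hg : 2 * g = (m + p - 2) * (n + q - 2) - k - l) :
    E'.eulerGenus = ⌈g⌉ ∧ E'.HasMinimumEulerGenus ∧
      (E'.IsQuadrilateral ∨ E'.IsNearQuadrilateral) := by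
  have hV : ∀ v w : (Fin m ⊕ Fin p) ⊕ (Fin n ⊕ Fin q), ∃ u, u ≠ v ∧ u ≠ w :=
    exists_ne_ne_of_card (by simp only [Nat.card_sum, Nat.card_fin]; omega)
  have hc := card_join_edgeSet hkm hkn p q l hp hq
  have hle := E'.card_edge_le_of_period (isPart_bipGraph _) hV h
  refine ⟨?_, E'.hasMinimumEulerGenus (isPart_bipGraph _) hV hle,
    (E'.quadrilateral_or_near (isPart_bipGraph _) hV hle).imp And.right And.right⟩
  rw [(E'.eulerGenus_eq_iff (isPart_bipGraph _) hV).2 hle]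
  congr 1
  have hc' : (Nat.card (bipGraph (bipJoin (minusMatching m n k)
      (minusMatching p q l))).edgeSet : ℚ) + k + l = (m + p) * (n + q) := by
    exact_mod_cast hc
  simp only [Nat.card_sum, Nat.card_fin]
  push_cast
  linarith [hc']

variable {R : Fin m → Fin n → Prop} {E : CellEmbedding (bipGraph R)}
  {FA FB : FaceSeq (bipGraph R)}

theorem mem_range_inl_compl {A B : Type*} : (Set.range Sum.inl : Set (A ⊕ B))ᶜ = Set.range Sum.inr :=
  Set.isCompl_range_inl_range_inr.compl_eq

theorem IsExtended020.almostFour {E' : CellEmbedding (bipGraph (bipJoin R (minusMatching 0 2 0)))}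
    (h : IsExtended020 E FA E') (hm : 2 ≤ m)
    (hE : E.IsQuadrilateral ∨ E.IsNearQuadrilateral) (hF : Extendible E FA FB) :
    E'.AlmostFour := by
  refine almostFour_of_attached (isPart_bipGraph R) hm hE hF.seqA hF.parallel_A
    (bipGraph_joinIncl R _) ?_ ?_ ?_ h.attachA ?_ h.twist_old
  · rintro ((a | c) | (b | d))
    · exact Or.inl ⟨Sum.inl a, rfl⟩
    · exact c.elim0
    · exact Or.inl ⟨Sum.inr b, rfl⟩
    · right; fin_cases d <;> simp
  · rintro (v | v) w (rfl | rfl) hv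
    · simp
    · simp
    · exact hv.elim
    · exact hv.elim
  · rintro w w' (rfl | rfl) (rfl | rfl) hv <;> exact hv.elim
  · rintro (v | v) hv
    · simp at hv
    · exact h.rot_old v

theorem IsExtended200.almostFour {E' : CellEmbedding (bipGraph (bipJoin R (minusMatching 2 0 0)))}
    (h : IsExtended200 E FB E') (hn : 2 ≤ n)
    (hE : E.IsQuadrilateral ∨ E.IsNearQuadrilateral) (hF : Extendible E FA FB) :
    E'.AlmostFour := by
  have hX := (isPart_bipGraph R).compl
  rw [mem_range_inl_compl] at hX
  refine almostFour_of_attached hX hn hE hF.seqB hF.parallel_B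
    (bipGraph_joinIncl R _) ?_ ?_ ?_ h.attachB ?_ h.twist_old
  · rintro ((a | c) | (b | d))
    · exact Or.inl ⟨Sum.inl a, rfl⟩
    · right; fin_cases c <;> simp
    · exact Or.inl ⟨Sum.inr b, rfl⟩
    · exact d.elim0
  · rintro (v | v) w (rfl | rfl) hv
    · exact hv.elim
    · exact hv.elim
    · simp
    · simp
  · rintro w w' (rfl | rfl) (rfl | rfl) hv <;> exact hv.elim
  · rintro (v | v) hv
    · exact h.rot_old v
    · simp at hv

theorem IsExtended222.almostFour {E' : CellEmbedding (bipGraph (bipJoin R (minusMatching 2 2 2)))}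
    (h : IsExtended222 E FA FB E') (hm : 2 ≤ m) (hn : 2 ≤ n)
    (hE : E.IsQuadrilateral ∨ E.IsNearQuadrilateral) (hF : Extendible E FA FB) :
    E'.AlmostFour := by
  have hB := hF.seqB
  rw [← mem_range_inl_compl] at hB
  refine almostFour_of_attached_two (isPart_bipGraph R) hm hn hE hF.seqA hB hF.central hF.parallel_A
    hF.parallel_B hF.parallel_A_B (bipGraph_joinIncl R _) ?_ ?_ ?_ ?_ h.attachA h.attachB
    h.twist_old h.twist_new₁ h.twist_new₂
  · rintro ((a | c) | (b | d))
    · exact Or.inl ⟨Sum.inl a, rfl⟩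
    · right; right; fin_cases c <;> simp
    · exact Or.inl ⟨Sum.inr b, rfl⟩
    · right; left; fin_cases d <;> simp
  · rintro (v | v) w (rfl | rfl) hv
    · simp
    · simp
    · exact hv.elim
    · exact hv.elim
  · rintro (v | v) w (rfl | rfl) hv
    · exact hv.elim
    · exact hv.elim
    · simp
    · simp
  · have hS : ∀ i : Fin 2, ¬ minusMatching 2 2 2 i i := fun i h => h ⟨rfl, i.2⟩
    rintro w w' (rfl | rfl | rfl | rfl) (rfl | rfl | rfl | rfl) hv
    all_goals first
      | exact hv.elim
      | exact absurd hv (hS _)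
      | simp

/-- In an oriented surface both new vertices of a part would have the same orientation, hence the two
edges between new vertices would have the same signature. -/
theorem IsExtended222.not_orientable
    {E' : CellEmbedding (bipGraph (bipJoin R (minusMatching 2 2 2)))}
    (h : IsExtended222 E FA FB E') (hm : 2 ≤ m) (hn : 2 ≤ n) (hF : Extendible E FA FB) :
    ¬ E'.Orientable := by
  rintro ⟨o, ho⟩
  have hA : ∃ a, (FA.right ((m + 1) / 2)).fst = Sum.inl a := by
    have h1 := hF.seqA.right_fst ((m + 1) / 2) (by omega) le_rfl
    rw [pairRight_last] at h1
    obtain ⟨a, ha⟩ := hF.seqA.names.mapsTo (x := m) ⟨by omega, le_rfl⟩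
    exact ⟨a, h1.trans ha.symm⟩
  have hB : ∃ b, (FB.right ((n + 1) / 2)).fst = Sum.inr b := by
    have h1 := hF.seqB.right_fst ((n + 1) / 2) (by omega) le_rfl
    rw [pairRight_last] at h1
    obtain ⟨b, hb⟩ := hF.seqB.names.mapsTo (x := n) ⟨by omega, le_rfl⟩
    exact ⟨b, h1.trans hb.symm⟩
  obtain ⟨a, ha⟩ := hA
  obtain ⟨b, hb⟩ := hB
  have h1 := CellEmbedding.Orientable.eq_of_inserted ho h.attachA.right_last
    (by rw [ha]; trivial) (by rw [ha]; trivial)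
  have h2 := CellEmbedding.Orientable.eq_of_inserted ho h.attachB.right_last
    (by rw [hb]; trivial) (by rw [hb]; trivial)
  have h3 := h.twist_new₁
  have h4 := h.twist_new₂
  have e₁ : (bipGraph (bipJoin R (minusMatching 2 2 2))).Adj (Sum.inl (Sum.inr 0))
    (Sum.inr (Sum.inr 1)) := show minusMatching 2 2 2 0 1 by simp [minusMatching]
  have e₂ : (bipGraph (bipJoin R (minusMatching 2 2 2))).Adj (Sum.inl (Sum.inr 1))
    (Sum.inr (Sum.inr 0)) := show minusMatching 2 2 2 1 0 by simp [minusMatching]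
  rw [ho _ _ e₁] at h3
  rw [ho _ _ e₂, h1, ← h2, h3] at h4
  exact Bool.noConfusion h4

end Join

/-! ### Existence of the extended embeddings -/

section Existence

variable {V W : Type*} [DecidableEq V] [DecidableEq W] {G : SimpleGraph V} {H : SimpleGraph W}

/-- A cyclic order given in either reading direction. -/
theorem exists_cycle_of_read (r : Bool) {L : List W} (hL : L.Nodup) :
    ∃ c : Cycle W, c.Nodup ∧ (∀ w, w ∈ c ↔ w ∈ L) ∧
      ∀ {H : SimpleGraph W} (E' : CellEmbedding H) v, E'.rot v = c → E'.read r v = ↑L := by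
  cases r
  · exact ⟨↑L, hL, fun w => Iff.rfl, fun E' v h => h⟩
  · refine ⟨(↑L : Cycle W).reverse, Cycle.nodup_reverse_iff.2 hL, fun w => ?_, fun E' v h => ?_⟩
    · rw [Cycle.mem_reverse_iff]; rfl
    · change (E'.rot v).reverse = _
      rw [h, Cycle.reverse_reverse]

/-- The cycle `c` is a cyclic order of the vertices `u₀`, `u₁` and the neighbours of `v`. -/
structure IsLocalRot (G : SimpleGraph V) (ι : V → W) (u₀ u₁ : W) (v : V) (c : Cycle W) : Prop where
  nodup : c.Nodup
  mem_iff : ∀ w, w ∈ c ↔ (∃ p, G.Adj v p ∧ w = ι p) ∨ w = u₀ ∨ w = u₁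

/-- In `E'`, the old vertex `v` has the rotation `c` and the signatures `t` at the new edges. -/
def LocallyGiven (E' : CellEmbedding H) (ι : V → W) (u₀ u₁ : W) (v : V) (c : Cycle W)
    (t : Bool × Bool) : Prop :=
  E'.rot (ι v) = c ∧ E'.twist s(ι v, u₀) = t.1 ∧ E'.twist s(ι v, u₁) = t.2

variable {E : CellEmbedding G} {ι : V → W} {u₀ u₁ : W}

/-- A rotation and signatures at one vertex that insert two edges at the corner `x`. -/
theorem exists_inserted (hι : Function.Injective ι) (h₀ : u₀ ∉ Set.range ι) (h₁ : u₁ ∉ Set.range ι)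
    (h₀₁ : u₀ ≠ u₁) (x : FaceFlag G) (swap tw : Bool) :
    ∃ c t, IsLocalRot G ι u₀ u₁ x.fst c ∧ ∀ {H : SimpleGraph W} (E' : CellEmbedding H),
      LocallyGiven E' ι u₀ u₁ x.fst c t → Inserted E E' ι u₀ u₁ x swap tw := by
  obtain ⟨l, hl⟩ := E.exists_read_eq (r := x.rev) x.adj
  have hnd := E.nodup_of_read hl
  have hm := fun p => E.adj_of_read hl (p := p)
  have hL : ((x.snd :: l).map ι ++ (if swap = true then [u₁, u₀] else [u₀, u₁])).Nodup := by
    rw [List.nodup_append]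
    refine ⟨hnd.map hι, by cases swap <;> simp [h₀₁, h₀₁.symm], ?_⟩
    rintro a ha b hb rfl
    obtain ⟨p, -, rfl⟩ := List.mem_map.1 ha
    have hb' : ι p = u₀ ∨ ι p = u₁ := by cases swap <;> simp at hb <;> tauto
    rcases hb' with h | h
    · exact h₀ ⟨p, h⟩
    · exact h₁ ⟨p, h⟩
  obtain ⟨c, hc, hmem, hread⟩ := exists_cycle_of_read x.rev hL
  refine ⟨c, (tw ^^ x.rev, tw ^^ x.rev), ⟨hc, fun w => ?_⟩, fun E' h =>
    ⟨⟨l, hl, hread E' _ h.1⟩, h.2⟩⟩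
  rw [hmem, List.mem_append, List.mem_map]
  refine or_congr (exists_congr fun p => ?_) (by cases swap <;> simp [or_comm])
  rw [hm, eq_comm]

theorem exists_isArc {x y : FaceFlag G} (h : y.fst = x.fst) :
    ∃ S₁ S₂ : List V, E.IsArc x y S₁ S₂ := by
  obtain ⟨l, hl⟩ := E.exists_read_eq (r := x.rev) x.adj
  obtain ⟨A, B, hAB⟩ := List.append_of_mem ((E.adj_of_read hl).2 (h ▸ y.adj))
  refine ⟨A ++ [y.snd], B, ?_, ?_, by simp⟩
  · rw [hl, hAB]; simp
  · rcases A with _ | ⟨a, A⟩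
    · simp at hAB ⊢; exact hAB.1.symm
    · simp at hAB ⊢; exact hAB.1.symm

/-- A rotation and signatures at one vertex that add a crosscap for the corners `x` and `y`. -/
theorem exists_insertedCrosscap (hι : Function.Injective ι) (h₀ : u₀ ∉ Set.range ι)
    (h₁ : u₁ ∉ Set.range ι) (h₀₁ : u₀ ≠ u₁) {x y : FaceFlag G} (hxy : y.fst = x.fst)
    (swap tw : Bool) :
    ∃ c t, IsLocalRot G ι u₀ u₁ x.fst c ∧ ∀ {H : SimpleGraph W} (E' : CellEmbedding H),
      LocallyGiven E' ι u₀ u₁ x.fst c t → InsertedCrosscap E E' ι u₀ u₁ x y swap tw := by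
  obtain ⟨S₁, S₂, hS⟩ := exists_isArc (E := E) hxy
  have hnd := E.nodup_of_read hS.1
  have hm := fun p => E.adj_of_read hS.1 (p := p)
  have hnd' := hnd.map hι
  rw [List.map_append] at hnd'
  set a := if swap = true then u₀ else u₁ with ha
  set b := if swap = true then u₁ else u₀ with hb
  have hab : a ≠ b := by cases swap <;> simp [ha, hb, h₀₁, h₀₁.symm]
  have hno : ∀ p, ι p ≠ a ∧ ι p ≠ b := by
    intro p
    have h2 : ι p ≠ u₀ := fun h => h₀ ⟨p, h⟩
    have h3 : ι p ≠ u₁ := fun h => h₁ ⟨p, h⟩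
    cases swap <;> simp [ha, hb, h2, h3]
  have hperm : ((S₁.map ι).reverse ++ [a] ++ S₂.map ι ++ [b]).Perm
      ((S₁.map ι ++ S₂.map ι) ++ [a, b]) := by
    have h2 : ((S₁.map ι).reverse ++ [a] ++ S₂.map ι ++ [b]).Perm
        (S₁.map ι ++ [a] ++ S₂.map ι ++ [b]) :=
      (((List.reverse_perm _).append_right _).append_right _).append_right _
    refine h2.trans ?_
    have h3 := (List.perm_append_comm (l₁ := [a]) (l₂ := S₂.map ι)).append_left (S₁.map ι)
    simpa using h3.append_right [b]
  have hL : ((S₁.map ι).reverse ++ [a] ++ S₂.map ι ++ [b]).Nodup := by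
    rw [hperm.nodup_iff, List.nodup_append]
    refine ⟨hnd', by simp [hab], ?_⟩
    rintro c hc d hd rfl
    rw [← List.map_append] at hc
    obtain ⟨p, -, rfl⟩ := List.mem_map.1 hc
    have := hno p
    simp at hd; tauto
  obtain ⟨c, hc, hmem, hread⟩ := exists_cycle_of_read x.rev hL
  refine ⟨c, (if swap = true then !(tw ^^ x.rev) else (tw ^^ x.rev),
    if swap = true then (tw ^^ x.rev) else !(tw ^^ x.rev)), ⟨hc, fun w => ?_⟩, fun E' h =>
    ⟨S₁, S₂, hS, hread E' _ h.1, ?_⟩⟩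
  · rw [hmem, hperm.mem_iff, List.mem_append, ← List.map_append, List.mem_map]
    refine or_congr (exists_congr fun p => ?_) (by cases swap <;> simp [ha, hb, or_comm])
    rw [hm, eq_comm]
  · have := h.2
    cases swap <;> simp_all

variable {S : FaceSeq G} {m : ℕ} {X : Set V}

/-- Every vertex of a part plays a single role in attaching two vertices to this part, so
the local data at the old vertices can be chosen independently. -/
theorem exists_attached (hι : Function.Injective ι) (h₀ : u₀ ∉ Set.range ι) (h₁ : u₁ ∉ Set.range ι)
    (h₀₁ : u₀ ≠ u₁) (hm : 2 ≤ m) (hS : S.IsFaceSeq E m X) (cross : Bool) :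
    ∃ (c : V → Cycle W) (t : V → Bool × Bool), (∀ v ∈ X, IsLocalRot G ι u₀ u₁ v (c v)) ∧
      ∀ {H : SimpleGraph W} (E' : CellEmbedding H) (extra₀ extra₁ : List W),
        (∀ v ∈ X, LocallyGiven E' ι u₀ u₁ v (c v) (t v)) →
        (E'.rot u₀ = ↑((List.range' 1 (m - 1)).map (fun i => ι (S.vertex i)) ++ extra₀ ++
          [ι (S.vertex m)])) →
        (E'.rot u₁ = ↑((List.range' 1 (m - 1)).map (fun i => ι (S.vertex i)) ++ extra₁ ++
          [ι (S.vertex m)]).reverse) → Attached E E' ι S m u₀ u₁ cross extra₀ extra₁ := by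
  classical
  have hlast : (S.left ((m + 1) / 2)).fst = S.vertex (m - 1) := by
    rw [hS.left_fst _ (by omega) le_rfl, pairLeft_last]
  have hlast' : (S.right ((m + 1) / 2)).fst = S.vertex m := by
    rw [hS.right_fst _ (by omega) le_rfl, pairRight_last]
  have hl : ∀ i, 1 ≤ i → i ≤ (m - 2) / 2 → (S.left i).fst = S.vertex (2 * i - 1) := by
    intro i hi hi'
    rw [hS.left_fst _ hi (by omega), pairLeft_of_le hm hi']
  have hr : ∀ i, 1 ≤ i → i ≤ (m - 2) / 2 → (S.right i).fst = S.vertex (2 * i) := by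
    intro i hi hi'
    rw [hS.right_fst _ hi (by omega), pairRight_of_le hm hi']
  have hro : m % 2 = 1 → (S.right ((m - 1) / 2)).fst = S.vertex (m - 2) := by
    intro h
    rw [hS.right_fst _ (by omega) (by omega), pairRight_odd (Nat.odd_iff.2 h)]
  have hsh : m % 2 = 1 → (S.shared m).fst = S.vertex (if m = 3 then 2 else m - 3) := by
    intro h
    unfold FaceSeq.shared
    split_ifs with h3
    · subst h3
      rw [hS.left_fst 2 (by norm_num) (by norm_num)]; rfl
    · rw [hr _ (by omega) (by omega)]; congr 1; omega
  have hlo : m % 2 = 1 → (S.left ((m - 1) / 2)).fst = (S.shared m).fst := by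
    intro h
    rw [hsh h, hS.left_fst _ (by omega) (by omega)]
    split_ifs with h3
    · subst h3; rfl
    · rw [pairLeft_odd (Nat.odd_iff.2 h) h3]
  -- what the structure `Attached` demands at the vertex with number `j`
  let Role : {H : SimpleGraph W} → CellEmbedding H → ℕ → Prop := fun E' j =>
    (j = m → Inserted E E' ι u₀ u₁ (S.right ((m + 1) / 2)) true false) ∧
    (m ≠ 3 → j = m - 1 → Inserted E E' ι u₀ u₁ (S.left ((m + 1) / 2)) cross cross) ∧
    (∀ i, 1 ≤ i → i ≤ (m - 2) / 2 → j = 2 * i - 1 →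
      Inserted E E' ι u₀ u₁ (S.left i) false false) ∧
    (∀ i, 1 ≤ i → i ≤ (m - 2) / 2 → ¬ (m % 2 = 1 ∧ i = (m - 2) / 2) → j = 2 * i →
      Inserted E E' ι u₀ u₁ (S.right i) true false) ∧
    (m % 2 = 1 → m ≠ 3 → j = m - 3 →
      InsertedCrosscap E E' ι u₀ u₁ (S.shared m) (S.left ((m - 1) / 2)) true false) ∧
    (m % 2 = 1 → m ≠ 3 → j = m - 2 →
      Inserted E E' ι u₀ u₁ (S.right ((m - 1) / 2)) true false) ∧
    (m = 3 → j = 2 →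
      InsertedCrosscap E E' ι u₀ u₁ (S.shared m) (S.left ((m - 1) / 2)) cross cross) ∧
    (m = 3 → j = 1 → Inserted E E' ι u₀ u₁ (S.right ((m - 1) / 2)) cross cross)
  have key : ∀ j, 1 ≤ j → j ≤ m → ∃ c t, IsLocalRot G ι u₀ u₁ (S.vertex j) c ∧
      ∀ {H : SimpleGraph W} (E' : CellEmbedding H),
        LocallyGiven E' ι u₀ u₁ (S.vertex j) c t → Role E' j := by
    intro j hj hj'
    have hins : ∀ (x : FaceFlag G) (swap tw : Bool), x.fst = S.vertex j →
        ∃ c t, IsLocalRot G ι u₀ u₁ (S.vertex j) c ∧ ∀ {H : SimpleGraph W} (E' : CellEmbedding H),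
          LocallyGiven E' ι u₀ u₁ (S.vertex j) c t → Inserted E E' ι u₀ u₁ x swap tw := by
      intro x swap tw hx
      rw [← hx]
      exact exists_inserted hι h₀ h₁ h₀₁ x swap tw
    have hcc : ∀ (swap tw : Bool), m % 2 = 1 → j = (if m = 3 then 2 else m - 3) →
        ∃ c t, IsLocalRot G ι u₀ u₁ (S.vertex j) c ∧ ∀ {H : SimpleGraph W} (E' : CellEmbedding H),
          LocallyGiven E' ι u₀ u₁ (S.vertex j) c t →
            InsertedCrosscap E E' ι u₀ u₁ (S.shared m) (S.left ((m - 1) / 2)) swap tw := by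
      intro swap tw ho hx
      rw [hx, ← hsh ho]
      exact exists_insertedCrosscap hι h₀ h₁ h₀₁ (hlo ho) swap tw
    have hcases : j = m ∨ (m ≠ 3 ∧ j = m - 1) ∨
        (∃ i, 1 ≤ i ∧ i ≤ (m - 2) / 2 ∧ j = 2 * i - 1 ∧ m ≠ 3) ∨
        (∃ i, 1 ≤ i ∧ i ≤ (m - 2) / 2 ∧ ¬ (m % 2 = 1 ∧ i = (m - 2) / 2) ∧ j = 2 * i) ∨
        (m % 2 = 1 ∧ m ≠ 3 ∧ j = m - 3) ∨ (m % 2 = 1 ∧ m ≠ 3 ∧ j = m - 2) ∨ (m = 3 ∧ j = 2) ∨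
        (m = 3 ∧ j = 1) := by
      by_cases h1 : j + 2 ≤ m
      · by_cases h2 : j % 2 = 1
        · by_cases h3 : m % 2 = 1 ∧ m = j + 2
          · omega
          · right; right; left; exact ⟨(j + 1) / 2, by omega, by omega, by omega, by omega⟩
        · by_cases h3 : m % 2 = 1 ∧ j / 2 = (m - 2) / 2
          · omega
          · right; right; right; left; exact ⟨j / 2, by omega, by omega, h3, by omega⟩
      · omega
    rcases hcases with rfl | ⟨h3, h4⟩ | ⟨i, hi, hi', h4, h3⟩ | ⟨i, hi, hi', h3, h4⟩ |
      ⟨ho, h3, h4⟩ | ⟨ho, h3, h4⟩ | ⟨h3, h4⟩ | ⟨h3, h4⟩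
    · obtain ⟨c, t, hc, h⟩ := hins _ true false hlast'
      refine ⟨c, t, hc, fun E' hE => ⟨fun _ => h E' hE, ?_, ?_, ?_, ?_, ?_, ?_, ?_⟩⟩ <;> intros <;>
        exfalso <;> omega
    · obtain ⟨c, t, hc, h⟩ := hins (S.left ((m + 1) / 2)) cross cross (by rw [hlast, h4])
      refine ⟨c, t, hc, fun E' hE => ⟨?_, fun _ _ => h E' hE, ?_, ?_, ?_, ?_, ?_, ?_⟩⟩ <;> intros <;>
        exfalso <;> omega
    · obtain ⟨c, t, hc, h⟩ := hins (S.left i) false false (by rw [hl i hi hi', h4])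
      refine ⟨c, t, hc, fun E' hE => ⟨?_, ?_, ?_, ?_, ?_, ?_, ?_, ?_⟩⟩
      on_goal 3 =>
        intro i' h5 h6 h7
        obtain rfl : i' = i := by omega
        exact h E' hE
      all_goals intros; exfalso; omega
    · obtain ⟨c, t, hc, h⟩ := hins (S.right i) true false (by rw [hr i hi hi', h4])
      refine ⟨c, t, hc, fun E' hE => ⟨?_, ?_, ?_, ?_, ?_, ?_, ?_, ?_⟩⟩
      on_goal 4 =>
        intro i' h5 h6 h8 h7
        obtain rfl : i' = i := by omega
        exact h E' hE
      all_goals intros; exfalso; omega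
    · obtain ⟨c, t, hc, h⟩ := hcc true false ho (by rw [if_neg h3, h4])
      refine ⟨c, t, hc, fun E' hE => ⟨?_, ?_, ?_, ?_, fun _ _ _ => h E' hE, ?_, ?_, ?_⟩⟩ <;> intros <;>
        exfalso <;> omega
    · obtain ⟨c, t, hc, h⟩ := hins (S.right ((m - 1) / 2)) true false (by rw [hro ho, h4])
      refine ⟨c, t, hc, fun E' hE => ⟨?_, ?_, ?_, ?_, ?_, fun _ _ _ => h E' hE, ?_, ?_⟩⟩ <;> intros <;>
        exfalso <;> omega
    · obtain ⟨c, t, hc, h⟩ := hcc cross cross (by omega) (by rw [if_pos h3, h4])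
      refine ⟨c, t, hc, fun E' hE => ⟨?_, ?_, ?_, ?_, ?_, ?_, fun _ _ => h E' hE, ?_⟩⟩ <;> intros <;>
        exfalso <;> omega
    · obtain ⟨c, t, hc, h⟩ := hins (S.right ((m - 1) / 2)) cross cross
        (by rw [hro (by omega), h4]; congr 1; omega)
      refine ⟨c, t, hc, fun E' hE => ⟨?_, ?_, ?_, ?_, ?_, ?_, ?_, fun _ _ => h E' hE⟩⟩ <;> intros <;>
        exfalso <;> omega
  choose c t hc hrole using key
  have hidx : ∀ v : X, ∃ j, 1 ≤ j ∧ j ≤ m ∧ S.vertex j = v := by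
    rintro ⟨v, hv⟩
    obtain ⟨j, ⟨h1, h2⟩, h3⟩ := hS.names.surjOn hv
    exact ⟨j, h1, h2, h3⟩
  choose idx hi1 hi2 hi3 using hidx
  have hmem : ∀ j, 1 ≤ j → j ≤ m → S.vertex j ∈ X := fun j h1 h2 => hS.names.mapsTo ⟨h1, h2⟩
  have hidx' : ∀ j (h1 : 1 ≤ j) (h2 : j ≤ m), idx ⟨S.vertex j, hmem j h1 h2⟩ = j :=
    fun j h1 h2 => hS.names.injOn ⟨hi1 _, hi2 _⟩ ⟨h1, h2⟩ (hi3 _)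
  refine ⟨fun v => if hv : v ∈ X then c (idx ⟨v, hv⟩) (hi1 _) (hi2 _) else Cycle.nil,
    fun v => if hv : v ∈ X then t (idx ⟨v, hv⟩) (hi1 _) (hi2 _) else (false, false), ?_, ?_⟩
  · intro v hv
    have := hc (idx ⟨v, hv⟩) (hi1 _) (hi2 _)
    rw [hi3] at this
    simpa [hv] using this
  · intro H E' extra₀ extra₁ hloc hrot₀ hrot₁
    have hR : ∀ j, 1 ≤ j → j ≤ m → Role E' j := by
      intro j h1 h2
      have h3 := hloc (S.vertex j) (hmem j h1 h2)
      simp only [hmem j h1 h2, dif_pos] at h3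
      have h4 := hrole (idx ⟨_, hmem j h1 h2⟩) (hi1 _) (hi2 _) E' (by rw [hi3]; exact h3)
      rwa [hidx' j h1 h2] at h4
    exact
      { right_last := (hR m (by omega) le_rfl).1 rfl
        left_last := fun h3 => (hR (m - 1) (by omega) (by omega)).2.1 h3 rfl
        left_handle := fun i h1 h2 => (hR (2 * i - 1) (by omega) (by omega)).2.2.1 i h1 h2 rfl
        right_handle := fun i h1 h2 h3 => (hR (2 * i) (by omega) (by omega)).2.2.2.1 i h1 h2
          (by rwa [Nat.odd_iff] at h3) rfl
        shared_odd := fun ho h3 => by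
          rw [Nat.odd_iff] at ho
          exact (hR (m - 3) (by omega) (by omega)).2.2.2.2.1 ho h3 rfl
        right_odd := fun ho h3 => by
          rw [Nat.odd_iff] at ho
          exact (hR (m - 2) (by omega) (by omega)).2.2.2.2.2.1 ho h3 rfl
        shared_three := fun h3 => (hR 2 (by omega) (by omega)).2.2.2.2.2.2.1 h3 rfl
        right_three := fun h3 => (hR 1 (by omega) (by omega)).2.2.2.2.2.2.2 h3 rfl
        rot₀ := hrot₀
        rot₁ := hrot₁ }

/-- The rotation at a new vertex meets each of its neighbours once. -/
theorem FaceSeq.IsFaceSeq.rot_new (hι : Function.Injective ι) (hm : 2 ≤ m)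
    (hS : S.IsFaceSeq E m X) {extra : List W} (he : extra.Nodup)
    (he' : ∀ w ∈ extra, w ∉ Set.range ι) :
    ((List.range' 1 (m - 1)).map (fun i => ι (S.vertex i)) ++ extra ++ [ι (S.vertex m)]).Nodup ∧
    ∀ w, w ∈ ((List.range' 1 (m - 1)).map (fun i => ι (S.vertex i)) ++ extra ++ [ι (S.vertex m)]) ↔
      (∃ v ∈ X, w = ι v) ∨ w ∈ extra := by
  have hperm : ((List.range' 1 (m - 1)).map (fun i => ι (S.vertex i)) ++ extra ++
      [ι (S.vertex m)]).Perm ((List.range' 1 m).map (fun i => ι (S.vertex i)) ++ extra) := by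
    have h1 : List.range' 1 m = List.range' 1 (m - 1) ++ [m] := by
      obtain ⟨k, rfl⟩ : ∃ k, m = k + 1 := ⟨m - 1, by omega⟩
      rw [List.range'_concat]; simp [add_comm]
    rw [h1, List.map_append, List.append_assoc, List.append_assoc]
    exact List.perm_append_comm.append_left _
  have hmem : ∀ i, i ∈ List.range' 1 m ↔ i ∈ Set.Icc 1 m := by
    intro i
    rw [List.mem_range'_1, Set.mem_Icc]; omega
  constructor
  · rw [hperm.nodup_iff, List.nodup_append]
    refine ⟨List.Nodup.map_on ?_ (List.nodup_range' ..), he, ?_⟩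
    · intro i hi j hj h
      exact hS.names.injOn ((hmem i).1 hi) ((hmem j).1 hj) (hι h)
    · rintro a ha b hb rfl
      obtain ⟨i, -, rfl⟩ := List.mem_map.1 ha
      exact he' _ hb ⟨_, rfl⟩
  · intro w
    rw [hperm.mem_iff, List.mem_append, List.mem_map]
    refine or_congr_left ⟨?_, ?_⟩
    · rintro ⟨i, hi, rfl⟩
      exact ⟨_, hS.names.mapsTo ((hmem i).1 hi), rfl⟩
    · rintro ⟨v, hv, rfl⟩
      obtain ⟨i, hi, rfl⟩ := hS.names.surjOn hv
      exact ⟨i, (hmem i).2 hi, rfl⟩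

end Existence

/-! ### Existence of the extended embeddings of bipartite joins -/

section JoinExistence

/-- An embedding of a bipartite graph is given by arbitrary rotations at the vertices of the two parts
and arbitrary signatures of the edges. -/
theorem exists_cellEmbedding_bipGraph {A B : Type*} {R : A → B → Prop} (hc : (bipGraph R).Connected)
    (rA : A → Cycle (A ⊕ B)) (rB : B → Cycle (A ⊕ B)) (tw : A → B → Bool)
    (hA : ∀ a, (rA a).Nodup ∧ ∀ w, w ∈ rA a ↔ (bipGraph R).Adj (Sum.inl a) w)
    (hB : ∀ b, (rB b).Nodup ∧ ∀ w, w ∈ rB b ↔ (bipGraph R).Adj (Sum.inr b) w) :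
    ∃ E' : CellEmbedding (bipGraph R), (∀ a, E'.rot (Sum.inl a) = rA a) ∧
      (∀ b, E'.rot (Sum.inr b) = rB b) ∧ ∀ a b, E'.twist s(Sum.inl a, Sum.inr b) = tw a b :=
  ⟨{  connected := hc
      rot := Sum.elim rA rB
      nodup := by rintro (a | b); exacts [(hA a).1, (hB b).1]
      mem_rot := by rintro (a | b); exacts [(hA a).2, (hB b).2]
      twist := Sym2.lift ⟨fun x y =>
          match x, y with
          | Sum.inl a, Sum.inr b => tw a b
          | Sum.inr b, Sum.inl a => tw a b
          | _, _ => false, by rintro (a | b) (a' | b') <;> rfl⟩ },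
    fun _ => rfl, fun _ => rfl, fun _ _ => rfl⟩

theorem connected_bipJoin {A B C D : Type*} {R : A → B → Prop} {S : C → D → Prop}
    (h : (bipGraph R).Connected) (a : A) (b : B) : (bipGraph (bipJoin R S)).Connected := by
  have hold : ∀ v, (bipGraph (bipJoin R S)).Reachable (joinIncl (Sum.inl a)) (joinIncl v) := by
    intro v
    have := h.preconnected (Sum.inl a) v
    let f : bipGraph R →g bipGraph (bipJoin R S) :=
      ⟨joinIncl, fun {x y} hxy => (bipGraph_joinIncl R S x y).2 hxy⟩
    exact this.map f
  have key : ∀ v, (bipGraph (bipJoin R S)).Reachable (joinIncl (Sum.inl a)) v := by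
    rintro ((a' | c) | (b' | d))
    · exact hold (Sum.inl a')
    · refine (hold (Sum.inr b)).trans (SimpleGraph.Adj.reachable ?_)
      trivial
    · exact hold (Sum.inr b')
    · exact SimpleGraph.Adj.reachable trivial
  exact { preconnected := fun v w => (key v).symm.trans (key w), nonempty := ⟨joinIncl (Sum.inl a)⟩ }

theorem joinIncl_injective {A B C D : Type*} :
    Function.Injective (joinIncl : A ⊕ B → (A ⊕ C) ⊕ (B ⊕ D)) :=
  Sum.inl_injective.sumMap Sum.inl_injective

variable {m n : ℕ} {R : Fin m → Fin n → Prop} {E : CellEmbedding (bipGraph R)}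
  {FA FB : FaceSeq (bipGraph R)}

theorem mem_map_joinIncl {C D : Type*} (E : CellEmbedding (bipGraph R)) (v : Fin m ⊕ Fin n)
    (w : (Fin m ⊕ C) ⊕ (Fin n ⊕ D)) :
    w ∈ (E.rot v).map joinIncl ↔ ∃ p, (bipGraph R).Adj v p ∧ w = joinIncl p := by
  simp only [← E.mem_rot]
  induction E.rot v using Quot.inductionOn with
  | h l =>
    change w ∈ l.map joinIncl ↔ ∃ p, p ∈ l ∧ _
    rw [List.mem_map]
    exact exists_congr fun p => and_congr_right fun _ => eq_comm

theorem nodup_map_joinIncl {C D : Type*} (E : CellEmbedding (bipGraph R)) (v : Fin m ⊕ Fin n) :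
    ((E.rot v).map (joinIncl : _ → (Fin m ⊕ C) ⊕ (Fin n ⊕ D))).Nodup := by
  have := E.nodup v
  induction h : E.rot v using Quot.inductionOn with
  | h l =>
    rw [h] at this
    exact List.Nodup.map joinIncl_injective this

theorem xor_ne_iff (b : Bool) (P : Prop) [Decidable P] : (b ^^ decide P) ≠ b ↔ P := by
  by_cases hP : P <;> simp [hP]

open Classical in
theorem exists_isExtended020 (hm : 2 ≤ m) (hn : 2 ≤ n) (hA : FA.IsFaceSeq E m (Set.range Sum.inl)) :
    ∃ E', IsExtended020 E FA E' := by
  obtain ⟨c, t, hc, hatt⟩ := exists_attached (W := (Fin m ⊕ Fin 0) ⊕ (Fin n ⊕ Fin 2))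
    (ι := joinIncl) (u₀ := Sum.inr (Sum.inr 0)) (u₁ := Sum.inr (Sum.inr 1)) joinIncl_injective
    (by rintro ⟨v | v, hv⟩ <;> simp [joinIncl] at hv)
    (by rintro ⟨v | v, hv⟩ <;> simp [joinIncl] at hv) (by simp) hm hA false
  obtain ⟨hnd, hmem⟩ := hA.rot_new
    (joinIncl_injective (A := Fin m) (B := Fin n) (C := Fin 0) (D := Fin 2)) hm (extra := [])
    List.nodup_nil (by simp)
  set L := ((List.range' 1 (m - 1)).map (fun i => (joinIncl (FA.vertex i) :
    (Fin m ⊕ Fin 0) ⊕ (Fin n ⊕ Fin 2))) ++ [] ++ [joinIncl (FA.vertex m)]) with hL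
  obtain ⟨E', h1, h2, h3⟩ := exists_cellEmbedding_bipGraph
    (connected_bipJoin (S := minusMatching 0 2 0) E.connected ⟨0, by omega⟩ ⟨0, by omega⟩)
    (Sum.elim (fun a => c (Sum.inl a)) (fun x => x.elim0))
    (Sum.elim (fun b => (E.rot (Sum.inr b)).map joinIncl)
      (fun d => if d = 0 then ↑L else ↑L.reverse))
    (Sum.elim (fun a => Sum.elim
      (fun b => E.twist s(Sum.inl a, Sum.inr b) ^^
        decide (s(Sum.inl a, Sum.inr b) ∈ crosscapEdges E FA m))
      (fun d => if d = 0 then (t (Sum.inl a)).1 else (t (Sum.inl a)).2)) (fun x => x.elim0))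
    (by
      rintro (a | x)
      · refine ⟨(hc _ ⟨a, rfl⟩).nodup, fun w => ((hc _ ⟨a, rfl⟩).mem_iff w).trans ?_⟩
        rcases w with (a' | x) | (b | d)
        · simp [joinIncl, bipGraph]
        · exact x.elim0
        · simp [joinIncl, bipGraph, bipJoin]
        · fin_cases d <;> simp [bipGraph, bipJoin]
      · exact x.elim0)
    (by
      rintro (b | d)
      · refine ⟨nodup_map_joinIncl E _, fun w => (mem_map_joinIncl E _ w).trans ?_⟩
        rcases w with (a' | x) | (b | d)
        · simp [joinIncl, bipGraph, bipJoin]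
        · exact x.elim0
        · simp [joinIncl, bipGraph]
        · simp [joinIncl, bipGraph]
      · have hw : ∀ w, w ∈ L ↔ (bipGraph (bipJoin R (minusMatching 0 2 0))).Adj
            (Sum.inr (Sum.inr d)) w := by
          intro w
          rw [hmem]
          rcases w with (a' | x) | (b | d)
          · simp [joinIncl, bipGraph, bipJoin]
          · exact x.elim0
          · simp [joinIncl, bipGraph]
          · simp [joinIncl, bipGraph]
        fin_cases d
        · exact ⟨hnd, hw⟩
        · exact ⟨List.nodup_reverse.2 hnd, fun w => List.mem_reverse.trans (hw w)⟩)
  refine ⟨E', hatt E' [] [] ?_ ?_ ?_, fun b => ?_, ?_⟩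
  · rintro _ ⟨a, rfl⟩
    exact ⟨h1 _, h3 _ _, h3 _ _⟩
  · exact h2 _
  · exact h2 _
  · exact h2 _
  · rintro (a | b) (a' | b') hab
    · exact hab.elim
    · change E'.twist s(Sum.inl (Sum.inl a), Sum.inr (Sum.inl b')) ≠ _ ↔ _
      rw [h3]
      exact xor_ne_iff _ _
    · rw [Sym2.eq_swap, Sym2.eq_swap (a := Sum.inr b)]
      change E'.twist s(Sum.inl (Sum.inl a'), Sum.inr (Sum.inl b)) ≠ _ ↔ _
      rw [h3]
      exact xor_ne_iff _ _
    · exact hab.elim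

open Classical in
theorem exists_isExtended200 (hm : 2 ≤ m) (hn : 2 ≤ n) (hB : FB.IsFaceSeq E n (Set.range Sum.inr)) :
    ∃ E', IsExtended200 E FB E' := by
  obtain ⟨c, t, hc, hatt⟩ := exists_attached (W := (Fin m ⊕ Fin 2) ⊕ (Fin n ⊕ Fin 0))
    (ι := joinIncl) (u₀ := Sum.inl (Sum.inr 0)) (u₁ := Sum.inl (Sum.inr 1)) joinIncl_injective
    (by rintro ⟨v | v, hv⟩ <;> simp [joinIncl] at hv)
    (by rintro ⟨v | v, hv⟩ <;> simp [joinIncl] at hv) (by simp) hn hB false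
  obtain ⟨hnd, hmem⟩ := hB.rot_new
    (joinIncl_injective (A := Fin m) (B := Fin n) (C := Fin 2) (D := Fin 0)) hn (extra := [])
    List.nodup_nil (by simp)
  set L := ((List.range' 1 (n - 1)).map (fun i => (joinIncl (FB.vertex i) :
    (Fin m ⊕ Fin 2) ⊕ (Fin n ⊕ Fin 0))) ++ [] ++ [joinIncl (FB.vertex n)]) with hL
  obtain ⟨E', h1, h2, h3⟩ := exists_cellEmbedding_bipGraph
    (connected_bipJoin (S := minusMatching 2 0 0) E.connected ⟨0, by omega⟩ ⟨0, by omega⟩)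
    (Sum.elim (fun a => (E.rot (Sum.inl a)).map joinIncl)
      (fun d => if d = 0 then ↑L else ↑L.reverse))
    (Sum.elim (fun b => c (Sum.inr b)) (fun x => x.elim0))
    (fun x y => Sum.elim (fun b => Sum.elim
      (fun a => E.twist s(Sum.inl a, Sum.inr b) ^^
        decide (s(Sum.inl a, Sum.inr b) ∈ crosscapEdges E FB n))
      (fun d => if d = 0 then (t (Sum.inr b)).1 else (t (Sum.inr b)).2) x) (fun x => x.elim0) y)
    (by
      rintro (a | d)
      · refine ⟨nodup_map_joinIncl E _, fun w => (mem_map_joinIncl E _ w).trans ?_⟩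
        rcases w with (a' | c) | (b | x)
        · simp [joinIncl, bipGraph]
        · simp [joinIncl, bipGraph]
        · simp [joinIncl, bipGraph, bipJoin]
        · exact x.elim0
      · have hw : ∀ w, w ∈ L ↔ (bipGraph (bipJoin R (minusMatching 2 0 0))).Adj
            (Sum.inl (Sum.inr d)) w := by
          intro w
          rw [hmem]
          rcases w with (a' | c) | (b | x)
          · simp [joinIncl, bipGraph]
          · simp [joinIncl, bipGraph]
          · simp [joinIncl, bipGraph, bipJoin]
          · exact x.elim0
        fin_cases d
        · exact ⟨hnd, hw⟩
        · exact ⟨List.nodup_reverse.2 hnd, fun w => List.mem_reverse.trans (hw w)⟩)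
    (by
      rintro (b | x)
      · refine ⟨(hc _ ⟨b, rfl⟩).nodup, fun w => ((hc _ ⟨b, rfl⟩).mem_iff w).trans ?_⟩
        rcases w with (a' | d) | (b | x)
        · simp [joinIncl, bipGraph, bipJoin]
        · fin_cases d <;> simp [bipGraph, bipJoin]
        · simp [joinIncl, bipGraph]
        · exact x.elim0
      · exact x.elim0)
  refine ⟨E', hatt E' [] [] ?_ ?_ ?_, fun a => ?_, ?_⟩
  · rintro _ ⟨b, rfl⟩
    refine ⟨h2 _, ?_, ?_⟩
    · rw [Sym2.eq_swap]; exact h3 _ _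
    · rw [Sym2.eq_swap]; exact h3 _ _
  · exact h1 _
  · exact h1 _
  · exact h1 _
  · rintro (a | b) (a' | b') hab
    · exact hab.elim
    · change E'.twist s(Sum.inl (Sum.inl a), Sum.inr (Sum.inl b')) ≠ _ ↔ _
      rw [h3]
      exact xor_ne_iff _ _
    · rw [Sym2.eq_swap, Sym2.eq_swap (a := Sum.inr b)]
      change E'.twist s(Sum.inl (Sum.inl a'), Sum.inr (Sum.inl b)) ≠ _ ↔ _
      rw [h3]
      exact xor_ne_iff _ _
    · exact hab.elim

open Classical in
theorem exists_isExtended222 (hm : 2 ≤ m) (hn : 2 ≤ n) (hA : FA.IsFaceSeq E m (Set.range Sum.inl))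
    (hB : FB.IsFaceSeq E n (Set.range Sum.inr)) : ∃ E', IsExtended222 E FA FB E' := by
  obtain ⟨c, t, hc, hatt⟩ := exists_attached (W := (Fin m ⊕ Fin 2) ⊕ (Fin n ⊕ Fin 2))
    (ι := joinIncl) (u₀ := Sum.inr (Sum.inr 0)) (u₁ := Sum.inr (Sum.inr 1)) joinIncl_injective
    (by rintro ⟨v | v, hv⟩ <;> simp [joinIncl] at hv)
    (by rintro ⟨v | v, hv⟩ <;> simp [joinIncl] at hv) (by simp) hm hA true
  obtain ⟨c', t', hc', hatt'⟩ := exists_attached (W := (Fin m ⊕ Fin 2) ⊕ (Fin n ⊕ Fin 2))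
    (ι := joinIncl) (u₀ := Sum.inl (Sum.inr 0)) (u₁ := Sum.inl (Sum.inr 1)) joinIncl_injective
    (by rintro ⟨v | v, hv⟩ <;> simp [joinIncl] at hv)
    (by rintro ⟨v | v, hv⟩ <;> simp [joinIncl] at hv) (by simp) hn hB true
  have hA' := fun d : Fin 2 => hA.rot_new
    (joinIncl_injective (A := Fin m) (B := Fin n) (C := Fin 2) (D := Fin 2)) hm
    (extra := [Sum.inl (Sum.inr d)]) (by simp)
    (by rintro w hw ⟨v | v, rfl⟩ <;> simp [joinIncl] at hw)
  have hB' := fun d : Fin 2 => hB.rot_new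
    (joinIncl_injective (A := Fin m) (B := Fin n) (C := Fin 2) (D := Fin 2)) hn
    (extra := [Sum.inr (Sum.inr d)]) (by simp)
    (by rintro w hw ⟨v | v, rfl⟩ <;> simp [joinIncl] at hw)
  set L := fun d : Fin 2 => ((List.range' 1 (m - 1)).map (fun i => (joinIncl (FA.vertex i) :
    (Fin m ⊕ Fin 2) ⊕ (Fin n ⊕ Fin 2))) ++ [Sum.inl (Sum.inr d)] ++ [joinIncl (FA.vertex m)]) with hL
  set L' := fun d : Fin 2 => ((List.range' 1 (n - 1)).map (fun i => (joinIncl (FB.vertex i) :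
    (Fin m ⊕ Fin 2) ⊕ (Fin n ⊕ Fin 2))) ++ [Sum.inr (Sum.inr d)] ++ [joinIncl (FB.vertex n)]) with hL'
  obtain ⟨E', h1, h2, h3⟩ := exists_cellEmbedding_bipGraph
    (connected_bipJoin (S := minusMatching 2 2 2) E.connected ⟨0, by omega⟩ ⟨0, by omega⟩)
    (Sum.elim (fun a => c (Sum.inl a)) (fun d => if d = 0 then ↑(L' 1) else ↑(L' 0).reverse))
    (Sum.elim (fun b => c' (Sum.inr b)) (fun d => if d = 0 then ↑(L 1) else ↑(L 0).reverse))
    (Sum.elim (fun a => Sum.elim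
        (fun b => E.twist s(Sum.inl a, Sum.inr b) ^^
          decide (Xor (s(Sum.inl a, Sum.inr b) ∈ crosscapEdges E FA m)
            (s(Sum.inl a, Sum.inr b) ∈ crosscapEdges E FB n)))
        (fun d => if d = 0 then (t (Sum.inl a)).1 else (t (Sum.inl a)).2))
      (fun d' => Sum.elim (fun b => if d' = 0 then (t' (Sum.inr b)).1 else (t' (Sum.inr b)).2)
        (fun _ => decide (d' = 0))))
    (by
      rintro (a | d)
      · refine ⟨(hc _ ⟨a, rfl⟩).nodup, fun w => ((hc _ ⟨a, rfl⟩).mem_iff w).trans ?_⟩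
        rcases w with (a' | x) | (b | d)
        · simp [joinIncl, bipGraph]
        · simp [joinIncl, bipGraph]
        · simp [joinIncl, bipGraph, bipJoin]
        · fin_cases d <;> simp [bipGraph, bipJoin]
      · have hw : ∀ d d' : Fin 2, d ≠ d' → ∀ w, w ∈ L' d' ↔
            (bipGraph (bipJoin R (minusMatching 2 2 2))).Adj (Sum.inl (Sum.inr d)) w := by
          intro d d' hd w
          rw [(hB' d').2]
          rcases w with (a' | x) | (b | x)
          · simp [joinIncl, bipGraph]
          · simp [joinIncl, bipGraph]
          · simp [joinIncl, bipGraph, bipJoin]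
          · fin_cases d <;> fin_cases d' <;> fin_cases x <;>
              simp [joinIncl, bipGraph, bipJoin, minusMatching] at hd ⊢
        fin_cases d
        · exact ⟨(hB' 1).1, hw 0 1 (by decide)⟩
        · exact ⟨List.nodup_reverse.2 (hB' 0).1,
            fun w => List.mem_reverse.trans (hw 1 0 (by decide) w)⟩)
    (by
      rintro (b | d)
      · refine ⟨(hc' _ ⟨b, rfl⟩).nodup, fun w => ((hc' _ ⟨b, rfl⟩).mem_iff w).trans ?_⟩
        rcases w with (a' | d) | (b | x)
        · simp [joinIncl, bipGraph, bipJoin]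
        · fin_cases d <;> simp [bipGraph, bipJoin]
        · simp [joinIncl, bipGraph]
        · simp [joinIncl, bipGraph]
      · have hw : ∀ d d' : Fin 2, d ≠ d' → ∀ w, w ∈ L d' ↔
            (bipGraph (bipJoin R (minusMatching 2 2 2))).Adj (Sum.inr (Sum.inr d)) w := by
          intro d d' hd w
          rw [(hA' d').2]
          rcases w with (a' | x) | (b | x)
          · simp [joinIncl, bipGraph, bipJoin]
          · fin_cases d <;> fin_cases d' <;> fin_cases x <;>
              simp [joinIncl, bipGraph, bipJoin, minusMatching] at hd ⊢
          · simp [joinIncl, bipGraph]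
          · simp [joinIncl, bipGraph]
        fin_cases d
        · exact ⟨(hA' 1).1, hw 0 1 (by decide)⟩
        · exact ⟨List.nodup_reverse.2 (hA' 0).1,
            fun w => List.mem_reverse.trans (hw 1 0 (by decide) w)⟩)
  refine ⟨E', hatt E' _ _ ?_ ?_ ?_, hatt' E' _ _ ?_ ?_ ?_, ?_, h3 _ _, h3 _ _⟩
  · rintro _ ⟨a, rfl⟩
    exact ⟨h1 _, h3 _ _, h3 _ _⟩
  · exact h2 _
  · exact h2 _
  · rintro _ ⟨b, rfl⟩
    refine ⟨h2 _, ?_, ?_⟩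
    · rw [Sym2.eq_swap]; exact h3 _ _
    · rw [Sym2.eq_swap]; exact h3 _ _
  · exact h1 _
  · exact h1 _
  · rintro (a | b) (a' | b') hab
    · exact hab.elim
    · change E'.twist s(Sum.inl (Sum.inl a), Sum.inr (Sum.inl b')) ≠ _ ↔ _
      rw [h3]
      exact xor_ne_iff _ _
    · rw [Sym2.eq_swap, Sym2.eq_swap (a := Sum.inr b)]
      change E'.twist s(Sum.inl (Sum.inl a'), Sum.inr (Sum.inl b)) ≠ _ ↔ _
      rw [h3]
      exact xor_ne_iff _ _
    · exact hab.elim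

end JoinExistence

/-! ### Corners in a common face and turning around a vertex -/

namespace CellEmbedding

variable {V : Type*} [DecidableEq V] {G : SimpleGraph V} (E : CellEmbedding G)

/-- The two neighbours of a corner on the boundary walk of its face. -/
def flank (y : FaceFlag G) : Set V := {(E.pre y).fst, y.snd}

theorem mem_flank {y : FaceFlag G} {v : V} : v ∈ E.flank y ↔ v = (E.pre y).fst ∨ v = y.snd :=
  Iff.rfl

theorem flank_back (y : FaceFlag G) : E.flank (E.back y) = E.flank y := by
  unfold flank
  rw [E.pre_back, E.back_fst, E.step_fst, E.back_snd, ← E.pre_fst, Set.pair_comm]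

variable {E} in
theorem SameCorner.flank_eq {x y : FaceFlag G} (h : E.SameCorner x y) : E.flank y = E.flank x := by
  rcases h with rfl | rfl
  · rfl
  · exact E.flank_back x

variable [Finite V] {X : Set V}

theorem exists_sameCorner_of_face {y z : FaceFlag G} (h : E.face z = E.face y) :
    ∃ i < E.walkLength y, E.SameCorner (E.step^[i] y) z := by
  obtain ⟨i, hi, rfl | rfl⟩ := E.exists_iterate_or_rv h
  · exact ⟨i, hi, Or.inl rfl⟩
  · refine ⟨(i + 1) % E.walkLength y, Nat.mod_lt _ (E.walkLength_pos y), Or.inr ?_⟩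
    rw [iterate_mod_walkLength, Function.iterate_succ_apply', rv]

variable {E}

theorem pre_pre_eq {y : FaceFlag G} (h6 : E.walkLength y = 6) : E.pre (E.pre y) = E.step^[4] y := by
  have h := E.iterate_walkLength y
  rw [h6] at h
  rw [← E.pre_step (E.step^[4] y), ← E.pre_step (E.step (E.step^[4] y))]
  exact congrArg (fun z => E.pre (E.pre z)) h.symm

/-- The corners of one part in a face of length at most six, seen from one of them. -/
theorem sameCorner_of_face (h46 : E.FourOrSix) (hX : IsPart G X) {y z : FaceFlag G}
    (hf : E.face z = E.face y) (hyz : z.fst ∈ X ↔ y.fst ∈ X) :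
    E.SameCorner y z ∨ E.SameCorner (E.step (E.step y)) z ∨
      (E.walkLength y = 6 ∧ E.SameCorner (E.pre (E.pre y)) z) := by
  obtain ⟨i, hi, hs⟩ := E.exists_sameCorner_of_face hf
  have hm := E.mem_iterate hX y i
  rw [← hs.fst_eq, hyz] at hm
  have he : Even i := by tauto
  rw [Nat.even_iff] at he
  rcases h46 y with h4 | h6
  · have : i = 0 ∨ i = 2 := by omega
    rcases this with rfl | rfl
    · exact Or.inl hs
    · exact Or.inr (Or.inl hs)
  · have : i = 0 ∨ i = 2 ∨ i = 4 := by omega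
    rcases this with rfl | rfl | rfl
    · exact Or.inl hs
    · exact Or.inr (Or.inl hs)
    · exact Or.inr (Or.inr ⟨h6, by rw [pre_pre_eq h6]; exact hs⟩)

/-- Two corners at vertices of one part in a face of length at most six have a common neighbour on
its boundary walk. -/
theorem exists_mem_flank_of_face (h46 : E.FourOrSix) (hX : IsPart G X) {y z : FaceFlag G}
    (hf : E.face z = E.face y) (hyz : z.fst ∈ X ↔ y.fst ∈ X) :
    ∃ v, v ∈ E.flank y ∧ v ∈ E.flank z := by
  rcases sameCorner_of_face h46 hX hf hyz with h | h | ⟨-, h⟩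
  · exact ⟨y.snd, Or.inr rfl, by rw [h.flank_eq]; exact Or.inr rfl⟩
  · refine ⟨y.snd, Or.inr rfl, ?_⟩
    rw [h.flank_eq]
    left; simp
  · refine ⟨(E.pre y).fst, Or.inl rfl, ?_⟩
    rw [h.flank_eq]
    exact Or.inr (E.pre_snd _).symm

theorem flank_eq_of_face (hq : E.IsQuadrilateral) (hX : IsPart G X) {y z : FaceFlag G}
    (hf : E.face z = E.face y) (hyz : z.fst ∈ X ↔ y.fst ∈ X) : E.flank z = E.flank y := by
  rcases sameCorner_of_face (fun x => Or.inl (hq x)) hX hf hyz with h | h | ⟨h6, -⟩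
  · exact h.flank_eq
  · rw [h.flank_eq]
    have h4 := E.iterate_walkLength y
    rw [hq y] at h4
    have h5 : E.step (E.step (E.step y)) = E.pre y := E.step_injective (by rw [E.step_pre]; exact h4)
    unfold flank
    rw [E.pre_step, E.step_fst, ← E.step_fst (E.step (E.step y)), h5, Set.pair_comm]
  · rw [hq y] at h6
    omega

/-- A corner at a vertex of one part and one at a vertex of the other part, lying in the same face
of length at most six: unless they are neighbours on its boundary walk, they are opposite in a
hexagon. -/
theorem opposite_of_face (h46 : E.FourOrSix) (hX : IsPart G X) {y z : FaceFlag G}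
    (hf : E.face z = E.face y) (hyz : z.fst ∈ X ↔ y.fst ∉ X)
    (hc : z.fst ∉ E.flank y ∨ y.fst ∉ E.flank z) :
    E.Opposite (E.pre y) (E.step y) (E.pre z) (E.step z) := by
  obtain ⟨i, hi, hs⟩ := E.exists_sameCorner_of_face hf
  have hm := E.mem_iterate hX y i
  rw [← hs.fst_eq, hyz] at hm
  have ho : ¬ Even i := by tauto
  rw [Nat.even_iff] at ho
  have h1 : ¬ E.SameCorner (E.step y) z := by
    intro h
    rcases hc with hc | hc
    · exact hc (Or.inr (by rw [h.fst_eq]; exact E.step_fst y))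
    · exact hc (by rw [h.flank_eq]; exact Or.inl (by simp))
  have h2 : ¬ E.SameCorner (E.pre y) z := by
    intro h
    rcases hc with hc | hc
    · exact hc (Or.inl (by rw [h.fst_eq]))
    · exact hc (by rw [h.flank_eq]; exact Or.inr (E.pre_snd y).symm)
  have hpre : ∀ k, E.walkLength y = k + 1 → i ≠ k := by
    rintro k hk rfl
    rw [E.pre_eq_iterate, hk] at h2
    exact h2 hs
  have h1' : i ≠ 1 := by
    rintro rfl
    exact h1 hs
  rcases h46 y with h4 | h6
  · have := hpre 3 h4
    omega
  · have := hpre 5 h6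
    obtain rfl : i = 3 := by omega
    -- the hexagon, written from the corner before `y`
    have hL : E.walkLength (E.pre y) = 6 := by
      rw [← h6, ← E.walkLength_eq_of_face_eq (y := E.pre y) (z := y)]
      rw [← E.face_step (E.pre y), E.step_pre]
    have e : ∀ j, E.step^[j + 1] (E.pre y) = E.step^[j] y := by
      intro j
      rw [Function.iterate_succ_apply, E.step_pre]
    refine ⟨E.pre y, hL, Or.inl ⟨Or.inl rfl, Or.inl (e 1)⟩, ?_⟩
    rw [e 2, e 4]
    rcases hs with rfl | rfl
    · left
      refine ⟨Or.inl ?_, Or.inl ?_⟩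
      · exact (E.pre_step _).symm
      · rfl
    · right
      refine ⟨?_, ?_⟩
      · rw [← E.back_pre]
        refine Or.inr ?_
        rw [E.back_back]
        exact (E.pre_step _).symm
      · rw [E.pre_back]
        refine Or.inr ?_
        rw [E.back_back]
        rfl

end CellEmbedding

section Turning

variable {V : Type*} [DecidableEq V] {G : SimpleGraph V} (E : CellEmbedding G) [Finite V]

theorem CellEmbedding.isCycleOn_nx (r : Bool) (v : V) : (E.nx r v).IsCycleOn {w | G.Adj v w} := by
  have key : ∀ (c : Cycle V) (hc : c.Nodup), (c.formPerm hc).IsCycleOn {w | w ∈ c} := by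
    intro c hc
    induction c using Quot.inductionOn with
    | h l => exact List.Nodup.isCycleOn_formPerm hc
  have h1 : (E.perm v).IsCycleOn {w | G.Adj v w} := by
    have h := key (E.rot v) (E.nodup v)
    have hs : {w | w ∈ E.rot v} = {w | G.Adj v w} := Set.ext fun w => E.mem_rot v w
    rwa [hs] at h
  cases r
  · exact h1
  · exact h1.inv

variable {v p q : V} {N : ℕ}

theorem CellEmbedding.adj_iterate_nx (r : Bool) (hp : G.Adj v p) (i : ℕ) :
    G.Adj v ((E.nx r v)^[i] p) := by
  induction i with
  | zero => exact hp
  | succ i ih => rw [Function.iterate_succ_apply']; exact E.adj_nx r ih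

theorem CellEmbedding.exists_iterate_nx (hN : {w | G.Adj v w}.ncard = N) (r : Bool)
    (hp : G.Adj v p) (hq : G.Adj v q) : ∃ i < N, (E.nx r v)^[i] p = q := by
  classical
  have := Fintype.ofFinite V
  have h := E.isCycleOn_nx r v
  rw [← Set.coe_toFinset {w | G.Adj v w}] at h
  obtain ⟨i, hi, h⟩ := h.exists_pow_eq (a := p) (b := q) (by simpa using hp) (by simpa using hq)
  refine ⟨i, ?_, by rw [← h, Equiv.Perm.coe_pow]⟩
  rwa [← hN, Set.ncard_eq_toFinset_card']

theorem CellEmbedding.iterate_nx_eq (hN : {w | G.Adj v w}.ncard = N) (r : Bool)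
    (hp : G.Adj v p) : (E.nx r v)^[N] p = p := by
  classical
  have := Fintype.ofFinite V
  have h := E.isCycleOn_nx r v
  rw [← Set.coe_toFinset {w | G.Adj v w}] at h
  have := h.pow_card_apply (a := p) (by simpa using hp)
  rwa [Equiv.Perm.coe_pow, ← Set.ncard_eq_toFinset_card', hN] at this

theorem CellEmbedding.iterate_nx_inj (hN : {w | G.Adj v w}.ncard = N) (r : Bool)
    (hp : G.Adj v p) {i j : ℕ} (hi : i < N) (hj : j < N)
    (h : (E.nx r v)^[i] p = (E.nx r v)^[j] p) : i = j := by
  classical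
  have := Fintype.ofFinite V
  have hc := E.isCycleOn_nx r v
  rw [← Set.coe_toFinset {w | G.Adj v w}] at hc
  have := (hc.pow_apply_eq_pow_apply (a := p) (by simpa using hp) (m := i) (n := j)).1
    (by rwa [Equiv.Perm.coe_pow, Equiv.Perm.coe_pow])
  rw [← Set.ncard_eq_toFinset_card', hN] at this
  exact Nat.ModEq.eq_of_lt_of_lt this hi hj

theorem CellEmbedding.iterate_nx_not (hN : {w | G.Adj v w}.ncard = N) (r : Bool)
    (hp : G.Adj v p) {i : ℕ} (hi : i ≤ N) : (E.nx (!r) v)^[N - i] p = (E.nx r v)^[i] p := by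
  have h1 := E.iterate_nx_eq hN r hp
  conv_lhs => rw [← h1, show N = (N - i) + i by omega, Function.iterate_add_apply]
  rw [show N - i + i - i = N - i by omega]
  have hinv : ∀ (k : ℕ) (x : V), (E.nx (!r) v)^[k] ((E.nx r v)^[k] x) = x := by
    intro k x
    exact Function.LeftInverse.iterate (E.nx_not_nx r v) k x
  rw [hinv]

theorem CellEmbedding.nx_ne_self (hN : 2 ≤ {w | G.Adj v w}.ncard) (r : Bool) (hp : G.Adj v p) :
    E.nx r v p ≠ p := by
  intro h
  have := E.iterate_nx_inj rfl r hp (i := 1) (j := 0) (by omega) (by omega) h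
  omega

theorem CellEmbedding.nx_ne_nx_not (hN : 3 ≤ {w | G.Adj v w}.ncard) (r : Bool) (hp : G.Adj v p) :
    E.nx r v p ≠ E.nx (!r) v p := by
  intro h
  have := E.iterate_nx_inj rfl r hp (i := 2) (j := 0) (by omega) (by omega) (by
    change E.nx r v (E.nx r v p) = p
    rw [h, E.nx_nx_not])
  omega

/-- The next corner at the vertex of the flag `y`, in the sense in which `y` passes it. -/
def CellEmbedding.turn (y : FaceFlag G) : FaceFlag G :=
  ⟨y.fst, E.nx y.rev y.fst y.snd, E.adj_nx _ y.adj, y.rev⟩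

theorem CellEmbedding.iterate_turn (y : FaceFlag G) (i : ℕ) :
    (E.turn^[i] y).fst = y.fst ∧ (E.turn^[i] y).rev = y.rev ∧
      (E.turn^[i] y).snd = (E.nx y.rev y.fst)^[i + 1] (E.pre y).fst ∧
      (E.pre (E.turn^[i] y)).fst = (E.nx y.rev y.fst)^[i] (E.pre y).fst := by
  induction i with
  | zero =>
    refine ⟨rfl, rfl, ?_, rfl⟩
    rw [E.pre_fst]
    simp
  | succ i ih =>
    obtain ⟨h1, h2, h3, h4⟩ := ih
    have h5 : E.turn^[i + 1] y = E.turn (E.turn^[i] y) := Function.iterate_succ_apply' ..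
    refine ⟨by rw [h5]; exact h1, by rw [h5]; exact h2, ?_, ?_⟩
    · rw [h5]
      change E.nx (E.turn^[i] y).rev (E.turn^[i] y).fst (E.turn^[i] y).snd = _
      rw [h1, h2, h3]
      exact (Function.iterate_succ_apply' ..).symm
    · rw [h5, E.pre_fst]
      change E.nx (!(E.turn^[i] y).rev) (E.turn^[i] y).fst
        (E.nx (E.turn^[i] y).rev (E.turn^[i] y).fst (E.turn^[i] y).snd) = _
      rw [E.nx_not_nx, h3]

end Turning

/-! ### Systems of pairs of vertices of one part -/

section PairSystem

variable {V : Type*} [DecidableEq V] {G : SimpleGraph V} {E : CellEmbedding G} {X : Set V}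

/-- A division of the `m` vertices of the part `X` into pairs, each of which consists of the two
neighbours of a corner on the boundary walk of its face: the central pair at the corner `y₀` and the
pairs at the corners `Y 1, Y 2, …`.  If `m` is odd there remains one vertex, which forms a pair with
a vertex of one of the other pairs (if `m = 3`, of the central pair), at the corner `e`; the two
pairs at this vertex lie in different faces. -/
structure PairSystem (E : CellEmbedding G) (X : Set V) (m : ℕ) (y₀ : FaceFlag G)
    (Y : ℕ → FaceFlag G) (e : FaceFlag G) : Prop where
  two_le : 2 ≤ m
  card : X.ncard = m
  central : y₀.fst ∉ X
  notMem : ∀ i, 1 ≤ i → i ≤ (m - 2) / 2 → (Y i).fst ∉ X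
  extra : m % 2 = 1 → e.fst ∉ X
  cover : ∀ v ∈ X, v ∈ E.flank y₀ ∨ (∃ i, 1 ≤ i ∧ i ≤ (m - 2) / 2 ∧ v ∈ E.flank (Y i)) ∨
    (m % 2 = 1 ∧ v = e.snd)
  shared : m % 2 = 1 → (m = 3 ∧ (E.pre e).fst = y₀.snd ∧ E.face e ≠ E.face y₀) ∨
    ∃ i, 1 ≤ i ∧ i ≤ (m - 2) / 2 ∧ (E.pre e).fst ∈ E.flank (Y i) ∧ E.face e ≠ E.face (Y i)

/-- The corners of a system of pairs other than the central one. -/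
def IsNoncentral (m : ℕ) (Y : ℕ → FaceFlag G) (e y : FaceFlag G) : Prop :=
  (∃ i, 1 ≤ i ∧ i ≤ (m - 2) / 2 ∧ y = Y i) ∨ (m % 2 = 1 ∧ y = e)

/-- `l` and `r` are the two neighbours of the corner `y` on the boundary walk of its face. -/
def CellEmbedding.Flanking (E : CellEmbedding G) (y l r : FaceFlag G) : Prop :=
  (E.SameCorner (E.pre y) l ∧ E.SameCorner (E.step y) r) ∨
    (E.SameCorner (E.step y) l ∧ E.SameCorner (E.pre y) r)

variable [Finite V]

theorem CellEmbedding.Flanking.of_sameCorner {y y' l r : FaceFlag G} (h : E.Flanking y' l r)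
    (hs : E.SameCorner y y') : E.Flanking y l r := by
  rcases hs with rfl | rfl
  · exact h
  · have h1 : E.SameCorner (E.step y) (E.pre (E.back y)) := Or.inr (E.pre_back y)
    have h2 : E.SameCorner (E.pre y) (E.step (E.back y)) := Or.inr (E.back_pre y).symm
    rcases h with ⟨h, h'⟩ | ⟨h, h'⟩
    · exact Or.inr ⟨h1.trans h, h2.trans h'⟩
    · exact Or.inl ⟨h2.trans h, h1.trans h'⟩

theorem CellEmbedding.Flanking.face_eq {y l r : FaceFlag G} (h : E.Flanking y l r) :
    E.face l = E.face y := by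
  rcases h with ⟨h, -⟩ | ⟨h, -⟩
  · rw [h.face_eq, E.face_pre]
  · rw [h.face_eq, E.face_step]

theorem CellEmbedding.Flanking.mem_flank {y l r : FaceFlag G} (h : E.Flanking y l r) {v : V} :
    v ∈ E.flank y ↔ v = l.fst ∨ v = r.fst := by
  rw [E.mem_flank, ← E.step_fst y]
  rcases h with ⟨h, h'⟩ | ⟨h, h'⟩ <;> rw [h.fst_eq, h'.fst_eq]
  exact or_comm

namespace PairSystem

variable {m : ℕ} {y₀ e : FaceFlag G} {Y : ℕ → FaceFlag G}

/-- The pairs can be ordered and directed so that the last one ends at the vertex it shares with the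
additional pair. -/
theorem exists_ordered (h : PairSystem E X m y₀ Y e) : ∃ Y', PairSystem E X m y₀ Y' e ∧
    (m % 2 = 1 → m ≠ 3 → (Y' ((m - 2) / 2)).snd = (E.pre e).fst ∧
      E.face e ≠ E.face (Y' ((m - 2) / 2))) ∧
    ∀ i, 1 ≤ i → i ≤ (m - 2) / 2 → ∃ j, 1 ≤ j ∧ j ≤ (m - 2) / 2 ∧ E.SameCorner (Y j) (Y' i) := by
  by_cases hodd : m % 2 = 1 ∧ m ≠ 3
  swap
  · exact ⟨Y, h, fun h1 h2 => absurd ⟨h1, h2⟩ hodd, fun i h1 h2 => ⟨i, h1, h2, Or.inl rfl⟩⟩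
  obtain ⟨ho, h3⟩ := hodd
  set t := (m - 2) / 2 with ht
  rcases h.shared ho with ⟨h', -⟩ | ⟨j, hj, hj', hv, hf⟩
  · exact absurd h' h3
  set z := if (Y j).snd = (E.pre e).fst then Y j else E.back (Y j) with hz
  have hzs : E.SameCorner (Y j) z := by
    rw [hz]; split_ifs
    · exact Or.inl rfl
    · exact Or.inr rfl
  have hz1 : z.snd = (E.pre e).fst := by
    rw [hz]
    split_ifs with h1
    · exact h1
    · rw [E.back_snd, ← E.pre_fst]
      rcases hv with hv | hv
      · exact hv.symm
      · exact absurd hv.symm h1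
  let Y' : ℕ → FaceFlag G := Function.update (Y ∘ Equiv.swap j t) t z
  have hY' : ∀ i, E.SameCorner (Y (Equiv.swap j t i)) (Y' i) := by
    intro i
    by_cases hi : i = t
    · subst hi
      simp only [Y', Function.update_self, Equiv.swap_apply_right]
      exact hzs
    · simp only [Y', Function.update_of_ne hi, Function.comp_apply]
      exact Or.inl rfl
  have hsw : ∀ i, 1 ≤ i → i ≤ t → 1 ≤ Equiv.swap j t i ∧ Equiv.swap j t i ≤ t := by
    intro i h1 h2
    rw [Equiv.swap_apply_def]
    split_ifs <;> omega
  have hYt : Y' t = z := Function.update_self ..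
  refine ⟨Y', ⟨h.two_le, h.card, h.central, ?_, h.extra, ?_, ?_⟩, ?_, ?_⟩
  · intro i h1 h2
    rw [(hY' i).fst_eq]
    exact h.notMem _ (hsw i h1 h2).1 (hsw i h1 h2).2
  · intro v hv
    refine (h.cover v hv).imp_right (Or.imp_left ?_)
    rintro ⟨i, h1, h2, h3⟩
    refine ⟨Equiv.swap j t i, (hsw i h1 h2).1, (hsw i h1 h2).2, ?_⟩
    rw [(hY' _).flank_eq, Equiv.swap_apply_self]
    exact h3
  · intro _
    refine Or.inr ⟨t, by omega, le_rfl, ?_, ?_⟩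
    · rw [hYt, hzs.flank_eq]; exact hv
    · rw [hYt, hzs.face_eq]; exact hf
  · intro _ _
    rw [hYt]
    exact ⟨hz1, by rw [hzs.face_eq]; exact hf⟩
  · intro i h1 h2
    exact ⟨_, (hsw i h1 h2).1, (hsw i h1 h2).2, hY' i⟩

/-- The naming of the vertices according to the pairs. -/
def name (E : CellEmbedding G) (m : ℕ) (y₀ : FaceFlag G) (Y : ℕ → FaceFlag G) (e : FaceFlag G)
    (j : ℕ) : V :=
  if j = m then (E.pre y₀).fst
  else if j = m - 1 then y₀.snd
  else if m % 2 = 1 ∧ j = m - 2 then e.snd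
  else if j % 2 = 1 then (E.pre (Y ((j + 1) / 2))).fst
  else (Y (j / 2)).snd

theorem name_odd {i : ℕ} (hi : 1 ≤ i) (hi' : i ≤ (m - 2) / 2) :
    name E m y₀ Y e (2 * i - 1) = (E.pre (Y i)).fst := by
  unfold name
  rw [if_neg (by omega), if_neg (by omega), if_neg (by omega), if_pos (by omega)]
  congr 3; omega

theorem name_even {i : ℕ} (hi : 1 ≤ i) (hi' : i ≤ (m - 2) / 2) :
    name E m y₀ Y e (2 * i) = (Y i).snd := by
  unfold name
  rw [if_neg (by omega), if_neg (by omega), if_neg (by omega), if_neg (by omega)]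
  congr 2; omega

/-- As every vertex gets a name, and there are as many names as vertices, no name is given
twice. -/
theorem name_bijOn (h : PairSystem E X m y₀ Y e) (hX : IsPart G X) :
    Set.BijOn (name E m y₀ Y e) (Set.Icc 1 m) X := by
  have hm := h.two_le
  have hs : ∀ y : FaceFlag G, y.fst ∉ X → y.snd ∈ X := fun y hy => by
    by_contra hc; exact hy ((hX _ _ y.adj).2 hc)
  have hp : ∀ y : FaceFlag G, y.fst ∉ X → (E.pre y).fst ∈ X := fun y hy => (E.mem_pre hX y).2 hy
  have hmaps : Set.MapsTo (name E m y₀ Y e) (Set.Icc 1 m) X := by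
    rintro j ⟨h1, h2⟩
    unfold name
    split_ifs with h3 h4 h5 h6
    · exact hp _ h.central
    · exact hs _ h.central
    · exact hs _ (h.extra h5.1)
    · exact hp _ (h.notMem _ (by omega) (by omega))
    · exact hs _ (h.notMem _ (by omega) (by omega))
  have hsurj : Set.SurjOn (name E m y₀ Y e) (Set.Icc 1 m) X := by
    intro v hv
    rcases h.cover v hv with (h1 | h1) | ⟨i, h1, h2, h3 | h3⟩ | ⟨h1, h2⟩
    · exact ⟨m, ⟨by omega, le_rfl⟩, by rw [h1]; simp [name]⟩
    · refine ⟨m - 1, ⟨by omega, by omega⟩, ?_⟩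
      rw [h1]; unfold name
      rw [if_neg (by omega), if_pos rfl]
    · exact ⟨2 * i - 1, ⟨by omega, by omega⟩, by rw [name_odd h1 h2, h3]⟩
    · exact ⟨2 * i, ⟨by omega, by omega⟩, by rw [name_even h1 h2, h3]⟩
    · refine ⟨m - 2, ⟨by omega, by omega⟩, ?_⟩
      rw [h2]; unfold name
      rw [if_neg (by omega), if_neg (by omega), if_pos ⟨h1, rfl⟩]
  refine ⟨hmaps, Set.injOn_of_ncard_image_eq ?_ (Set.finite_Icc 1 m), hsurj⟩
  rw [Set.Subset.antisymm hmaps.image_subset hsurj, h.card]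
  rw [Set.ncard_eq_toFinset_card']
  simp

/-- The first vertex of the central pair lies in no other pair; the second one may be shared with
the additional pair. -/
theorem pre_fst_notMem_flank (h : PairSystem E X m y₀ Y e) (hX : IsPart G X) {y : FaceFlag G}
    (hy : IsNoncentral m Y e y) : (E.pre y₀).fst ∉ E.flank y := by
  have hm := h.two_le
  have hinj := (h.name_bijOn hX).injOn
  have h0 : name E m y₀ Y e m = (E.pre y₀).fst := by simp [name]
  have hne : ∀ j, 1 ≤ j → j < m → name E m y₀ Y e j ≠ (E.pre y₀).fst := by
    intro j h1 h2 h3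
    have := hinj ⟨h1, h2.le⟩ ⟨by omega, le_rfl⟩ (h3.trans h0.symm)
    omega
  have hne' : ∀ i, 1 ≤ i → i ≤ (m - 2) / 2 → (E.pre y₀).fst ∉ E.flank (Y i) := by
    rintro i h1 h2 (h3 | h3)
    · rw [← name_odd (y₀ := y₀) (e := e) h1 h2] at h3
      exact hne _ (by omega) (by omega) h3.symm
    · rw [← name_even (E := E) (y₀ := y₀) (e := e) h1 h2] at h3
      exact hne _ (by omega) (by omega) h3.symm
  rcases hy with ⟨i, h1, h2, rfl⟩ | ⟨ho, rfl⟩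
  · exact hne' i h1 h2
  · rintro (h1 | h1)
    · rcases h.shared ho with ⟨h3, h4, -⟩ | ⟨i, h3, h4, h5, -⟩
      · refine hne (m - 1) (by omega) (by omega) ?_
        rw [h1, h4]; unfold name
        rw [if_neg (by omega), if_pos rfl]
      · rw [← h1] at h5
        exact hne' i h3 h4 h5
    · refine hne (m - 2) (by omega) (by omega) ?_
      rw [h1]; unfold name
      rw [if_neg (by omega), if_neg (by omega), if_pos ⟨ho, rfl⟩]

/-- A system of pairs gives a face sequence in which each pair has a face of its own, with prescribed
marked corners in the last face. -/
theorem exists_faceSeq (h : PairSystem E X m y₀ Y e) (hX : IsPart G X) (h46 : E.FourOrSix)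
    {L R : FaceFlag G} (hL : E.SameCorner (E.step y₀) L) (hR : E.SameCorner (E.pre y₀) R)
    (hLR : ∃ t, E.step^[t] L = R) :
    ∃ S : FaceSeq G, S.IsFaceSeq E m X ∧ S.left ((m + 1) / 2) = L ∧ S.right ((m + 1) / 2) = R ∧
      (∀ i, 1 ≤ i → i < (m + 1) / 2 → ∃ y, IsNoncentral m Y e y ∧
        E.Flanking y (S.left i) (S.right i)) ∧
      ∀ s t, 1 ≤ s → s < t → t ≤ (m + 1) / 2 → E.face (S.left s) ≠ E.face (S.left t) := by
  have hm := h.two_le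
  obtain ⟨Y', h', hsh, hY'⟩ := h.exists_ordered
  -- the direction of the additional pair
  obtain ⟨l, r, hl, hr, hlr, hrev⟩ : ∃ l r, E.SameCorner (E.pre e) l ∧ E.SameCorner (E.step e) r ∧
      (∃ t, E.step^[t] l = r) ∧
      l.rev = !(if m = 3 then L else E.step (Y' ((m - 2) / 2))).rev := by
    rcases Bool.eq_or_eq_not (E.pre e).rev (if m = 3 then L else E.step (Y' ((m - 2) / 2))).rev
      with h1 | h1
    · refine ⟨E.back (E.pre e), E.back (E.step e), Or.inr rfl, Or.inr rfl, ?_, by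
        rw [E.back_rev, h1]⟩
      refine E.exists_walk_back ⟨2, ?_⟩
      rw [← E.pre_back, E.back_pre]
      exact congrArg E.step (E.step_pre _)
    · exact ⟨E.pre e, E.step e, Or.inl rfl, Or.inl rfl, ⟨2, by simp⟩, h1⟩
  let S : FaceSeq G :=
    { vertex := name E m y₀ Y' e
      left := fun i => if i = (m + 1) / 2 then L else if m % 2 = 1 ∧ i = (m - 1) / 2 then l else
        E.pre (Y' i)
      right := fun i => if i = (m + 1) / 2 then R else if m % 2 = 1 ∧ i = (m - 1) / 2 then r else
        E.step (Y' i) }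
  have hSM : S.left ((m + 1) / 2) = L ∧ S.right ((m + 1) / 2) = R := by simp [S]
  have hSo : m % 2 = 1 → S.left ((m - 1) / 2) = l ∧ S.right ((m - 1) / 2) = r := by
    intro ho
    have h1 : (m - 1) / 2 ≠ (m + 1) / 2 := by omega
    simp [S, h1, ho]
  have hSi : ∀ i, i ≤ (m - 2) / 2 → S.left i = E.pre (Y' i) ∧ S.right i = E.step (Y' i) := by
    intro i hi
    simp only [S]
    rw [if_neg (by omega), if_neg (by omega), if_neg (by omega), if_neg (by omega)]
    exact ⟨rfl, rfl⟩
  have hcases : ∀ i, 1 ≤ i → i ≤ (m + 1) / 2 → i = (m + 1) / 2 ∨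
      (m % 2 = 1 ∧ i = (m - 1) / 2) ∨ i ≤ (m - 2) / 2 := by
    intro i h1 h2; omega
  have hpo : m % 2 = 1 → pairLeft m ((m - 1) / 2) = (if m = 3 then 2 else m - 3) ∧
      pairRight m ((m - 1) / 2) = m - 2 := by
    intro ho
    refine ⟨?_, pairRight_odd (Nat.odd_iff.2 ho)⟩
    split_ifs with h3
    · subst h3; rfl
    · exact pairLeft_odd (Nat.odd_iff.2 ho) h3
  have hn1 : name E m y₀ Y' e (m - 1) = y₀.snd := by
    unfold name; rw [if_neg (by omega), if_pos rfl]
  have hne : m % 2 = 1 → (E.pre e).fst = name E m y₀ Y' e (if m = 3 then 2 else m - 3) := by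
    intro ho
    split_ifs with h3
    · rcases h.shared ho with ⟨-, h4, -⟩ | ⟨i, h5, h6, -⟩
      · rw [h4, ← hn1, h3]
      · omega
    · rw [← (hsh ho h3).1, ← name_even (E := E) (y₀ := y₀) (e := e) (by omega) le_rfl]
      congr 1; omega
  have hbij := h'.name_bijOn hX
  have hS : S.IsFaceSeq E m X := by
    refine ⟨hbij, ?_, ?_, ?_, ?_⟩
    · intro i h1 h2
      rcases hcases i h1 h2 with rfl | ⟨ho, rfl⟩ | h3
      · rw [hSM.1, pairLeft_last, hL.fst_eq, E.step_fst]
        exact hn1.symm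
      · rw [(hSo ho).1, (hpo ho).1, hl.fst_eq]
        exact hne ho
      · rw [(hSi i h3).1, pairLeft_of_le hm h3]
        exact (name_odd h1 h3).symm
    · intro i h1 h2
      rcases hcases i h1 h2 with rfl | ⟨ho, rfl⟩ | h3
      · rw [hSM.2, pairRight_last, hR.fst_eq]
        change _ = name E m y₀ Y' e m
        simp [name]
      · rw [(hSo ho).2, (hpo ho).2, hr.fst_eq, E.step_fst]
        change _ = name E m y₀ Y' e (m - 2)
        unfold name
        rw [if_neg (by omega), if_neg (by omega), if_pos ⟨ho, rfl⟩]
      · rw [(hSi i h3).2, pairRight_of_le hm h3, E.step_fst]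
        exact (name_even h1 h3).symm
    · intro i h1 h2
      rcases hcases i h1 h2 with rfl | ⟨ho, rfl⟩ | h3
      · rwa [hSM.1, hSM.2]
      · rwa [(hSo ho).1, (hSo ho).2]
      · rw [(hSi i h3).1, (hSi i h3).2]
        exact ⟨2, by simp⟩
    · intro ho
      have ho' := Nat.odd_iff.1 ho
      rw [(hSo ho').1, hrev]
      unfold FaceSeq.shared
      split_ifs with h3
      · subst h3; rw [← hSM.1]
      · have : (m - 3) / 2 = (m - 2) / 2 := by omega
        rw [this, (hSi _ le_rfl).2]
  refine ⟨S, hS, hSM.1, hSM.2, ?_, ?_⟩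
  · intro i h1 h2
    rcases hcases i h1 h2.le with h3 | ⟨ho, rfl⟩ | h3
    · omega
    · rw [(hSo ho).1, (hSo ho).2]
      exact ⟨e, Or.inr ⟨ho, rfl⟩, Or.inl ⟨hl, hr⟩⟩
    · obtain ⟨j, h4, h5, h6⟩ := hY' i h1 h3
      rw [(hSi i h3).1, (hSi i h3).2]
      refine ⟨Y j, Or.inl ⟨j, h4, h5, rfl⟩, CellEmbedding.Flanking.of_sameCorner ?_ h6⟩
      exact Or.inl ⟨Or.inl rfl, Or.inl rfl⟩
  · -- two corners in one face have a common neighbour, hence belong to pairs with a common vertex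
    have hZ : ∀ i, 1 ≤ i → i ≤ (m + 1) / 2 → ∃ y, y.fst ∉ X ∧ E.Flanking y (S.left i) (S.right i) ∧
        (i = (m + 1) / 2 → y = y₀) ∧ (m % 2 = 1 → i = (m - 1) / 2 → y = e) ∧
        (i ≤ (m - 2) / 2 → y = Y' i) := by
      intro i h1 h2
      rcases hcases i h1 h2 with rfl | ⟨ho, rfl⟩ | h3
      · refine ⟨y₀, h.central, ?_, fun _ => rfl, by omega, by omega⟩
        rw [hSM.1, hSM.2]
        exact Or.inr ⟨hL, hR⟩
      · refine ⟨e, h.extra ho, ?_, by omega, fun _ _ => rfl, by omega⟩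
        rw [(hSo ho).1, (hSo ho).2]
        exact Or.inl ⟨hl, hr⟩
      · refine ⟨Y' i, h'.notMem i h1 h3, ?_, by omega, by omega, fun _ => rfl⟩
        rw [(hSi i h3).1, (hSi i h3).2]
        exact Or.inl ⟨Or.inl rfl, Or.inl rfl⟩
    intro s t h1 h2 h3 hf
    obtain ⟨y, hy, hyf, -, -, hy3⟩ := hZ s h1 (by omega)
    obtain ⟨z, hz, hzf, hz1, hz2, hz3⟩ := hZ t (by omega) h3
    have hyz : E.face z = E.face y := by rw [← hyf.face_eq, ← hzf.face_eq, hf]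
    -- the additional pair and the pair with which it shares a vertex
    have hexc : ¬ (m % 2 = 1 ∧ m ≠ 3 ∧ s = (m - 3) / 2 ∧ t = (m - 1) / 2) := by
      rintro ⟨ho, h5, rfl, rfl⟩
      rw [hz2 ho rfl, hy3 (by omega), show (m - 3) / 2 = (m - 2) / 2 by omega] at hyz
      exact (hsh ho h5).2 hyz
    have hexc3 : ¬ (m = 3 ∧ s = 1 ∧ t = 2) := by
      rintro ⟨h5, rfl, rfl⟩
      subst h5
      obtain ⟨y', -, hyf', -, hy2', -⟩ := hZ 1 (by norm_num) (by norm_num)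
      rw [hy2' rfl rfl] at hyf'
      rcases h.shared rfl with ⟨-, -, h6⟩ | ⟨i, h6, h7, -⟩
      · refine h6 ?_
        rw [← hz1 rfl, ← hzf.face_eq, ← hyf'.face_eq, hf]
      · omega
    obtain ⟨v, hv1, hv2⟩ := CellEmbedding.exists_mem_flank_of_face h46 hX hyz (by simp [hy, hz])
    rw [hyf.mem_flank, hS.left_fst s h1 (by omega), hS.right_fst s h1 (by omega)] at hv1
    rw [hzf.mem_flank, hS.left_fst t (by omega) h3, hS.right_fst t (by omega) h3] at hv2
    have hinj : ∀ i j, 1 ≤ i → i ≤ m → 1 ≤ j → j ≤ m → S.vertex i = S.vertex j → i = j :=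
      fun i j h1 h2 h3 h4 h5 => hbij.injOn ⟨h1, h2⟩ ⟨h3, h4⟩ h5
    have hval : ∀ i, 1 ≤ i → i ≤ (m + 1) / 2 →
        (i = (m + 1) / 2 ∧ pairLeft m i = m - 1 ∧ pairRight m i = m) ∨
        (m % 2 = 1 ∧ i = (m - 1) / 2 ∧ ((m = 3 ∧ pairLeft m i = 2) ∨ (m ≠ 3 ∧ pairLeft m i = m - 3)) ∧
          pairRight m i = m - 2) ∨
        (i ≤ (m - 2) / 2 ∧ pairLeft m i = 2 * i - 1 ∧ pairRight m i = 2 * i) := by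
      intro i h1 h2
      rcases hcases i h1 h2 with rfl | ⟨ho, rfl⟩ | h3
      · exact Or.inl ⟨rfl, pairLeft_last m, pairRight_last m⟩
      · refine Or.inr (Or.inl ⟨ho, rfl, ?_, (hpo ho).2⟩)
        have := (hpo ho).1
        split_ifs at this with h3
        · exact Or.inl ⟨h3, this⟩
        · exact Or.inr ⟨h3, this⟩
      · exact Or.inr (Or.inr ⟨h3, pairLeft_of_le hm h3, pairRight_of_le hm h3⟩)
    have hs := hval s h1 (by omega)
    have ht := hval t (by omega) h3
    have hdone : ∀ i j, (i = pairLeft m s ∨ i = pairRight m s) →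
        (j = pairLeft m t ∨ j = pairRight m t) → S.vertex i ≠ S.vertex j := by
      intro i j hi hj hij
      have := hinj i j (by omega) (by omega) (by omega) (by omega) hij
      omega
    rcases hv1 with hv1 | hv1 <;> rcases hv2 with hv2 | hv2
    · exact hdone _ _ (Or.inl rfl) (Or.inl rfl) (hv1.symm.trans hv2)
    · exact hdone _ _ (Or.inl rfl) (Or.inr rfl) (hv1.symm.trans hv2)
    · exact hdone _ _ (Or.inr rfl) (Or.inl rfl) (hv1.symm.trans hv2)
    · exact hdone _ _ (Or.inr rfl) (Or.inr rfl) (hv1.symm.trans hv2)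

end PairSystem

end PairSystem

/-! ### Extendible pairs from two systems of pairs -/

section Configuration

variable {V : Type*} [DecidableEq V] {G : SimpleGraph V} {E : CellEmbedding G} {X : Set V}

/-- Systems of pairs for both parts whose central pairs cross: the two central corners are
neighbours on the boundary walk of a face.  Moreover two noncentral corners of the two systems are
never neighbours on a boundary walk; this is required only if neither of them is a
corner at an end of the edge between the two central corners, as otherwise it holds anyway. -/
def HasConfiguration (E : CellEmbedding G) (X : Set V) (m n : ℕ) : Prop :=
  ∃ (z : FaceFlag G) (Y : ℕ → FaceFlag G) (e : FaceFlag G) (Y' : ℕ → FaceFlag G) (e' : FaceFlag G),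
    PairSystem E X m (E.step z) Y e ∧ PairSystem E Xᶜ n (E.back z) Y' e' ∧
      ∀ y y', IsNoncentral m Y e y → IsNoncentral n Y' e' y' →
        y.fst = z.snd ∨ y'.fst = z.fst ∨ y'.fst ∉ E.flank y ∨ y.fst ∉ E.flank y'

theorem HasConfiguration.swap {m n : ℕ} (h : HasConfiguration E X m n) :
    HasConfiguration E Xᶜ n m := by
  obtain ⟨z, Y, e, Y', e', hA, hB, hc⟩ := h
  refine ⟨E.rv z, Y', e', Y, e, by rwa [E.step_rv], ?_, fun y y' hy hy' => ?_⟩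
  · rw [compl_compl, CellEmbedding.rv, E.back_back]
    exact hA
  · rw [E.rv_fst, E.rv_snd]
    have := hc y' y hy' hy
    tauto

variable [Finite V]

theorem CellEmbedding.Opposite.of_flanking {y y' l r l' r' : FaceFlag G}
    (h : E.Opposite (E.pre y) (E.step y) (E.pre y') (E.step y')) (hy : E.Flanking y l r)
    (hy' : E.Flanking y' l' r') : E.Opposite l r l' r' := by
  have key : ∀ {l r l' r' : FaceFlag G}, E.SameCorner (E.pre y) l → E.SameCorner (E.step y) r →
      E.SameCorner (E.pre y') l' → E.SameCorner (E.step y') r' → E.Opposite l r l' r' :=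
    fun h1 h2 h3 h4 => h.congr h1.symm h2.symm h3.symm h4.symm
  rcases hy with ⟨h1, h2⟩ | ⟨h1, h2⟩ <;> rcases hy' with ⟨h3, h4⟩ | ⟨h3, h4⟩
  · exact key h1 h2 h3 h4
  · exact (key h1 h2 h4 h3).swap_right
  · exact (key h2 h1 h3 h4).swap_left
  · exact (key h2 h1 h4 h3).swap_left.swap_right

/-- A configuration yields an extendible pair, the last face being the one that contains both central
corners. -/
theorem HasConfiguration.exists_extendible {m n : ℕ} {G : SimpleGraph (Fin m ⊕ Fin n)}
    {E : CellEmbedding G} (hX : IsPart G (Set.range Sum.inl)) (h46 : E.FourOrSix)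
    (h : HasConfiguration E (Set.range Sum.inl) m n) : ∃ FA FB : FaceSeq G, Extendible E FA FB := by
  obtain ⟨z, Y, e, Y', e', hA, hB, hc⟩ := h
  have hm := hA.two_le
  have hn := hB.two_le
  obtain ⟨FA, a1, a2, a3, a4, a5⟩ := hA.exists_faceSeq hX h46 (L := E.step (E.step z)) (R := z)
    (Or.inl rfl) (Or.inl (E.pre_step z).symm) (E.exists_walk_back ⟨2, rfl⟩)
  obtain ⟨FB, b1, b2, b3, b4, b5⟩ := hB.exists_faceSeq hX.compl h46 (L := E.pre z) (R := E.step z)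
    (Or.inr (by rw [← E.back_pre, E.back_back])) (Or.inr (by rw [E.pre_back, E.back_back]))
    ⟨2, congrArg E.step (E.step_pre z)⟩
  have hzA : (E.pre (E.step z)).fst = z.fst := by rw [E.pre_step]
  have hzB : (E.pre (E.back z)).fst = z.snd := by rw [E.pre_back, E.back_fst, E.step_fst]
  -- the central pairs
  have cA : E.Flanking (E.step z) (FA.left ((m + 1) / 2)) (FA.right ((m + 1) / 2)) := by
    rw [a2, a3]
    exact Or.inr ⟨Or.inl rfl, Or.inl (E.pre_step z).symm⟩
  have cB : E.Flanking (E.back z) (FB.left ((n + 1) / 2)) (FB.right ((n + 1) / 2)) := by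
    rw [b2, b3]
    exact Or.inr ⟨Or.inr (by rw [← E.back_pre, E.back_back]),
      Or.inr (by rw [E.pre_back, E.back_back])⟩
  have hyA : ∀ y, IsNoncentral m Y e y → y.fst ∉ Set.range Sum.inl := by
    rintro y (⟨i, h1, h2, rfl⟩ | ⟨ho, rfl⟩)
    · exact hA.notMem i h1 h2
    · exact hA.extra ho
  have hyB : ∀ y, IsNoncentral n Y' e' y → y.fst ∈ Set.range Sum.inl := by
    rintro y (⟨i, h1, h2, rfl⟩ | ⟨ho, rfl⟩)
    · simpa only [Set.mem_compl_iff, not_not] using hB.notMem i h1 h2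
    · simpa only [Set.mem_compl_iff, not_not] using hB.extra ho
  have opp : ∀ {y y' l r l' r'}, y.fst ∉ Set.range Sum.inl → y'.fst ∈ Set.range Sum.inl →
      E.Flanking y l r → E.Flanking y' l' r' → E.face l = E.face l' →
      (y'.fst ∉ E.flank y ∨ y.fst ∉ E.flank y') → E.Opposite l r l' r' := by
    intro y y' l r l' r' h1 h2 h3 h4 hf h5
    refine (CellEmbedding.opposite_of_face h46 hX ?_ ?_ h5).of_flanking h3 h4
    · rw [← h3.face_eq, ← h4.face_eq, hf]
    · simp only [h1, h2, not_false_eq_true]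
  refine ⟨FA, FB, a1, ?_, ?_, ?_, ?_, ?_, ?_⟩
  · rw [mem_range_inl_compl] at b1
    exact b1
  · rw [a2, a3, b2, b3]
    have hL : E.walkLength (E.step (E.step z)) = E.walkLength z :=
      E.walkLength_eq_of_face_eq (by rw [E.face_step, E.face_step])
    have h4 : 4 ≤ E.walkLength z := by rcases h46 z with h | h <;> omega
    have e1 : ∀ i, E.step^[i] (E.step (E.step z)) = E.step^[i + 2] z := fun i =>
      (Function.iterate_add_apply E.step i 2 z).symm
    have e2 : E.step^[E.walkLength z - 3] (E.step (E.step z)) = E.pre z := by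
      rw [e1, E.pre_eq_iterate]; congr 1; omega
    refine ⟨E.walkLength z - 3, E.walkLength z - 3 + 1, E.walkLength z - 3 + 2, by omega, by omega,
      by omega, by omega, e2, ?_, ?_⟩
    · rw [Function.iterate_succ_apply', e2, E.step_pre]
    · rw [Function.iterate_succ_apply', Function.iterate_succ_apply', e2, E.step_pre]
  · intro s t h1 h2 h3 hf
    exact absurd hf (a5 s t h1 h2 h3)
  · intro s t h1 h2 h3 hf
    exact absurd hf (b5 s t h1 h2 h3)
  · intro i j hi hi' hj hj' hf
    obtain ⟨y, hy, hyf⟩ := a4 i hi hi'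
    have h1 := hA.pre_fst_notMem_flank hX hy
    rw [hzA] at h1
    rcases hj'.lt_or_eq with hj' | rfl
    · obtain ⟨y', hy', hyf'⟩ := b4 j hj hj'
      have h2 := hB.pre_fst_notMem_flank hX.compl hy'
      rw [hzB] at h2
      refine (opp (hyA y hy) (hyB y' hy') hyf hyf' hf ?_).parallel
      rcases hc y y' hy hy' with h | h | h
      · rw [h]; exact Or.inr h2
      · rw [h]; exact Or.inl h1
      · exact h
    · refine (opp (hyA y hy) ?_ hyf cB hf (Or.inl ?_)).parallel
      · simpa only [Set.mem_compl_iff, not_not] using hB.central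
      · rw [E.back_fst]; exact h1
  · intro j hj hj' hf
    obtain ⟨y', hy', hyf'⟩ := b4 j hj hj'
    have h2 := hB.pre_fst_notMem_flank hX.compl hy'
    rw [hzB] at h2
    refine (opp hA.central (hyB y' hy') cA hyf' hf.symm (Or.inr ?_)).symm.parallel
    rw [E.step_fst]; exact h2

end Configuration

/-! ### Systems of pairs around one vertex -/

section AroundVertex

variable {V : Type*} [DecidableEq V] {G : SimpleGraph V} {E : CellEmbedding G} {X : Set V}

/-- The `i`-th neighbour of the vertex of the flag `y`, counted from the one before the corner `y`
in the sense in which `y` passes the vertex. -/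
def CellEmbedding.nbr (E : CellEmbedding G) (y : FaceFlag G) (i : ℕ) : V :=
  (E.nx y.rev y.fst)^[i] (E.pre y).fst

theorem CellEmbedding.nbr_one (y : FaceFlag G) : E.nbr y 1 = y.snd := by
  change E.nx y.rev y.fst (E.pre y).fst = y.snd
  rw [E.pre_fst, E.nx_nx_not]

theorem CellEmbedding.adj_pre_fst (y : FaceFlag G) : G.Adj y.fst (E.pre y).fst := by
  have := (E.pre y).adj.symm
  rwa [E.pre_snd] at this

variable [Finite V]

theorem CellEmbedding.adj_nbr (y : FaceFlag G) (i : ℕ) : G.Adj y.fst (E.nbr y i) :=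
  E.adj_iterate_nx _ (E.adj_pre_fst y) i

theorem CellEmbedding.mem_flank_turn (y : FaceFlag G) (i : ℕ) (v : V) :
    v ∈ E.flank (E.turn^[i] y) ↔ v = E.nbr y i ∨ v = E.nbr y (i + 1) := by
  obtain ⟨-, -, h1, h2⟩ := E.iterate_turn y i
  rw [E.mem_flank, h1, h2]; rfl

/-- Consecutive corners at a vertex lie in different faces, unless the edge between them ends in a
vertex of degree one. -/
theorem CellEmbedding.face_turn_ne (h46 : E.FourOrSix) (hX : IsPart G X) {y : FaceFlag G}
    (h₀ : (E.pre y).fst ≠ y.snd) (h₁ : (E.turn y).snd ≠ y.snd)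
    (h₂ : (E.turn y).snd ≠ (E.pre y).fst) (hd : ∃ u, G.Adj y.snd u ∧ u ≠ y.fst) :
    E.face (E.turn y) ≠ E.face y := by
  intro hf
  rcases CellEmbedding.sameCorner_of_face h46 hX hf Iff.rfl with h | h | ⟨-, h⟩
  · have h3 : (E.turn y).snd ∈ E.flank y := by rw [← h.flank_eq]; exact Or.inr rfl
    rcases h3 with h3 | h3
    · exact h₂ h3
    · exact h₁ h3
  · have h3 : y.fst = (E.step y).snd := by
      have := h.fst_eq
      rwa [E.step_fst] at this
    rw [E.step_snd] at h3
    obtain ⟨u, hu, hu'⟩ := hd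
    exact hu' (E.eq_of_nx_eq_self y.adj.symm h3.symm u hu)
  · have h3 : (E.pre y).fst ∈ E.flank (E.turn y) := by
      rw [h.flank_eq]; exact Or.inr (E.pre_snd _).symm
    rcases h3 with h3 | h3
    · have h4 := (E.iterate_turn y 1).2.2.2
      change (E.pre (E.turn y)).fst = E.nbr y 1 at h4
      rw [h4, CellEmbedding.nbr_one] at h3
      exact h₀ h3
    · exact h₂ h3.symm

theorem ncard_adj_of_full (hX : IsPart G X) {w : V} (hw : w ∉ X) (hfull : ∀ v ∈ X, G.Adj w v) :
    {v | G.Adj w v}.ncard = X.ncard := by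
  congr 1
  ext v
  exact ⟨fun h => by by_contra hc; exact hw ((hX _ _ h).2 hc), hfull v⟩

theorem ncard_adj_of_missing (hX : IsPart G X) {w s : V} (hw : w ∉ X) (hs : s ∈ X)
    (hs' : ¬ G.Adj w s) (hfull : ∀ v ∈ X, v ≠ s → G.Adj w v) :
    {v | G.Adj w v}.ncard = X.ncard - 1 := by
  rw [← Set.ncard_sdiff_singleton_of_mem hs]
  congr 1
  ext v
  refine ⟨fun h => ⟨by by_contra hc; exact hw ((hX _ _ h).2 hc), ?_⟩, fun h => hfull v h.1 h.2⟩
  rintro rfl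
  exact hs' h

variable {m : ℕ} {y₀ : FaceFlag G}

/-- If the vertex of the corner `y₀` is adjacent to the whole part, all pairs can be taken
around this vertex. -/
theorem pairSystem_full (h46 : E.FourOrSix) (hX : IsPart G X) (hm : 2 ≤ m) (hcard : X.ncard = m)
    (hy₀ : y₀.fst ∉ X) (hfull : ∀ v ∈ X, G.Adj y₀.fst v)
    (hd : m % 2 = 1 → ∃ u, G.Adj (E.nbr y₀ (m - 2)) u ∧ u ≠ y₀.fst) :
    PairSystem E X m y₀ (fun i => E.turn^[2 * i] y₀) (E.turn^[m - 2] y₀) := by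
  have hN : {w | G.Adj y₀.fst w}.ncard = m := by rw [ncard_adj_of_full hX hy₀ hfull, hcard]
  have hinj : ∀ i j, i < m → j < m → E.nbr y₀ i = E.nbr y₀ j → i = j := fun i j hi hj h =>
    E.iterate_nx_inj hN _ (E.adj_pre_fst y₀) hi hj h
  have hface : ∀ k, k + 2 = m - 1 → m % 2 = 1 →
      E.face (E.turn^[m - 2] y₀) ≠ E.face (E.turn^[k] y₀) := by
    intro k hk ho
    rw [show m - 2 = k + 1 by omega, Function.iterate_succ_apply']
    obtain ⟨e1, -, e2, e3⟩ := E.iterate_turn y₀ k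
    obtain ⟨-, -, e4, -⟩ := E.iterate_turn y₀ (k + 1)
    rw [Function.iterate_succ_apply'] at e4
    refine CellEmbedding.face_turn_ne h46 hX ?_ ?_ ?_ ?_
    · rw [e2, e3]
      intro h
      have := hinj _ _ (by omega) (by omega) h
      omega
    · rw [e2, e4]
      intro h
      have := hinj _ _ (by omega) (by omega) h
      omega
    · rw [e3, e4]
      intro h
      have := hinj _ _ (by omega) (by omega) h
      omega
    · rw [e1, e2, show k + 1 = m - 2 by omega]
      exact hd ho
  refine ⟨hm, hcard, hy₀, ?_, ?_, ?_, ?_⟩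
  · intro i _ _
    rw [(E.iterate_turn y₀ _).1]; exact hy₀
  · intro _
    rw [(E.iterate_turn y₀ _).1]; exact hy₀
  · intro v hv
    obtain ⟨j, hj, rfl⟩ := E.exists_iterate_nx hN y₀.rev (E.adj_pre_fst y₀) (hfull v hv)
    change E.nbr y₀ j ∈ _ ∨ (∃ i, 1 ≤ i ∧ i ≤ _ ∧ E.nbr y₀ j ∈ _) ∨ (_ ∧ E.nbr y₀ j = _)
    by_cases h1 : j < 2
    · left
      rw [show E.flank y₀ = E.flank (E.turn^[0] y₀) from rfl, E.mem_flank_turn]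
      have : j = 0 ∨ j = 1 := by omega
      rcases this with rfl | rfl
      · exact Or.inl rfl
      · exact Or.inr rfl
    by_cases h2 : j / 2 ≤ (m - 2) / 2
    · refine Or.inr (Or.inl ⟨j / 2, by omega, h2, ?_⟩)
      rw [E.mem_flank_turn]
      have : j = 2 * (j / 2) ∨ j = 2 * (j / 2) + 1 := by omega
      exact this.imp (congrArg _) (congrArg _)
    · refine Or.inr (Or.inr ⟨by omega, ?_⟩)
      rw [(E.iterate_turn y₀ _).2.2.1]
      exact congrArg (E.nbr y₀) (by omega)
  · intro ho
    have he : (E.pre (E.turn^[m - 2] y₀)).fst = E.nbr y₀ (m - 2) := (E.iterate_turn y₀ _).2.2.2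
    by_cases h3 : m = 3
    · left
      refine ⟨h3, ?_, hface 0 (by omega) ho⟩
      rw [he, h3, ← CellEmbedding.nbr_one]
    · right
      refine ⟨(m - 2) / 2, by omega, le_rfl, ?_, hface _ (by omega) ho⟩
      rw [he, E.mem_flank_turn]
      right; exact congrArg (E.nbr y₀) (by omega)

/-- If `m` is even and the vertex of the corner `y₀` is adjacent to the whole part except for `s`,
the pairs can be taken around this vertex except for one, which consists of `s` and another
vertex, provided that the latter is at an even distance from the beginning. -/
theorem pairSystem_hole (hX : IsPart G X) (hcard : X.ncard = m)
    (hy₀ : y₀.fst ∉ X) {s : V} (hs : s ∈ X) (hs' : ¬ G.Adj y₀.fst s)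
    (hfull : ∀ v ∈ X, v ≠ s → G.Adj y₀.fst v) (hm : m % 2 = 0) {h : ℕ} (h2 : 2 ≤ h)
    (hlt : h < m - 1) (he : h % 2 = 0) {ψ : FaceFlag G} (hψ : ψ.fst ∉ X) (hψs : s ∈ E.flank ψ)
    (hψh : E.nbr y₀ h ∈ E.flank ψ) :
    ∃ Y : ℕ → FaceFlag G, PairSystem E X m y₀ Y ψ ∧
      ∀ y, IsNoncentral m Y ψ y → y.fst = y₀.fst ∨ y = ψ := by
  have hN : {w | G.Adj y₀.fst w}.ncard = m - 1 := by
    rw [ncard_adj_of_missing hX hy₀ hs hs' hfull, hcard]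
  let Y : ℕ → FaceFlag G := fun i => if 2 * i < h then E.turn^[2 * i] y₀ else
    if i < (m - 2) / 2 then E.turn^[2 * i + 1] y₀ else ψ
  have hYc : ∀ i, (Y i).fst = y₀.fst ∨ Y i = ψ := by
    intro i
    simp only [Y]
    split_ifs
    · exact Or.inl (E.iterate_turn y₀ _).1
    · exact Or.inl (E.iterate_turn y₀ _).1
    · exact Or.inr rfl
  have hYt : Y ((m - 2) / 2) = ψ := by
    simp only [Y]
    rw [if_neg (by omega), if_neg (by omega)]
  refine ⟨Y, ⟨by omega, hcard, hy₀, ?_, fun ho => by omega, ?_, fun ho => by omega⟩, ?_⟩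
  · intro i _ _
    rcases hYc i with h | h
    · rw [h]; exact hy₀
    · rw [h]; exact hψ
  · intro v hv
    by_cases hvs : v = s
    · subst hvs
      exact Or.inr (Or.inl ⟨(m - 2) / 2, by omega, le_rfl, by rwa [hYt]⟩)
    obtain ⟨j, hj, rfl⟩ := E.exists_iterate_nx hN y₀.rev (E.adj_pre_fst y₀) (hfull v hv hvs)
    change E.nbr y₀ j ∈ _ ∨ (∃ i, 1 ≤ i ∧ i ≤ _ ∧ E.nbr y₀ j ∈ _) ∨ (_ ∧ E.nbr y₀ j = _)
    by_cases h1 : j < 2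
    · left
      rw [show E.flank y₀ = E.flank (E.turn^[0] y₀) from rfl, E.mem_flank_turn]
      have : j = 0 ∨ j = 1 := by omega
      rcases this with rfl | rfl
      · exact Or.inl rfl
      · exact Or.inr rfl
    refine Or.inr (Or.inl ?_)
    rcases Nat.lt_trichotomy j h with h3 | rfl | h3
    · refine ⟨j / 2, by omega, by omega, ?_⟩
      simp only [Y]
      rw [if_pos (by omega), E.mem_flank_turn]
      have : j = 2 * (j / 2) ∨ j = 2 * (j / 2) + 1 := by omega
      exact this.imp (congrArg _) (congrArg _)
    · exact ⟨(m - 2) / 2, by omega, le_rfl, by rwa [hYt]⟩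
    · refine ⟨(j - 1) / 2, by omega, by omega, ?_⟩
      simp only [Y]
      rw [if_neg (by omega), if_pos (by omega), E.mem_flank_turn]
      have : j = 2 * ((j - 1) / 2) + 1 ∨ j = 2 * ((j - 1) / 2) + 1 + 1 := by omega
      exact this.imp (congrArg _) (congrArg _)
  · rintro y (⟨i, -, -, rfl⟩ | ⟨ho, -⟩)
    · exact hYc i
    · omega

/-- If `m` is odd and the vertex of the corner `y₀` is adjacent to the whole part except for `s`,
the pairs can be taken around this vertex except for the additional one, which contains `s`. -/
theorem pairSystem_extra (hq : E.IsQuadrilateral) (hX : IsPart G X) (hcard : X.ncard = m)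
    (hy₀ : y₀.fst ∉ X) {s : V} (hs : s ∈ X) (hs' : ¬ G.Adj y₀.fst s)
    (hfull : ∀ v ∈ X, v ≠ s → G.Adj y₀.fst v) (hm : m % 2 = 1) {h : ℕ} (h2 : 2 ≤ h)
    (hlt : h < m - 1) {ψ : FaceFlag G} (hψ : ψ.fst ∉ X) (hψs : ψ.snd = s)
    (hψh : (E.pre ψ).fst = E.nbr y₀ h) :
    ∃ Y : ℕ → FaceFlag G, PairSystem E X m y₀ Y ψ ∧
      ∀ y, IsNoncentral m Y ψ y → y.fst = y₀.fst ∨ y = ψ := by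
  have hN : {w | G.Adj y₀.fst w}.ncard = m - 1 := by
    rw [ncard_adj_of_missing hX hy₀ hs hs' hfull, hcard]
  have hmem : ∀ j, 2 ≤ j → j < m - 1 → 1 ≤ j / 2 ∧ j / 2 ≤ (m - 2) / 2 ∧
      E.nbr y₀ j ∈ E.flank (E.turn^[2 * (j / 2)] y₀) := by
    intro j h1 h2
    refine ⟨by omega, by omega, ?_⟩
    rw [E.mem_flank_turn]
    have : j = 2 * (j / 2) ∨ j = 2 * (j / 2) + 1 := by omega
    exact this.imp (congrArg _) (congrArg _)
  refine ⟨fun i => E.turn^[2 * i] y₀, ⟨by omega, hcard, hy₀, ?_, fun _ => hψ, ?_, ?_⟩, ?_⟩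
  · intro i _ _
    rw [(E.iterate_turn y₀ _).1]; exact hy₀
  · intro v hv
    by_cases hvs : v = s
    · exact Or.inr (Or.inr ⟨hm, by rw [hψs, hvs]⟩)
    obtain ⟨j, hj, rfl⟩ := E.exists_iterate_nx hN y₀.rev (E.adj_pre_fst y₀) (hfull v hv hvs)
    change E.nbr y₀ j ∈ _ ∨ (∃ i, 1 ≤ i ∧ i ≤ _ ∧ E.nbr y₀ j ∈ _) ∨ (_ ∧ E.nbr y₀ j = _)
    by_cases h1 : j < 2
    · left
      rw [show E.flank y₀ = E.flank (E.turn^[0] y₀) from rfl, E.mem_flank_turn]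
      have : j = 0 ∨ j = 1 := by omega
      rcases this with rfl | rfl
      · exact Or.inl rfl
      · exact Or.inr rfl
    · exact Or.inr (Or.inl ⟨j / 2, hmem j (by omega) hj⟩)
  · intro _
    refine Or.inr ⟨h / 2, (hmem h h2 hlt).1, (hmem h h2 hlt).2.1, ?_, fun hf => ?_⟩
    · rw [hψh]
      exact (hmem h h2 hlt).2.2
    · have h3 := CellEmbedding.flank_eq_of_face hq hX hf (by
        rw [(E.iterate_turn y₀ _).1]; simp [hψ, hy₀])
      have h4 : s ∈ E.flank ψ := Or.inr hψs.symm
      rw [h3, E.mem_flank_turn] at h4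
      rcases h4 with h4 | h4 <;> rw [h4] at hs' <;> exact hs' (E.adj_nbr _ _)
  · rintro y (⟨i, -, -, rfl⟩ | ⟨-, rfl⟩)
    · exact Or.inl (E.iterate_turn y₀ _).1
    · exact Or.inr rfl

/-- If the vertex of the corner `y₀` is adjacent to the whole part except for `s`, the pairs can be
taken around this vertex except for one, at the corner `ψ`, which contains `s`; its other vertex has
to be at an even distance from the beginning only if `m` is even. -/
theorem pairSystem_missing (hq : m % 2 = 1 → E.IsQuadrilateral) (hX : IsPart G X)
    (hcard : X.ncard = m) (hy₀ : y₀.fst ∉ X) {s : V} (hs : s ∈ X) (hs' : ¬ G.Adj y₀.fst s)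
    (hfull : ∀ v ∈ X, v ≠ s → G.Adj y₀.fst v) {h : ℕ} (h2 : 2 ≤ h)
    (hlt : h < m - 1) (he : m % 2 = 0 → h % 2 = 0) {ψ : FaceFlag G} (hψ : ψ.fst ∉ X)
    (hψs : ψ.snd = s) (hψh : (E.pre ψ).fst = E.nbr y₀ h) :
    ∃ Y : ℕ → FaceFlag G, PairSystem E X m y₀ Y ψ ∧
      ∀ y, IsNoncentral m Y ψ y → y.fst = y₀.fst ∨ y = ψ := by
  rcases Nat.mod_two_eq_zero_or_one m with h0 | h1
  · exact pairSystem_hole hX hcard hy₀ hs hs' hfull h0 h2 hlt (he h0) hψ (Or.inr hψs.symm)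
      (Or.inl hψh.symm)
  · exact pairSystem_extra (hq h1) hX hcard hy₀ hs hs' hfull h1 h2 hlt hψ hψs hψh

end AroundVertex

/-! ### Configurations in nearly complete bipartite graphs -/

section NearlyComplete

variable {V : Type*} [DecidableEq V] {G : SimpleGraph V} {E : CellEmbedding G} {X : Set V}

/-- Every vertex is adjacent to all vertices of the other part, with at most one exception. -/
structure IsNearlyComplete (G : SimpleGraph V) (X : Set V) : Prop where
  left : ∀ v ∈ X, ∀ w ∉ X, ∀ w' ∉ X, ¬ G.Adj v w → ¬ G.Adj v w' → w = w'
  right : ∀ w ∉ X, ∀ v ∈ X, ∀ v' ∈ X, ¬ G.Adj w v → ¬ G.Adj w v' → v = v'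

theorem IsNearlyComplete.compl (h : IsNearlyComplete G X) : IsNearlyComplete G Xᶜ where
  left v hv w hw w' hw' := h.right v hv w (not_not.1 hw) w' (not_not.1 hw')
  right w hw v hv v' hv' := h.left w (not_not.1 hw) v hv v' hv'

theorem exists_flag_of_step_rev {a b : V} (h : G.Adj a b) (r : Bool) :
    ∃ z : FaceFlag G, z.fst = a ∧ z.snd = b ∧ (E.step z).rev = r :=
  ⟨⟨a, b, h, r ^^ E.twist s(a, b)⟩, rfl, rfl, by rw [E.step_rev]; simp⟩

theorem exists_flag_of_back_rev {a b : V} (h : G.Adj a b) (r : Bool) :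
    ∃ z : FaceFlag G, z.fst = a ∧ z.snd = b ∧ (E.back z).rev = r :=
  ⟨⟨a, b, h, !r⟩, rfl, rfl, by rw [E.back_rev]; simp⟩

theorem CellEmbedding.nbr_step (z : FaceFlag G) (i : ℕ) :
    E.nbr (E.step z) i = (E.nx (E.step z).rev z.snd)^[i] z.fst := by
  unfold CellEmbedding.nbr
  rw [E.pre_step, E.step_fst]

theorem CellEmbedding.nbr_back (z : FaceFlag G) (i : ℕ) :
    E.nbr (E.back z) i = (E.nx (E.back z).rev z.fst)^[i] z.snd := by
  unfold CellEmbedding.nbr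
  rw [E.pre_back, E.back_fst, E.back_fst, E.step_fst]

variable [Finite V] {m n : ℕ}

theorem exists_notMem_of_ncard_lt {Y S : Set V} (h : S.ncard < Y.ncard) : ∃ v ∈ Y, v ∉ S := by
  by_contra! hc
  exact absurd (Set.ncard_le_ncard hc (Set.toFinite S)) (by omega)

theorem ncard_insert_le {S : Set V} (a : V) {k : ℕ} (h : S.ncard ≤ k) :
    (insert a S : Set V).ncard ≤ k + 1 :=
  (Set.ncard_insert_le a S).trans (by omega)

theorem IsNearlyComplete.exists_adj_ne (h : IsNearlyComplete G X) (hn : 3 ≤ (Xᶜ : Set V).ncard)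
    {v : V} (hv : v ∈ X) (b : V) : ∃ u, G.Adj v u ∧ u ≠ b := by
  obtain ⟨w, hw, hwb⟩ := exists_notMem_of_ncard_lt (Y := Xᶜ) (S := {b})
    (by rw [Set.ncard_singleton]; omega)
  obtain ⟨w', hw', hwb'⟩ := exists_notMem_of_ncard_lt (Y := Xᶜ) (S := {w, b})
    (lt_of_le_of_lt (ncard_insert_le w (Set.ncard_singleton b).le) (by omega))
  simp only [Set.mem_singleton_iff, Set.mem_insert_iff, not_or] at hwb hwb'
  by_cases h1 : G.Adj v w
  · exact ⟨w, h1, hwb⟩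
  · by_cases h2 : G.Adj v w'
    · exact ⟨w', h2, hwb'.2⟩
    · exact absurd (h.left v hv w hw w' hw' h1 h2).symm hwb'.1

/-- Around a vertex of degree at least three, one of the two directions leads from `p` to `q` in at
least two steps, and in an even number of steps if the degree is odd. -/
theorem exists_direction {v p q : V} {N : ℕ} (hN : {w | G.Adj v w}.ncard = N) (hN3 : 3 ≤ N)
    (hp : G.Adj v p) (hq : G.Adj v q) (hpq : p ≠ q) :
    ∃ r h, 2 ≤ h ∧ h < N ∧ (N % 2 = 1 → h % 2 = 0) ∧ (E.nx r v)^[h] p = q := by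
  by_cases ho : N % 2 = 1
  · obtain ⟨h, hlt, hh⟩ := E.exists_iterate_nx hN false hp hq
    have h0 : h ≠ 0 := by rintro rfl; exact hpq hh
    by_cases he : h % 2 = 0
    · exact ⟨false, h, by omega, hlt, fun _ => he, hh⟩
    · refine ⟨true, N - h, by omega, by omega, fun _ => by omega, ?_⟩
      rw [← hh]
      exact E.iterate_nx_not hN false hp hlt.le
  · obtain ⟨r, hr⟩ : ∃ r, E.nx r v p ≠ q := by
      by_contra! hc
      exact E.nx_ne_nx_not (by omega) false hp ((hc false).trans (hc true).symm)
    obtain ⟨h, hlt, hh⟩ := E.exists_iterate_nx hN r hp hq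
    have h0 : h ≠ 0 := by rintro rfl; exact hpq hh
    have h1 : h ≠ 1 := by rintro rfl; exact hr hh
    exact ⟨r, h, by omega, hlt, fun h => absurd h ho, hh⟩

/-- A configuration around two adjacent vertices of full degree. -/
theorem hasConfiguration_of_flag (h46 : E.FourOrSix) (hX : IsPart G X) (hm : X.ncard = m)
    (hn : (Xᶜ : Set V).ncard = n) (hm2 : 2 ≤ m) (hn2 : 2 ≤ n) {z : FaceFlag G} (hz : z.fst ∈ X)
    (hA : ∀ v ∈ X, G.Adj z.snd v) (hB : ∀ w ∉ X, G.Adj z.fst w)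
    (hdA : m % 2 = 1 → ∃ u, G.Adj (E.nbr (E.step z) (m - 2)) u ∧ u ≠ z.snd)
    (hdB : n % 2 = 1 → ∃ u, G.Adj (E.nbr (E.back z) (n - 2)) u ∧ u ≠ z.fst) :
    HasConfiguration E X m n := by
  have hz' : z.snd ∉ X := (hX _ _ z.adj).1 hz
  have h1 := pairSystem_full h46 hX hm2 hm (y₀ := E.step z) (by rwa [E.step_fst])
    (by rwa [E.step_fst]) (by rwa [E.step_fst])
  have h2 := pairSystem_full h46 hX.compl hn2 hn (y₀ := E.back z)
    (by rw [E.back_fst]; exact not_not.2 hz) (by rw [E.back_fst]; exact hB) (by rwa [E.back_fst])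
  refine ⟨z, _, _, _, _, h1, h2, fun y y' hy hy' => Or.inl ?_⟩
  rcases hy with ⟨i, -, -, rfl⟩ | ⟨-, rfl⟩ <;> rw [(E.iterate_turn _ _).1, E.step_fst]

/-- A configuration in case that one of the parts has only two vertices. -/
theorem hasConfiguration_of_full_of_two (h46 : E.FourOrSix) (hX : IsPart G X)
    (hG : IsNearlyComplete G X) (hm : X.ncard = m) (hn : (Xᶜ : Set V).ncard = 2) (hm2 : 2 ≤ m)
    {a₀ b₀ : V} (ha₀ : a₀ ∈ X) (hb₀ : b₀ ∉ X) (ha : ∀ w ∉ X, G.Adj a₀ w)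
    (hb : ∀ v ∈ X, G.Adj b₀ v) : HasConfiguration E X m 2 := by
  obtain ⟨b₁, hb₁, hb₁'⟩ := exists_notMem_of_ncard_lt (Y := Xᶜ) (S := {b₀})
    (by rw [Set.ncard_singleton]; omega)
  have hb01 : b₁ ≠ b₀ := hb₁'
  have htwo : ∀ w ∉ X, w = b₀ ∨ w = b₁ := by
    intro w hw
    by_contra! hc
    obtain ⟨h1, h2⟩ := hc
    have h3 : ({w, b₁, b₀} : Set V).ncard ≤ 2 := by
      rw [← hn]
      refine Set.ncard_le_ncard ?_ (Set.toFinite _)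
      rintro x (rfl | rfl | rfl)
      exacts [hw, hb₁, hb₀]
    rw [Set.ncard_insert_of_notMem (by simp [h1, h2]), Set.ncard_pair hb01] at h3
    omega
  by_cases hfull : ∀ v ∈ X, G.Adj v b₁
  · obtain ⟨z, hz1, hz2, -⟩ := exists_flag_of_step_rev (E := E) (hb a₀ ha₀).symm false
    refine hasConfiguration_of_flag h46 hX hm hn hm2 le_rfl (z := z) (by rwa [hz1])
      (by rwa [hz2]) (by rwa [hz1]) (fun _ => ⟨b₁, hfull _ ?_, by rwa [hz2]⟩) (by omega)
    have h := E.adj_nbr (E.step z) (m - 2)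
    rw [E.step_fst, hz2] at h
    by_contra hc
    exact hb₀ ((hX _ _ h).2 hc)
  · -- `a₁` has degree one; it is met last around `b₀`
    push Not at hfull
    obtain ⟨a₁, ha₁, ha₁'⟩ := hfull
    have hN : {v | G.Adj b₀ v}.ncard = m := by rw [ncard_adj_of_full hX hb₀ hb, hm]
    set a := E.nx false b₀ a₁ with hadef
    have haX : ∀ {v}, G.Adj b₀ v → v ∈ X := fun {v} h => by
      by_contra hc; exact hb₀ ((hX _ _ h).2 hc)
    have haa : a ≠ a₁ := E.nx_ne_self (by omega) false (hb a₁ ha₁)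
    have hab : G.Adj b₀ a := E.adj_nx false (hb a₁ ha₁)
    have hadj : ∀ v ∈ X, v ≠ a₁ → G.Adj v b₁ := by
      intro v hv hne
      by_contra hc
      exact hne (hG.right b₁ hb₁ v hv a₁ ha₁ (fun h => hc h.symm) fun h => ha₁' h.symm)
    obtain ⟨z, hz1, hz2, hz3⟩ := exists_flag_of_step_rev (E := E) hab.symm false
    refine hasConfiguration_of_flag h46 hX hm hn hm2 le_rfl (z := z) (by rw [hz1]; exact haX hab)
      (by rwa [hz2]) ?_ (fun _ => ⟨b₁, hadj _ ?_ ?_, by rwa [hz2]⟩) (by omega)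
    · rw [hz1]
      intro w hw
      rcases htwo w hw with rfl | rfl
      · exact hab.symm
      · exact hadj a (haX hab) haa
    · have h := E.adj_nbr (E.step z) (m - 2)
      rw [E.step_fst, hz2] at h
      exact haX h
    · rw [CellEmbedding.nbr_step, hz1, hz2, hz3]
      intro h
      have h1 : (E.nx false b₀)^[m - 1] a = a₁ := by
        rw [hadef, ← Function.iterate_succ_apply, show (m - 1).succ = m by omega]
        exact E.iterate_nx_eq hN false (hb a₁ ha₁)
      have := E.iterate_nx_inj hN false hab (by omega) (by omega) (h.trans h1.symm)
      omega

/-- A configuration in case that there is a vertex of full degree in each part. -/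
theorem hasConfiguration_of_full (h46 : E.FourOrSix) (hX : IsPart G X)
    (hG : IsNearlyComplete G X) (hm : X.ncard = m) (hn : (Xᶜ : Set V).ncard = n) (hm2 : 2 ≤ m)
    (hn2 : 2 ≤ n) {a₀ b₀ : V} (ha₀ : a₀ ∈ X) (hb₀ : b₀ ∉ X) (ha : ∀ w ∉ X, G.Adj a₀ w)
    (hb : ∀ v ∈ X, G.Adj b₀ v) : HasConfiguration E X m n := by
  rcases hn2.eq_or_lt with rfl | hn3
  · exact hasConfiguration_of_full_of_two h46 hX hG hm hn hm2 ha₀ hb₀ ha hb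
  rcases hm2.eq_or_lt with rfl | hm3
  · have h := hasConfiguration_of_full_of_two h46 hX.compl hG.compl hn (by rwa [compl_compl]) hn2
      hb₀ (not_not.2 ha₀) (fun v hv => hb v (not_not.1 hv)) ha
    simpa only [compl_compl] using h.swap
  obtain ⟨z, hz1, hz2, -⟩ := exists_flag_of_step_rev (E := E) (hb a₀ ha₀).symm false
  refine hasConfiguration_of_flag h46 hX hm hn hm2 hn2 (z := z) (by rwa [hz1])
    (by rwa [hz2]) (by rwa [hz1]) (fun _ => hG.exists_adj_ne (by omega) ?_ _)
    (fun _ => hG.compl.exists_adj_ne (by rw [compl_compl]; omega) ?_ _)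
  · have h := E.adj_nbr (E.step z) (m - 2)
    rw [E.step_fst, hz2] at h
    by_contra hc
    exact hb₀ ((hX _ _ h).2 hc)
  · have h := E.adj_nbr (E.back z) (n - 2)
    rw [E.back_fst, hz1] at h
    exact (hX _ _ h).1 ha₀

/-- A configuration in case that there is a vertex of full degree in the part `X`, but none in the
other part: the pairs of the latter are taken around a vertex `a₀` of full degree, and those
of `X` around any vertex `b₀`, except for one. -/
theorem hasConfiguration_of_full_left (h46 : E.FourOrSix) (hq : m % 2 = 1 → E.IsQuadrilateral)
    (hX : IsPart G X) (hG : IsNearlyComplete G X) (hm : X.ncard = m)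
    (hn : (Xᶜ : Set V).ncard = n) (hm4 : 4 ≤ m) (hn2 : 2 ≤ n) {a₀ : V} (ha₀ : a₀ ∈ X)
    (ha : ∀ w ∉ X, G.Adj a₀ w) (hmiss : ∀ w ∉ X, ∃ v ∈ X, ¬ G.Adj w v) :
    HasConfiguration E X m n := by
  obtain ⟨b₀, hb₀, -⟩ := exists_notMem_of_ncard_lt (Y := Xᶜ) (S := ∅) (by rw [Set.ncard_empty]; omega)
  obtain ⟨b, hb, hbb⟩ := exists_notMem_of_ncard_lt (Y := Xᶜ) (S := {b₀})
    (by rw [Set.ncard_singleton]; omega)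
  have hbb : b ≠ b₀ := hbb
  obtain ⟨s, hs, hs'⟩ := hmiss b₀ hb₀
  obtain ⟨s', hs₁, hs₁'⟩ := hmiss b hb
  have hadj : ∀ {w t : V}, w ∉ X → t ∈ X → ¬ G.Adj w t → ∀ v ∈ X, v ≠ t → G.Adj w v := by
    intro w t hw ht hwt v hv hne
    by_contra hc
    exact hne (hG.right w hw v hv t ht hc hwt)
  have hbs : G.Adj b s := by
    by_contra hc
    exact hbb (hG.left s hs b hb b₀ hb₀ (fun h => hc h.symm) fun h => hs' h.symm)
  have hNb := ncard_adj_of_missing hX hb hs₁ hs₁' (hadj hb hs₁ hs₁')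
  have hN := ncard_adj_of_missing hX hb₀ hs hs' (hadj hb₀ hs hs')
  rw [hm] at hNb hN
  obtain ⟨r, hr⟩ : ∃ r, E.nx r b s ≠ a₀ := by
    by_contra! hc
    exact E.nx_ne_nx_not (by omega) false hbs ((hc false).trans (hc true).symm)
  have hbX : ∀ {w v : V}, w ∉ X → G.Adj w v → v ∈ X := fun {w v} hw h => by
    by_contra hc; exact hw ((hX _ _ h).2 hc)
  have hne : E.nx r b s ≠ s := E.nx_ne_self (by omega) r hbs
  have h₀ : G.Adj b₀ (E.nx r b s) := hadj hb₀ hs hs' _ (hbX hb (E.adj_nx r hbs)) hne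
  have hab := (ha b₀ hb₀).symm
  obtain ⟨ρ, h, h2, hlt, he, hh⟩ := exists_direction (E := E) hN (by omega) hab h₀ hr.symm
  obtain ⟨z, hz1, hz2, hz3⟩ := exists_flag_of_step_rev (E := E) hab.symm ρ
  let ψ : FaceFlag G := ⟨b, s, hbs, !r⟩
  have hψ : (E.pre ψ).fst = E.nx r b s := by rw [E.pre_fst]; simp [ψ]
  obtain ⟨Y, hY, -⟩ := pairSystem_missing (y₀ := E.step z) hq hX hm (by rwa [E.step_fst, hz2]) hs
    (by rwa [E.step_fst, hz2]) (by rw [E.step_fst, hz2]; exact hadj hb₀ hs hs') h2 hlt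
    (fun h => he (by omega)) (ψ := ψ) hb rfl
    (by rw [hψ, CellEmbedding.nbr_step, hz1, hz2, hz3, hh])
  have hY' := pairSystem_full h46 hX.compl hn2 hn (y₀ := E.back z)
    (by rw [E.back_fst, hz1]; exact not_not.2 ha₀) (by rw [E.back_fst, hz1]; exact ha)
    (fun _ => hG.compl.exists_adj_ne (by rw [compl_compl]; omega) (by
      have h := E.adj_nbr (E.back z) (n - 2)
      rw [E.back_fst, hz1] at h
      exact (hX _ _ h).1 ha₀) _)
  refine ⟨z, _, _, _, _, hY, hY', fun y y' hy hy' => Or.inr (Or.inl ?_)⟩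
  rcases hy' with ⟨i, -, -, rfl⟩ | ⟨-, rfl⟩ <;> rw [(E.iterate_turn _ _).1, E.back_fst]

/-- Let `b₀` be a vertex of odd degree and `a'`, `a''` two of its neighbours.  One of the two arcs
around `b₀` from `a'` to `a''` has even length; from an inner vertex of this arc, each of the two
directions leads to `a'` or to `a''` in an even number of steps. -/
theorem exists_both_directions_of_odd {b₀ : V} {N : ℕ} (hN : {w | G.Adj b₀ w}.ncard = N)
    (hodd : N % 2 = 1) (hN3 : 3 ≤ N) {a : Bool → V} (ha : ∀ r, G.Adj b₀ (a r))
    (hne : a false ≠ a true) : ∃ a₀, G.Adj b₀ a₀ ∧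
      ∀ ρ, ∃ h r, 2 ≤ h ∧ h < N ∧ h % 2 = 0 ∧ (E.nx ρ b₀)^[h] a₀ = a r := by
  obtain ⟨ρ₀, q, h2, hlt, he, hq⟩ := exists_direction (E := E) hN hN3 (ha false) (ha true) hne
  have he := he hodd
  have hadj : G.Adj b₀ (E.nx ρ₀ b₀ (a false)) := E.adj_nx ρ₀ (ha false)
  refine ⟨E.nx ρ₀ b₀ (a false), hadj, fun ρ => ?_⟩
  rcases Bool.eq_or_eq_not ρ ρ₀ with rfl | rfl
  · refine ⟨N - 1, false, by omega, by omega, by omega, ?_⟩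
    rw [← Function.iterate_succ_apply, show (N - 1).succ = N by omega]
    exact E.iterate_nx_eq hN ρ (ha false)
  · refine ⟨N - (q - 1), true, by omega, by omega, by omega, ?_⟩
    rw [E.iterate_nx_not hN ρ₀ hadj (by omega), ← Function.iterate_succ_apply,
      show (q - 1).succ = q by omega, hq]

/-- Around a vertex of degree at least four, any vertex other than `a` and its two neighbours in the
rotation is at distance at least two from `a` in both directions. -/
theorem exists_both_directions_of_even {b₀ : V} {N : ℕ} (hN : {w | G.Adj b₀ w}.ncard = N)
    (hN4 : 4 ≤ N) {a : V} (ha : G.Adj b₀ a) : ∃ a₀, G.Adj b₀ a₀ ∧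
      ∀ ρ, ∃ h, 2 ≤ h ∧ h < N ∧ (E.nx ρ b₀)^[h] a₀ = a := by
  obtain ⟨a₀, h₀, h₁⟩ := exists_notMem_of_ncard_lt (Y := {w | G.Adj b₀ w})
    (S := {a, E.nx false b₀ a, E.nx true b₀ a})
    (lt_of_le_of_lt (ncard_insert_le a (ncard_insert_le _ (Set.ncard_singleton _).le)) (by omega))
  simp only [Set.mem_insert_iff, Set.mem_singleton_iff, not_or] at h₁
  have h₀ : G.Adj b₀ a₀ := h₀
  refine ⟨a₀, h₀, fun ρ => ?_⟩
  obtain ⟨h, hlt, hh⟩ := E.exists_iterate_nx hN ρ h₀ ha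
  have h0 : h ≠ 0 := by rintro rfl; exact h₁.1 hh
  have h1 : h ≠ 1 := by
    rintro rfl
    have h3 : a₀ = E.nx (!ρ) b₀ a := by
      rw [← hh]; exact (E.nx_not_nx ρ b₀ a₀).symm
    cases ρ
    · exact h₁.2.2 h3
    · exact h₁.2.1 h3
  exact ⟨h, by omega, hlt, hh⟩

/-- A configuration in case that no vertex has full degree: the pairs of the two parts are taken
around adjacent vertices `b₀` and `a₀`, except for one in each part. -/
theorem hasConfiguration_of_missing (hq : E.IsQuadrilateral) (hX : IsPart G X)
    (hG : IsNearlyComplete G X) (hm : X.ncard = m) (hn : (Xᶜ : Set V).ncard = n) (hm5 : 5 ≤ m)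
    (hn4 : 4 ≤ n) (hmissA : ∀ v ∈ X, ∃ w ∉ X, ¬ G.Adj v w)
    (hmissB : ∀ w ∉ X, ∃ v ∈ X, ¬ G.Adj w v) : HasConfiguration E X m n := by
  have hadjB : ∀ {w t : V}, w ∉ X → t ∈ X → ¬ G.Adj w t → ∀ v ∈ X, v ≠ t → G.Adj w v := by
    intro w t hw ht hwt v hv hne
    by_contra hc
    exact hne (hG.right w hw v hv t ht hc hwt)
  have hadjA : ∀ {v t : V}, v ∈ X → t ∉ X → ¬ G.Adj v t → ∀ w ∉ X, w ≠ t → G.Adj v w := by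
    intro v t hv ht hvt w hw hne
    by_contra hc
    exact hne (hG.left v hv w hw t ht hc hvt)
  have hNB : ∀ {w}, w ∉ X → {v | G.Adj w v}.ncard = m - 1 := by
    intro w hw
    obtain ⟨v, hv, hv'⟩ := hmissB w hw
    rw [ncard_adj_of_missing hX hw hv hv' (hadjB hw hv hv'), hm]
  have hNA : ∀ {v}, v ∈ X → {w | G.Adj v w}.ncard = n - 1 := by
    intro v hv
    obtain ⟨w, hw, hw'⟩ := hmissA v hv
    rw [ncard_adj_of_missing hX.compl (not_not.2 hv) hw hw' (hadjA hv hw hw'), hn]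
  have hbX : ∀ {w v : V}, w ∉ X → G.Adj w v → v ∈ X := fun {w v} hw h => by
    by_contra hc; exact hw ((hX _ _ h).2 hc)
  have haX : ∀ {v w : V}, v ∈ X → G.Adj v w → w ∉ X := fun {v w} hv h => (hX _ _ h).1 hv
  obtain ⟨b₀, hb₀, -⟩ := exists_notMem_of_ncard_lt (Y := Xᶜ) (S := ∅) (by rw [Set.ncard_empty]; omega)
  obtain ⟨b, hb, hbb⟩ := exists_notMem_of_ncard_lt (Y := Xᶜ) (S := {b₀})
    (by rw [Set.ncard_singleton]; omega)
  have hbb : b ≠ b₀ := hbb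
  obtain ⟨s, hs, hs'⟩ := hmissB b₀ hb₀
  have hbs : G.Adj b s := by
    by_contra hc
    exact hbb (hG.left s hs b hb b₀ hb₀ (fun h => hc h.symm) fun h => hs' h.symm)
  have h₀ : ∀ r, G.Adj b₀ (E.nx r b s) := fun r =>
    hadjB hb₀ hs hs' _ (hbX hb (E.adj_nx r hbs)) (E.nx_ne_self (by rw [hNB hb]; omega) r hbs)
  obtain ⟨a₀, hab, hdir⟩ : ∃ a₀, G.Adj b₀ a₀ ∧ ∀ ρ, ∃ h r, 2 ≤ h ∧ h < m - 1 ∧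
      (m % 2 = 0 → h % 2 = 0) ∧ (E.nx ρ b₀)^[h] a₀ = E.nx r b s := by
    rcases Nat.mod_two_eq_zero_or_one m with hme | hmo
    · obtain ⟨a₀, h1, h2⟩ := exists_both_directions_of_odd (E := E) (hNB hb₀) (by omega) (by omega)
        (a := fun r => E.nx r b s) h₀ (E.nx_ne_nx_not (by rw [hNB hb]; omega) false hbs)
      refine ⟨a₀, h1, fun ρ => ?_⟩
      obtain ⟨h, r, h3, h4, h5, h6⟩ := h2 ρ
      exact ⟨h, r, h3, h4, fun _ => h5, h6⟩
    · obtain ⟨a₀, h1, h2⟩ := exists_both_directions_of_even (E := E) (hNB hb₀) (by omega) (h₀ false)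
      refine ⟨a₀, h1, fun ρ => ?_⟩
      obtain ⟨h, h3, h4, h6⟩ := h2 ρ
      exact ⟨h, false, h3, h4, by omega, h6⟩
  have ha₀ : a₀ ∈ X := hbX hb₀ hab
  obtain ⟨t, ht, ht'⟩ := hmissA a₀ ha₀
  -- the corner `χ` is chosen at a vertex that is not a neighbour of the corner `ψ`
  obtain ⟨a, ha, haS⟩ := exists_notMem_of_ncard_lt (Y := X) (S := {a₀, s, E.nx false b s, E.nx true b s})
    (lt_of_le_of_lt (ncard_insert_le a₀ (ncard_insert_le s (ncard_insert_le _
      (Set.ncard_singleton _).le))) (by omega))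
  simp only [Set.mem_insert_iff, Set.mem_singleton_iff, not_or] at haS
  have hat : G.Adj a t := by
    by_contra hc
    exact haS.1 (hG.right t ht a ha a₀ ha₀ (fun h => hc h.symm) fun h => ht' h.symm)
  obtain ⟨r', hr'⟩ : ∃ r, E.nx r a t ≠ b₀ := by
    by_contra! hc
    exact E.nx_ne_nx_not (by rw [hNA ha]; omega) false hat ((hc false).trans (hc true).symm)
  have h₁ : G.Adj a₀ (E.nx r' a t) :=
    hadjA ha₀ ht ht' _ (haX ha (E.adj_nx r' hat)) (E.nx_ne_self (by rw [hNA ha]; omega) r' hat)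
  obtain ⟨σ, h', h2', hlt', he', hh'⟩ := exists_direction (E := E) (hNA ha₀) (by omega) hab.symm h₁
    hr'.symm
  obtain ⟨z, hz1, hz2, hz3⟩ := exists_flag_of_back_rev (E := E) hab.symm σ
  obtain ⟨h, r, h2, hlt, he, hh⟩ := hdir (E.step z).rev
  let ψ : FaceFlag G := ⟨b, s, hbs, !r⟩
  have hψ : (E.pre ψ).fst = E.nx r b s := by rw [E.pre_fst]; simp [ψ]
  let χ : FaceFlag G := ⟨a, t, hat, !r'⟩
  have hχ : (E.pre χ).fst = E.nx r' a t := by rw [E.pre_fst]; simp [χ]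
  obtain ⟨Y, hY, hYc⟩ := pairSystem_missing (y₀ := E.step z) (fun _ => hq) hX hm
    (by rwa [E.step_fst, hz2]) hs
    (by rwa [E.step_fst, hz2]) (by rw [E.step_fst, hz2]; exact hadjB hb₀ hs hs') h2 hlt
    he (ψ := ψ) hb rfl
    (by rw [hψ, CellEmbedding.nbr_step, hz1, hz2, hh])
  obtain ⟨Y', hY', hYc'⟩ := pairSystem_missing (y₀ := E.back z) (fun _ => hq) hX.compl hn
    (by rw [E.back_fst, hz1]; exact not_not.2 ha₀) ht
    (by rwa [E.back_fst, hz1]) (by rw [E.back_fst, hz1]; exact hadjA ha₀ ht ht') h2' hlt'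
    (fun h => he' (by omega)) (ψ := χ) (not_not.2 ha) rfl
    (by rw [hχ, CellEmbedding.nbr_back, hz1, hz2, hz3, hh'])
  refine ⟨z, _, _, _, _, hY, hY', fun y y' hy hy' => ?_⟩
  rcases hYc y hy with h3 | rfl
  · left; rw [h3, E.step_fst]
  rcases hYc' y' hy' with h4 | rfl
  · right; left; rw [h4, E.back_fst]
  right; right; left
  rw [E.mem_flank, hψ]
  rintro (h5 | h5)
  · cases r
    · exact haS.2.2.1 h5
    · exact haS.2.2.2 h5
  · exact haS.2.1 h5

end NearlyComplete

/-! ### Existence of extendible pairs -/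

section Matching

/-- A vertex of degree one on a quadrilateral is opposite to another one, unless it is the only
neighbour of its neighbour. -/
theorem CellEmbedding.IsQuadrilateral.exists_of_degree_one {V : Type*} [DecidableEq V]
    {G : SimpleGraph V} {E : CellEmbedding G} (hq : E.IsQuadrilateral) {v w : V} (h : G.Adj w v)
    (hv : ∀ u, G.Adj v u → u = w) :
    (∀ u, G.Adj w u → u = v) ∨ ∃ p ≠ v, G.Adj w p ∧ ∀ u, G.Adj p u → u = w := by
  let y : FaceFlag G := ⟨w, v, h, false⟩
  have h1 : (E.step y).snd = w := hv _ (by have := (E.step y).adj; rwa [E.step_fst] at this)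
  have h2 : (E.step (E.step y)).fst = w := by rw [E.step_fst, h1]
  have h4 : E.step (E.step (E.step (E.step y))) = y := by
    have := E.iterate_walkLength y
    rwa [hq y] at this
  have hadj := (E.step (E.step y)).adj
  by_cases hp : (E.step (E.step y)).snd = v
  · left
    have h5 := E.step_snd (E.step y)
    rw [h1, E.step_fst, hp] at h5
    exact E.eq_of_nx_eq_self h h5.symm
  · right
    rw [h2] at hadj
    refine ⟨_, hp, hadj, ?_⟩
    have h5 := E.step_snd (E.step (E.step y))
    rw [← E.step_fst (E.step (E.step (E.step y))), h4, h2] at h5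
    exact E.eq_of_nx_eq_self hadj.symm h5.symm

theorem not_connected_minusMatching_two : ¬ (bipGraph (minusMatching 2 2 2)).Connected := by
  intro h
  have h1 : (bipGraph (minusMatching 2 2 2)).Adj (Sum.inl 0) (Sum.inr 1) :=
    show minusMatching 2 2 2 0 1 by simp [minusMatching]
  have := h.eq_or_eq_of_adj h1 ?_ ?_ (Sum.inl 1)
  · simp at this
  · rintro (i | j) h
    · exact h.elim
    · change ¬ _ at h
      fin_cases j <;> simp at h ⊢
  · rintro (i | j) h
    · change ¬ _ at h
      fin_cases i <;> simp at h ⊢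
    · exact h.elim

theorem not_isQuadrilateral_of_three_two
    (E : CellEmbedding (bipGraph (minusMatching 3 2 2))) : ¬ E.IsQuadrilateral := by
  intro hq
  have hv : ∀ u, (bipGraph (minusMatching 3 2 2)).Adj (Sum.inl 0) u → u = Sum.inr 1 := by
    rintro (i | j) h
    · exact h.elim
    · change ¬ _ at h
      fin_cases j <;> simp at h ⊢
  rcases hq.exists_of_degree_one (w := Sum.inr 1) (v := Sum.inl 0)
    (show minusMatching 3 2 2 0 1 by simp [minusMatching]) hv with h | ⟨p, hp, h1, h2⟩
  · have := h (Sum.inl 2) (show minusMatching 3 2 2 2 1 by simp [minusMatching])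
    simp at this
  · rcases p with i | j
    · change ¬ _ at h1
      fin_cases i
      · simp at hp
      · simp at h1
      · have := h2 (Sum.inr 0) (show minusMatching 3 2 2 2 0 by simp [minusMatching])
        simp at this
    · exact h1.elim

theorem not_isQuadrilateral_of_two_three
    (E : CellEmbedding (bipGraph (minusMatching 2 3 2))) : ¬ E.IsQuadrilateral := by
  intro hq
  have hv : ∀ u, (bipGraph (minusMatching 2 3 2)).Adj (Sum.inr 0) u → u = Sum.inl 1 := by
    rintro (i | j) h
    · change ¬ _ at h
      fin_cases i <;> simp at h ⊢
    · exact h.elim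
  rcases hq.exists_of_degree_one (w := Sum.inl 1) (v := Sum.inr 0)
    (show minusMatching 2 3 2 1 0 by simp [minusMatching]) hv with h | ⟨p, hp, h1, h2⟩
  · have := h (Sum.inr 2) (show minusMatching 2 3 2 1 2 by simp [minusMatching])
    simp at this
  · rcases p with i | j
    · exact h1.elim
    · change ¬ _ at h1
      fin_cases j
      · simp at hp
      · simp at h1
      · have := h2 (Sum.inl 0) (show minusMatching 2 3 2 0 2 by simp [minusMatching])
        simp at this

/-- The graph is a cycle of length six. -/
theorem not_isQuadrilateral_of_three
    (E : CellEmbedding (bipGraph (minusMatching 3 3 3))) : ¬ E.IsQuadrilateral := by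
  intro hq
  have hadj : ∀ i j : Fin 3, (bipGraph (minusMatching 3 3 3)).Adj (Sum.inl i) (Sum.inr j) ↔
      i ≠ j := by
    intro i j
    change ¬ (i.val = j.val ∧ i.val < 3) ↔ _
    rw [Ne, Fin.ext_iff]; have := i.2; tauto
  have hother : ∀ v w : Fin 3 ⊕ Fin 3, (bipGraph (minusMatching 3 3 3)).Adj v w →
      ∃ u, (bipGraph (minusMatching 3 3 3)).Adj v u ∧ u ≠ w := by
    have key : ∀ i j : Fin 3, i ≠ j → ∃ l, i ≠ l ∧ l ≠ j := by decide
    rintro (i | j) (i' | j') h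
    · exact h.elim
    · obtain ⟨l, h1, h2⟩ := key i j' ((hadj _ _).1 h)
      exact ⟨Sum.inr l, (hadj _ _).2 h1, by simpa using h2⟩
    · obtain ⟨l, h1, h2⟩ := key j i' ((hadj _ _).1 h.symm).symm
      exact ⟨Sum.inl l, ((hadj _ _).2 h1.symm).symm, by simpa using h2⟩
    · exact h.elim
  have hne : ∀ y, (E.step y).snd ≠ y.fst := by
    intro y h
    rw [E.step_snd] at h
    obtain ⟨u, h1, h2⟩ := hother _ _ y.adj.symm
    exact h2 (E.eq_of_nx_eq_self y.adj.symm h u h1)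
  let y : FaceFlag (bipGraph (minusMatching 3 3 3)) :=
    ⟨Sum.inl 0, Sum.inr 1, (hadj _ _).2 (by decide), false⟩
  have h4 : (E.step (E.step (E.step y))).snd = Sum.inl 0 := by
    have := E.iterate_walkLength y
    rw [hq y] at this
    rw [← E.step_fst]
    exact congrArg FaceFlag.fst this
  have a1 := (E.step y).adj
  have a2 := (E.step (E.step y)).adj
  have a3 := (E.step (E.step (E.step y))).adj
  have n1 := hne y
  have n2 := hne (E.step y)
  rw [E.step_fst] at a1 a2 a3 n2
  rw [h4] at a3
  generalize (E.step (E.step y)).snd = v at *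
  generalize (E.step y).snd = w at *
  change (bipGraph (minusMatching 3 3 3)).Adj (Sum.inr 1) w at a1
  change w ≠ Sum.inl 0 at n1
  change v ≠ Sum.inr 1 at n2
  rcases w with i | j
  · rcases v with i' | j'
    · exact a2.elim
    · have b1 := (hadj _ _).1 a1.symm
      have b2 := (hadj _ _).1 a2
      have b3 := (hadj _ _).1 a3.symm
      have n1' : i ≠ 0 := fun h => n1 (by rw [h])
      have n2' : j' ≠ 1 := fun h => n2 (by rw [h])
      omega
  · exact a1.elim

variable {m n k : ℕ}

theorem isNearlyComplete_minusMatching :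
    IsNearlyComplete (bipGraph (minusMatching m n k)) (Set.range Sum.inl) where
  left := by
    rintro _ ⟨i, rfl⟩ (j | j) hj (j' | j') hj' h h'
    · simp at hj
    · simp at hj
    · simp at hj'
    · have h1 : i.val = j.val ∧ i.val < k := not_not.1 h
      have h2 : i.val = j'.val ∧ i.val < k := not_not.1 h'
      rw [Fin.ext (h1.1.symm.trans h2.1)]
  right := by
    rintro (j | j) hj _ ⟨i, rfl⟩ _ ⟨i', rfl⟩ h h'
    · simp at hj
    · have h1 : i.val = j.val ∧ i.val < k := not_not.1 h
      have h2 : i'.val = j.val ∧ i'.val < k := not_not.1 h'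
      rw [Fin.ext (h1.1.trans h2.1.symm)]

theorem ncard_range_inl : (Set.range Sum.inl : Set (Fin m ⊕ Fin n)).ncard = m := by
  rw [← Set.image_univ, Set.ncard_image_of_injective _ Sum.inl_injective, Set.ncard_univ,
    Nat.card_fin]

theorem ncard_range_inl_compl : ((Set.range Sum.inl : Set (Fin m ⊕ Fin n))ᶜ).ncard = n := by
  rw [mem_range_inl_compl, ← Set.image_univ, Set.ncard_image_of_injective _ Sum.inr_injective,
    Set.ncard_univ, Nat.card_fin]

/-- The three cases are those of a full degree in both parts, in one part, and in none. -/
theorem exists_extendible (hm : 2 ≤ m) (hn : 2 ≤ n) (hkm : k ≤ m) (hkn : k ≤ n)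
    (h4 : (m, n, k) ≠ (4, 4, 4)) (E : CellEmbedding (bipGraph (minusMatching m n k)))
    (hE : (Even (m * n - k) ∧ E.IsQuadrilateral) ∨ (¬ Even (m * n - k) ∧ E.IsNearQuadrilateral)) :
    ∃ FA FB : FaceSeq (bipGraph (minusMatching m n k)), Extendible E FA FB := by
  have h46 := CellEmbedding.fourOrSix (hE.imp And.right And.right)
  have hX := isPart_bipGraph (minusMatching m n k)
  have hG := isNearlyComplete_minusMatching (m := m) (n := n) (k := k)
  have hcA := ncard_range_inl (m := m) (n := n)
  have hcB := ncard_range_inl_compl (m := m) (n := n)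
  have hq : Even (m * n - k) → E.IsQuadrilateral := fun h => by
    rcases hE with hE | hE
    · exact hE.2
    · exact absurd h hE.1
  refine HasConfiguration.exists_extendible hX h46 ?_
  have hfullA : ∀ i : Fin m, k ≤ i.val → ∀ w ∉ Set.range Sum.inl,
      (bipGraph (minusMatching m n k)).Adj (Sum.inl i) w := by
    rintro i hi (w | w) hw
    · simp at hw
    · exact fun h => absurd h.2 (by omega)
  have hfullB : ∀ j : Fin n, k ≤ j.val → ∀ v ∈ Set.range Sum.inl,
      (bipGraph (minusMatching m n k)).Adj (Sum.inr j) v := by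
    rintro j hj _ ⟨i, rfl⟩
    exact fun h => absurd h.2 (by omega)
  have hmissA : k = m → ∀ v ∈ Set.range Sum.inl, ∃ w ∉ Set.range Sum.inl,
      ¬ (bipGraph (minusMatching m n k)).Adj v w := by
    rintro hk _ ⟨i, rfl⟩
    exact ⟨Sum.inr ⟨i, by omega⟩, by simp, fun h => h ⟨rfl, by omega⟩⟩
  have hmissB : k = n → ∀ w ∉ Set.range Sum.inl, ∃ v ∈ Set.range Sum.inl,
      ¬ (bipGraph (minusMatching m n k)).Adj w v := by
    rintro hk (j | j) hj
    · simp at hj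
    · exact ⟨Sum.inl ⟨j, by omega⟩, by simp, fun h => h ⟨rfl, by simp; omega⟩⟩
  rcases hkm.lt_or_eq with hkm' | rfl
  · rcases hkn.lt_or_eq with hkn' | rfl
    · exact hasConfiguration_of_full h46 hX hG hcA hcB hm hn (a₀ := Sum.inl ⟨m - 1, by omega⟩)
        (b₀ := Sum.inr ⟨n - 1, by omega⟩) (by simp) (by simp) (hfullA _ (by simp; omega))
        (hfullB _ (by simp; omega))
    · have he : m % 2 = 1 → Even (m * k - k) := by
        intro ho
        rw [show m * k - k = (m - 1) * k by rw [Nat.sub_mul, one_mul]]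
        exact Even.mul_right (by rw [Nat.even_iff]; omega) _
      by_cases hm4 : 4 ≤ m
      · exact hasConfiguration_of_full_left h46 (fun ho => hq (he ho)) hX hG hcA hcB hm4 hn
          (a₀ := Sum.inl ⟨m - 1, by omega⟩) (by simp) (hfullA _ (by simp; omega)) (hmissB rfl)
      · obtain rfl : m = 3 := by omega
        obtain rfl : k = 2 := by omega
        exact absurd (hq (by decide)) (not_isQuadrilateral_of_three_two E)
  · rcases hkn.lt_or_eq with hkn' | rfl
    · have he : n % 2 = 1 → Even (k * n - k) := by
        intro ho
        rw [show k * n - k = k * (n - 1) by rw [Nat.mul_sub, mul_one]]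
        exact Even.mul_left (by rw [Nat.even_iff]; omega) _
      by_cases hn4 : 4 ≤ n
      · have h := hasConfiguration_of_full_left h46 (fun ho => hq (he ho)) hX.compl hG.compl hcB
          (by rwa [compl_compl]) hn4 hm (a₀ := Sum.inr ⟨n - 1, by omega⟩) (by simp)
          (fun v hv => hfullB _ (by simp; omega) v (not_not.1 hv))
          (fun w hw => hmissA rfl w (not_not.1 hw))
        simpa only [compl_compl] using h.swap
      · obtain rfl : n = 3 := by omega
        obtain rfl : k = 2 := by omega
        exact absurd (hq (by decide)) (not_isQuadrilateral_of_two_three E)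
    · have he : Even (k * k - k) := by
        rw [show k * k - k = (k - 1) * k by rw [Nat.sub_mul, one_mul]]
        rw [mul_comm]
        exact Nat.even_mul_pred_self k
      by_cases hk5 : 5 ≤ k
      · exact hasConfiguration_of_missing (hq he) hX hG hcA hcB hk5 (by omega) (hmissA rfl)
          (hmissB rfl)
      · have : k = 2 ∨ k = 3 ∨ k = 4 := by omega
        rcases this with rfl | rfl | rfl
        · exact absurd E.connected not_connected_minusMatching_two
        · exact absurd (hq he) (not_isQuadrilateral_of_three E)
        · exact absurd rfl h4

end Matching

theorem mainTheorem2 (m n k : ℕ) (hm : 2 ≤ m) (hn : 2 ≤ n) (hkm : k ≤ m) (hkn : k ≤ n)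
    (h4 : (m, n, k) ≠ (4, 4, 4)) (h5 : (m, n, k) ≠ (5, 5, 5))
    (E : CellEmbedding (bipGraph (minusMatching m n k)))
    (hE : E.eulerGenus = ⌈(((m : ℚ) - 2) * ((n : ℚ) - 2) - (k : ℚ)) / 2⌉) :
    (∃ FA FB : FaceSeq (bipGraph (minusMatching m n k)), Extendible E FA FB) ∧
    ∀ FA FB : FaceSeq (bipGraph (minusMatching m n k)), Extendible E FA FB →
      ((∃ E₁, IsExtended222 E FA FB E₁) ∧
        ∀ E₁, IsExtended222 E FA FB E₁ →
          E₁.eulerGenus = ⌈((m : ℚ) * (n : ℚ) - ((k : ℚ) + 2)) / 2⌉ ∧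
          ¬ E₁.Orientable ∧
          E₁.HasMinimumEulerGenus ∧ (E₁.IsQuadrilateral ∨ E₁.IsNearQuadrilateral)) ∧
      ((∃ E₂, IsExtended200 E FB E₂) ∧
        ∀ E₂, IsExtended200 E FB E₂ →
          E₂.eulerGenus = ⌈((m : ℚ) * ((n : ℚ) - 2) - (k : ℚ)) / 2⌉ ∧
          E₂.HasMinimumEulerGenus ∧ (E₂.IsQuadrilateral ∨ E₂.IsNearQuadrilateral)) ∧
      ((∃ E₃, IsExtended020 E FA E₃) ∧
        ∀ E₃, IsExtended020 E FA E₃ →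
          E₃.eulerGenus = ⌈(((m : ℚ) - 2) * (n : ℚ) - (k : ℚ)) / 2⌉ ∧
          E₃.HasMinimumEulerGenus ∧ (E₃.IsQuadrilateral ∨ E₃.IsNearQuadrilateral)) := by
  have hE' := E.isQuadrilateral_or hm hn hkm hkn hE
  have hQ := hE'.imp And.right And.right
  refine ⟨exists_extendible hm hn hkm hkn h4 E hE', fun FA FB hF => ⟨⟨?_, ?_⟩, ⟨?_, ?_⟩, ?_, ?_⟩⟩
  · exact exists_isExtended222 hm hn hF.seqA hF.seqB
  · intro E₁ h₁
    obtain ⟨h1, h2⟩ := (h₁.almostFour hm hn hQ hF).conclude hm hkm hkn le_rfl le_rfl hn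
      (g := ((m : ℚ) * (n : ℚ) - ((k : ℚ) + 2)) / 2) (by push_cast; ring)
    exact ⟨h1, h₁.not_orientable hm hn hF, h2⟩
  · exact exists_isExtended200 hm hn hF.seqB
  · intro E₂ h₂
    exact (h₂.almostFour hn hQ hF).conclude hm hkm hkn (Nat.zero_le _) (Nat.zero_le _) hn
      (by push_cast; ring)
  · exact exists_isExtended020 hm hn hF.seqA
  · intro E₃ h₃
    exact (h₃.almostFour hm hQ hF).conclude hm hkm hkn (Nat.zero_le _) (Nat.zero_le _) hn
      (by push_cast; ring)
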